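/- Let $Z$ and $Y$ be real random variables with values in Borel sets $\mathcal Z,\mathcal Y\subseteq\mathbb R$ carrying Lebesgue measure, and let $X$ take values in a measurable space $\mathfrak X$ with a $\sigma$-finite measure $\mu_X$. Densities are taken with respect to these measures and their products. Call a family of densities $(p_\theta)_{\theta\in\Theta}$ with respect to $\mu$, with $\Theta$ an open subset of a finite-dimensional real vector space, *smooth and regular* if at every $\theta_0\in\Theta$ it is differentiable in quadratic mean, i.e. there is a score $\dot\ell$ with $\int(\sqrt{p_\theta}-\sqrt{p_{\theta_0}}-\tfrac12(\theta-\theta_0)^T\dot\ell\sqrt{p_{\theta_0}})^2\,d\mu=o(\|\theta-\theta_0\|^2)$ and $\dot\ell\sqrt{p_{\theta_0}}\in L^2(\mu)$, and the Fisher information $\int\dot\ell\dot\ell^Tp_{\theta_0}\,d\mu$ is non-singular. Suppose we are given the following three models, with open parameter sets $\Theta_{ZX}$, $\Theta_{Y|X}$ and $\Phi$. 1. A smooth and regular family of joint densities $p_{ZX}(z,x;\theta_{ZX})$, positive on $\mathcal Z\times\mathfrak X$. Write $p_X$ and $p_{Z|X}$ for the marginal and conditional densities derived from it. 2. A family of conditional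 densities $p_{Y|X}(y\mid x;\theta_{Y|X})$, positive on $\mathcal Y$ for every $x$, which is smooth and regular in the sense that for every $\theta_{ZX}\in\Theta_{ZX}$ the family $p_X(x;\theta_{ZX})\,p_{Y|X}(y\mid x;\theta_{Y|X})$ is smooth and regular in $\theta_{Y|X}$. 3. A family of conditional copulas $C_{YZ|X}(u,v\mid x;\phi)$ with densities $c(u,v\mid x;\phi)$, positive on $(0,1)^2$, which is smooth and regular in the following sense. First, for every $\theta_{ZX}\in\Theta_{ZX}$ the family $p_X(x;\theta_{ZX})\,c(u,v\mid x;\phi)$ is smooth and regular in $\phi$. Second, for every $\phi$ and $x$ the density $c$ is continuously differentiable in $(u,v)\in(0,1)^2$, and there is a constant $K=K(\phi)$ such that, for all $x$ and all $u\in(0,1)$, $v\in(0,1)$ respectively, $$\int_0^1\Bigl(\frac{\partial\log c}{\partial u}(u,v\mid x)\Bigr)^2c(u,v\mid x)\,dv\le\frac{K^2}{u^2(1-u)^2},\qquad \int_0^1\Bigl(\frac{\partial\log c}{\partial v}(u,v\mid x)\Bigr)^2c(u,v\mid x)\,du\le\frac{K^2}{v^2(1-v)^2}.$$ Let $\Theta$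 be the set of $\theta=(\theta_{ZX},\theta_{Y|X},\phi)\in\Theta_{ZX}\times\Theta_{Y|X}\times\Phi$ for which there is a joint density $q$ of $(Z,X,Y)$ with these pieces, i.e. such that the marginal density of $(Z,X)$ is $p_{ZX}(\cdot;\theta_{ZX})$, the conditional density of $Y$ given $X$, $\int q(y\mid z,x)\,w(z\mid x)\,dz$ with weight $w=p_{Z|X}(\cdot;\theta_{ZX})$, is $p_{Y|X}(\cdot;\theta_{Y|X})$, and the conditional copula $P(F_{Y|X}(Y\mid x)\le u,\,F_{Z|X}(Z\mid x)\le v\mid X=x)$ is $C_{YZ|X}(u,v\mid x;\phi)$ (all for almost every value of the arguments outside the copula). Then: - $\Theta=\Theta_{ZX}\times\Theta_{Y|X}\times\Phi$; - $\theta\in\Theta$ is a frugal parameterization of the joint distribution of $(Z,X,Y)$ with respect to the kernel $p_{Y|X}$: for every $\theta\in\Theta$ the joint density $p_\theta$ with these three pieces exists and is almost everywhere unique, and the family $(p_\theta)_{\theta\in\Theta}$ is smooth and regular; - (A1) $\phi$ is variation independent of $(\theta_{ZX},\theta_{Y|X})$ on $\Theta$: the range on $\Theta$ of $(\phi,(\theta_{ZX},\theta_{Y|X}))$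 is the Cartesian product of the ranges of $\phi$ and of $(\theta_{ZX},\theta_{Y|X})$. -/

import Mathlib

open MeasureTheory Set Filter Topology Asymptotics

noncomputable section

namespace Frugal

/-! ### Smooth and regular parametric models -/

section Models

variable {Ω : Type*} [MeasurableSpace Ω]

/-- `f` is a probability density with respect to `μ`. -/
structure IsDensity (μ : Measure Ω) (f : Ω → ℝ) : Prop where
  measurable : Measurable f
  nonneg : ∀ᵐ ω ∂μ, 0 ≤ f ω
  total : ∫⁻ ω, ENNReal.ofReal (f ω) ∂μ = 1

variable {E : Type*} [NormedAddCommGroup E] [NormedSpace ℝ E]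

/-- The family of densities `p θ`, `θ ∈ Θ`, is differentiable in quadratic mean at `θ₀`, and `ℓ` is
its (square integrable) score there; `ℓ ω h` is the paper's product `hᵀ ℓ̇(ω)`. -/
structure IsScoreAt (μ : Measure Ω) (Θ : Set E) (p : E → Ω → ℝ) (θ₀ : E)
    (ℓ : Ω → E →L[ℝ] ℝ) : Prop where
  memLp : ∀ h : E, MemLp (fun ω => ℓ ω h * √(p θ₀ ω)) 2 μ
  expansion :
    (fun θ : E =>
        ∫ ω, (√(p θ ω) - √(p θ₀ ω) - 1 / 2 * ℓ ω (θ - θ₀) * √(p θ₀ ω)) ^ 2 ∂μ)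
      =o[𝓝[Θ] θ₀] fun θ : E => ‖θ - θ₀‖ ^ 2

/-- Fisher information at `θ₀`, as a bilinear form: the expectation of `ℓ(h) ℓ(k)`. -/
def fisherInfo (μ : Measure Ω) (p : E → Ω → ℝ) (θ₀ : E) (ℓ : Ω → E →L[ℝ] ℝ) (h k : E) : ℝ :=
  ∫ ω, ℓ ω h * ℓ ω k * p θ₀ ω ∂μ

/-- The model is smooth (differentiable in quadratic mean at every parameter value) and regular
(the Fisher information is everywhere non-singular). -/
def IsSmoothRegular (μ : Measure Ω) (Θ : Set E) (p : E → Ω → ℝ) : Prop :=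
  ∀ θ₀ ∈ Θ, ∃ ℓ : Ω → E →L[ℝ] ℝ, IsScoreAt μ Θ p θ₀ ℓ ∧
    ∀ h : E, (∀ k : E, fisherInfo μ p θ₀ ℓ h k = 0) → h = 0

end Models

/-- `f` and `g` are variation independent on `Θ`: their joint range is the product of their
ranges. -/
def VariationIndependent {α β γ : Type*} (Θ : Set α) (f : α → β) (g : α → γ) : Prop :=
  (fun a => (f a, g a)) '' Θ = (f '' Θ) ×ˢ (g '' Θ)

/-! ### Copulas -/

/-- A bivariate copula: a distribution function on the unit square with uniform margins. -/
structure IsCopula (C : ℝ → ℝ → ℝ) : Prop where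
  zero_left : ∀ v ∈ Icc (0 : ℝ) 1, C 0 v = 0
  zero_right : ∀ u ∈ Icc (0 : ℝ) 1, C u 0 = 0
  one_left : ∀ v ∈ Icc (0 : ℝ) 1, C 1 v = v
  one_right : ∀ u ∈ Icc (0 : ℝ) 1, C u 1 = u
  two_increasing : ∀ u ∈ Icc (0 : ℝ) 1, ∀ u' ∈ Icc (0 : ℝ) 1, ∀ v ∈ Icc (0 : ℝ) 1,
    ∀ v' ∈ Icc (0 : ℝ) 1, u ≤ u' → v ≤ v' → 0 ≤ C u' v' - C u' v - C u v' + C u v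

/-- `c` is a density of the copula `C`. -/
def HasCopulaDensity (C c : ℝ → ℝ → ℝ) : Prop :=
  ∀ u ∈ Icc (0 : ℝ) 1, ∀ v ∈ Icc (0 : ℝ) 1,
    C u v = ∫ s in Ioc 0 u ×ˢ Ioc 0 v, c s.1 s.2

/-- Lebesgue measure on the open unit interval. -/
def unitVol : Measure ℝ := volume.restrict (Ioo (0 : ℝ) 1)

/-- A conditional copula density `c x u v` is smooth in its arguments `u`, `v`: it is continuously
differentiable on the open unit square, and, for one constant and all `x`, the conditional second
moment of `∂ log c / ∂u` given `u` is at most a multiple of `(u (1 - u))⁻²`, and likewise in `v`. -/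
structure SmoothInArguments {𝒳 : Type*} (c : 𝒳 → ℝ → ℝ → ℝ) : Prop where
  contDiffOn : ∀ x, ContDiffOn ℝ 1 (fun s : ℝ × ℝ => c x s.1 s.2) (Ioo 0 1 ×ˢ Ioo 0 1)
  score_left : ∃ K : ℝ, ∀ x, ∀ u ∈ Ioo (0 : ℝ) 1,
    ∫⁻ v, ENNReal.ofReal ((deriv (fun s => Real.log (c x s v)) u) ^ 2 * c x u v) ∂unitVol
      ≤ ENNReal.ofReal ((K / (u * (1 - u))) ^ 2)
  score_right : ∃ K : ℝ, ∀ x, ∀ v ∈ Ioo (0 : ℝ) 1,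
    ∫⁻ u, ENNReal.ofReal ((deriv (fun t => Real.log (c x u t)) v) ^ 2 * c x u v) ∂unitVol
      ≤ ENNReal.ofReal ((K / (v * (1 - v))) ^ 2)

/-- `C` is the copula of `(Y, Z)` when `(Z, Y)` has density `r` with respect to `μZ × μY`:
`C(u, v) = P(F_Y(Y) ≤ u, F_Z(Z) ≤ v)`. -/
def IsCopulaOf (μZ μY : Measure ℝ) (r : ℝ → ℝ → ℝ) (C : ℝ → ℝ → ℝ) : Prop :=
  let FZ : ℝ → ℝ := fun z => ∫ s in Iic z ×ˢ univ, r s.1 s.2 ∂(μZ.prod μY)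
  let FY : ℝ → ℝ := fun y => ∫ s in univ ×ˢ Iic y, r s.1 s.2 ∂(μZ.prod μY)
  ∀ u ∈ Icc (0 : ℝ) 1, ∀ v ∈ Icc (0 : ℝ) 1,
    ∫ s in {s : ℝ × ℝ | FY s.2 ≤ u ∧ FZ s.1 ≤ v}, r s.1 s.2 ∂(μZ.prod μY) = C u v

/-! ### Frugal parameterizations -/

section Frugality

variable {𝒳 : Type*} [MeasurableSpace 𝒳]

/-- The `X`-margin of a density of `(Z, X)`. -/
def margX (μZ : Measure ℝ) (p : ℝ × 𝒳 → ℝ) (x : 𝒳) : ℝ := ∫ z, p (z, x) ∂μZ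

/-- The conditional density of `Z` given `X` of a density of `(Z, X)`. -/
def condZ (μZ : Measure ℝ) (p : ℝ × 𝒳 → ℝ) (z : ℝ) (x : 𝒳) : ℝ := p (z, x) / margX μZ p x

/-- The `(Z, X)`-margin of a density of `(Z, X, Y)`. -/
def margZX (μY : Measure ℝ) (q : ℝ × 𝒳 × ℝ → ℝ) (s : ℝ × 𝒳) : ℝ := ∫ y, q (s.1, s.2, y) ∂μY

/-- The conditional density of `Y` given `Z, X` of a density of `(Z, X, Y)`. -/
def condY (μY : Measure ℝ) (q : ℝ × 𝒳 × ℝ → ℝ) (z : ℝ) (x : 𝒳) (y : ℝ) : ℝ :=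
  q (z, x, y) / margZX μY q (z, x)

/-- The conditional density of `(Z, Y)` given `X = x` in the reweighted (causal) distribution
`p*_X(x) w(z|x) p(y|z,x)`. -/
def causal (μY : Measure ℝ) (q : ℝ × 𝒳 × ℝ → ℝ) (w : ℝ → 𝒳 → ℝ) (x : 𝒳) (z y : ℝ) : ℝ :=
  condY μY q z x y * w z x

/-- The cognate kernel `p*(y|x) = ∫ p(y|z,x) w(z|x) dz`. -/
def cognate (μZ μY : Measure ℝ) (q : ℝ × 𝒳 × ℝ → ℝ) (w : ℝ → 𝒳 → ℝ) (x : 𝒳) (y : ℝ) : ℝ :=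
  ∫ z, causal μY q w x z y ∂μZ

/-- `q` is a density of `(Z, X, Y)` whose `(Z, X)`-margin is `pZX`, whose cognate kernel for the
weight `w` is `k`, and whose reweighted distribution has conditional copula `C` for `Y` and `Z`
given `X`. -/
structure HasPieces (μZ : Measure ℝ) (μX : Measure 𝒳) (μY : Measure ℝ)
    (q : ℝ × 𝒳 × ℝ → ℝ) (w : ℝ → 𝒳 → ℝ)
    (pZX : ℝ × 𝒳 → ℝ) (k : 𝒳 → ℝ → ℝ) (C : 𝒳 → ℝ → ℝ → ℝ) : Prop where
  density : IsDensity (μZ.prod (μX.prod μY)) q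
  past : margZX μY q =ᵐ[μZ.prod μX] pZX
  kernel : ∀ᵐ s ∂(μX.prod μY), cognate μZ μY q w s.1 s.2 = k s.1 s.2
  association : ∀ᵐ x ∂μX, IsCopulaOf μZ μY (causal μY q w x) (C x)

variable {E₁ E₂ E₃ : Type*}

/-- The values in `Θ₁ × Θ₂ × Φ` that arise from some joint distribution of `(Z, X, Y)`. -/
def jointParams (μZ : Measure ℝ) (μX : Measure 𝒳) (μY : Measure ℝ)
    (Θ₁ : Set E₁) (Θ₂ : Set E₂) (Φ : Set E₃) (w : E₁ × E₂ × E₃ → ℝ → 𝒳 → ℝ)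
    (pZX : E₁ → ℝ × 𝒳 → ℝ) (k : E₂ → 𝒳 → ℝ → ℝ) (C : E₃ → 𝒳 → ℝ → ℝ → ℝ) :
    Set (E₁ × E₂ × E₃) :=
  {θ | (θ.1 ∈ Θ₁ ∧ θ.2.1 ∈ Θ₂ ∧ θ.2.2 ∈ Φ) ∧
    ∃ q, HasPieces μZ μX μY q (w θ) (pZX θ.1) (k θ.2.1) (C θ.2.2)}

variable [NormedAddCommGroup E₁] [NormedSpace ℝ E₁] [NormedAddCommGroup E₂] [NormedSpace ℝ E₂]
  [NormedAddCommGroup E₃] [NormedSpace ℝ E₃]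

/-- `θ = (θ_ZX, θ_Y|X, φ) ∈ Θ`, through `θ ↦ q θ`, is a parameterization of `(Z, X, Y)` that is
frugal with respect to the cognate kernel with weight `w`: it is smooth and regular; `θ_ZX`, `θ_Y|X`
and `φ` separately parameterize the `(Z, X)`-margin, the cognate kernel and the conditional copula;
and these three pieces together determine the joint distribution. -/
structure IsFrugal (μZ : Measure ℝ) (μX : Measure 𝒳) (μY : Measure ℝ)
    (Θ : Set (E₁ × E₂ × E₃)) (q : E₁ × E₂ × E₃ → ℝ × 𝒳 × ℝ → ℝ) (w : E₁ × E₂ × E₃ → ℝ → 𝒳 → ℝ)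
    (pZX : E₁ → ℝ × 𝒳 → ℝ) (k : E₂ → 𝒳 → ℝ → ℝ) (C : E₃ → 𝒳 → ℝ → ℝ → ℝ) : Prop where
  weight : ∀ θ ∈ Θ, ∀ᵐ x ∂μX, IsDensity μZ (fun z => w θ z x)
  pieces : ∀ θ ∈ Θ, HasPieces μZ μX μY (q θ) (w θ) (pZX θ.1) (k θ.2.1) (C θ.2.2)
  determined : ∀ θ ∈ Θ, ∀ q', HasPieces μZ μX μY q' (w θ) (pZX θ.1) (k θ.2.1) (C θ.2.2) →
    q' =ᵐ[μZ.prod (μX.prod μY)] q θ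
  smoothRegular : IsSmoothRegular (μZ.prod (μX.prod μY)) Θ q

end Frugality

end Frugal

end

/-! Densities are handled through their square roots. Differentiability in quadratic mean is
differentiability of `√p` as a map into `L²`, and the Fisher information is non-singular when this
derivative is injective.

By Sklar's theorem, the law of `(Z, Y)` over a fixed `x` with margins `a²`, `b²` and copula density
`γ²` has the root `a(z) b(y) γ(F_Y(y), F_Z(z))`. Taking for `a` the root of the unnormalized slice
of the density of `(Z, X)` gives the root of the joint density, `rootDensity`. Since the weight is
the model's own `p(z | x)`, reweighting does nothing on a fibre except divide by the density of `X`.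
That the pieces are the right ones is a change of variables along distribution functions
(`IsModel.hasPieces`); uniqueness holds because a copula and atomless margins determine the
distribution function (`IsModel.ae_eq`). So every combination of parameters occurs, and variation
independence is immediate.

The work lies in smoothness. When a margin varies, so does the distribution function at which `γ` is
evaluated, and the derivative of `γ` may blow up like `K / (u (1 - u))`. Three facts control this.
(1) Hardy's inequality: the displacement of a distribution function, relative to the distance from
`0` and from `1`, is bounded in `L²(a²)` by the `L²` distance of the roots. This makes the root of
the joint density Lipschitz in the margins (`IsCurve.sqInt_transport_sub_le`). Localized to the
tails, it dominates difference quotients up to small errors (`asympDominated_cdfVar`). (2) The curve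
`u ↦ γ(u, ·)` is differentiable in `L²` at almost every `u` (`IsCurve.ae_tendsto_quotient`), and
null sets of levels `u` correspond to null sets of points. With the domination this gives the chain
rule `IsCurve.tendsto_transport_quotient`. (3) Substituting a distribution function and multiplying
by the root of its density is an isometry, depending strongly continuously on the root
(`tendsto_transport`). This disposes of derivative terms evaluated at a moving margin. A telescoping
sum combines them on the plane (`tendsto_joint_quotient`), and the Lipschitz bound, uniform over the
fibres, allows integration over `x` (`tendsto_rootDensity_quotient`).

Regularity uses that margins contract the `L²` distance of roots. If the derivative of the joint
root vanishes in a direction, so do those of the roots of the `(Z, X)`-margin and then of the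
`Y`-margin. With both margins at rest, copula roots are exactly as far apart as joint roots, so the
copula direction vanishes too (`IsRootDeriv.eq_zero_of_ae_eq_zero`). -/

open scoped ENNReal

noncomputable section

namespace Frugal

/-! ### Integrals of squares -/

section SqInt

variable {Ω Ω' : Type*} [MeasurableSpace Ω] [MeasurableSpace Ω']

/-- The integral of `f ^ 2`, as an extended nonnegative number. -/
def sqInt (μ : Measure Ω) (f : Ω → ℝ) : ℝ≥0∞ := ∫⁻ ω, ENNReal.ofReal (f ω ^ 2) ∂μ

variable {μ : Measure Ω}

lemma sqInt_congr {f g : Ω → ℝ} (h : f =ᵐ[μ] g) : sqInt μ f = sqInt μ g :=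
  lintegral_congr_ae (h.mono fun ω hω => by simp [hω])

lemma sqInt_const_mul (c : ℝ) (f : Ω → ℝ) :
    sqInt μ (fun ω => c * f ω) = ENNReal.ofReal (c ^ 2) * sqInt μ f := by
  unfold sqInt
  rw [← lintegral_const_mul' _ _ ENNReal.ofReal_ne_top]
  refine lintegral_congr fun ω => ?_
  rw [mul_pow, ENNReal.ofReal_mul (sq_nonneg c)]

lemma sqInt_div_const (f : Ω → ℝ) (c : ℝ) :
    sqInt μ (fun ω => f ω / c) = ENNReal.ofReal (c⁻¹ ^ 2) * sqInt μ f := by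
  rw [← sqInt_const_mul]; simp [div_eq_inv_mul]

lemma sqInt_neg (f : Ω → ℝ) : sqInt μ (fun ω => -f ω) = sqInt μ f := by
  simp [sqInt]

lemma sqInt_sub_comm (f g : Ω → ℝ) :
    sqInt μ (fun ω => f ω - g ω) = sqInt μ (fun ω => g ω - f ω) := by
  rw [← sqInt_neg]; simp

lemma ofReal_add_sq_le (x y : ℝ) :
    ENNReal.ofReal ((x + y) ^ 2) ≤ 2 * ENNReal.ofReal (x ^ 2) + 2 * ENNReal.ofReal (y ^ 2) := by
  rw [← ENNReal.ofReal_ofNat 2, ← ENNReal.ofReal_mul (by norm_num), ← ENNReal.ofReal_mul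
    (by norm_num), ← ENNReal.ofReal_add (by positivity) (by positivity)]
  exact ENNReal.ofReal_le_ofReal (by nlinarith [sq_nonneg (x - y)])

lemma sqInt_add_le {f g : Ω → ℝ} (hf : AEMeasurable f μ) :
    sqInt μ (fun ω => f ω + g ω) ≤ 2 * sqInt μ f + 2 * sqInt μ g := by
  unfold sqInt
  rw [← lintegral_const_mul' 2 _ (by simp), ← lintegral_const_mul' 2 _ (by simp),
    ← lintegral_add_left' (by fun_prop)]
  exact lintegral_mono fun ω => ofReal_add_sq_le _ _

lemma sqInt_sub_le {f g : Ω → ℝ} (hf : AEMeasurable f μ) :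
    sqInt μ (fun ω => f ω - g ω) ≤ 2 * sqInt μ f + 2 * sqInt μ g := by
  have := sqInt_add_le (g := fun ω => -g ω) hf
  rw [sqInt_neg] at this
  simpa [sub_eq_add_neg] using this

lemma sqInt_eq_eLpNorm (f : Ω → ℝ) : sqInt μ f = eLpNorm f 2 μ ^ 2 := by
  have h := eLpNorm_nnreal_pow_eq_lintegral (f := f) (μ := μ) (p := 2) (by norm_num)
  simp only [ENNReal.coe_ofNat, NNReal.coe_ofNat, ENNReal.rpow_ofNat] at h
  rw [h]
  refine lintegral_congr fun ω => ?_
  rw [← sq_abs, ENNReal.ofReal_pow (abs_nonneg _), ← Real.norm_eq_abs, ofReal_norm]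

lemma memLp_of_sqInt {f : Ω → ℝ} (hf : AEStronglyMeasurable f μ) (h : sqInt μ f ≠ ∞) :
    MemLp f 2 μ := by
  refine ⟨hf, lt_top_iff_ne_top.2 fun h' => h ?_⟩
  rw [sqInt_eq_eLpNorm, h']; simp

lemma sqInt_ne_top_of_memLp {f : Ω → ℝ} (h : MemLp f 2 μ) : sqInt μ f ≠ ∞ := by
  rw [sqInt_eq_eLpNorm]
  exact ENNReal.pow_ne_top h.2.ne

lemma integral_sq_eq_toReal {f : Ω → ℝ} (hf : AEStronglyMeasurable f μ) :
    ∫ ω, f ω ^ 2 ∂μ = (sqInt μ f).toReal :=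
  integral_eq_lintegral_of_nonneg_ae (ae_of_all _ fun _ => sq_nonneg _) (hf.pow 2)

lemma sqInt_eq_zero_iff {f : Ω → ℝ} (hf : AEMeasurable f μ) :
    sqInt μ f = 0 ↔ f =ᵐ[μ] 0 := by
  unfold sqInt
  rw [lintegral_eq_zero_iff' (by fun_prop)]
  refine ⟨fun h => h.mono fun ω hω => ?_, fun h => h.mono fun ω hω => by simp [hω]⟩
  have : f ω ^ 2 ≤ 0 := by simpa using hω
  simpa using le_antisymm this (sq_nonneg _)

lemma sqInt_prod [SFinite μ] {ν : Measure Ω'} [SFinite ν] {f : Ω × Ω' → ℝ} (hf : Measurable f) :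
    sqInt (μ.prod ν) f = ∫⁻ x, sqInt ν (fun y => f (x, y)) ∂μ :=
  lintegral_prod _ (by fun_prop)

lemma sqInt_prod_symm [SFinite μ] {ν : Measure Ω'} [SFinite ν] {f : Ω × Ω' → ℝ}
    (hf : Measurable f) :
    sqInt (μ.prod ν) f = ∫⁻ y, sqInt μ (fun x => f (x, y)) ∂ν :=
  lintegral_prod_symm _ (by fun_prop)

lemma measurable_sqInt_right {ν : Measure Ω'} [SFinite ν] {f : Ω × Ω' → ℝ} (hf : Measurable f) :
    Measurable fun x => sqInt ν (fun y => f (x, y)) :=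
  Measurable.lintegral_prod_right' (f := fun s : Ω × Ω' => ENNReal.ofReal (f s ^ 2)) (by fun_prop)

/-- Cauchy-Schwarz. -/
lemma lintegral_mul_sq_le {f g : Ω → ℝ≥0∞} (hf : AEMeasurable f μ) (hg : AEMeasurable g μ) :
    (∫⁻ ω, f ω * g ω ∂μ) ^ 2 ≤ (∫⁻ ω, f ω ^ 2 ∂μ) * ∫⁻ ω, g ω ^ 2 ∂μ := by
  have h := ENNReal.lintegral_mul_le_Lp_mul_Lq μ Real.HolderConjugate.two_two hf hg
  simp only [Pi.mul_apply, ENNReal.rpow_ofNat] at h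
  calc _ ≤ _ := pow_le_pow_left₀ zero_le h 2
    _ = _ := by
      rw [mul_pow, ← ENNReal.rpow_ofNat, ← ENNReal.rpow_ofNat, ← ENNReal.rpow_mul,
        ← ENNReal.rpow_mul]
      norm_num

lemma lintegral_mul_abs_sq_le {f g : Ω → ℝ} (hf : AEMeasurable f μ) (hg : AEMeasurable g μ) :
    (∫⁻ ω, ENNReal.ofReal |f ω * g ω| ∂μ) ^ 2 ≤ sqInt μ f * sqInt μ g := by
  have h := lintegral_mul_sq_le (μ := μ) (f := fun ω => ENNReal.ofReal |f ω|)
    (g := fun ω => ENNReal.ofReal |g ω|) (by fun_prop) (by fun_prop)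
  simpa only [sqInt, abs_mul, ENNReal.ofReal_mul (abs_nonneg _), ← ENNReal.ofReal_pow
    (abs_nonneg _), sq_abs] using h

lemma integral_mul_sq_le {f g : Ω → ℝ} (hf : AEMeasurable f μ) (hg : AEMeasurable g μ) :
    ENNReal.ofReal ((∫ ω, f ω * g ω ∂μ) ^ 2) ≤ sqInt μ f * sqInt μ g := by
  refine le_trans ?_ (lintegral_mul_abs_sq_le hf hg)
  rw [← sq_abs, ENNReal.ofReal_pow (abs_nonneg _)]
  refine pow_le_pow_left₀ zero_le ?_ 2
  have := enorm_integral_le_lintegral_enorm (μ := μ) (fun ω => f ω * g ω)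
  simpa only [Real.enorm_eq_ofReal_abs] using this

lemma integrable_mul_of_sqInt {f g : Ω → ℝ} (hf : AEStronglyMeasurable f μ)
    (hg : AEStronglyMeasurable g μ) (h1 : sqInt μ f ≠ ∞) (h2 : sqInt μ g ≠ ∞) :
    Integrable (fun ω => f ω * g ω) μ :=
  (memLp_of_sqInt hf h1).integrable_mul (memLp_of_sqInt hg h2)

/-- The reverse triangle inequality in `L²`. -/
lemma ofReal_sqrt_sub_sq_le {f g : Ω → ℝ} (hf : AEStronglyMeasurable f μ)
    (hg : AEStronglyMeasurable g μ) (h1 : sqInt μ f ≠ ∞) (h2 : sqInt μ g ≠ ∞) :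
    ENNReal.ofReal ((√(sqInt μ f).toReal - √(sqInt μ g).toReal) ^ 2)
      ≤ sqInt μ (fun ω => f ω - g ω) := by
  have hF := memLp_of_sqInt hf h1
  have hG := memLp_of_sqInt hg h2
  have e : ∀ {k : Ω → ℝ} (hk : MemLp k 2 μ), √(sqInt μ k).toReal = ‖hk.toLp k‖ := by
    intro k hk
    rw [sqInt_eq_eLpNorm, ENNReal.toReal_pow, Real.sqrt_sq ENNReal.toReal_nonneg, Lp.norm_toLp]
  have h3 : sqInt μ (fun ω => f ω - g ω) = ENNReal.ofReal (‖hF.toLp f - hG.toLp g‖ ^ 2) := by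
    rw [← MemLp.toLp_sub, Lp.norm_toLp, ← ENNReal.toReal_pow, ENNReal.ofReal_toReal, sqInt_eq_eLpNorm]
    · rfl
    · exact ENNReal.pow_ne_top (hF.sub hG).2.ne
  rw [h3, e hF, e hG]
  refine ENNReal.ofReal_le_ofReal ?_
  rw [← sq_abs]
  exact pow_le_pow_left₀ (abs_nonneg _) (abs_norm_sub_norm_le _ _) 2

end SqInt

/-! ### Asymptotic domination -/

section Domination

variable {Ω : Type*} [MeasurableSpace Ω] {μ : Measure Ω}

/-- Up to an arbitrarily small part, the sequence is dominated by an integrable function. -/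
def AsympDominated (μ : Measure Ω) (X : ℕ → Ω → ℝ≥0∞) : Prop :=
  ∀ ε : ℝ≥0∞, 0 < ε → ∃ (R : ℕ → Ω → ℝ≥0∞) (G : Ω → ℝ≥0∞), (∀ n, AEMeasurable (R n) μ) ∧
    AEMeasurable G μ ∧ ∫⁻ ω, G ω ∂μ ≠ ∞ ∧ (∀ᶠ n in atTop, ∫⁻ ω, R n ω ∂μ ≤ ε) ∧
    ∀ᶠ n in atTop, ∀ᵐ ω ∂μ, X n ω ≤ R n ω + G ω

lemma AsympDominated.mono {X Y : ℕ → Ω → ℝ≥0∞} (hY : AsympDominated μ Y)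
    (h : ∀ᶠ n in atTop, ∀ᵐ ω ∂μ, X n ω ≤ Y n ω) : AsympDominated μ X := by
  intro ε hε
  obtain ⟨R, G, h1, h2, h3, h4, h5⟩ := hY ε hε
  refine ⟨R, G, h1, h2, h3, h4, ?_⟩
  filter_upwards [h, h5] with n hn hn'
  filter_upwards [hn, hn'] with ω a b using a.trans b

lemma AsympDominated.add {X Y : ℕ → Ω → ℝ≥0∞} (hX : AsympDominated μ X)
    (hY : AsympDominated μ Y) : AsympDominated μ fun n ω => X n ω + Y n ω := by
  intro ε hε
  obtain ⟨R, G, h1, h2, h3, h4, h5⟩ := hX (ε / 2) (ENNReal.half_pos hε.ne')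
  obtain ⟨R', G', h1', h2', h3', h4', h5'⟩ := hY (ε / 2) (ENNReal.half_pos hε.ne')
  refine ⟨fun n ω => R n ω + R' n ω, fun ω => G ω + G' ω, fun n => (h1 n).add (h1' n),
    h2.add h2', ?_, ?_, ?_⟩
  · rw [lintegral_add_left' h2]; exact ENNReal.add_ne_top.2 ⟨h3, h3'⟩
  · filter_upwards [h4, h4'] with n a b
    rw [lintegral_add_left' (h1 n), ← ENNReal.add_halves ε]
    exact add_le_add a b
  · filter_upwards [h5, h5'] with n a b
    filter_upwards [a, b] with ω a b
    calc _ ≤ _ := add_le_add a b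
      _ = _ := by ring

lemma AsympDominated.const_mul {X : ℕ → Ω → ℝ≥0∞} (hX : AsympDominated μ X) {c : ℝ≥0∞}
    (hc : c ≠ ∞) : AsympDominated μ fun n ω => c * X n ω := by
  intro ε hε
  obtain ⟨R, G, h1, h2, h3, h4, h5⟩ := hX (ε / (c + 1))
    (ENNReal.div_pos hε.ne' (by simp [hc]))
  refine ⟨fun n ω => c * R n ω, fun ω => c * G ω, fun n => (h1 n).const_mul c, h2.const_mul c,
    ?_, ?_, ?_⟩
  · rw [lintegral_const_mul' _ _ hc]; exact ENNReal.mul_ne_top hc h3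
  · filter_upwards [h4] with n a
    rw [lintegral_const_mul' _ _ hc]
    calc _ ≤ (c + 1) * (ε / (c + 1)) := mul_le_mul' le_self_add a
      _ ≤ ε := ENNReal.mul_div_le
  · filter_upwards [h5] with n a
    filter_upwards [a] with ω a
    calc _ ≤ _ := mul_le_mul' le_rfl a
      _ = _ := by ring

lemma asympDominated_const {G : Ω → ℝ≥0∞} (hG : AEMeasurable G μ) (h : ∫⁻ ω, G ω ∂μ ≠ ∞) :
    AsympDominated μ fun _ => G :=
  fun ε _ => ⟨fun _ _ => 0, G, by fun_prop, hG, h, by simp, by simp⟩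

lemma asympDominated_of_tendsto {R : ℕ → Ω → ℝ≥0∞} (hR : ∀ n, AEMeasurable (R n) μ)
    (h : Tendsto (fun n => ∫⁻ ω, R n ω ∂μ) atTop (𝓝 0)) : AsympDominated μ R :=
  fun _ hε => ⟨R, fun _ => 0, hR, by fun_prop, by simp,
    (h.eventually (gt_mem_nhds hε)).mono fun _ h => h.le, by simp⟩

/-- Dominated convergence under asymptotic domination. -/
theorem AsympDominated.tendsto_zero {X : ℕ → Ω → ℝ≥0∞} (hX : AsympDominated μ X)
    (hm : ∀ n, AEMeasurable (X n) μ) (h0 : ∀ᵐ ω ∂μ, Tendsto (fun n => X n ω) atTop (𝓝 0)) :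
    Tendsto (fun n => ∫⁻ ω, X n ω ∂μ) atTop (𝓝 0) := by
  rw [ENNReal.tendsto_nhds_zero]
  intro ε hε
  obtain ⟨R, G, h1, h2, h3, h4, h5⟩ := hX (ε / 2) (ENNReal.half_pos hε.ne')
  -- The truncation at `G` is dominated outright, and what it cuts off from `X n` is at most `R n`.
  have hlim : Tendsto (fun n => ∫⁻ ω, min (X n ω) (G ω) ∂μ) atTop (𝓝 (∫⁻ _, 0 ∂μ)) := by
    refine tendsto_lintegral_of_dominated_convergence' G (fun n => (hm n).min h2)
      (fun n => ae_of_all _ fun ω => min_le_right _ _) h3 ?_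
    filter_upwards [h0] with ω hω
    exact tendsto_of_tendsto_of_tendsto_of_le_of_le tendsto_const_nhds hω
      (fun _ => zero_le) fun _ => min_le_left _ _
  rw [lintegral_zero, ENNReal.tendsto_nhds_zero] at hlim
  filter_upwards [hlim (ε / 2) (ENNReal.half_pos hε.ne'), h4, h5] with n a b c
  calc ∫⁻ ω, X n ω ∂μ ≤ ∫⁻ ω, (R n ω + min (X n ω) (G ω)) ∂μ := by
        refine lintegral_mono_ae (c.mono fun ω hω => ?_)
        rcases le_total (X n ω) (G ω) with h | h
        · rw [min_eq_left h]; exact le_add_self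
        · rw [min_eq_right h]; exact hω
    _ = ∫⁻ ω, R n ω ∂μ + ∫⁻ ω, min (X n ω) (G ω) ∂μ := lintegral_add_left' (h1 n) _
    _ ≤ ε := by rw [← ENNReal.add_halves ε]; exact add_le_add b a

/-- Convergence in `L¹` to zero gives almost everywhere convergence along a subsequence. -/
lemma exists_subseq_tendsto_ae {R : ℕ → Ω → ℝ≥0∞} (hR : ∀ n, Measurable (R n))
    (h : Tendsto (fun n => ∫⁻ ω, R n ω ∂μ) atTop (𝓝 0)) :
    ∃ φ : ℕ → ℕ, StrictMono φ ∧ ∀ᵐ ω ∂μ, Tendsto (fun n => R (φ n) ω) atTop (𝓝 0) := by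
  -- Along a subsequence the integrals lie below a geometric sequence, so the sum of the functions
  -- is finite almost everywhere and its terms tend to zero.
  have h2 : ∀ k : ℕ, ∀ᶠ n in atTop, ∫⁻ ω, R n ω ∂μ ≤ (2⁻¹ : ℝ≥0∞) ^ k := fun k =>
    (ENNReal.tendsto_nhds_zero.1 h) _ (by simp [pos_iff_ne_zero])
  obtain ⟨φ, hφ, hφ'⟩ := extraction_forall_of_eventually h2
  refine ⟨φ, hφ, ?_⟩
  have hsum : ∫⁻ ω, ∑' k, R (φ k) ω ∂μ ≠ ∞ := by
    rw [lintegral_tsum fun k => (hR _).aemeasurable]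
    refine ne_top_of_le_ne_top ?_ (ENNReal.tsum_le_tsum hφ')
    rw [ENNReal.tsum_geometric]
    simp
  filter_upwards [ae_lt_top (Measurable.tsum fun k => hR _) hsum] with ω hω
  exact ENNReal.tendsto_atTop_zero_of_tsum_ne_top hω.ne

end Domination

/-! ### The probability integral transform -/

instance : IsProbabilityMeasure unitVol := ⟨by simp [unitVol]⟩

lemma unitVol_Iic (t : ℝ) : unitVol (Iic t) = ENNReal.ofReal (min t 1) := by
  unfold unitVol
  rw [Measure.restrict_congr_set Ioo_ae_eq_Ioc, Measure.restrict_apply measurableSet_Iic,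
    inter_comm, Ioc_inter_Iic, Real.volume_Ioc]
  simp [min_comm]

lemma map_one_sub_unitVol : unitVol.map (fun u => 1 - u) = unitVol := by
  have h := (Measure.measurePreserving_sub_left (volume : Measure ℝ) 1).restrict_preimage
    (measurableSet_Ioo (a := (0 : ℝ)) (b := 1))
  have h2 : (fun u : ℝ => 1 - u) ⁻¹' Ioo 0 1 = Ioo 0 1 := by ext u; simp
  rw [h2] at h
  exact h.map_eq

lemma ae_unitVol_mem : ∀ᵐ u ∂unitVol, u ∈ Ioo (0 : ℝ) 1 := ae_restrict_mem measurableSet_Ioo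

/-- Without atoms the distribution function is continuous, so it attains each level `t` in `(0, 1)`,
and `{F ≤ t}` is the half-line up to the last point where it does. Strict monotonicity plays no
role. -/
theorem map_cdf_eq_unitVol (P : Measure ℝ) [IsProbabilityMeasure P] [NullSingletonClass P] :
    P.map (fun z => P.real (Iic z)) = unitVol := by
  set F : ℝ → ℝ := fun z => P.real (Iic z) with hF
  have hFc : F = ProbabilityTheory.cdf P := by
    ext z; rw [ProbabilityTheory.cdf_eq_real]
  have hmono : Monotone F := by rw [hFc]; exact ProbabilityTheory.monotone_cdf P
  have hbot : Tendsto F atBot (𝓝 0) := by rw [hFc]; exact ProbabilityTheory.tendsto_cdf_atBot P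
  have htop : Tendsto F atTop (𝓝 1) := by rw [hFc]; exact ProbabilityTheory.tendsto_cdf_atTop P
  have hcont : Continuous F := by
    rw [continuous_iff_continuousAt]
    intro z
    have hr : ContinuousWithinAt F (Ici z) z := by
      rw [hFc]; exact (ProbabilityTheory.cdf P).right_continuous z
    have hl : ContinuousWithinAt F (Iio z) z := by
      rw [hmono.continuousWithinAt_Iio_iff_leftLim_eq]
      have h1 : (ProbabilityTheory.cdf P).measure {z} = 0 := by
        rw [ProbabilityTheory.measure_cdf]; exact measure_singleton z
      rw [StieltjesFunction.measure_singleton, ENNReal.ofReal_eq_zero] at h1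
      have h2 := hmono.leftLim_le (le_refl z)
      rw [hFc] at h2 ⊢
      linarith
    exact continuousAt_iff_continuous_left'_right'.2 ⟨hl, hr.mono Ioi_subset_Ici_self⟩
  have key : ∀ t ∈ Ioo (0 : ℝ) 1, P {z | F z ≤ t} = ENNReal.ofReal t := by
    intro t ht
    obtain ⟨x, hx⟩ := (hbot.eventually (gt_mem_nhds ht.1)).exists
    obtain ⟨y, hy⟩ := (htop.eventually (lt_mem_nhds ht.2)).exists
    obtain ⟨z, hz⟩ := mem_range_of_exists_le_of_exists_ge hcont ⟨x, hx.le⟩ ⟨y, hy.le⟩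
    have hbdd : BddAbove {z | F z ≤ t} := ⟨y, fun w hw => by
      by_contra h
      exact absurd (hmono (not_le.1 h).le) (not_le.2 (lt_of_le_of_lt hw hy))⟩
    have hcl : IsClosed {z | F z ≤ t} := isClosed_le hcont continuous_const
    have hmem := hcl.csSup_mem ⟨z, hz.le⟩ hbdd
    set m := sSup {z | F z ≤ t}
    have hm : F m = t := le_antisymm hmem (hz ▸ hmono (le_csSup hbdd hz.le))
    have hset : {z | F z ≤ t} = Iic m := by
      ext w
      exact ⟨fun hw => le_csSup hbdd hw, fun hw => (hmono hw).trans hm.le⟩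
    rw [hset, ← hm, hF]
    simp
  refine Measure.ext_of_Iic _ _ fun t => ?_
  rw [Measure.map_apply hcont.measurable measurableSet_Iic, unitVol_Iic]
  change P {z | F z ≤ t} = _
  rcases lt_or_ge t 0 with h | h
  · have : {z | F z ≤ t} = ∅ := by
      ext w
      simpa using h.trans_le measureReal_nonneg
    rw [this, measure_empty, min_eq_left (by linarith), ENNReal.ofReal_of_nonpos h.le]
  rcases le_or_gt 1 t with h1 | h1
  · have : {z | F z ≤ t} = univ := by
      ext w
      simpa using (measureReal_le_one (μ := P) (s := Iic w)).trans h1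
    rw [this, measure_univ, min_eq_right h1, ENNReal.ofReal_one]
  rw [min_eq_left h1.le]
  rcases h.lt_or_eq with h0 | h0
  · exact key t ⟨h0, h1⟩
  -- The level `0` need not be attained; its sublevel set lies in those of small positive levels.
  · subst h0
    rw [ENNReal.ofReal_zero]
    refine le_antisymm (ENNReal.le_of_forall_pos_le_add fun ε hε _ => ?_) zero_le
    have hs : min (ε : ℝ) (1 / 2) ∈ Ioo (0 : ℝ) 1 :=
      ⟨lt_min (by exact_mod_cast hε) (by norm_num), (min_le_right _ _).trans_lt (by norm_num)⟩
    calc P {z | F z ≤ 0} ≤ P {z | F z ≤ min (ε : ℝ) (1 / 2)} :=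
          measure_mono fun z hz => le_trans hz hs.1.le
      _ = ENNReal.ofReal (min (ε : ℝ) (1 / 2)) := key _ hs
      _ ≤ ENNReal.ofReal ε := ENNReal.ofReal_le_ofReal (min_le_left _ _)
      _ = 0 + ε := by simp

/-! ### Distribution functions of squares of unit vectors -/

section Cdf

variable {μ : Measure ℝ} {a : ℝ → ℝ}

/-- The distribution function of the density `a ^ 2`. -/
def sqCdf (μ : Measure ℝ) (a : ℝ → ℝ) (z : ℝ) : ℝ := ∫ s in Iic z, a s ^ 2 ∂μ

/-- The measure with density `a ^ 2`. -/
def sqMeas {Ω : Type*} [MeasurableSpace Ω] (μ : Measure Ω) (a : Ω → ℝ) : Measure Ω :=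
  μ.withDensity fun s => ENNReal.ofReal (a s ^ 2)

lemma isProbabilityMeasure_sqMeas {Ω : Type*} [MeasurableSpace Ω] {μ : Measure Ω} {a : Ω → ℝ}
    (h : sqInt μ a = 1) : IsProbabilityMeasure (sqMeas μ a) :=
  ⟨by rw [sqMeas, withDensity_apply _ MeasurableSet.univ, Measure.restrict_univ]; exact h⟩

instance [NullSingletonClass μ] : NullSingletonClass (sqMeas μ a) := by unfold sqMeas; infer_instance

lemma integrable_sq (ha : Measurable a) (h : sqInt μ a ≠ ∞) : Integrable (fun s => a s ^ 2) μ :=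
  (memLp_of_sqInt ha.aestronglyMeasurable h).integrable_sq

lemma sqMeas_real_Iic (ha : Measurable a) (z : ℝ) : (sqMeas μ a).real (Iic z) = sqCdf μ a z := by
  rw [sqCdf, integral_eq_lintegral_of_nonneg_ae (ae_of_all _ fun _ => sq_nonneg _)
    (ha.pow_const 2).aestronglyMeasurable, measureReal_def, sqMeas,
    withDensity_apply _ measurableSet_Iic]

lemma monotone_sqCdf (ha : Measurable a) (h : sqInt μ a = 1) : Monotone (sqCdf μ a) := by
  have := isProbabilityMeasure_sqMeas h
  intro x y hxy
  rw [← sqMeas_real_Iic ha, ← sqMeas_real_Iic ha]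
  exact measureReal_mono (Iic_subset_Iic.2 hxy)

lemma measurable_sqCdf (ha : Measurable a) (h : sqInt μ a = 1) : Measurable (sqCdf μ a) :=
  (monotone_sqCdf ha h).measurable

lemma sqCdf_nonneg (z : ℝ) : 0 ≤ sqCdf μ a z := integral_nonneg fun _ => sq_nonneg _

lemma sqCdf_le_one (ha : Measurable a) (h : sqInt μ a = 1) (z : ℝ) : sqCdf μ a z ≤ 1 := by
  have := isProbabilityMeasure_sqMeas h
  rw [← sqMeas_real_Iic ha]
  exact measureReal_le_one

lemma map_sqCdf [NullSingletonClass μ] (ha : Measurable a) (h : sqInt μ a = 1) :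
    (sqMeas μ a).map (sqCdf μ a) = unitVol := by
  have := isProbabilityMeasure_sqMeas h
  rw [← map_cdf_eq_unitVol (sqMeas μ a)]
  congr 1
  ext z; rw [sqMeas_real_Iic ha]

/-- Since `a` does not vanish, `μ` is absolutely continuous with respect to the measure with density
`a ^ 2`. -/
lemma ae_of_ae_sqMeas {Ω : Type*} [MeasurableSpace Ω] {μ : Measure Ω} {a : Ω → ℝ}
    (ha : Measurable a) (ha0 : ∀ᵐ s ∂μ, a s ≠ 0) {q : Ω → Prop}
    (hq : ∀ᵐ s ∂sqMeas μ a, q s) : ∀ᵐ s ∂μ, q s := by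
  rw [sqMeas, ae_withDensity_iff (by fun_prop)] at hq
  filter_upwards [ha0, hq] with s h1 h2
  exact h2 (by simpa using h1)

/-- Null sets of levels in the unit interval pull back to null sets of points. In this way
exceptional levels of a curve or of a copula density are discarded. -/
lemma ae_comp_sqCdf [NullSingletonClass μ] (ha : Measurable a) (h : sqInt μ a = 1)
    (ha0 : ∀ᵐ s ∂μ, a s ≠ 0) {q : ℝ → Prop} (hq : ∀ᵐ u ∂unitVol, q u) :
    ∀ᵐ s ∂μ, q (sqCdf μ a s) := by
  refine ae_of_ae_sqMeas ha ha0 ?_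
  rw [← map_sqCdf ha h] at hq
  exact ae_of_ae_map (measurable_sqCdf ha h).aemeasurable hq

lemma ae_sqCdf_mem [NullSingletonClass μ] (ha : Measurable a) (h : sqInt μ a = 1)
    (ha0 : ∀ᵐ s ∂μ, a s ≠ 0) : ∀ᵐ s ∂μ, sqCdf μ a s ∈ Ioo (0 : ℝ) 1 :=
  ae_comp_sqCdf ha h ha0 ae_unitVol_mem

/-- Change of variables along the distribution function. -/
lemma lintegral_comp_sqCdf [NullSingletonClass μ] (ha : Measurable a) (h : sqInt μ a = 1) {F : ℝ → ℝ≥0∞}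
    (hF : Measurable F) :
    ∫⁻ z, ENNReal.ofReal (a z ^ 2) * F (sqCdf μ a z) ∂μ = ∫⁻ u, F u ∂unitVol := by
  have hm := measurable_sqCdf ha h
  rw [← map_sqCdf ha h, lintegral_map hF hm, sqMeas,
    lintegral_withDensity_eq_lintegral_mul _ (by fun_prop) (g := fun z => F (sqCdf μ a z)) (hF.comp hm)]
  rfl

/-- Transport of a function of `(u, ω)`, `u ∈ (0, 1)`, to a function of `(z, ω)` along the
distribution function of `a ^ 2`. -/
def transport {Ω : Type*} (μ : Measure ℝ) (a : ℝ → ℝ) (f : ℝ × Ω → ℝ) (s : ℝ × Ω) : ℝ :=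
  a s.1 * f (sqCdf μ a s.1, s.2)

variable {Ω : Type*} [MeasurableSpace Ω] {ν : Measure Ω}

lemma measurable_transport (ha : Measurable a) (h : sqInt μ a = 1) {f : ℝ × Ω → ℝ}
    (hf : Measurable f) : Measurable (transport μ a f) := by
  have := measurable_sqCdf ha h
  unfold transport
  fun_prop

/-- Transport is an isometry: the factor `a ^ 2` turns `μ` into a law whose image under its
distribution function is uniform. -/
lemma sqInt_transport [SFinite μ] [NullSingletonClass μ] [SFinite ν] (ha : Measurable a) (h : sqInt μ a = 1)
    {f : ℝ × Ω → ℝ} (hf : Measurable f) :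
    sqInt (μ.prod ν) (transport μ a f) = sqInt (unitVol.prod ν) f := by
  rw [sqInt_prod (measurable_transport ha h hf), sqInt_prod hf,
    ← lintegral_comp_sqCdf ha h (measurable_sqInt_right hf)]
  refine lintegral_congr fun z => ?_
  rw [← sqInt_const_mul]
  rfl

end Cdf

/-! ### Hardy's inequality -/

/-- This integral and the next are the two one-dimensional integrals of the Schur test in
`lintegral_hardy`. -/
lemma lintegral_rpow_Ioc {t : ℝ} (ht : 0 ≤ t) :
    ∫⁻ u in Ioc 0 t, ENNReal.ofReal (u ^ (-(1 / 2) : ℝ)) = ENNReal.ofReal (2 * t ^ (1 / 2 : ℝ)) := by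
  have hi : IntervalIntegrable (fun u : ℝ => u ^ (-(1 / 2) : ℝ)) volume 0 t :=
    intervalIntegral.intervalIntegrable_rpow' (by norm_num)
  rw [← ofReal_integral_eq_lintegral_ofReal]
  · rw [← intervalIntegral.integral_of_le ht, integral_rpow (Or.inl (by norm_num))]
    congr 1
    rw [Real.zero_rpow (by norm_num)]
    norm_num
    ring
  · exact (intervalIntegrable_iff_integrableOn_Ioc_of_le ht).1 hi
  · filter_upwards [ae_restrict_mem measurableSet_Ioc] with u hu
    exact Real.rpow_nonneg hu.1.le _

lemma lintegral_rpow_Ioi {t : ℝ} (ht : 0 < t) :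
    ∫⁻ u in Ioi t, ENNReal.ofReal (u ^ (-(3 / 2) : ℝ))
      = ENNReal.ofReal (2 * t ^ (-(1 / 2) : ℝ)) := by
  rw [← ofReal_integral_eq_lintegral_ofReal]
  · rw [integral_Ioi_rpow_of_lt (by norm_num) ht]
    congr 1
    norm_num
    ring
  · exact integrableOn_Ioi_rpow_of_lt (by norm_num) ht
  · filter_upwards [ae_restrict_mem measurableSet_Ioi] with u hu
    exact Real.rpow_nonneg (ht.le.trans (le_of_lt hu)) _

section Hardy

variable {Ω : Type*} [MeasurableSpace Ω]

/-- **Hardy's inequality** for the averages of a function over the sublevel sets of a uniformly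
distributed `W`. -/
theorem lintegral_hardy {P : Measure Ω} [SFinite P] {W : Ω → ℝ} (hW : Measurable W)
    (hWP : P.map W = unitVol) {f : Ω → ℝ≥0∞} (hf : Measurable f) :
    ∫⁻ z, ((∫⁻ s in {s | W s ≤ W z}, f s ∂P) / ENNReal.ofReal (W z)) ^ 2 ∂P
      ≤ 4 * ∫⁻ s, f s ^ 2 ∂P := by
  have hpos : ∀ᵐ z ∂P, W z ∈ Ioo (0 : ℝ) 1 := by
    have := ae_unitVol_mem
    rw [← hWP] at this
    exact ae_of_ae_map hW.aemeasurable this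
  have hS : MeasurableSet {p : Ω × Ω | W p.2 ≤ W p.1} :=
    measurableSet_le (hW.comp measurable_snd) (hW.comp measurable_fst)
  have h1 : ∀ z, 0 < W z → ∫⁻ s in {s | W s ≤ W z}, ENNReal.ofReal (W s ^ (-(1 / 2) : ℝ)) ∂P
      ≤ ENNReal.ofReal (2 * W z ^ (1 / 2 : ℝ)) := by
    intro z hz
    rw [← lintegral_rpow_Ioc hz.le]
    have e1 : ∫⁻ s in {s | W s ≤ W z}, ENNReal.ofReal (W s ^ (-(1 / 2) : ℝ)) ∂P
        = ∫⁻ u in Iic (W z), ENNReal.ofReal (u ^ (-(1 / 2) : ℝ)) ∂unitVol := by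
      rw [← hWP, setLIntegral_map measurableSet_Iic (by fun_prop) hW]
      rfl
    rw [e1, unitVol, Measure.restrict_restrict measurableSet_Iic]
    have hss : Iic (W z) ∩ Ioo 0 1 ⊆ Ioc 0 (W z) := fun u hu => ⟨hu.2.1, hu.1⟩
    exact lintegral_mono' (Measure.restrict_mono hss le_rfl) le_rfl
  have h2 : ∀ s, 0 < W s → ∫⁻ z in {z | W s ≤ W z}, ENNReal.ofReal (W z ^ (-(3 / 2) : ℝ)) ∂P
      ≤ ENNReal.ofReal (2 * W s ^ (-(1 / 2) : ℝ)) := by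
    intro s hs
    rw [← lintegral_rpow_Ioi hs]
    have e1 : ∫⁻ z in {z | W s ≤ W z}, ENNReal.ofReal (W z ^ (-(3 / 2) : ℝ)) ∂P
        = ∫⁻ u in Ici (W s), ENNReal.ofReal (u ^ (-(3 / 2) : ℝ)) ∂unitVol := by
      rw [← hWP, setLIntegral_map measurableSet_Ici (by fun_prop) hW]
      rfl
    rw [e1, unitVol, Measure.restrict_restrict measurableSet_Ici,
      Measure.restrict_congr_set (Ioi_ae_eq_Ici (a := W s))]
    exact lintegral_mono' (Measure.restrict_mono (fun u hu => hu.1) le_rfl) le_rfl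
  -- Schur test: Cauchy-Schwarz with the factors `W ^ (1/4)` and `W ^ (-1/4)`. The integral of `W ^
  -- (-1/2)` over the sublevel set is at most `2 W(z) ^ (1/2)`.
  have hstep : ∀ᵐ z ∂P, ((∫⁻ s in {s | W s ≤ W z}, f s ∂P) / ENNReal.ofReal (W z)) ^ 2
      ≤ ∫⁻ s in {s | W s ≤ W z}, 2 * ENNReal.ofReal (W z ^ (-(3 / 2) : ℝ)) *
        (f s ^ 2 * ENNReal.ofReal (W s ^ (1 / 2 : ℝ))) ∂P := by
    filter_upwards [hpos] with z hz
    have hz0 := hz.1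
    have hcs := lintegral_mul_sq_le (μ := P.restrict {s | W s ≤ W z})
      (f := fun s => f s * ENNReal.ofReal (W s ^ (1 / 4 : ℝ)))
      (g := fun s => ENNReal.ofReal (W s ^ (-(1 / 4) : ℝ))) (by fun_prop) (by fun_prop)
    have e1 : ∫⁻ s in {s | W s ≤ W z}, f s ∂P = ∫⁻ s in {s | W s ≤ W z},
        f s * ENNReal.ofReal (W s ^ (1 / 4 : ℝ)) * ENNReal.ofReal (W s ^ (-(1 / 4) : ℝ)) ∂P := by
      refine lintegral_congr_ae ((ae_restrict_of_ae hpos).mono fun s hs => ?_)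
      have hs0 : (0 : ℝ) < W s := hs.1
      simp only
      rw [mul_assoc, ← ENNReal.ofReal_mul (by positivity), ← Real.rpow_add hs0]
      simp
    have e2 : ∀ᵐ s ∂P, ENNReal.ofReal (W s ^ (-(1 / 4) : ℝ)) ^ 2
        = ENNReal.ofReal (W s ^ (-(1 / 2) : ℝ)) := by
      filter_upwards [hpos] with s hs
      have hs0 : (0 : ℝ) < W s := hs.1
      rw [← ENNReal.ofReal_pow (by positivity), ← Real.rpow_natCast, ← Real.rpow_mul hs0.le]
      norm_num
    have e3 : ∀ᵐ s ∂P, (f s * ENNReal.ofReal (W s ^ (1 / 4 : ℝ))) ^ 2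
        = f s ^ 2 * ENNReal.ofReal (W s ^ (1 / 2 : ℝ)) := by
      filter_upwards [hpos] with s hs
      have hs0 : (0 : ℝ) < W s := hs.1
      rw [mul_pow, ← ENNReal.ofReal_pow (by positivity), ← Real.rpow_natCast,
        ← Real.rpow_mul hs0.le]
      norm_num
    rw [← e1, lintegral_congr_ae (ae_restrict_of_ae e2), lintegral_congr_ae (ae_restrict_of_ae e3)]
      at hcs
    have hWz : ENNReal.ofReal (W z) ^ 2 = ENNReal.ofReal (W z ^ 2) := by
      rw [ENNReal.ofReal_pow hz0.le]
    rw [ENNReal.div_eq_inv_mul, mul_pow, ← ENNReal.inv_pow, hWz, lintegral_const_mul _ (by fun_prop)]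
    calc (ENNReal.ofReal (W z ^ 2))⁻¹ * (∫⁻ s in {s | W s ≤ W z}, f s ∂P) ^ 2
        ≤ (ENNReal.ofReal (W z ^ 2))⁻¹ * ((∫⁻ s in {s | W s ≤ W z},
            f s ^ 2 * ENNReal.ofReal (W s ^ (1 / 2 : ℝ)) ∂P)
            * ENNReal.ofReal (2 * W z ^ (1 / 2 : ℝ))) := by
          gcongr
          exact hcs.trans (mul_le_mul' le_rfl (h1 z hz0))
      _ = ((ENNReal.ofReal (W z ^ 2))⁻¹ * ENNReal.ofReal (2 * W z ^ (1 / 2 : ℝ)))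
          * ∫⁻ s in {s | W s ≤ W z}, f s ^ 2 * ENNReal.ofReal (W s ^ (1 / 2 : ℝ)) ∂P := by ring
      _ = _ := by
          congr 1
          rw [← ENNReal.ofReal_inv_of_pos (by positivity), ← ENNReal.ofReal_mul (by positivity),
            ← ENNReal.ofReal_ofNat 2, ← ENNReal.ofReal_mul (by norm_num)]
          congr 1
          rw [mul_left_comm, ← Real.rpow_natCast, ← Real.rpow_neg hz0.le, ← Real.rpow_add hz0]
          norm_num
  refine (lintegral_mono_ae hstep).trans ?_
  -- After the exchange of integrals, `W(z) ^ (-3/2)` is integrated over `W s ≤ W z`, with value at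
  -- most `2 W(s) ^ (-1/2)`. The powers of `W s` cancel, and the constant is `2 * 2`.
  set k : Ω × Ω → ℝ≥0∞ := {p : Ω × Ω | W p.2 ≤ W p.1}.indicator
    (fun p => 2 * ENNReal.ofReal (W p.1 ^ (-(3 / 2) : ℝ)) *
      (f p.2 ^ 2 * ENNReal.ofReal (W p.2 ^ (1 / 2 : ℝ)))) with hk
  have hkm : Measurable k := Measurable.indicator (by fun_prop) hS
  calc ∫⁻ z, ∫⁻ s in {s | W s ≤ W z}, 2 * ENNReal.ofReal (W z ^ (-(3 / 2) : ℝ)) *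
        (f s ^ 2 * ENNReal.ofReal (W s ^ (1 / 2 : ℝ))) ∂P ∂P
      = ∫⁻ z, ∫⁻ s, k (z, s) ∂P ∂P := by
        refine lintegral_congr fun z => ?_
        rw [← lintegral_indicator (measurableSet_le hW measurable_const)]
        rfl
    _ = ∫⁻ (s : Ω), ∫⁻ (z : Ω), k (z, s) ∂P ∂P :=
        lintegral_lintegral_swap hkm.aemeasurable
    _ = ∫⁻ s, ∫⁻ z in {z | W s ≤ W z}, 2 * (f s ^ 2 * ENNReal.ofReal (W s ^ (1 / 2 : ℝ))) *
        ENNReal.ofReal (W z ^ (-(3 / 2) : ℝ)) ∂P ∂P := by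
        refine lintegral_congr fun s => ?_
        rw [← lintegral_indicator (measurableSet_le measurable_const hW)]
        refine lintegral_congr fun z => ?_
        by_cases h : W s ≤ W z
        · simp [hk, indicator, h]; ring
        · simp [hk, indicator, h]
    _ ≤ ∫⁻ s, 4 * f s ^ 2 ∂P := by
        refine lintegral_mono_ae (hpos.mono fun s hs => ?_)
        have hs0 : (0 : ℝ) < W s := hs.1
        rw [lintegral_const_mul _ (by fun_prop)]
        calc _ ≤ 2 * (f s ^ 2 * ENNReal.ofReal (W s ^ (1 / 2 : ℝ))) *
              ENNReal.ofReal (2 * W s ^ (-(1 / 2) : ℝ)) := mul_le_mul' le_rfl (h2 s hs0)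
          _ = 2 * f s ^ 2 * (ENNReal.ofReal (W s ^ (1 / 2 : ℝ)) *
              ENNReal.ofReal (2 * W s ^ (-(1 / 2) : ℝ))) := by ring
          _ = 4 * f s ^ 2 := by
            rw [← ENNReal.ofReal_mul (by positivity), mul_left_comm, ← Real.rpow_add hs0]
            norm_num
            ring
    _ = _ := lintegral_const_mul _ (by fun_prop)

end Hardy

section HardyTail

variable {Ω : Type*} [MeasurableSpace Ω]

/-- Hardy's inequality for the variation of the distribution function between the densities `a ^ 2`
and `b ^ 2`, localized to a set `S` that is closed under taking predecessors. -/
lemma lintegral_hardy_tail {μ : Measure Ω} [SFinite μ] {a b : Ω → ℝ} (ha : Measurable a)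
    (hb : Measurable b) {W : Ω → ℝ} (hW : Measurable W)
    (hWP : (μ.withDensity fun s => ENNReal.ofReal ((a s ^ 2 + b s ^ 2) / 2)).map W = unitVol)
    {L : Ω → Set Ω} (hL : ∀ z, MeasurableSet (L z)) (hLW : ∀ z, ∀ s ∈ L z, W s ≤ W z)
    {S : Set Ω} (hS : MeasurableSet S) (hLS : ∀ z ∈ S, L z ⊆ S) :
    ∫⁻ z in S, ENNReal.ofReal (a z ^ 2) *
        ((∫⁻ s in L z, ENNReal.ofReal |b s ^ 2 - a s ^ 2| ∂μ) / ENNReal.ofReal (W z)) ^ 2 ∂μ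
      ≤ 32 * ∫⁻ z in S, ENNReal.ofReal ((b z - a z) ^ 2) ∂μ := by
  -- Hardy's inequality is applied under the mixture `p` to the relative difference `|b² - a²| / p`.
  -- Its square times `p` is at most `4 (b - a)²`, because `(b + a)² ≤ 4 p`; this would fail with
  -- `a²` for `p`. The constant is `32 = 2 * 4 * 4`, from `a² ≤ 2 p`, Hardy's constant and this
  -- bound.
  set p : Ω → ℝ≥0∞ := fun s => ENNReal.ofReal ((a s ^ 2 + b s ^ 2) / 2) with hp
  have hpm : Measurable p := by fun_prop
  set P := μ.withDensity p with hP
  -- The cut-off to `S` costs nothing at points `z` of `S`, since their predecessors stay in `S`.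
  set f : Ω → ℝ≥0∞ := S.indicator fun s => ENNReal.ofReal |b s ^ 2 - a s ^ 2| / p s with hf
  have hfm : Measurable f := Measurable.indicator (by fun_prop) hS
  have hkey : ∀ s, ENNReal.ofReal |b s ^ 2 - a s ^ 2| ≤
      p s * (ENNReal.ofReal |b s ^ 2 - a s ^ 2| / p s) := by
    intro s
    by_cases h : p s = 0
    · have h1 : (a s ^ 2 + b s ^ 2) / 2 ≤ 0 := by simpa [hp] using h
      have h2 : b s ^ 2 - a s ^ 2 = 0 := by nlinarith [sq_nonneg (a s), sq_nonneg (b s)]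
      simp [h2]
    · rw [ENNReal.mul_div_cancel h ENNReal.ofReal_ne_top]
  have h1 : ∀ z ∈ S, ∫⁻ s in L z, ENNReal.ofReal |b s ^ 2 - a s ^ 2| ∂μ
      ≤ ∫⁻ s in {s | W s ≤ W z}, f s ∂P := by
    intro z hz
    calc ∫⁻ s in L z, ENNReal.ofReal |b s ^ 2 - a s ^ 2| ∂μ
        ≤ ∫⁻ s in L z, (p * f) s ∂μ := by
          refine setLIntegral_mono (hpm.mul hfm) fun s hs => ?_
          simp only [Pi.mul_apply, hf, indicator_of_mem (hLS z hz hs)]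
          exact hkey s
      _ = ∫⁻ s in L z, f s ∂P := by
          rw [hP, setLIntegral_withDensity_eq_setLIntegral_mul _ hpm hfm (hL z)]
      _ ≤ _ := lintegral_mono_set (hLW z)
  have h2 : ∀ z, ENNReal.ofReal (a z ^ 2) ≤ 2 * p z := by
    intro z
    rw [hp, ← ENNReal.ofReal_ofNat 2, ← ENNReal.ofReal_mul (by norm_num)]
    exact ENNReal.ofReal_le_ofReal (by nlinarith [sq_nonneg (b z)])
  have h3 : ∀ z, p z * f z ^ 2 ≤ S.indicator (fun z => 4 * ENNReal.ofReal ((b z - a z) ^ 2)) z := by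
    intro z
    by_cases hz : z ∈ S
    · simp only [hf, indicator_of_mem hz]
      by_cases h : (a z ^ 2 + b z ^ 2) / 2 = 0
      · simp [hp, h]
      · have h' : 0 < (a z ^ 2 + b z ^ 2) / 2 := lt_of_le_of_ne (by positivity) (Ne.symm h)
        simp only [hp]
        rw [← ENNReal.ofReal_div_of_pos h', ← ENNReal.ofReal_pow (by positivity),
          ← ENNReal.ofReal_mul h'.le, ← ENNReal.ofReal_ofNat 4, ← ENNReal.ofReal_mul (by norm_num)]
        refine ENNReal.ofReal_le_ofReal ?_
        rw [div_pow, sq_abs, mul_div_assoc', div_le_iff₀ (by positivity)]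
        have : (b z ^ 2 - a z ^ 2) ^ 2 = (b z - a z) ^ 2 * (b z + a z) ^ 2 := by ring
        rw [this]
        nlinarith [mul_nonneg h'.le (mul_nonneg (sq_nonneg (b z - a z)) (sq_nonneg (b z - a z)))]
    · simp [hf, hz]
  have hm : Measurable fun z => (∫⁻ s in {s | W s ≤ W z}, f s ∂P) / ENNReal.ofReal (W z) := by
    refine Measurable.div ?_ (by fun_prop)
    have e : (fun z => ∫⁻ s in {s | W s ≤ W z}, f s ∂P)
        = fun z => ∫⁻ s, {q : Ω × Ω | W q.2 ≤ W q.1}.indicator (fun q => f q.2) (z, s) ∂P := by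
      ext z
      rw [← lintegral_indicator (measurableSet_le hW measurable_const)]
      rfl
    rw [e]
    exact Measurable.lintegral_prod_right' (Measurable.indicator (by fun_prop)
      (measurableSet_le (hW.comp measurable_snd) (hW.comp measurable_fst)))
  calc _ ≤ ∫⁻ z in S, 2 * (p z *
        ((∫⁻ s in {s | W s ≤ W z}, f s ∂P) / ENNReal.ofReal (W z)) ^ 2) ∂μ := by
        refine setLIntegral_mono (by fun_prop) fun z hz => ?_
        rw [← mul_assoc]
        exact mul_le_mul' (h2 z) (pow_le_pow_left₀ zero_le (ENNReal.div_le_div_right (h1 z hz) _) 2)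
    _ ≤ ∫⁻ z, 2 * (p z *
        ((∫⁻ s in {s | W s ≤ W z}, f s ∂P) / ENNReal.ofReal (W z)) ^ 2) ∂μ :=
        setLIntegral_le_lintegral _ _
    _ = 2 * ∫⁻ z, ((∫⁻ s in {s | W s ≤ W z}, f s ∂P) / ENNReal.ofReal (W z)) ^ 2 ∂P := by
        rw [lintegral_const_mul _ (by fun_prop), hP,
          lintegral_withDensity_eq_lintegral_mul _ hpm (hm.pow_const 2)]
        rfl
    _ ≤ 2 * (4 * ∫⁻ s, f s ^ 2 ∂P) := by
        gcongr
        exact lintegral_hardy hW hWP hfm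
    _ = 2 * (4 * ∫⁻ s, p s * f s ^ 2 ∂μ) := by
        rw [hP, lintegral_withDensity_eq_lintegral_mul _ hpm (hfm.pow_const 2)]
        rfl
    _ ≤ 2 * (4 * ∫⁻ s, S.indicator (fun z => 4 * ENNReal.ofReal ((b z - a z) ^ 2)) s ∂μ) := by
        gcongr with s
        exact h3 s
    _ = _ := by
        rw [lintegral_indicator hS, lintegral_const_mul _ (by fun_prop)]
        ring

/-- Cauchy-Schwarz for `b² - a² = (b - a)(b + a)`, where `b + a` has square norm at most `4`. -/
lemma lintegral_abs_sq_sub_sq_le {μ : Measure Ω} {a b : Ω → ℝ} (ha : Measurable a)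
    (hb : Measurable b) (ha1 : sqInt μ a = 1) (hb1 : sqInt μ b = 1) (S : Set Ω) :
    (∫⁻ s in S, ENNReal.ofReal |b s ^ 2 - a s ^ 2| ∂μ) ^ 2 ≤ 4 * sqInt μ fun s => b s - a s := by
  have h := lintegral_mul_abs_sq_le (μ := μ) (f := fun s => b s - a s) (g := fun s => b s + a s)
    (by fun_prop) (by fun_prop)
  have h2 : sqInt μ (fun s => b s + a s) ≤ 4 := by
    refine (sqInt_add_le hb.aemeasurable).trans ?_
    rw [ha1, hb1]; norm_num
  calc _ ≤ (∫⁻ s, ENNReal.ofReal |(b s - a s) * (b s + a s)| ∂μ) ^ 2 := by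
        refine pow_le_pow_left₀ zero_le ((setLIntegral_le_lintegral _ _).trans (le_of_eq ?_)) 2
        congr with s
        ring_nf
    _ ≤ _ := h
    _ ≤ _ := by rw [mul_comm]; gcongr

/-- The Hardy quotients of a differentiable path of unit vectors are asymptotically dominated. -/
lemma asympDominated_hardy {μ : Measure Ω} [SFinite μ] {a : ℕ → Ω → ℝ} {a0 α : Ω → ℝ} {t : ℕ → ℝ}
    (ha : ∀ n, Measurable (a n)) (ha0 : Measurable a0) (hα : Measurable α)
    (ha1 : ∀ n, sqInt μ (a n) = 1) (ha01 : sqInt μ a0 = 1) (hα1 : sqInt μ α ≠ ∞)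
    (hlim : Tendsto (fun n => sqInt μ fun z => (a n z - a0 z) / t n - α z) atTop (𝓝 0))
    {W : ℕ → Ω → ℝ} {W0 : Ω → ℝ} (hW : ∀ n, Measurable (W n)) (hW0 : Measurable W0)
    (hWP : ∀ n, (μ.withDensity fun s => ENNReal.ofReal ((a0 s ^ 2 + a n s ^ 2) / 2)).map (W n)
      = unitVol)
    {L : Ω → Set Ω} (hL : MeasurableSet {p : Ω × Ω | p.2 ∈ L p.1})
    (hLW : ∀ n z, ∀ s ∈ L z, W n s ≤ W n z) (hLW0 : ∀ z, ∀ s ∈ L z, W0 s ≤ W0 z)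
    (hW0W : ∀ n z, W0 z ≤ 2 * W n z) (hW0pos : ∀ᵐ z ∂μ, 0 < W0 z) :
    AsympDominated μ fun n z => ENNReal.ofReal (a0 z ^ 2) *
        ((∫⁻ s in L z, ENNReal.ofReal |a n s ^ 2 - a0 s ^ 2| ∂μ) / ENNReal.ofReal (W n z)) ^ 2
        * ENNReal.ofReal ((t n)⁻¹ ^ 2) := by
  intro ε hε
  have hLz : ∀ z, MeasurableSet (L z) := fun z => hL.preimage measurable_prodMk_left
  -- The tails `S k` shrink to a null set, so `α` carries little mass on one of them. On this tail
  -- the localized Hardy inequality makes the quotient small in the mean. Off it, `W n` is at least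
  -- `δ / 2`, and the quotient is at most a constant times `a0 ^ 2`.
  set S : ℕ → Set Ω := fun k => {z | W0 z < 1 / ((k : ℝ) + 1)} with hS
  have hSm : ∀ k, MeasurableSet (S k) := fun k => measurableSet_lt hW0 measurable_const
  have hSlim : Tendsto (fun k => ∫⁻ z, (S k).indicator (fun z => ENNReal.ofReal (α z ^ 2)) z ∂μ)
      atTop (𝓝 (∫⁻ _, 0 ∂μ)) := by
    refine tendsto_lintegral_of_dominated_convergence (fun z => ENNReal.ofReal (α z ^ 2))
      (fun k => Measurable.indicator (by fun_prop) (hSm k))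
      (fun k => ae_of_all _ fun z => indicator_le_self _ _ _) hα1 ?_
    filter_upwards [hW0pos] with z hz
    have : ∀ᶠ k : ℕ in atTop, 1 / ((k : ℝ) + 1) < W0 z :=
      tendsto_one_div_add_atTop_nhds_zero_nat.eventually (gt_mem_nhds hz)
    refine tendsto_const_nhds.congr' (this.mono fun k hk => ?_)
    exact (indicator_of_notMem (s := S k) (fun h => lt_asymm h hk)
      fun z => ENNReal.ofReal (α z ^ 2)).symm
  rw [lintegral_zero] at hSlim
  -- Hardy's `32` is doubled when the quotient is split into its remainder and `α`, and there are
  -- two such terms.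
  have hε' : 0 < ε / 128 := ENNReal.div_pos hε.ne' (by simp)
  obtain ⟨k, hk⟩ := (hSlim.eventually (gt_mem_nhds hε')).exists
  rw [lintegral_indicator (hSm k)] at hk
  set δ : ℝ := 1 / ((k : ℝ) + 1) with hδ
  have hδ0 : 0 < δ := by positivity
  set c : ℝ≥0∞ := 4 * (2 * 1 + 2 * sqInt μ α) / ENNReal.ofReal (δ / 2) ^ 2 with hc
  have hctop : c ≠ ∞ := by
    refine ENNReal.div_ne_top (ENNReal.mul_ne_top (by simp) (ENNReal.add_ne_top.2
      ⟨by simp, ENNReal.mul_ne_top (by simp) hα1⟩)) ?_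
    simp [hδ0]
  have hIm : ∀ n, Measurable fun z => ∫⁻ s in L z, ENNReal.ofReal |a n s ^ 2 - a0 s ^ 2| ∂μ := by
    intro n
    have e : (fun z => ∫⁻ s in L z, ENNReal.ofReal |a n s ^ 2 - a0 s ^ 2| ∂μ)
        = fun z => ∫⁻ s, {q : Ω × Ω | q.2 ∈ L q.1}.indicator
          (fun q => ENNReal.ofReal |a n q.2 ^ 2 - a0 q.2 ^ 2|) (z, s) ∂μ := by
      ext z
      rw [← lintegral_indicator (hLz z)]
      rfl
    rw [e]
    have h1 := ha n
    exact Measurable.lintegral_prod_right' (Measurable.indicator (by fun_prop) hL)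
  have hdn : ∀ n, sqInt μ (fun z => a n z - a0 z) * ENNReal.ofReal ((t n)⁻¹ ^ 2)
      = sqInt μ fun z => (a n z - a0 z) / t n := fun n => by
    rw [sqInt_div_const, mul_comm]
  have hadd : ∀ n, sqInt μ (fun z => (a n z - a0 z) / t n)
      ≤ 2 * (sqInt μ fun z => (a n z - a0 z) / t n - α z) + 2 * sqInt μ α := by
    intro n
    have h1 := ha n
    have := sqInt_add_le (μ := μ) (f := fun z => (a n z - a0 z) / t n - α z) (g := α)
      (by fun_prop)
    simpa using this
  refine ⟨fun n => (S k).indicator fun z => ENNReal.ofReal (a0 z ^ 2) *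
        ((∫⁻ s in L z, ENNReal.ofReal |a n s ^ 2 - a0 s ^ 2| ∂μ) / ENNReal.ofReal (W n z)) ^ 2
        * ENNReal.ofReal ((t n)⁻¹ ^ 2), fun z => c * ENNReal.ofReal (a0 z ^ 2), fun n => ?_,
        by fun_prop, ?_, ?_, ?_⟩
  · have h1 := hIm n
    have h2 := hW n
    exact (Measurable.indicator (by fun_prop) (hSm k)).aemeasurable
  · rw [lintegral_const_mul' _ _ hctop]
    refine ENNReal.mul_ne_top hctop ?_
    change sqInt μ a0 ≠ ∞
    simp [ha01]
  · filter_upwards [ENNReal.tendsto_nhds_zero.1 hlim _ hε'] with n hn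
    rw [lintegral_indicator (hSm k), lintegral_mul_const' _ _ ENNReal.ofReal_ne_top]
    have h1 := ha n
    calc _ ≤ 32 * (∫⁻ z in S k, ENNReal.ofReal ((a n z - a0 z) ^ 2) ∂μ)
            * ENNReal.ofReal ((t n)⁻¹ ^ 2) := by
          gcongr
          exact lintegral_hardy_tail ha0 (ha n) (hW n) (hWP n) hLz (hLW n) (hSm k)
            fun z hz s hs => (hLW0 z s hs).trans_lt hz
      _ = 32 * ∫⁻ z in S k, ENNReal.ofReal (((a n z - a0 z) / t n) ^ 2) ∂μ := by
          rw [mul_assoc, ← lintegral_mul_const' _ _ ENNReal.ofReal_ne_top]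
          congr 2 with z
          rw [← ENNReal.ofReal_mul (sq_nonneg _), ← mul_pow, div_eq_mul_inv]
      _ ≤ 32 * ∫⁻ z in S k, (2 * ENNReal.ofReal (((a n z - a0 z) / t n - α z) ^ 2)
            + 2 * ENNReal.ofReal (α z ^ 2)) ∂μ := by
          gcongr with z
          simpa using ofReal_add_sq_le ((a n z - a0 z) / t n - α z) (α z)
      _ = 64 * (∫⁻ z in S k, ENNReal.ofReal (((a n z - a0 z) / t n - α z) ^ 2) ∂μ)
            + 64 * ∫⁻ z in S k, ENNReal.ofReal (α z ^ 2) ∂μ := by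
          rw [lintegral_add_left (by fun_prop), lintegral_const_mul _ (by fun_prop),
            lintegral_const_mul _ (by fun_prop)]
          ring
      _ ≤ 64 * (ε / 128) + 64 * (ε / 128) := by
          gcongr
          exact (setLIntegral_le_lintegral _ _).trans hn
      _ = 128 * (ε / 128) := by ring
      _ ≤ ε := ENNReal.mul_div_le
  · filter_upwards [ENNReal.tendsto_nhds_zero.1 hlim 1 one_pos] with n hn
    refine ae_of_all _ fun z => ?_
    by_cases hz : z ∈ S k
    · rw [indicator_of_mem hz]; exact le_self_add
    · rw [indicator_of_notMem hz, zero_add]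
      have hWz : δ / 2 ≤ W n z := by
        have hz' : δ ≤ W0 z := not_lt.1 hz
        linarith [hW0W n z]
      calc _ ≤ ENNReal.ofReal (a0 z ^ 2) *
            ((4 * sqInt μ fun s => a n s - a0 s) / ENNReal.ofReal (δ / 2) ^ 2)
            * ENNReal.ofReal ((t n)⁻¹ ^ 2) := by
            gcongr
            rw [div_eq_mul_inv, mul_pow, div_eq_mul_inv, ← ENNReal.inv_pow]
            gcongr
            exact lintegral_abs_sq_sub_sq_le ha0 (ha n) ha01 (ha1 n) _
        _ = ENNReal.ofReal (a0 z ^ 2) *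
            ((4 * ((sqInt μ fun s => a n s - a0 s) * ENNReal.ofReal ((t n)⁻¹ ^ 2)))
              / ENNReal.ofReal (δ / 2) ^ 2) := by
            simp only [div_eq_mul_inv]; ring
        _ ≤ ENNReal.ofReal (a0 z ^ 2) * c := by
            rw [hdn, hc]
            gcongr
            exact (hadd n).trans (by gcongr)
        _ = _ := mul_comm _ _

end HardyTail

/-! ### Variation of distribution functions between two densities -/

section CdfVariation

variable {μ : Measure ℝ} {a b : ℝ → ℝ}

lemma ofReal_abs_sqCdf_sub_le (ha : Measurable a) (hb : Measurable b) (ha1 : sqInt μ a = 1)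
    (hb1 : sqInt μ b = 1) (z : ℝ) : ENNReal.ofReal |sqCdf μ b z - sqCdf μ a z|
      ≤ ∫⁻ s in Iic z, ENNReal.ofReal |b s ^ 2 - a s ^ 2| ∂μ := by
  have hia := integrable_sq (μ := μ) ha (by simp [ha1])
  have hib := integrable_sq (μ := μ) hb (by simp [hb1])
  rw [sqCdf, sqCdf, ← integral_sub hib.integrableOn hia.integrableOn]
  simpa only [Real.enorm_eq_ofReal_abs] using enorm_integral_le_lintegral_enorm
    (μ := μ.restrict (Iic z)) (fun s => b s ^ 2 - a s ^ 2)

lemma sqCdf_add_integral_Ioi (ha : Measurable a) (ha1 : sqInt μ a = 1) (z : ℝ) :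
    sqCdf μ a z + ∫ s in Ioi z, a s ^ 2 ∂μ = 1 := by
  have hia := integrable_sq (μ := μ) ha (by simp [ha1])
  rw [sqCdf, ← compl_Iic, integral_add_compl measurableSet_Iic hia,
    integral_sq_eq_toReal ha.aestronglyMeasurable, ha1]
  rfl

lemma ofReal_abs_sqCdf_sub_le_Ioi (ha : Measurable a) (hb : Measurable b) (ha1 : sqInt μ a = 1)
    (hb1 : sqInt μ b = 1) (z : ℝ) : ENNReal.ofReal |sqCdf μ b z - sqCdf μ a z|
      ≤ ∫⁻ s in Ioi z, ENNReal.ofReal |b s ^ 2 - a s ^ 2| ∂μ := by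
  have hia := integrable_sq (μ := μ) ha (by simp [ha1])
  have hib := integrable_sq (μ := μ) hb (by simp [hb1])
  have e : |sqCdf μ b z - sqCdf μ a z| = |∫ s in Ioi z, (b s ^ 2 - a s ^ 2) ∂μ| := by
    rw [integral_sub hib.integrableOn hia.integrableOn, abs_sub_comm]
    congr 1
    linarith [sqCdf_add_integral_Ioi ha ha1 z, sqCdf_add_integral_Ioi hb hb1 z]
  rw [e]
  simpa only [Real.enorm_eq_ofReal_abs] using enorm_integral_le_lintegral_enorm
    (μ := μ.restrict (Ioi z)) (fun s => b s ^ 2 - a s ^ 2)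

/-- The distribution function of the mixture of the densities `a ^ 2` and `b ^ 2`. -/
def midCdf (μ : Measure ℝ) (a b : ℝ → ℝ) (z : ℝ) : ℝ := (sqCdf μ a z + sqCdf μ b z) / 2

lemma measurable_midCdf (ha : Measurable a) (hb : Measurable b) (ha1 : sqInt μ a = 1)
    (hb1 : sqInt μ b = 1) : Measurable (midCdf μ a b) := by
  have h1 := measurable_sqCdf ha ha1
  have h2 := measurable_sqCdf hb hb1
  unfold midCdf
  fun_prop

lemma monotone_midCdf (ha : Measurable a) (hb : Measurable b) (ha1 : sqInt μ a = 1)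
    (hb1 : sqInt μ b = 1) : Monotone (midCdf μ a b) := fun x y h => by
  have h1 := monotone_sqCdf ha ha1 h
  have h2 := monotone_sqCdf hb hb1 h
  unfold midCdf
  linarith

/-- The mixture is again the square of a unit vector, so the transform for `sqCdf` applies to it. -/
lemma map_midCdf [NullSingletonClass μ] (ha : Measurable a) (hb : Measurable b)
    (ha1 : sqInt μ a = 1) (hb1 : sqInt μ b = 1) :
    (μ.withDensity fun s => ENNReal.ofReal ((a s ^ 2 + b s ^ 2) / 2)).map (midCdf μ a b)
      = unitVol := by
  have hc1 : sqInt μ (fun s => √((a s ^ 2 + b s ^ 2) / 2)) = 1 := by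
    have : ∀ s, ENNReal.ofReal (√((a s ^ 2 + b s ^ 2) / 2) ^ 2)
        = 2⁻¹ * (ENNReal.ofReal (a s ^ 2) + ENNReal.ofReal (b s ^ 2)) := fun s => by
      rw [Real.sq_sqrt (by positivity), ← ENNReal.ofReal_add (by positivity) (by positivity),
        div_eq_inv_mul, ENNReal.ofReal_mul (by norm_num), ENNReal.ofReal_inv_of_pos (by norm_num)]
      simp
    simp only [sqInt, this]
    rw [lintegral_const_mul _ (by fun_prop), lintegral_add_left (by fun_prop)]
    change 2⁻¹ * (sqInt μ a + sqInt μ b) = 1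
    rw [ha1, hb1, one_add_one_eq_two, ENNReal.inv_mul_cancel (by simp) (by simp)]
  have h := map_sqCdf (μ := μ) (a := fun s => √((a s ^ 2 + b s ^ 2) / 2)) (by fun_prop) hc1
  have e1 : sqMeas μ (fun s => √((a s ^ 2 + b s ^ 2) / 2))
      = μ.withDensity fun s => ENNReal.ofReal ((a s ^ 2 + b s ^ 2) / 2) := by
    unfold sqMeas
    congr with s
    rw [Real.sq_sqrt (by positivity)]
  have e2 : sqCdf μ (fun s => √((a s ^ 2 + b s ^ 2) / 2)) = midCdf μ a b := by
    ext z
    have hia := integrable_sq (μ := μ) ha (by simp [ha1])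
    have hib := integrable_sq (μ := μ) hb (by simp [hb1])
    unfold midCdf sqCdf
    rw [← integral_add hia.integrableOn hib.integrableOn, ← integral_div]
    congr with s
    rw [Real.sq_sqrt (by positivity)]
  rwa [e1, e2] at h

lemma map_one_sub_midCdf [NullSingletonClass μ] (ha : Measurable a) (hb : Measurable b)
    (ha1 : sqInt μ a = 1) (hb1 : sqInt μ b = 1) :
    (μ.withDensity fun s => ENNReal.ofReal ((a s ^ 2 + b s ^ 2) / 2)).map
      (fun z => 1 - midCdf μ a b z) = unitVol := by
  have h := map_midCdf ha hb ha1 hb1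
  have h2 := Measure.map_map (μ := μ.withDensity fun s => ENNReal.ofReal ((a s ^ 2 + b s ^ 2) / 2))
    (g := fun u : ℝ => 1 - u) (by fun_prop) (measurable_midCdf ha hb ha1 hb1)
  rw [h, map_one_sub_unitVol] at h2
  exact h2.symm

/-- The relative variation of the distribution function between the densities `a ^ 2` and
`b ^ 2`. -/
def cdfVar (μ : Measure ℝ) (a b : ℝ → ℝ) (z : ℝ) : ℝ :=
  (sqCdf μ b z - sqCdf μ a z) ^ 2 * (1 / midCdf μ a b z ^ 2 + 1 / (1 - midCdf μ a b z) ^ 2)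

lemma measurable_cdfVar (ha : Measurable a) (hb : Measurable b) (ha1 : sqInt μ a = 1)
    (hb1 : sqInt μ b = 1) : Measurable (cdfVar μ a b) := by
  have h1 := measurable_sqCdf ha ha1
  have h2 := measurable_sqCdf hb hb1
  have h3 := measurable_midCdf ha hb ha1 hb1
  unfold cdfVar
  fun_prop

/-- Both densities have total mass one, so the difference of the distribution functions at `z` is
bounded by the integral of `|b² - a²|` on either side of `z`. The left side serves the pole at level
`0`, the right side the pole at level `1`. -/
lemma ofReal_cdfVar_le (ha : Measurable a) (hb : Measurable b) (ha1 : sqInt μ a = 1)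
    (hb1 : sqInt μ b = 1) {z : ℝ} (hz : sqCdf μ a z ∈ Ioo (0 : ℝ) 1) :
    ENNReal.ofReal (cdfVar μ a b z) ≤
      ((∫⁻ s in Iic z, ENNReal.ofReal |b s ^ 2 - a s ^ 2| ∂μ)
        / ENNReal.ofReal (midCdf μ a b z)) ^ 2 +
      ((∫⁻ s in Ioi z, ENNReal.ofReal |b s ^ 2 - a s ^ 2| ∂μ)
        / ENNReal.ofReal (1 - midCdf μ a b z)) ^ 2 := by
  have h1 : 0 < midCdf μ a b z := by
    have := sqCdf_nonneg (μ := μ) (a := b) z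
    unfold midCdf; linarith [hz.1]
  have h2 : 0 < 1 - midCdf μ a b z := by
    have := sqCdf_le_one hb hb1 z
    unfold midCdf; linarith [hz.2]
  have key : ∀ w : ℝ, 0 < w → ENNReal.ofReal ((sqCdf μ b z - sqCdf μ a z) ^ 2 * (1 / w ^ 2))
      = (ENNReal.ofReal |sqCdf μ b z - sqCdf μ a z| / ENNReal.ofReal w) ^ 2 := by
    intro w hw
    rw [← ENNReal.ofReal_div_of_pos hw, ← ENNReal.ofReal_pow (by positivity), div_pow, sq_abs]
    congr 1
    ring
  rw [cdfVar, mul_add, ENNReal.ofReal_add (by positivity) (by positivity), key _ h1, key _ h2]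
  exact add_le_add
    (pow_le_pow_left₀ zero_le
      (ENNReal.div_le_div_right (ofReal_abs_sqCdf_sub_le ha hb ha1 hb1 z) _) 2)
    (pow_le_pow_left₀ zero_le
      (ENNReal.div_le_div_right (ofReal_abs_sqCdf_sub_le_Ioi ha hb ha1 hb1 z) _) 2)

lemma measurableSet_snd_Iic : MeasurableSet {p : ℝ × ℝ | p.2 ∈ Iic p.1} :=
  measurableSet_le measurable_snd measurable_fst

lemma measurableSet_snd_Ioi : MeasurableSet {p : ℝ × ℝ | p.2 ∈ Ioi p.1} :=
  measurableSet_lt measurable_fst measurable_snd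

/-- Hardy's inequality is used from below and, with `1 - midCdf` for `midCdf`, from above; each use
contributes `32`. -/
lemma lintegral_cdfVar_le [SFinite μ] [NullSingletonClass μ] (ha : Measurable a) (hb : Measurable b)
    (ha1 : sqInt μ a = 1) (hb1 : sqInt μ b = 1) (ha0 : ∀ᵐ s ∂μ, a s ≠ 0) :
    ∫⁻ z, ENNReal.ofReal (a z ^ 2) * ENNReal.ofReal (cdfVar μ a b z) ∂μ
      ≤ 64 * sqInt μ fun z => b z - a z := by
  have hmid := measurable_midCdf ha hb ha1 hb1
  have h1 := lintegral_hardy_tail ha hb hmid (map_midCdf ha hb ha1 hb1)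
    (L := fun z => Iic z) (fun _ => measurableSet_Iic)
    (fun z s hs => monotone_midCdf ha hb ha1 hb1 hs) MeasurableSet.univ (by simp)
  have h2 := lintegral_hardy_tail ha hb (W := fun z => 1 - midCdf μ a b z) (by fun_prop)
    (map_one_sub_midCdf ha hb ha1 hb1)
    (L := fun z => Ioi z) (fun _ => measurableSet_Ioi)
    (fun z s hs => sub_le_sub_left (monotone_midCdf ha hb ha1 hb1 (le_of_lt hs)) _)
    MeasurableSet.univ (by simp)
  simp only [Measure.restrict_univ] at h1 h2
  have hm : Measurable fun z => ∫⁻ s in Iic z, ENNReal.ofReal |b s ^ 2 - a s ^ 2| ∂μ := by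
    refine Monotone.measurable fun x y h => lintegral_mono_set (Iic_subset_Iic.2 h)
  calc _ ≤ ∫⁻ z, (ENNReal.ofReal (a z ^ 2) *
        ((∫⁻ s in Iic z, ENNReal.ofReal |b s ^ 2 - a s ^ 2| ∂μ)
          / ENNReal.ofReal (midCdf μ a b z)) ^ 2 + ENNReal.ofReal (a z ^ 2) *
        ((∫⁻ s in Ioi z, ENNReal.ofReal |b s ^ 2 - a s ^ 2| ∂μ)
          / ENNReal.ofReal (1 - midCdf μ a b z)) ^ 2) ∂μ := by
        refine lintegral_mono_ae ((ae_sqCdf_mem ha ha1 ha0).mono fun z hz => ?_)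
        rw [← mul_add]
        exact mul_le_mul' le_rfl (ofReal_cdfVar_le ha hb ha1 hb1 hz)
    _ ≤ _ := by
        rw [lintegral_add_left (by fun_prop)]
        refine (add_le_add h1 h2).trans (le_of_eq ?_)
        unfold sqInt
        ring

/-- This supplies the domination in the chain rule, where the bound of the integrals alone would not
permit passing to the limit. -/
lemma asympDominated_cdfVar [SFinite μ] [NullSingletonClass μ] {a : ℕ → ℝ → ℝ} {a0 α : ℝ → ℝ}
    {t : ℕ → ℝ} (ha : ∀ n, Measurable (a n)) (ha0 : Measurable a0) (hα : Measurable α)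
    (ha1 : ∀ n, sqInt μ (a n) = 1) (ha01 : sqInt μ a0 = 1) (hα1 : sqInt μ α ≠ ∞)
    (hlim : Tendsto (fun n => sqInt μ fun z => (a n z - a0 z) / t n - α z) atTop (𝓝 0))
    (hne : ∀ᵐ s ∂μ, a0 s ≠ 0) :
    AsympDominated μ fun n z => ENNReal.ofReal (a0 z ^ 2) * ENNReal.ofReal (cdfVar μ a0 (a n) z)
      * ENNReal.ofReal ((t n)⁻¹ ^ 2) := by
  have hmid := fun n => measurable_midCdf ha0 (ha n) ha01 (ha1 n)
  have hV0 := measurable_sqCdf ha0 ha01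
  have hmono := monotone_sqCdf ha0 ha01
  have h1 := asympDominated_hardy ha ha0 hα ha1 ha01 hα1 hlim hmid hV0
    (fun n => map_midCdf ha0 (ha n) ha01 (ha1 n)) measurableSet_snd_Iic
    (fun n z s hs => monotone_midCdf ha0 (ha n) ha01 (ha1 n) hs) (fun z s hs => hmono hs)
    (fun n z => by
      have := sqCdf_nonneg (μ := μ) (a := a n) z
      unfold midCdf; linarith)
    ((ae_sqCdf_mem ha0 ha01 hne).mono fun z hz => hz.1)
  have h2 := asympDominated_hardy ha ha0 hα ha1 ha01 hα1 hlim
    (W := fun n z => 1 - midCdf μ a0 (a n) z) (W0 := fun z => 1 - sqCdf μ a0 z)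
    (fun n => (hmid n).const_sub 1) (hV0.const_sub 1)
    (fun n => map_one_sub_midCdf ha0 (ha n) ha01 (ha1 n)) measurableSet_snd_Ioi
    (fun n z s hs => sub_le_sub_left (monotone_midCdf ha0 (ha n) ha01 (ha1 n) (le_of_lt hs)) _)
    (fun z s hs => sub_le_sub_left (hmono (le_of_lt hs)) _)
    (fun n z => by
      have := sqCdf_le_one (ha n) (ha1 n) z
      unfold midCdf; linarith)
    ((ae_sqCdf_mem ha0 ha01 hne).mono fun z hz => by linarith [hz.2])
  refine (h1.add h2).mono (Eventually.of_forall fun n => ?_)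
  filter_upwards [ae_sqCdf_mem ha0 ha01 hne] with z hz
  rw [← add_mul, ← mul_add]
  exact mul_le_mul' (mul_le_mul' le_rfl (ofReal_cdfVar_le ha0 (ha n) ha01 (ha1 n) hz)) le_rfl

end CdfVariation

/-! ### Curves in `L²` whose speed may blow up at the ends of the unit interval -/

section Curve

variable {Ω : Type*} [MeasurableSpace Ω]

/-- Pointwise convergence together with convergence of the norms gives convergence in `L²`. -/
lemma tendsto_sqInt_sub_of_ae_tendsto {ν : Measure Ω} {f : ℕ → Ω → ℝ} {g : Ω → ℝ}
    (hf : ∀ n, Measurable (f n)) (hg : Measurable g) (hgt : sqInt ν g ≠ ∞)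
    (hlim : ∀ᵐ ω ∂ν, Tendsto (fun n => f n ω) atTop (𝓝 (g ω)))
    {c : ℕ → ℝ≥0∞} (hc : Tendsto c atTop (𝓝 (sqInt ν g))) (hfc : ∀ᶠ n in atTop, sqInt ν (f n) ≤ c n) :
    Tendsto (fun n => sqInt ν fun ω => f n ω - g ω) atTop (𝓝 0) := by
  set S := sqInt ν g with hS
  set y : ℕ → ℝ≥0∞ := fun n => sqInt ν fun ω => f n ω + g ω with hy
  -- Parallelogram identity: `‖f n - g‖² = 2 ‖f n‖² + 2 ‖g‖² - ‖f n + g‖²`, and by Fatou's lemma the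
  -- last square is in the limit at least `4 ‖g‖²`.
  have hfatou : 4 * S ≤ liminf y atTop := by
    have h1 : 4 * S = ∫⁻ ω, liminf (fun n => ENNReal.ofReal ((f n ω + g ω) ^ 2)) atTop ∂ν := by
      rw [hS, sqInt, ← lintegral_const_mul' _ _ (by simp)]
      refine lintegral_congr_ae (hlim.mono fun ω hω => ?_)
      have h2 : Tendsto (fun n => ENNReal.ofReal ((f n ω + g ω) ^ 2)) atTop
          (𝓝 (ENNReal.ofReal ((g ω + g ω) ^ 2))) :=
        ENNReal.tendsto_ofReal ((hω.add tendsto_const_nhds).pow 2)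
      simp only
      rw [h2.liminf_eq, ← ENNReal.ofReal_ofNat 4, ← ENNReal.ofReal_mul (by norm_num)]
      ring_nf
    rw [h1]
    exact lintegral_liminf_le fun n => by have := hf n; fun_prop
  -- The truncation at the finite value `4 * S` keeps the subtraction in `ℝ≥0∞` continuous.
  have hmin : Tendsto (fun n => min (y n) (4 * S)) atTop (𝓝 (4 * S)) := by
    refine tendsto_order.2 ⟨fun b hb => ?_, fun b hb => Eventually.of_forall fun n =>
      (min_le_right _ _).trans_lt hb⟩
    exact (eventually_lt_of_lt_liminf (hb.trans_le hfatou)).mono fun n hn => lt_min hn hb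
  have hsum : ∀ n, (sqInt ν fun ω => f n ω - g ω) + y n = 2 * sqInt ν (f n) + 2 * S := by
    intro n
    have h1 := hf n
    simp only [hy, hS, sqInt]
    rw [← lintegral_add_left (by fun_prop), ← lintegral_const_mul _ (by fun_prop),
      ← lintegral_const_mul _ (by fun_prop), ← lintegral_add_left (by fun_prop)]
    refine lintegral_congr fun ω => ?_
    rw [← ENNReal.ofReal_add (by positivity) (by positivity), ← ENNReal.ofReal_ofNat 2,
      ← ENNReal.ofReal_mul (by norm_num), ← ENNReal.ofReal_mul (by norm_num),
      ← ENNReal.ofReal_add (by positivity) (by positivity)]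
    ring_nf
  have h4 : 4 * S ≠ ∞ := ENNReal.mul_ne_top (by simp) hgt
  have hup : Tendsto (fun n => 2 * c n + 2 * S - min (y n) (4 * S)) atTop (𝓝 0) := by
    have h1 : Tendsto (fun n => 2 * c n + 2 * S) atTop (𝓝 (2 * S + 2 * S)) :=
      (ENNReal.Tendsto.const_mul hc (Or.inr (by simp))).add tendsto_const_nhds
    have h2 := ENNReal.Tendsto.sub h1 hmin (Or.inr h4)
    have h3 : 2 * S + 2 * S - 4 * S = 0 := by
      rw [← add_mul]; norm_num
    rwa [h3] at h2
  refine tendsto_of_tendsto_of_tendsto_of_le_of_le' tendsto_const_nhds hup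
    (Eventually.of_forall fun _ => zero_le) (hfc.mono fun n hn => ?_)
  refine ENNReal.le_sub_of_add_le_right (ne_top_of_le_ne_top h4 (min_le_right _ _)) ?_
  calc _ ≤ (sqInt ν fun ω => f n ω - g ω) + y n := by gcongr; exact min_le_left _ _
    _ = 2 * sqInt ν (f n) + 2 * S := hsum n
    _ ≤ _ := by gcongr

/-- A curve `u ↦ γ (u, ·)`, `0 < u < 1`, in the unit ball of `L²(ν)`, with a pointwise continuous
derivative of norm at most `K / (u (1 - u))`. -/
structure IsCurve (ν : Measure Ω) (γ γ' : ℝ × Ω → ℝ) (K : ℝ) : Prop where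
  meas : Measurable γ
  meas' : Measurable γ'
  hasDeriv : ∀ᵐ ω ∂ν, ∀ u ∈ Ioo (0 : ℝ) 1, HasDerivAt (fun u => γ (u, ω)) (γ' (u, ω)) u
  cont : ∀ᵐ ω ∂ν, ContinuousOn (fun u => γ' (u, ω)) (Ioo (0 : ℝ) 1)
  bound : ∀ u ∈ Ioo (0 : ℝ) 1,
    sqInt ν (fun ω => γ' (u, ω)) ≤ ENNReal.ofReal ((K / (u * (1 - u))) ^ 2)
  norm : ∀ u ∈ Ioo (0 : ℝ) 1, sqInt ν (fun ω => γ (u, ω)) ≤ 1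

variable {ν : Measure Ω} [SFinite ν] {γ γ' : ℝ × Ω → ℝ} {K : ℝ}

/-- The fundamental theorem of calculus for almost every `ω`, then Cauchy-Schwarz on the interval
and Tonelli. -/
lemma IsCurve.sqInt_sub_le_lintegral (h : IsCurve ν γ γ' K) {u w : ℝ} (hu : 0 < u) (huw : u ≤ w)
    (hw : w < 1) :
    sqInt ν (fun ω => γ (w, ω) - γ (u, ω))
      ≤ ENNReal.ofReal (w - u) * ∫⁻ s in Ioc u w, sqInt ν (fun ω => γ' (s, ω)) := by
  have hm := h.meas'
  have hsub : Icc u w ⊆ Ioo 0 1 := fun s hs => ⟨hu.trans_le hs.1, hs.2.trans_lt hw⟩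
  have h1 : ∀ᵐ ω ∂ν, ENNReal.ofReal ((γ (w, ω) - γ (u, ω)) ^ 2)
      ≤ ENNReal.ofReal (w - u) * ∫⁻ s in Ioc u w, ENNReal.ofReal (γ' (s, ω) ^ 2) := by
    filter_upwards [h.hasDeriv, h.cont] with ω hd hc
    have hii : IntervalIntegrable (fun s => γ' (s, ω)) volume u w :=
      (hc.mono (by rw [uIcc_of_le huw]; exact hsub)).intervalIntegrable
    have h2 := intervalIntegral.integral_eq_sub_of_hasDerivAt (f := fun u => γ (u, ω))
      (fun s hs => hd s (hsub (by rwa [uIcc_of_le huw] at hs))) hii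
    rw [← h2, intervalIntegral.integral_of_le huw]
    have h3 := integral_mul_sq_le (μ := volume.restrict (Ioc u w)) (f := fun _ => (1 : ℝ))
      (g := fun s => γ' (s, ω)) (by fun_prop) (by fun_prop)
    simpa [sqInt] using h3
  refine (lintegral_mono_ae h1).trans (le_of_eq ?_)
  rw [lintegral_const_mul' _ _ ENNReal.ofReal_ne_top]
  congr 1
  exact lintegral_lintegral_swap (by fun_prop)

/-- Integrating the speed bound gives poles at `u` and `w` separately, whereas `cdfVar` has its
poles at the midpoint `m`. If `u w ≥ m² / 4`, the poles at `0` are comparable. Otherwise `(w - u)² ≥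
m²`, and the trivial bound `4` for two points of the unit ball suffices. The other end is treated in
the same way. -/
lemma IsCurve.sqInt_sub_le (h : IsCurve ν γ γ' K) {u w : ℝ} (hu : u ∈ Ioo (0 : ℝ) 1)
    (hw : w ∈ Ioo (0 : ℝ) 1) :
    sqInt ν (fun ω => γ (w, ω) - γ (u, ω)) ≤ ENNReal.ofReal ((8 * K ^ 2 + 4) *
      ((w - u) ^ 2 * (1 / ((u + w) / 2) ^ 2 + 1 / (1 - (u + w) / 2) ^ 2))) := by
  wlog huw : u ≤ w generalizing u w
  · have := this hw hu (le_of_not_ge huw)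
    have e : (w - u) ^ 2 = (u - w) ^ 2 := by ring
    rw [sqInt_sub_comm, add_comm u w, e]
    exact this
  have hm := h.meas
  obtain ⟨hu0, hu1⟩ := hu
  obtain ⟨hw0, hw1⟩ := hw
  have h4 : sqInt ν (fun ω => γ (w, ω) - γ (u, ω)) ≤ ENNReal.ofReal 4 := by
    refine (Frugal.sqInt_sub_le (by fun_prop)).trans ?_
    calc _ ≤ 2 * 1 + 2 * (1 : ℝ≥0∞) := by
          gcongr
          · exact h.norm w ⟨hw0, hw1⟩
          · exact h.norm u ⟨hu0, hu1⟩
      _ = _ := by norm_num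
  have hint : ∫⁻ s in Ioc u w, sqInt ν (fun ω => γ' (s, ω))
      ≤ ENNReal.ofReal (2 * K ^ 2 * ((w - u) / (u * w) + (w - u) / ((1 - u) * (1 - w)))) := by
    -- `(K / (s (1 - s)))²` is at most `2 K² (1 / s² + 1 / (1 - s)²)`, whose primitive is explicit.
    have hd : ∀ s ∈ uIcc u w, HasDerivAt (fun s => 2 * K ^ 2 * ((1 - s)⁻¹ - s⁻¹))
        (2 * K ^ 2 * (1 / s ^ 2 + 1 / (1 - s) ^ 2)) s := by
      intro s hs
      rw [uIcc_of_le huw] at hs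
      have hs0 : s ≠ 0 := (hu0.trans_le hs.1).ne'
      have hs1 : 1 - s ≠ 0 := by linarith [hs.2]
      have h1 := (((hasDerivAt_id s).const_sub 1).fun_inv hs1).sub ((hasDerivAt_id s).fun_inv hs0)
      have h2 := h1.const_mul (2 * K ^ 2)
      refine h2.congr_deriv ?_
      simp only [id]
      ring
    have hcont : ContinuousOn (fun s : ℝ => 2 * K ^ 2 * (1 / s ^ 2 + 1 / (1 - s) ^ 2)) (uIcc u w) := by
      rw [uIcc_of_le huw]
      refine ContinuousOn.mul continuousOn_const (ContinuousOn.add ?_ ?_)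
      · exact continuousOn_const.div (by fun_prop) fun s hs => by
          have : 0 < s := hu0.trans_le hs.1
          positivity
      · exact continuousOn_const.div (by fun_prop) fun s hs => by
          have : 0 < 1 - s := by linarith [hs.2]
          positivity
    have hii := hcont.intervalIntegrable (μ := volume)
    have hval := intervalIntegral.integral_eq_sub_of_hasDerivAt hd hii
    calc _ ≤ ∫⁻ s in Ioc u w, ENNReal.ofReal (2 * K ^ 2 * (1 / s ^ 2 + 1 / (1 - s) ^ 2)) := by
          refine setLIntegral_mono' measurableSet_Ioc fun s hs => ?_
          have hs0 : 0 < s := hu0.trans hs.1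
          have hs1 : 0 < 1 - s := by linarith [hs.2]
          refine (h.bound s ⟨hs0, by linarith⟩).trans (ENNReal.ofReal_le_ofReal ?_)
          have e : K / (s * (1 - s)) = K * (1 / s + 1 / (1 - s)) := by
            field_simp
            ring
          rw [e, mul_pow, mul_comm 2, mul_assoc]
          refine mul_le_mul_of_nonneg_left ?_ (sq_nonneg K)
          have e2 : 1 / s ^ 2 = (1 / s) ^ 2 := by ring
          have e3 : 1 / (1 - s) ^ 2 = (1 / (1 - s)) ^ 2 := by rw [div_pow, one_pow]
          rw [e2, e3]
          nlinarith [sq_nonneg (1 / s - 1 / (1 - s))]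
      _ = ENNReal.ofReal (∫ s in u..w, 2 * K ^ 2 * (1 / s ^ 2 + 1 / (1 - s) ^ 2)) := by
          rw [intervalIntegral.integral_of_le huw, ofReal_integral_eq_lintegral_ofReal]
          · exact (intervalIntegrable_iff_integrableOn_Ioc_of_le huw).1 hii
          · exact ae_of_all _ fun s => by positivity
      _ = _ := by
          rw [hval]
          congr 1
          have hs1 : 1 - w ≠ 0 := by linarith
          have hs2 : 1 - u ≠ 0 := by linarith
          field_simp
          ring
  have hmain : sqInt ν (fun ω => γ (w, ω) - γ (u, ω)) ≤ ENNReal.ofReal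
      (2 * K ^ 2 * ((w - u) ^ 2 * (1 / (u * w) + 1 / ((1 - u) * (1 - w))))) := by
    refine (h.sqInt_sub_le_lintegral hu0 huw hw1).trans ?_
    refine (mul_le_mul' le_rfl hint).trans (le_of_eq ?_)
    rw [← ENNReal.ofReal_mul (by linarith)]
    ring_nf
  set m := (u + w) / 2 with hmdef
  have hm0 : 0 < m := by rw [hmdef]; linarith
  have hm1 : 0 < 1 - m := by rw [hmdef]; linarith
  have hu1' : 0 < 1 - u := by linarith
  have hw1' : 0 < 1 - w := by linarith
  have hp1 : (0 : ℝ) ≤ 1 / m ^ 2 := by positivity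
  have hp2 : (0 : ℝ) ≤ 1 / (1 - m) ^ 2 := by positivity
  have hδ : 0 ≤ (w - u) ^ 2 := sq_nonneg _
  by_cases hc1 : m ^ 2 / 4 ≤ u * w
  · by_cases hc2 : (1 - m) ^ 2 / 4 ≤ (1 - u) * (1 - w)
    · refine hmain.trans (ENNReal.ofReal_le_ofReal ?_)
      have h1 : 1 / (u * w) ≤ 4 * (1 / m ^ 2) := by
        rw [← div_eq_mul_one_div, div_le_div_iff₀ (by positivity) (by positivity)]; linarith
      have h2 : 1 / ((1 - u) * (1 - w)) ≤ 4 * (1 / (1 - m) ^ 2) := by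
        rw [← div_eq_mul_one_div, div_le_div_iff₀ (by positivity) (by positivity)]; linarith
      calc _ ≤ 2 * K ^ 2 * ((w - u) ^ 2 * (4 * (1 / m ^ 2) + 4 * (1 / (1 - m) ^ 2))) := by gcongr
        _ = 8 * K ^ 2 * ((w - u) ^ 2 * (1 / m ^ 2 + 1 / (1 - m) ^ 2)) := by ring
        _ ≤ _ := by gcongr; linarith
    · refine h4.trans (ENNReal.ofReal_le_ofReal ?_)
      -- This follows from `(1 - m)² - (1 - u)(1 - w) = (w - u)² / 4`.
      have h1 : (1 - m) ^ 2 ≤ (w - u) ^ 2 := by rw [hmdef] at hc2 ⊢; nlinarith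
      have h2 : 1 ≤ (w - u) ^ 2 * (1 / (1 - m) ^ 2) := by
        rw [← div_eq_mul_one_div, le_div_iff₀ (by positivity)]; linarith
      nlinarith [mul_nonneg hδ hp1, mul_nonneg (sq_nonneg K) (add_nonneg (mul_nonneg hδ hp1) (mul_nonneg hδ hp2))]
  · refine h4.trans (ENNReal.ofReal_le_ofReal ?_)
    have h1 : m ^ 2 ≤ (w - u) ^ 2 := by rw [hmdef] at hc1 ⊢; nlinarith
    have h2 : 1 ≤ (w - u) ^ 2 * (1 / m ^ 2) := by
      rw [← div_eq_mul_one_div, le_div_iff₀ (by positivity)]; linarith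
    nlinarith [mul_nonneg hδ hp2, mul_nonneg (sq_nonneg K) (add_nonneg (mul_nonneg hδ hp1) (mul_nonneg hδ hp2))]

/-- The curve is continuous in `L²`. -/
lemma IsCurve.tendsto_sqInt_sub (h : IsCurve ν γ γ' K) {u : ℝ} (hu : u ∈ Ioo (0 : ℝ) 1) :
    Tendsto (fun w => sqInt ν fun ω => γ (w, ω) - γ (u, ω)) (𝓝 u) (𝓝 0) := by
  have hlim : Tendsto (fun w => ENNReal.ofReal ((8 * K ^ 2 + 4) *
      ((w - u) ^ 2 * (1 / ((u + w) / 2) ^ 2 + 1 / (1 - (u + w) / 2) ^ 2)))) (𝓝 u) (𝓝 0) := by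
    have hc : ContinuousAt (fun w => (8 * K ^ 2 + 4) *
      ((w - u) ^ 2 * (1 / ((u + w) / 2) ^ 2 + 1 / (1 - (u + w) / 2) ^ 2))) u := by
      have h1 : ((u + u) / 2) ^ 2 ≠ 0 := pow_ne_zero 2 (by linarith [hu.1])
      have h2 : (1 - (u + u) / 2) ^ 2 ≠ 0 := pow_ne_zero 2 (by linarith [hu.2])
      fun_prop (disch := assumption)
    have := ENNReal.tendsto_ofReal hc.tendsto
    simpa using this
  refine tendsto_of_tendsto_of_tendsto_of_le_of_le' tendsto_const_nhds hlim
    (Eventually.of_forall fun _ => zero_le) ?_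
  filter_upwards [Ioo_mem_nhds hu.1 hu.2] with w hw using h.sqInt_sub_le hu hw

/-- The curve is differentiable in `L²` almost everywhere. -/
lemma IsCurve.ae_tendsto_quotient (h : IsCurve ν γ γ' K) : ∀ᵐ u ∂unitVol,
    Tendsto (fun w => sqInt ν fun ω => (γ (w, ω) - γ (u, ω)) / (w - u) - γ' (u, ω))
      (𝓝[≠] u) (𝓝 0) := by
  have hm := h.meas
  have hm' := h.meas'
  set J : ℝ → ℝ≥0∞ := fun u => sqInt ν fun ω => γ' (u, ω) with hJ
  have hJm : Measurable J := measurable_sqInt_right hm'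
  have hJt : ∀ u ∈ Ioo (0 : ℝ) 1, J u ≠ ∞ := fun u hu =>
    ne_top_of_le_ne_top ENNReal.ofReal_ne_top (h.bound u hu)
  -- The squared speed `J` is controlled only away from the ends, so Lebesgue's differentiation
  -- theorem is used on compact intervals exhausting `(0, 1)`. The `2` in `k + 2` keeps their
  -- endpoints in order.
  have hii : ∀ k : ℕ, IntervalIntegrable (fun u => (J u).toReal) volume
      (1 / ((k : ℝ) + 2)) (1 - 1 / ((k : ℝ) + 2)) := by
    intro k
    have hk : (0 : ℝ) < 1 / ((k : ℝ) + 2) := by positivity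
    have hk2 : 1 / ((k : ℝ) + 2) ≤ 1 / 2 :=
      one_div_le_one_div_of_le (by norm_num) (by linarith [(Nat.cast_nonneg k : (0 : ℝ) ≤ k)])
    set d := 1 / ((k : ℝ) + 2)
    refine (intervalIntegrable_const (c := (K / (d * d)) ^ 2)).mono_fun
      hJm.ennreal_toReal.aestronglyMeasurable ?_
    filter_upwards [ae_restrict_mem measurableSet_uIoc] with u hu
    rw [uIoc_of_le (by linarith)] at hu
    have hu0 : 0 < u := hk.trans hu.1
    have hu1 : u < 1 := by linarith [hu.2]
    rw [Real.norm_of_nonneg ENNReal.toReal_nonneg, Real.norm_of_nonneg (sq_nonneg _)]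
    refine ENNReal.toReal_le_of_le_ofReal (sq_nonneg _) ((h.bound u ⟨hu0, hu1⟩).trans
      (ENNReal.ofReal_le_ofReal ?_))
    rw [div_pow, div_pow]
    have h1 : d ≤ 1 - u := by linarith [hu.2]
    have h2 := hu.1.le
    gcongr
  have hae : ∀ᵐ u : ℝ, ∀ k : ℕ, u ∈ uIcc (1 / ((k : ℝ) + 2)) (1 - 1 / ((k : ℝ) + 2)) →
      ∀ c ∈ uIcc (1 / ((k : ℝ) + 2)) (1 - 1 / ((k : ℝ) + 2)),
      HasDerivAt (fun x => ∫ s in c..x, (J s).toReal) (J u).toReal u :=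
    ae_all_iff.2 fun k => (hii k).ae_hasDerivAt_integral
  filter_upwards [ae_restrict_of_ae hae, ae_unitVol_mem] with u hu hu01
  obtain ⟨k, hk⟩ : ∃ k : ℕ, 1 / ((k : ℝ) + 2) < min u (1 - u) := by
    obtain ⟨k, hk⟩ := exists_nat_one_div_lt (lt_min hu01.1 (sub_pos.2 hu01.2))
    refine ⟨k, lt_of_le_of_lt ?_ hk⟩
    exact one_div_le_one_div_of_le (by positivity) (by linarith)
  have hk1 := hk.trans_le (min_le_left _ _)
  have hk2 := hk.trans_le (min_le_right _ _)
  have hmem : u ∈ uIcc (1 / ((k : ℝ) + 2)) (1 - 1 / ((k : ℝ) + 2)) := by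
    rw [uIcc_of_le (by linarith)]; exact ⟨hk1.le, by linarith⟩
  have hder := hu k hmem u hmem
  rw [hasDerivAt_iff_tendsto_slope] at hder
  have hc : Tendsto (fun w => ENNReal.ofReal (slope (fun x => ∫ s in u..x, (J s).toReal) u w))
      (𝓝[≠] u) (𝓝 (J u)) := by
    have := ENNReal.tendsto_ofReal hder
    rwa [ENNReal.ofReal_toReal (hJt u hu01)] at this
  have hJint : ∀ a b : ℝ, 0 < a → a ≤ b → b < 1 →
      ∫⁻ s in Ioc a b, J s = ENNReal.ofReal (∫ s in a..b, (J s).toReal) := by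
    intro a b ha hab hb
    have hlt : ∀ s ∈ Ioc a b, J s ≠ ∞ := fun s hs => hJt s ⟨ha.trans hs.1, hs.2.trans_lt hb⟩
    rw [intervalIntegral.integral_of_le hab, integral_toReal hJm.aemeasurable, ENNReal.ofReal_toReal]
    · set B : ℝ≥0∞ := ENNReal.ofReal ((K / (a * (1 - b))) ^ 2)
      refine ne_top_of_le_ne_top (b := ∫⁻ s in Ioc a b, B) (by simp [B, ENNReal.mul_ne_top]) ?_
      refine setLIntegral_mono' measurableSet_Ioc fun s hs => ?_
      have hs0 : 0 < s := ha.trans hs.1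
      have hs1 : s < 1 := hs.2.trans_lt hb
      refine (h.bound s ⟨hs0, hs1⟩).trans (ENNReal.ofReal_le_ofReal ?_)
      rw [div_pow, div_pow]
      have h1 : 1 - b ≤ 1 - s := by linarith [hs.2]
      have h2 := hs.1.le
      have h3 : 0 < 1 - b := by linarith
      gcongr
    · filter_upwards [ae_restrict_mem measurableSet_Ioc] with s hs using lt_top_iff_ne_top.2 (hlt s hs)
  -- The squared norm of a difference quotient is at most the mean of `J` between `u` and `w`, which
  -- tends to `J u` for almost every `u`. With the pointwise limit this yields convergence in `L²`.
  have hquot : ∀ᶠ w in 𝓝[≠] u, sqInt ν (fun ω => (γ (w, ω) - γ (u, ω)) / (w - u))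
      ≤ ENNReal.ofReal (slope (fun x => ∫ s in u..x, (J s).toReal) u w) := by
    filter_upwards [self_mem_nhdsWithin, mem_nhdsWithin_of_mem_nhds (Ioo_mem_nhds hu01.1 hu01.2)]
      with w hw hw01
    rw [sqInt_div_const, slope_def_field]
    simp only [intervalIntegral.integral_same, sub_zero]
    rcases lt_or_gt_of_ne (show w ≠ u from hw) with hlt | hlt
    · have h1 := h.sqInt_sub_le_lintegral hw01.1 hlt.le hu01.2
      rw [hJint w u hw01.1 hlt.le hu01.2] at h1
      rw [sqInt_sub_comm, intervalIntegral.integral_symm]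
      refine (mul_le_mul' le_rfl h1).trans (le_of_eq ?_)
      rw [← ENNReal.ofReal_mul (by linarith), ← ENNReal.ofReal_mul (by positivity)]
      congr 1
      have : w - u ≠ 0 := by linarith
      field_simp
      ring
    · have h1 := h.sqInt_sub_le_lintegral hu01.1 hlt.le hw01.2
      rw [hJint u w hu01.1 hlt.le hw01.2] at h1
      refine (mul_le_mul' le_rfl h1).trans (le_of_eq ?_)
      rw [← ENNReal.ofReal_mul (by linarith), ← ENNReal.ofReal_mul (by positivity)]
      congr 1
      have : w - u ≠ 0 := by linarith
      field_simp
  refine tendsto_of_seq_tendsto fun w hw => ?_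
  refine tendsto_sqInt_sub_of_ae_tendsto (fun n => by fun_prop) (by fun_prop) (hJt u hu01) ?_
    (hc.comp hw) (hw.eventually hquot)
  filter_upwards [h.hasDeriv] with ω hω
  have h1 := (hasDerivAt_iff_tendsto_slope.1 (hω u hu01)).comp hw
  refine h1.congr fun n => ?_
  simp [slope_def_field]

end Curve

/-! ### Differentiable paths in `L²` and their distribution functions -/

lemma tendsto_zero_of_ofReal_sq {f : ℕ → ℝ} (h : Tendsto (fun n => ENNReal.ofReal (f n ^ 2)) atTop (𝓝 0)) :
    Tendsto f atTop (𝓝 0) := by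
  have h1 := (ENNReal.tendsto_toReal (by simp)).comp h
  simp only [Function.comp_def, ENNReal.toReal_ofReal (sq_nonneg _), ENNReal.toReal_zero] at h1
  have h2 := h1.sqrt
  simp only [Real.sqrt_sq_eq_abs, Real.sqrt_zero] at h2
  exact (tendsto_zero_iff_abs_tendsto_zero _).2 h2

lemma sqInt_restrict_le {Ω : Type*} [MeasurableSpace Ω] {μ : Measure Ω} (s : Set Ω) (f : Ω → ℝ) :
    sqInt (μ.restrict s) f ≤ sqInt μ f := setLIntegral_le_lintegral _ _

lemma tendsto_sqInt_of_tendsto_quotient {Ω : Type*} [MeasurableSpace Ω] {μ : Measure Ω}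
    {a : ℕ → Ω → ℝ} {a0 α : Ω → ℝ} {t : ℕ → ℝ}
    (ha : ∀ n, Measurable (a n)) (ha0 : Measurable a0) (hα1 : sqInt μ α ≠ ∞)
    (ht0 : ∀ n, t n ≠ 0) (ht : Tendsto t atTop (𝓝 0)) (hαm : Measurable α)
    (hlim : Tendsto (fun n => sqInt μ fun z => (a n z - a0 z) / t n - α z) atTop (𝓝 0)) :
    Tendsto (fun n => sqInt μ fun z => a n z - a0 z) atTop (𝓝 0) := by
  have h1 : ∀ n, (sqInt μ fun z => a n z - a0 z) ≤ ENNReal.ofReal (t n ^ 2) *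
      (2 * (sqInt μ fun z => (a n z - a0 z) / t n - α z) + 2 * sqInt μ α) := by
    intro n
    have hn := ha n
    have h2 := sqInt_add_le (μ := μ) (f := fun z => (a n z - a0 z) / t n - α z) (g := α)
      (by fun_prop)
    have h3 : (fun z => a n z - a0 z) = fun z => t n * ((a n z - a0 z) / t n - α z + α z) := by
      ext z
      have := ht0 n
      field_simp
      ring
    rw [h3, sqInt_const_mul]
    gcongr
  have h2 : Tendsto (fun n => ENNReal.ofReal (t n ^ 2) *
      (2 * (sqInt μ fun z => (a n z - a0 z) / t n - α z) + 2 * sqInt μ α)) atTop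
      (𝓝 (0 * (2 * 0 + 2 * sqInt μ α))) := by
    refine ENNReal.Tendsto.mul ?_ (Or.inr (by simp [hα1, ENNReal.mul_eq_top])) ?_ (Or.inr (by simp))
    · simpa using ENNReal.tendsto_ofReal (ht.pow 2)
    · exact (ENNReal.Tendsto.const_mul hlim (Or.inr (by simp))).add tendsto_const_nhds
  rw [zero_mul] at h2
  exact tendsto_of_tendsto_of_tendsto_of_le_of_le tendsto_const_nhds h2 (fun _ => zero_le) h1

/-- The derivative of the squared norm along a path in `L²`. -/
lemma tendsto_integral_sq_quotient {Ω : Type*} [MeasurableSpace Ω] {ρ : Measure Ω}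
    {a : ℕ → Ω → ℝ} {a0 α : Ω → ℝ} {t : ℕ → ℝ}
    (ha : ∀ n, Measurable (a n)) (ha0 : Measurable a0)
    (hα : Measurable α) (ha1 : ∀ n, sqInt ρ (a n) ≠ ∞) (ha01 : sqInt ρ a0 ≠ ∞)
    (hα1 : sqInt ρ α ≠ ∞) (ht0 : ∀ n, t n ≠ 0) (ht : Tendsto t atTop (𝓝 0))
    (hlim : Tendsto (fun n => sqInt ρ fun z => (a n z - a0 z) / t n - α z) atTop (𝓝 0)) :
    Tendsto (fun n => ((∫ s, a n s ^ 2 ∂ρ) - ∫ s, a0 s ^ 2 ∂ρ) / t n) atTop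
      (𝓝 (2 * ∫ s, a0 s * α s ∂ρ)) := by
  set d : ℕ → Ω → ℝ := fun n z => (a n z - a0 z) / t n with hd
  have hdm : ∀ n, Measurable (d n) := fun n => by have := ha n; fun_prop
  have hd1 : ∀ n, sqInt ρ (d n) ≠ ∞ := fun n => by
    rw [hd, sqInt_div_const]
    refine ENNReal.mul_ne_top ENNReal.ofReal_ne_top (ne_top_of_le_ne_top ?_
      (sqInt_sub_le (ha n).aemeasurable))
    simp [ha1, ha01, ENNReal.mul_eq_top]
  have hia := fun n => integrable_mul_of_sqInt (μ := ρ) ha0.aestronglyMeasurable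
    (hdm n).aestronglyMeasurable ha01 (hd1 n)
  have hsq : ∀ {f : Ω → ℝ}, Measurable f → sqInt ρ f ≠ ∞ → Integrable (fun s => f s ^ 2) ρ :=
    fun hf h => (memLp_of_sqInt hf.aestronglyMeasurable h).integrable_sq
  have hid := fun n => hsq (hdm n) (hd1 n)
  have hiα := integrable_mul_of_sqInt (μ := ρ) ha0.aestronglyMeasurable
    hα.aestronglyMeasurable ha01 hα1
  -- The square of `a n = a0 + t n * d n` is expanded: the cross term has the asserted limit, and
  -- the quadratic term keeps a factor `t n`.
  have hexp : ∀ n, ((∫ s, a n s ^ 2 ∂ρ) - ∫ s, a0 s ^ 2 ∂ρ) / t n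
      = 2 * (∫ s, a0 s * d n s ∂ρ) + t n * ∫ s, d n s ^ 2 ∂ρ := by
    intro n
    rw [← integral_sub (hsq (ha n) (ha1 n)) (hsq ha0 ha01), ← integral_div, ← integral_const_mul,
      ← integral_const_mul, ← integral_add ((hia n).const_mul 2) ((hid n).const_mul _)]
    congr with s
    have := ht0 n
    simp only [hd]
    field_simp
    ring
  simp only [hexp]
  have hA : Tendsto (fun n => ∫ s, a0 s * d n s ∂ρ) atTop (𝓝 (∫ s, a0 s * α s ∂ρ)) := by
    rw [← tendsto_sub_nhds_zero_iff]
    have hlim' : Tendsto (fun n => sqInt ρ a0 * sqInt ρ fun z => d n z - α z) atTop (𝓝 0) := by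
      simpa using ENNReal.Tendsto.const_mul hlim (Or.inr ha01)
    refine tendsto_zero_of_ofReal_sq (tendsto_of_tendsto_of_tendsto_of_le_of_le tendsto_const_nhds
      hlim' (fun _ => zero_le) fun n => ?_)
    simp only
    rw [← integral_sub (hia n) hiα]
    simp only [← mul_sub]
    have hn := hdm n
    exact integral_mul_sq_le (by fun_prop) (by fun_prop)
  have hB : Tendsto (fun n => t n * ∫ s, d n s ^ 2 ∂ρ) atTop (𝓝 0) := by
    set B : ℝ≥0∞ := 2 * 1 + 2 * sqInt ρ α with hBdef
    have hBt : B ≠ ∞ := by simp [hBdef, hα1, ENNReal.mul_eq_top]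
    have hb : ∀ᶠ n in atTop, |t n * ∫ s, d n s ^ 2 ∂ρ| ≤ |t n| * B.toReal := by
      filter_upwards [ENNReal.tendsto_nhds_zero.1 hlim 1 one_pos] with n hn
      rw [abs_mul]
      refine mul_le_mul_of_nonneg_left ?_ (abs_nonneg _)
      rw [abs_of_nonneg (integral_nonneg fun _ => sq_nonneg _),
        integral_sq_eq_toReal (hdm n).aestronglyMeasurable]
      refine ENNReal.toReal_mono hBt ?_
      have hm := hdm n
      have h2 := sqInt_add_le (μ := ρ) (f := fun z => d n z - α z) (g := α) (by fun_prop)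
      simp only [sub_add_cancel] at h2
      exact h2.trans (add_le_add (mul_le_mul' le_rfl hn) le_rfl)
    refine squeeze_zero_norm' hb ?_
    simpa using ht.abs.mul_const B.toReal
  simpa using (hA.const_mul 2).add hB

section

variable {μ : Measure ℝ} {a : ℕ → ℝ → ℝ} {a0 α : ℝ → ℝ} {t : ℕ → ℝ}

lemma tendsto_sqCdf (ha : ∀ n, Measurable (a n)) (ha0 : Measurable a0)
    (ha1 : ∀ n, sqInt μ (a n) = 1) (ha01 : sqInt μ a0 = 1)
    (hlim : Tendsto (fun n => sqInt μ fun z => a n z - a0 z) atTop (𝓝 0)) (z : ℝ) :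
    Tendsto (fun n => sqCdf μ (a n) z) atTop (𝓝 (sqCdf μ a0 z)) := by
  rw [← tendsto_sub_nhds_zero_iff]
  refine tendsto_zero_of_ofReal_sq ?_
  have h4 : Tendsto (fun n => 4 * sqInt μ fun z => a n z - a0 z) atTop (𝓝 0) := by
    simpa using ENNReal.Tendsto.const_mul hlim (Or.inr (by simp : (4 : ℝ≥0∞) ≠ ∞))
  refine tendsto_of_tendsto_of_tendsto_of_le_of_le tendsto_const_nhds h4 (fun _ => zero_le)
    fun n => ?_
  refine le_trans ?_ (lintegral_abs_sq_sub_sq_le ha0 (ha n) ha01 (ha1 n) (Iic z))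
  rw [← sq_abs, ENNReal.ofReal_pow (abs_nonneg _)]
  exact pow_le_pow_left₀ zero_le (ofReal_abs_sqCdf_sub_le ha0 (ha n) ha01 (ha1 n) z) 2

/-- The derivative of the distribution function along a path of unit vectors. -/
lemma tendsto_sqCdf_quotient (ha : ∀ n, Measurable (a n)) (ha0 : Measurable a0)
    (hα : Measurable α) (ha1 : ∀ n, sqInt μ (a n) = 1) (ha01 : sqInt μ a0 = 1)
    (hα1 : sqInt μ α ≠ ∞) (ht0 : ∀ n, t n ≠ 0) (ht : Tendsto t atTop (𝓝 0))
    (hlim : Tendsto (fun n => sqInt μ fun z => (a n z - a0 z) / t n - α z) atTop (𝓝 0)) (z : ℝ) :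
    Tendsto (fun n => (sqCdf μ (a n) z - sqCdf μ a0 z) / t n) atTop
      (𝓝 (2 * ∫ s in Iic z, a0 s * α s ∂μ)) :=
  tendsto_integral_sq_quotient ha ha0 hα
    (fun n => ne_top_of_le_ne_top (by simp [ha1]) (sqInt_restrict_le _ _))
    (ne_top_of_le_ne_top (by simp [ha01]) (sqInt_restrict_le _ _))
    (ne_top_of_le_ne_top hα1 (sqInt_restrict_le _ _)) ht0 ht
    (tendsto_of_tendsto_of_tendsto_of_le_of_le tendsto_const_nhds hlim (fun _ => zero_le)
      fun _ => sqInt_restrict_le _ _)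

lemma measurable_integral_Iic [SFinite μ] {f : ℝ → ℝ} (hf : Measurable f) :
    Measurable fun z => ∫ s in Iic z, f s ∂μ := by
  have e : (fun z => ∫ s in Iic z, f s ∂μ)
      = fun z => ∫ s, {q : ℝ × ℝ | q.2 ∈ Iic q.1}.indicator (fun q => f q.2) (z, s) ∂μ := by
    ext z
    rw [← integral_indicator measurableSet_Iic]
    rfl
  rw [e]
  refine (StronglyMeasurable.integral_prod_right' (f := {q : ℝ × ℝ | q.2 ∈ Iic q.1}.indicator
    fun q => f q.2) ?_).measurable
  exact (Measurable.indicator (by fun_prop) measurableSet_snd_Iic).stronglyMeasurable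

/-! ### Transport along distribution functions: Lipschitz estimate and chain rule -/

variable {Ω : Type*} [MeasurableSpace Ω] {ν : Measure Ω} [SFinite ν] {γ γ' : ℝ × Ω → ℝ} {K : ℝ}

/-- The Lipschitz constant of `a ↦ transport μ a γ` for the square norms. -/
def lipConst (K : ℝ) : ℝ≥0∞ := 2 + 128 * ENNReal.ofReal (8 * K ^ 2 + 4)

lemma lipConst_ne_top (K : ℝ) : lipConst K ≠ ∞ := by simp [lipConst, ENNReal.mul_eq_top]

lemma IsCurve.sqInt_comp_sqCdf_le [NullSingletonClass μ] (h : IsCurve ν γ γ' K) {a b : ℝ → ℝ}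
    (ha : Measurable a) (hb : Measurable b) (ha1 : sqInt μ a = 1) (hb1 : sqInt μ b = 1)
    (ha0 : ∀ᵐ s ∂μ, a s ≠ 0) (hb0 : ∀ᵐ s ∂μ, b s ≠ 0) :
    ∀ᵐ z ∂μ, sqInt ν (fun ω => γ (sqCdf μ b z, ω) - γ (sqCdf μ a z, ω))
      ≤ ENNReal.ofReal (8 * K ^ 2 + 4) * ENNReal.ofReal (cdfVar μ a b z) := by
  filter_upwards [ae_sqCdf_mem ha ha1 ha0, ae_sqCdf_mem hb hb1 hb0] with z h1 h2
  rw [← ENNReal.ofReal_mul (by positivity)]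
  exact h.sqInt_sub_le h1 h2

/-- The Lipschitz estimate for transport along distribution functions. -/
theorem IsCurve.sqInt_transport_sub_le [SFinite μ] [NullSingletonClass μ] (h : IsCurve ν γ γ' K)
    {a b : ℝ → ℝ} (ha : Measurable a) (hb : Measurable b) (ha1 : sqInt μ a = 1)
    (hb1 : sqInt μ b = 1) (ha0 : ∀ᵐ s ∂μ, a s ≠ 0) (hb0 : ∀ᵐ s ∂μ, b s ≠ 0) :
    sqInt (μ.prod ν) (fun s => transport μ b γ s - transport μ a γ s)
      ≤ lipConst K * sqInt μ fun z => b z - a z := by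
  have hm := h.meas
  have hVa := measurable_sqCdf ha ha1
  have hVb := measurable_sqCdf hb hb1
  -- The factor and the level are changed one after the other. Changing the factor costs at most `‖b
  -- - a‖²`, as the curve stays in the unit ball. Changing the level costs what
  -- `lintegral_cdfVar_le` allows. Hence the `2` and the `128 = 2 * 64` in `lipConst`.
  have e : (fun s : ℝ × Ω => transport μ b γ s - transport μ a γ s)
      = fun s => (b s.1 - a s.1) * γ (sqCdf μ b s.1, s.2) +
        a s.1 * (γ (sqCdf μ b s.1, s.2) - γ (sqCdf μ a s.1, s.2)) := by
    ext s; simp only [transport]; ring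
  rw [e]
  refine (sqInt_add_le (by fun_prop)).trans ?_
  have h1 : sqInt (μ.prod ν) (fun s => (b s.1 - a s.1) * γ (sqCdf μ b s.1, s.2))
      ≤ sqInt μ fun z => b z - a z := by
    rw [sqInt_prod (by fun_prop)]
    refine lintegral_mono_ae ((ae_sqCdf_mem hb hb1 hb0).mono fun z hz => ?_)
    simp only [sqInt_const_mul]
    exact (mul_le_mul' le_rfl (h.norm _ hz)).trans (mul_one _).le
  have h2 : sqInt (μ.prod ν) (fun s => a s.1 * (γ (sqCdf μ b s.1, s.2) - γ (sqCdf μ a s.1, s.2)))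
      ≤ ENNReal.ofReal (8 * K ^ 2 + 4) * (64 * sqInt μ fun z => b z - a z) := by
    rw [sqInt_prod (by fun_prop)]
    refine le_trans ?_ (mul_le_mul' le_rfl (lintegral_cdfVar_le ha hb ha1 hb1 ha0))
    rw [← lintegral_const_mul' _ _ ENNReal.ofReal_ne_top]
    refine lintegral_mono_ae ((h.sqInt_comp_sqCdf_le ha hb ha1 hb1 ha0 hb0).mono fun z hz => ?_)
    simp only [sqInt_const_mul]
    rw [mul_left_comm]
    exact mul_le_mul' le_rfl hz
  calc _ ≤ 2 * (sqInt μ fun z => b z - a z) +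
        2 * (ENNReal.ofReal (8 * K ^ 2 + 4) * (64 * sqInt μ fun z => b z - a z)) := by gcongr
    _ = _ := by rw [lipConst]; ring

/-- The derivative of `a ↦ transport μ a γ` at `a0` in the direction `α`. -/
def transportDeriv (μ : Measure ℝ) (a0 α : ℝ → ℝ) (γ γ' : ℝ × Ω → ℝ) (s : ℝ × Ω) : ℝ :=
  α s.1 * γ (sqCdf μ a0 s.1, s.2) +
    a0 s.1 * (γ' (sqCdf μ a0 s.1, s.2) * (2 * ∫ r in Iic s.1, a0 r * α r ∂μ))

lemma measurable_transportDeriv [SFinite μ] (ha0 : Measurable a0) (hα : Measurable α)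
    (ha01 : sqInt μ a0 = 1) (hγ : Measurable γ) (hγ' : Measurable γ') :
    Measurable (transportDeriv μ a0 α γ γ') := by
  have h1 := measurable_integral_Iic (μ := μ) (f := fun r => a0 r * α r) (by fun_prop)
  have h2 := measurable_sqCdf ha0 ha01
  exact ((hα.comp measurable_fst).mul (hγ.comp (by fun_prop))).add
    ((ha0.comp measurable_fst).mul ((hγ'.comp (by fun_prop)).mul
      ((h1.comp measurable_fst).const_mul 2)))

/-- Transport along distribution functions is differentiable. -/
theorem IsCurve.tendsto_transport_quotient [SFinite μ] [NullSingletonClass μ]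
    (h : IsCurve ν γ γ' K) (ha : ∀ n, Measurable (a n)) (ha0 : Measurable a0) (hα : Measurable α)
    (ha1 : ∀ n, sqInt μ (a n) = 1) (ha01 : sqInt μ a0 = 1) (hα1 : sqInt μ α ≠ ∞)
    (hane : ∀ n, ∀ᵐ s ∂μ, a n s ≠ 0) (ha0ne : ∀ᵐ s ∂μ, a0 s ≠ 0)
    (ht0 : ∀ n, t n ≠ 0) (ht : Tendsto t atTop (𝓝 0))
    (hlim : Tendsto (fun n => sqInt μ fun z => (a n z - a0 z) / t n - α z) atTop (𝓝 0)) :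
    Tendsto (fun n => sqInt (μ.prod ν) fun s => (transport μ (a n) γ s - transport μ a0 γ s) / t n
      - transportDeriv μ a0 α γ γ' s) atTop (𝓝 0) := by
  have hγ := h.meas
  have hγ' := h.meas'
  have hV := fun n => measurable_sqCdf (ha n) (ha1 n)
  have hV0 := measurable_sqCdf ha0 ha01
  have hmem0 := ae_sqCdf_mem ha0 ha01 ha0ne
  set D : ℝ → ℝ := fun z => 2 * ∫ r in Iic z, a0 r * α r ∂μ with hD
  have hDm : Measurable D := (measurable_integral_Iic (by fun_prop)).const_mul 2
  have hDlim : ∀ z, Tendsto (fun n => (sqCdf μ (a n) z - sqCdf μ a0 z) / t n) atTop (𝓝 (D z)) :=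
    tendsto_sqCdf_quotient ha ha0 hα ha1 ha01 hα1 ht0 ht hlim
  have hdiff := tendsto_sqInt_of_tendsto_quotient ha ha0 hα1 ht0 ht hα hlim
  have hVlim := tendsto_sqCdf ha ha0 ha1 ha01 hdiff
  -- The error has three parts: the remainder of the factor, the direction `α` at a moving point of
  -- the curve, and the remainder of the chain rule for the curve.
  have hA : Tendsto (fun n => sqInt (μ.prod ν) fun s =>
      ((a n s.1 - a0 s.1) / t n - α s.1) * γ (sqCdf μ (a n) s.1, s.2)) atTop (𝓝 0) := by
    refine tendsto_of_tendsto_of_tendsto_of_le_of_le tendsto_const_nhds hlim (fun _ => zero_le)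
      fun n => ?_
    have h1 := ha n
    have h2 := hV n
    simp only
    rw [sqInt_prod (by fun_prop)]
    refine lintegral_mono_ae ((ae_sqCdf_mem (ha n) (ha1 n) (hane n)).mono fun z hz => ?_)
    simp only [sqInt_const_mul]
    exact (mul_le_mul' le_rfl (h.norm _ hz)).trans (mul_one _).le
  have hB : Tendsto (fun n => sqInt (μ.prod ν) fun s =>
      α s.1 * (γ (sqCdf μ (a n) s.1, s.2) - γ (sqCdf μ a0 s.1, s.2))) atTop (𝓝 0) := by
    have h1 : ∀ n, (sqInt (μ.prod ν) fun s =>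
        α s.1 * (γ (sqCdf μ (a n) s.1, s.2) - γ (sqCdf μ a0 s.1, s.2)))
        = ∫⁻ z, ENNReal.ofReal (α z ^ 2) *
          sqInt ν (fun ω => γ (sqCdf μ (a n) z, ω) - γ (sqCdf μ a0 z, ω)) ∂μ := fun n => by
      have h2 := hV n
      rw [sqInt_prod (by fun_prop)]
      simp only [sqInt_const_mul]
    simp only [h1]
    refine AsympDominated.tendsto_zero (AsympDominated.mono
      (asympDominated_const (G := fun z => 4 * ENNReal.ofReal (α z ^ 2)) (by fun_prop) ?_)
      (Eventually.of_forall fun n => ?_)) (fun n => ?_) ?_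
    · rw [lintegral_const_mul' _ _ (by simp)]
      exact ENNReal.mul_ne_top (by simp) hα1
    · filter_upwards [ae_sqCdf_mem (ha n) (ha1 n) (hane n), hmem0] with z hz hz0
      rw [mul_comm]
      refine mul_le_mul' ?_ le_rfl
      refine (Frugal.sqInt_sub_le (by fun_prop)).trans ?_
      calc _ ≤ 2 * 1 + 2 * (1 : ℝ≥0∞) := by
            gcongr
            · exact h.norm _ hz
            · exact h.norm _ hz0
        _ = _ := by norm_num
    · have h2 := hV n
      have := measurable_sqInt_right (ν := ν) (f := fun s : ℝ × Ω =>
        γ (sqCdf μ (a n) s.1, s.2) - γ (sqCdf μ a0 s.1, s.2)) (by fun_prop)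
      fun_prop
    · filter_upwards [hmem0] with z hz
      have h2 := (h.tendsto_sqInt_sub hz).comp (hVlim z)
      simpa using ENNReal.Tendsto.const_mul h2
        (Or.inr (ENNReal.ofReal_ne_top (r := α z ^ 2)))
  have hC : Tendsto (fun n => sqInt (μ.prod ν) fun s =>
      a0 s.1 * ((γ (sqCdf μ (a n) s.1, s.2) - γ (sqCdf μ a0 s.1, s.2)) / t n
        - γ' (sqCdf μ a0 s.1, s.2) * D s.1)) atTop (𝓝 0) := by
    have h1 : ∀ n, (sqInt (μ.prod ν) fun s =>
        a0 s.1 * ((γ (sqCdf μ (a n) s.1, s.2) - γ (sqCdf μ a0 s.1, s.2)) / t n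
          - γ' (sqCdf μ a0 s.1, s.2) * D s.1))
        = ∫⁻ z, ENNReal.ofReal (a0 z ^ 2) *
          sqInt ν (fun ω => (γ (sqCdf μ (a n) z, ω) - γ (sqCdf μ a0 z, ω)) / t n
          - γ' (sqCdf μ a0 z, ω) * D z) ∂μ := fun n => by
      have h2 := hV n
      rw [sqInt_prod (by fun_prop)]
      simp only [sqInt_const_mul]
    simp only [h1]
    -- Up to a constant, `G` bounds the derivative term. It is integrable by Fatou's lemma, being
    -- the limit of relative variations whose integrals are bounded by Hardy's inequality.
    set G : ℝ → ℝ≥0∞ := fun z => ENNReal.ofReal (a0 z ^ 2) *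
      ENNReal.ofReal (D z ^ 2 * (1 / sqCdf μ a0 z ^ 2 + 1 / (1 - sqCdf μ a0 z) ^ 2)) with hG
    have hGfin : ∫⁻ z, G z ∂μ ≠ ∞ := by
      have hG1 : ∀ᵐ z ∂μ, G z = liminf (fun n => ENNReal.ofReal (a0 z ^ 2) *
          ENNReal.ofReal (cdfVar μ a0 (a n) z) * ENNReal.ofReal ((t n)⁻¹ ^ 2)) atTop := by
        filter_upwards [hmem0] with z hz
        refine (Tendsto.liminf_eq ?_).symm
        simp only [hG, mul_assoc]
        refine ENNReal.Tendsto.const_mul ?_ (Or.inr ENNReal.ofReal_ne_top)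
        have h2 : ∀ n, ENNReal.ofReal (cdfVar μ a0 (a n) z) * ENNReal.ofReal ((t n)⁻¹ ^ 2)
            = ENNReal.ofReal (((sqCdf μ (a n) z - sqCdf μ a0 z) / t n) ^ 2 *
              (1 / midCdf μ a0 (a n) z ^ 2 + 1 / (1 - midCdf μ a0 (a n) z) ^ 2)) := fun n => by
          rw [← ENNReal.ofReal_mul' (sq_nonneg _), cdfVar]
          congr 1
          ring
        simp only [h2]
        refine ENNReal.tendsto_ofReal (((hDlim z).pow 2).mul ?_)
        have h3 : Tendsto (fun n => midCdf μ a0 (a n) z) atTop (𝓝 (sqCdf μ a0 z)) := by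
          have := ((tendsto_const_nhds (x := sqCdf μ a0 z)).add (hVlim z)).div_const 2
          simpa [midCdf] using this
        have h4 : sqCdf μ a0 z ^ 2 ≠ 0 := pow_ne_zero 2 hz.1.ne'
        have h5 : (1 - sqCdf μ a0 z) ^ 2 ≠ 0 := pow_ne_zero 2 (sub_pos.2 hz.2).ne'
        exact (tendsto_const_nhds.div (h3.pow 2) h4).add
          (tendsto_const_nhds.div ((h3.const_sub 1).pow 2) h5)
      rw [lintegral_congr_ae hG1]
      refine ne_top_of_le_ne_top ?_ (lintegral_liminf_le fun n => by
        have := measurable_cdfVar ha0 (ha n) ha01 (ha1 n)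
        fun_prop)
      refine ne_top_of_le_ne_top (b := 64 * (2 * 1 + 2 * sqInt μ α))
        (by simp [ENNReal.mul_eq_top, hα1]) ?_
      refine liminf_le_of_frequently_le' (Eventually.frequently ?_)
      filter_upwards [ENNReal.tendsto_nhds_zero.1 hlim 1 one_pos] with n hn
      rw [lintegral_mul_const' _ _ ENNReal.ofReal_ne_top]
      refine (mul_le_mul' (lintegral_cdfVar_le ha0 (ha n) ha01 (ha1 n) ha0ne) le_rfl).trans ?_
      rw [mul_assoc, mul_comm (sqInt μ _), ← sqInt_div_const]
      have hn' := ha n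
      have h2 := sqInt_add_le (μ := μ) (f := fun z => (a n z - a0 z) / t n - α z) (g := α)
        (by fun_prop)
      simp only [sub_add_cancel] at h2
      gcongr
      exact h2.trans (by gcongr)
    have hdom := ((asympDominated_cdfVar ha ha0 hα ha1 ha01 hα1 hlim ha0ne).const_mul
      (c := 2 * ENNReal.ofReal (8 * K ^ 2 + 4)) (by simp [ENNReal.mul_eq_top])).add
      ((asympDominated_const (μ := μ) (G := G) (by fun_prop) hGfin).const_mul
        (c := 2 * ENNReal.ofReal (2 * K ^ 2)) (by simp [ENNReal.mul_eq_top]))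
    refine AsympDominated.tendsto_zero (hdom.mono (Eventually.of_forall fun n => ?_))
      (fun n => ?_) ?_
    · filter_upwards [h.sqInt_comp_sqCdf_le ha0 (ha n) ha01 (ha1 n) ha0ne (hane n), hmem0]
        with z hz hz0
      have h2 := Frugal.sqInt_sub_le (μ := ν)
        (f := fun ω => (γ (sqCdf μ (a n) z, ω) - γ (sqCdf μ a0 z, ω)) / t n)
        (g := fun ω => γ' (sqCdf μ a0 z, ω) * D z) (by fun_prop)
      have h3 : sqInt ν (fun ω => γ' (sqCdf μ a0 z, ω) * D z) ≤ ENNReal.ofReal (2 * K ^ 2) *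
          ENNReal.ofReal (D z ^ 2 * (1 / sqCdf μ a0 z ^ 2 + 1 / (1 - sqCdf μ a0 z) ^ 2)) := by
        simp only [mul_comm _ (D z), sqInt_const_mul]
        refine (mul_le_mul' le_rfl (h.bound _ hz0)).trans ?_
        rw [← ENNReal.ofReal_mul (sq_nonneg _), ← ENNReal.ofReal_mul (by positivity)]
        refine ENNReal.ofReal_le_ofReal ?_
        have hs0 := hz0.1
        have hs1 : 0 < 1 - sqCdf μ a0 z := sub_pos.2 hz0.2
        set v := sqCdf μ a0 z
        have e : K / (v * (1 - v)) = K * (1 / v + 1 / (1 - v)) := by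
          field_simp
          ring
        have e2 : 1 / v ^ 2 = (1 / v) ^ 2 := by ring
        have e3 : 1 / (1 - v) ^ 2 = (1 / (1 - v)) ^ 2 := by rw [div_pow, one_pow]
        rw [e, e2, e3, mul_pow]
        have : D z ^ 2 * (K ^ 2 * (1 / v + 1 / (1 - v)) ^ 2)
          ≤ D z ^ 2 * (K ^ 2 * (2 * ((1 / v) ^ 2 + (1 / (1 - v)) ^ 2))) := by
          gcongr
          nlinarith [sq_nonneg (1 / v - 1 / (1 - v))]
        linarith
      rw [sqInt_div_const] at h2
      calc _ ≤ ENNReal.ofReal (a0 z ^ 2) * (2 * (ENNReal.ofReal ((t n)⁻¹ ^ 2) *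
            (ENNReal.ofReal (8 * K ^ 2 + 4) * ENNReal.ofReal (cdfVar μ a0 (a n) z))) +
            2 * (ENNReal.ofReal (2 * K ^ 2) *
            ENNReal.ofReal (D z ^ 2 * (1 / sqCdf μ a0 z ^ 2 + 1 / (1 - sqCdf μ a0 z) ^ 2)))) := by
            gcongr
            exact h2.trans (by gcongr)
        _ = _ := by simp only [hG]; ring
    · have h2 := hV n
      have := measurable_sqInt_right (ν := ν) (f := fun s : ℝ × Ω =>
        (γ (sqCdf μ (a n) s.1, s.2) - γ (sqCdf μ a0 s.1, s.2)) / t n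
          - γ' (sqCdf μ a0 s.1, s.2) * D s.1) (by fun_prop)
      fun_prop
    -- For almost every `z` the curve is differentiable in `L²` at the level of `z`.
    · filter_upwards [hmem0, ae_comp_sqCdf ha0 ha01 ha0ne h.ae_tendsto_quotient] with z hz hz'
      set v := sqCdf μ a0 z
      set Q : ℝ → ℝ≥0∞ := fun w => sqInt ν fun ω => (γ (w, ω) - γ (v, ω)) / (w - v) - γ' (v, ω)
      -- The moving level may coincide with `v`, where `Q` is not a difference quotient. Its
      -- coefficient `q n` vanishes there, so the value may be replaced by the limit `0`.
      have hQ : Tendsto (Function.update Q v 0) (𝓝 v) (𝓝 0) := by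
        have h2 := (continuousAt_update_same (f := Q) (x := v) (y := 0)).2 hz'
        rw [ContinuousAt, Function.update_self] at h2
        exact h2
      set q : ℕ → ℝ := fun n => (sqCdf μ (a n) z - v) / t n
      have hbound : ∀ n, sqInt ν (fun ω => (γ (sqCdf μ (a n) z, ω) - γ (v, ω)) / t n
          - γ' (v, ω) * D z) ≤ 2 * (ENNReal.ofReal (q n ^ 2) *
            Function.update Q v 0 (sqCdf μ (a n) z)) +
            2 * (ENNReal.ofReal ((q n - D z) ^ 2) * sqInt ν fun ω => γ' (v, ω)) := by
        intro n
        have e : (fun ω => (γ (sqCdf μ (a n) z, ω) - γ (v, ω)) / t n - γ' (v, ω) * D z)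
            = fun ω => q n * ((γ (sqCdf μ (a n) z, ω) - γ (v, ω)) / (sqCdf μ (a n) z - v)
              - γ' (v, ω)) + (q n - D z) * γ' (v, ω) := by
          ext ω
          by_cases hv : sqCdf μ (a n) z = v
          · simp [q, hv]; ring
          · have h3 : sqCdf μ (a n) z - v ≠ 0 := sub_ne_zero.2 hv
            have h4 := ht0 n
            simp only [q]
            field_simp
            ring
        rw [e]
        refine (Frugal.sqInt_add_le (by fun_prop)).trans ?_
        rw [sqInt_const_mul, sqInt_const_mul]
        refine add_le_add (mul_le_mul' le_rfl ?_) le_rfl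
        by_cases hv : sqCdf μ (a n) z = v
        · simp [q, hv]
        · rw [Function.update_of_ne hv]
      have hlimb : Tendsto (fun n => 2 * (ENNReal.ofReal (q n ^ 2) *
            Function.update Q v 0 (sqCdf μ (a n) z)) +
            2 * (ENNReal.ofReal ((q n - D z) ^ 2) * sqInt ν fun ω => γ' (v, ω))) atTop (𝓝 0) := by
        have h2 : Tendsto (fun n => ENNReal.ofReal (q n ^ 2)) atTop
            (𝓝 (ENNReal.ofReal (D z ^ 2))) := ENNReal.tendsto_ofReal ((hDlim z).pow 2)
        have h3 := ENNReal.Tendsto.mul h2 (Or.inr (by simp)) (hQ.comp (hVlim z))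
          (Or.inr ENNReal.ofReal_ne_top)
        have h4 : Tendsto (fun n => ENNReal.ofReal ((q n - D z) ^ 2)) atTop (𝓝 0) := by
          have := ENNReal.tendsto_ofReal (((hDlim z).sub_const (D z)).pow 2)
          simpa using this
        have h5 : sqInt ν (fun ω => γ' (v, ω)) ≠ ∞ :=
          ne_top_of_le_ne_top ENNReal.ofReal_ne_top (h.bound _ hz)
        have h6 := ENNReal.Tendsto.mul_const h4 (Or.inr h5)
        have h7 := (ENNReal.Tendsto.const_mul h3 (Or.inr (by simp : (2 : ℝ≥0∞) ≠ ∞))).add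
          (ENNReal.Tendsto.const_mul h6 (Or.inr (by simp : (2 : ℝ≥0∞) ≠ ∞)))
        simpa using h7
      have h8 := tendsto_of_tendsto_of_tendsto_of_le_of_le tendsto_const_nhds hlimb
        (fun _ => zero_le) hbound
      simpa using ENNReal.Tendsto.const_mul h8 (Or.inr (ENNReal.ofReal_ne_top (r := a0 z ^ 2)))
  have hsum : Tendsto (fun n => 2 * (2 * (sqInt (μ.prod ν) fun s =>
      ((a n s.1 - a0 s.1) / t n - α s.1) * γ (sqCdf μ (a n) s.1, s.2)) +
      2 * (sqInt (μ.prod ν) fun s =>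
      α s.1 * (γ (sqCdf μ (a n) s.1, s.2) - γ (sqCdf μ a0 s.1, s.2)))) +
      2 * (sqInt (μ.prod ν) fun s =>
      a0 s.1 * ((γ (sqCdf μ (a n) s.1, s.2) - γ (sqCdf μ a0 s.1, s.2)) / t n
        - γ' (sqCdf μ a0 s.1, s.2) * D s.1))) atTop (𝓝 0) := by
    have h2 : ∀ {f : ℕ → ℝ≥0∞}, Tendsto f atTop (𝓝 0) → Tendsto (fun n => 2 * f n) atTop (𝓝 0) :=
      fun hf => by simpa using ENNReal.Tendsto.const_mul hf (Or.inr (by simp : (2 : ℝ≥0∞) ≠ ∞))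
    simpa using (h2 (by simpa using (h2 hA).add (h2 hB))).add (h2 hC)
  refine tendsto_of_tendsto_of_tendsto_of_le_of_le tendsto_const_nhds hsum (fun _ => zero_le)
    fun n => ?_
  have h1 := ha n
  have h2 := hV n
  have e : (fun s : ℝ × Ω => (transport μ (a n) γ s - transport μ a0 γ s) / t n
      - transportDeriv μ a0 α γ γ' s) = fun s =>
      (((a n s.1 - a0 s.1) / t n - α s.1) * γ (sqCdf μ (a n) s.1, s.2) +
      α s.1 * (γ (sqCdf μ (a n) s.1, s.2) - γ (sqCdf μ a0 s.1, s.2))) +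
      a0 s.1 * ((γ (sqCdf μ (a n) s.1, s.2) - γ (sqCdf μ a0 s.1, s.2)) / t n
        - γ' (sqCdf μ a0 s.1, s.2) * D s.1) := by
    ext s
    have := ht0 n
    simp only [transport, transportDeriv, hD]
    field_simp
    ring
  simp only [e]
  refine (Frugal.sqInt_add_le (by fun_prop)).trans ?_
  gcongr
  exact Frugal.sqInt_add_le (by fun_prop)

end

/-! ### Strong continuity of transport -/

lemma tendsto_transport_of_hasCompactSupport {μ ν : Measure ℝ} [SFinite μ] [NullSingletonClass μ]
    [SFinite ν] [IsFiniteMeasureOnCompacts ν] {a : ℕ → ℝ → ℝ} {a0 : ℝ → ℝ}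
    (ha : ∀ n, Measurable (a n)) (ha0 : Measurable a0)
    (ha1 : ∀ n, sqInt μ (a n) = 1) (ha01 : sqInt μ a0 = 1)
    (hlim : Tendsto (fun n => sqInt μ fun z => a n z - a0 z) atTop (𝓝 0))
    {G : ℝ × ℝ → ℝ} (hG : Continuous G) (hGs : HasCompactSupport G) :
    Tendsto (fun n => sqInt (μ.prod ν) fun s => transport μ (a n) G s - transport μ a0 G s)
      atTop (𝓝 0) := by
  have hV := fun n => measurable_sqCdf (ha n) (ha1 n)
  have hV0 := measurable_sqCdf ha0 ha01
  have hVlim := tendsto_sqCdf ha ha0 ha1 ha01 hlim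
  have hGm := hG.measurable
  obtain ⟨M, hM⟩ := hGs.exists_bound_of_continuous hG
  -- All slices of `G` live on the compact set `T`, which has finite measure, so their square norms
  -- have the common bound `B`.
  set T : Set ℝ := Prod.snd '' tsupport G with hT
  have hTc : IsCompact T := hGs.isCompact.image continuous_snd
  have hTm : MeasurableSet T := hTc.isClosed.measurableSet
  have hGT : ∀ u ω, ω ∉ T → G (u, ω) = 0 := fun u ω h => by
    by_contra h2
    exact h ⟨(u, ω), subset_tsupport G h2, rfl⟩
  set B : ℝ≥0∞ := ENNReal.ofReal (4 * M ^ 2) * ν T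
  have hB : B ≠ ∞ := ENNReal.mul_ne_top ENNReal.ofReal_ne_top hTc.measure_lt_top.ne
  have hbd : ∀ f : ℝ → ℝ, (∀ ω, |f ω| ≤ 2 * M) → (∀ ω, ω ∉ T → f ω = 0) → sqInt ν f ≤ B := by
    intro f h1 h2
    calc sqInt ν f ≤ ∫⁻ ω, T.indicator (fun _ => ENNReal.ofReal (4 * M ^ 2)) ω ∂ν := by
          refine lintegral_mono fun ω => ?_
          by_cases hω : ω ∈ T
          · rw [indicator_of_mem hω]
            refine ENNReal.ofReal_le_ofReal ?_
            rw [← sq_abs]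
            nlinarith [h1 ω, abs_nonneg (f ω)]
          · rw [h2 ω hω]; simp
      _ = B := by rw [lintegral_indicator_const hTm]
  have hA : Tendsto (fun n => sqInt (μ.prod ν) fun s =>
      (a n s.1 - a0 s.1) * G (sqCdf μ (a n) s.1, s.2)) atTop (𝓝 0) := by
    have hB0 : Tendsto (fun n => (sqInt μ fun z => a n z - a0 z) * B) atTop (𝓝 0) := by
      simpa using ENNReal.Tendsto.mul_const hlim (Or.inr hB)
    refine tendsto_of_tendsto_of_tendsto_of_le_of_le tendsto_const_nhds hB0 (fun _ => zero_le)
      fun n => ?_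
    have h1 := ha n
    have h2 := hV n
    simp only
    rw [sqInt_prod (by fun_prop)]
    simp only [sqInt_const_mul]
    rw [sqInt, ← lintegral_mul_const' _ _ hB]
    refine lintegral_mono fun z => mul_le_mul' le_rfl
        (hbd (fun ω => G (sqCdf μ (a n) z, ω)) (fun ω => ?_) fun ω => hGT _ ω)
    have := hM (sqCdf μ (a n) z, ω)
    rw [Real.norm_eq_abs] at this
    linarith [abs_nonneg (G (sqCdf μ (a n) z, ω))]
  have hC : Tendsto (fun n => sqInt (μ.prod ν) fun s =>
      a0 s.1 * (G (sqCdf μ (a n) s.1, s.2) - G (sqCdf μ a0 s.1, s.2))) atTop (𝓝 0) := by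
    have hTi : Measurable (T.indicator fun _ : ℝ => ENNReal.ofReal (4 * M ^ 2)) :=
      measurable_const.indicator hTm
    have hdom : AsympDominated (μ.prod ν) fun _ s => ENNReal.ofReal (a0 s.1 ^ 2) *
        T.indicator (fun _ => ENNReal.ofReal (4 * M ^ 2)) s.2 := by
      refine asympDominated_const (by fun_prop) ?_
      rw [lintegral_prod _ (by fun_prop)]
      have h3 : ∀ z : ℝ, ∫⁻ ω, ENNReal.ofReal (a0 z ^ 2) *
          T.indicator (fun _ => ENNReal.ofReal (4 * M ^ 2)) ω ∂ν
          = ENNReal.ofReal (a0 z ^ 2) * B := fun z => by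
        rw [lintegral_const_mul' _ _ ENNReal.ofReal_ne_top, lintegral_indicator_const hTm]
      simp only [h3]
      rw [lintegral_mul_const' _ _ hB]
      exact ENNReal.mul_ne_top (by change sqInt μ a0 ≠ ∞; simp [ha01]) hB
    have hle : ∀ n, ∀ s : ℝ × ℝ, ENNReal.ofReal ((a0 s.1 *
        (G (sqCdf μ (a n) s.1, s.2) - G (sqCdf μ a0 s.1, s.2))) ^ 2) ≤ ENNReal.ofReal (a0 s.1 ^ 2) *
        T.indicator (fun _ => ENNReal.ofReal (4 * M ^ 2)) s.2 := by
      intro n s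
      rw [mul_pow, ENNReal.ofReal_mul (sq_nonneg _)]
      refine mul_le_mul' le_rfl ?_
      by_cases hω : s.2 ∈ T
      · rw [indicator_of_mem hω]
        refine ENNReal.ofReal_le_ofReal ?_
        have h1 := hM (sqCdf μ (a n) s.1, s.2)
        have h2 := hM (sqCdf μ a0 s.1, s.2)
        rw [Real.norm_eq_abs, abs_le] at h1 h2
        rw [show 4 * M ^ 2 = (2 * M) ^ 2 by ring]
        exact sq_le_sq' (by linarith) (by linarith)
      · rw [hGT _ _ hω, hGT _ _ hω]; simp
    have hpt : ∀ s : ℝ × ℝ, Tendsto (fun n => ENNReal.ofReal ((a0 s.1 *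
        (G (sqCdf μ (a n) s.1, s.2) - G (sqCdf μ a0 s.1, s.2))) ^ 2)) atTop (𝓝 0) := by
      intro s
      have h1 : Tendsto (fun n => G (sqCdf μ (a n) s.1, s.2)) atTop (𝓝 (G (sqCdf μ a0 s.1, s.2))) :=
        (hG.tendsto _).comp ((hVlim s.1).prodMk_nhds tendsto_const_nhds)
      have h2 := ENNReal.tendsto_ofReal (((h1.sub_const (G (sqCdf μ a0 s.1, s.2))).const_mul
        (a0 s.1)).pow 2)
      simpa using h2
    refine (hdom.mono (Eventually.of_forall fun n => ae_of_all _ (hle n))).tendsto_zero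
      (fun n => ?_) (ae_of_all _ hpt)
    have h2 := hV n
    fun_prop
  have hsum : Tendsto (fun n => 2 * (sqInt (μ.prod ν) fun s =>
      (a n s.1 - a0 s.1) * G (sqCdf μ (a n) s.1, s.2)) + 2 * (sqInt (μ.prod ν) fun s =>
      a0 s.1 * (G (sqCdf μ (a n) s.1, s.2) - G (sqCdf μ a0 s.1, s.2)))) atTop (𝓝 0) := by
    simpa using (ENNReal.Tendsto.const_mul hA (Or.inr (by simp : (2 : ℝ≥0∞) ≠ ∞))).add
      (ENNReal.Tendsto.const_mul hC (Or.inr (by simp : (2 : ℝ≥0∞) ≠ ∞)))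
  refine tendsto_of_tendsto_of_tendsto_of_le_of_le tendsto_const_nhds hsum (fun _ => zero_le)
    fun n => ?_
  have h1 := ha n
  have h2 := hV n
  have e : (fun s : ℝ × ℝ => transport μ (a n) G s - transport μ a0 G s) = fun s =>
      (a n s.1 - a0 s.1) * G (sqCdf μ (a n) s.1, s.2) +
      a0 s.1 * (G (sqCdf μ (a n) s.1, s.2) - G (sqCdf μ a0 s.1, s.2)) := by
    ext s; simp only [transport]; ring
  simp only [e]
  exact sqInt_add_le (by fun_prop)

/-- Transport along distribution functions is strongly continuous. -/
theorem tendsto_transport {μ ν : Measure ℝ} [SFinite μ] [NullSingletonClass μ] [SFinite ν]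
    [IsFiniteMeasureOnCompacts ν] {a : ℕ → ℝ → ℝ} {a0 : ℝ → ℝ}
    (ha : ∀ n, Measurable (a n)) (ha0 : Measurable a0)
    (ha1 : ∀ n, sqInt μ (a n) = 1) (ha01 : sqInt μ a0 = 1)
    (hlim : Tendsto (fun n => sqInt μ fun z => a n z - a0 z) atTop (𝓝 0))
    {F : ℝ × ℝ → ℝ} (hF : Measurable F) (hF1 : sqInt (unitVol.prod ν) F ≠ ∞) :
    Tendsto (fun n => sqInt (μ.prod ν) fun s => transport μ (a n) F s - transport μ a0 F s)
      atTop (𝓝 0) := by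
  rw [ENNReal.tendsto_nhds_zero]
  intro ε hε
  have hε' : 0 < ε / 10 := ENNReal.div_pos hε.ne' (by simp)
  have hFL : MemLp F 2 (unitVol.prod ν) := memLp_of_sqInt hF.aestronglyMeasurable hF1
  have : IsFiniteMeasureOnCompacts (unitVol.prod ν) := inferInstance
  obtain ⟨δ, hδ0, hδ⟩ : ∃ δ : ℝ≥0∞, δ ≠ 0 ∧ δ ^ 2 ≤ ε / 10 := by
    refine ⟨min 1 (ε / 10), (lt_min one_pos hε').ne', ?_⟩
    rw [sq]
    exact (mul_le_mul' (min_le_left _ _) (min_le_right _ _)).trans (one_mul _).le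
  -- Transports are isometries, so the error of approximating `F` by `G` is the same for all `n`.
  -- The factors add up to `2 * (2 + 2) + 2 = 10`.
  obtain ⟨G, hGs, hGF, hGc, -⟩ := hFL.exists_hasCompactSupport_eLpNorm_sub_le (by simp) hδ0
  have hGm := hGc.measurable
  have hFG : sqInt (unitVol.prod ν) (fun s => F s - G s) ≤ ε / 10 := by
    rw [sqInt_eq_eLpNorm]
    exact (pow_le_pow_left₀ zero_le hGF 2).trans hδ
  filter_upwards [ENNReal.tendsto_nhds_zero.1 (tendsto_transport_of_hasCompactSupport (ν := ν)
    ha ha0 ha1 ha01 hlim hGc hGs) _ hε'] with n hn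
  have hm := fun n => measurable_transport (μ := μ) (ha n) (ha1 n) (f := fun s => F s - G s)
    (by fun_prop)
  have hm0 := measurable_transport (μ := μ) ha0 ha01 (f := fun s => F s - G s) (by fun_prop)
  have hm1 := measurable_transport (ha n) (ha1 n) hGm
  have hm2 := measurable_transport ha0 ha01 hGm
  have e : (fun s : ℝ × ℝ => transport μ (a n) F s - transport μ a0 F s) = fun s =>
      (transport μ (a n) (fun s => F s - G s) s - transport μ a0 (fun s => F s - G s) s) +
      (transport μ (a n) G s - transport μ a0 G s) := by
    ext s; simp only [transport]; ring
  rw [e]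
  have h1 : (sqInt (μ.prod ν) fun s => transport μ (a n) (fun s => F s - G s) s -
      transport μ a0 (fun s => F s - G s) s) ≤ 2 * (ε / 10) + 2 * (ε / 10) := by
    refine (sqInt_sub_le (hm n).aemeasurable).trans ?_
    rw [sqInt_transport (ha n) (ha1 n) (by fun_prop), sqInt_transport ha0 ha01 (by fun_prop)]
    gcongr
  calc _ ≤ 2 * (2 * (ε / 10) + 2 * (ε / 10)) + 2 * (ε / 10) :=
        (sqInt_add_le (f := fun s => transport μ (a n) (fun s => F s - G s) s -
          transport μ a0 (fun s => F s - G s) s) ((hm n).sub hm0).aemeasurable).trans (by gcongr)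
    _ = 10 * (ε / 10) := by ring
    _ ≤ ε := ENNReal.mul_div_le

/-! ### Elementary limits in `L²` -/

section SqIntLimits

variable {Ω Ω' : Type*} [MeasurableSpace Ω] [MeasurableSpace Ω'] {μ : Measure Ω} {ν : Measure Ω'}

lemma tendsto_sqInt_add {f g : ℕ → Ω → ℝ} (hf : ∀ n, Measurable (f n))
    (h1 : Tendsto (fun n => sqInt μ (f n)) atTop (𝓝 0))
    (h2 : Tendsto (fun n => sqInt μ (g n)) atTop (𝓝 0)) :
    Tendsto (fun n => sqInt μ fun ω => f n ω + g n ω) atTop (𝓝 0) := by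
  have h3 : Tendsto (fun n => 2 * sqInt μ (f n) + 2 * sqInt μ (g n)) atTop (𝓝 0) := by
    simpa using (ENNReal.Tendsto.const_mul h1 (Or.inr (by simp : (2 : ℝ≥0∞) ≠ ∞))).add
      (ENNReal.Tendsto.const_mul h2 (Or.inr (by simp : (2 : ℝ≥0∞) ≠ ∞)))
  exact tendsto_of_tendsto_of_tendsto_of_le_of_le tendsto_const_nhds h3 (fun _ => zero_le)
    fun n => sqInt_add_le (hf n).aemeasurable

lemma tendsto_sqInt_mul {f : ℕ → Ω → ℝ} {c : ℕ → ℝ} {c0 : ℝ} (hc : Tendsto c atTop (𝓝 c0))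
    (h1 : Tendsto (fun n => sqInt μ (f n)) atTop (𝓝 0)) :
    Tendsto (fun n => sqInt μ fun ω => c n * f n ω) atTop (𝓝 0) := by
  simp only [sqInt_const_mul]
  simpa using ENNReal.Tendsto.mul (ENNReal.tendsto_ofReal (hc.pow 2)) (Or.inr (by simp)) h1
    (Or.inr ENNReal.ofReal_ne_top)

lemma tendsto_sqInt_mul_const {f : Ω → ℝ} {c : ℕ → ℝ} (hc : Tendsto c atTop (𝓝 0))
    (h1 : sqInt μ f ≠ ∞) :
    Tendsto (fun n => sqInt μ fun ω => c n * f ω) atTop (𝓝 0) := by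
  simp only [sqInt_const_mul]
  simpa using ENNReal.Tendsto.mul_const (ENNReal.tendsto_ofReal (hc.pow 2)) (Or.inr h1)

lemma sqInt_swap [SFinite μ] [SFinite ν] {f : Ω × Ω' → ℝ} (hf : Measurable f) :
    sqInt (ν.prod μ) (fun s => f s.swap) = sqInt (μ.prod ν) f := by
  rw [sqInt_prod_symm hf, sqInt_prod (by fun_prop)]
  rfl

/-- The limit of an `L²`-convergent difference quotient is square integrable. -/
lemma sqInt_ne_top_of_tendsto {f : ℕ → Ω → ℝ} {g : Ω → ℝ} (hf : ∀ n, Measurable (f n))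
    (hf1 : ∀ n, sqInt μ (f n) ≠ ∞) (h : Tendsto (fun n => sqInt μ fun ω => f n ω - g ω) atTop (𝓝 0)) :
    sqInt μ g ≠ ∞ := by
  obtain ⟨n, hn⟩ := (h.eventually (gt_mem_nhds one_pos)).exists
  have h2 := sqInt_sub_le (μ := μ) (f := f n) (g := fun ω => f n ω - g ω) (hf n).aemeasurable
  simp only [sub_sub_cancel] at h2
  refine ne_top_of_le_ne_top ?_ h2
  simp [ENNReal.mul_eq_top, hf1 n, (hn.trans ENNReal.one_lt_top).ne]

end SqIntLimits

/-! ### Joint densities with given margins and copula: unit vectors -/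

section Joint

variable {μZ μY : Measure ℝ}

/-- The square root of the density of `(Z, Y)` with margins `a ^ 2` and `b ^ 2` and copula density
`γ ^ 2`. -/
def joint (μZ μY : Measure ℝ) (a b : ℝ → ℝ) (γ : ℝ × ℝ → ℝ) (s : ℝ × ℝ) : ℝ :=
  a s.1 * b s.2 * γ (sqCdf μY b s.2, sqCdf μZ a s.1)

/-- Transporting `γ` first in one coordinate and then in the other produces the joint root, so
results on a single transport can be used twice. -/
lemma joint_eq_transport_right (a b : ℝ → ℝ) (γ : ℝ × ℝ → ℝ) (s : ℝ × ℝ) :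
    joint μZ μY a b γ s
      = transport μY b (fun r => transport μZ a (fun q => γ q.swap) r.swap) s.swap := by
  simp only [joint, transport, Prod.swap]
  ring

variable {a b : ℝ → ℝ} {γ : ℝ × ℝ → ℝ}

lemma measurable_joint (ha : Measurable a) (ha1 : sqInt μZ a = 1) (hb : Measurable b)
    (hb1 : sqInt μY b = 1) (hγ : Measurable γ) : Measurable (joint μZ μY a b γ) := by
  have h1 := measurable_sqCdf ha ha1
  have h2 := measurable_sqCdf hb hb1
  unfold joint
  fun_prop

variable [SFinite μZ] [SFinite μY] [NullSingletonClass μY]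

/-- Transport in the second coordinate does not change square norms. -/
lemma sqInt_transport_swap (hb : Measurable b) (hb1 : sqInt μY b = 1) {f : ℝ × ℝ → ℝ}
    (hf : Measurable f) :
    sqInt (μZ.prod μY) (fun s => transport μY b (fun r => f r.swap) s.swap)
      = sqInt (μZ.prod unitVol) f := by
  rw [sqInt_swap (measurable_transport hb hb1 (by fun_prop)), sqInt_transport hb hb1 (by fun_prop),
    sqInt_swap hf]

variable [NullSingletonClass μZ]

lemma sqInt_joint (ha : Measurable a) (ha1 : sqInt μZ a = 1) (hb : Measurable b)
    (hb1 : sqInt μY b = 1) (hγ : Measurable γ) :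
    sqInt (μZ.prod μY) (joint μZ μY a b γ) = sqInt (unitVol.prod unitVol) γ := by
  rw [show joint μZ μY a b γ = _ from funext (joint_eq_transport_right a b γ),
    sqInt_transport_swap hb hb1 (measurable_transport ha ha1 (by fun_prop)),
    sqInt_transport ha ha1 (by fun_prop), sqInt_swap hγ]

/-- The Lipschitz estimate for the joint density. -/
theorem sqInt_joint_sub_le {a0 b0 : ℝ → ℝ} {γ0 γu γv : ℝ × ℝ → ℝ} {K K' : ℝ}
    (hu : IsCurve unitVol γ0 γu K)
    (hv : IsCurve unitVol (fun q => γ0 q.swap) (fun q => γv q.swap) K')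
    (ha : Measurable a) (ha0 : Measurable a0) (ha1 : sqInt μZ a = 1) (ha01 : sqInt μZ a0 = 1)
    (hane : ∀ᵐ s ∂μZ, a s ≠ 0) (ha0ne : ∀ᵐ s ∂μZ, a0 s ≠ 0)
    (hb : Measurable b) (hb0 : Measurable b0) (hb1 : sqInt μY b = 1) (hb01 : sqInt μY b0 = 1)
    (hbne : ∀ᵐ s ∂μY, b s ≠ 0) (hb0ne : ∀ᵐ s ∂μY, b0 s ≠ 0) (hγ : Measurable γ) :
    sqInt (μZ.prod μY) (fun s => joint μZ μY a b γ s - joint μZ μY a0 b0 γ0 s)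
      ≤ 4 * (1 + lipConst K + lipConst K') * ((sqInt (unitVol.prod unitVol) fun q => γ q - γ0 q)
        + (sqInt μY fun y => b y - b0 y) + sqInt μZ fun z => a z - a0 z) := by
  have hγ0 := hu.meas
  have hγ0s := hv.meas
  have m1 := measurable_transport ha ha1 hγ0s
  have m2 := measurable_transport ha0 ha01 hγ0s
  have m3 := measurable_transport hb hb1 hγ0
  have m4 := measurable_transport hb0 hb01 hγ0
  have hA := sqInt_joint (μZ := μZ) (μY := μY) ha ha1 hb hb1 (γ := fun q => γ q - γ0 q)
    (by fun_prop)
  have hB := sqInt_transport_swap (μZ := μZ) (μY := μY) hb hb1 (f := fun r =>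
    transport μZ a (fun q => γ0 q.swap) r - transport μZ a0 (fun q => γ0 q.swap) r) (by fun_prop)
  have hC := sqInt_transport (μ := μZ) (ν := μY) ha0 ha01 (f := fun r =>
    transport μY b γ0 r.swap - transport μY b0 γ0 r.swap) (by fun_prop)
  have hC2 : sqInt (unitVol.prod μY) (fun r => transport μY b γ0 r.swap - transport μY b0 γ0 r.swap)
      = _ := sqInt_swap (μ := μY) (ν := unitVol)
        (f := fun r => transport μY b γ0 r - transport μY b0 γ0 r) (by fun_prop)
  have hB' := hv.sqInt_transport_sub_le ha0 ha ha01 ha1 ha0ne hane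
  have hC' := hu.sqInt_transport_sub_le hb0 hb hb01 hb1 hb0ne hbne
  have mA := measurable_joint (μZ := μZ) (μY := μY) ha ha1 hb hb1 (γ := fun q => γ q - γ0 q)
    (by fun_prop)
  have mB := measurable_transport (μ := μY) hb hb1 (f := fun r : ℝ × ℝ =>
    transport μZ a (fun q => γ0 q.swap) r.swap - transport μZ a0 (fun q => γ0 q.swap) r.swap)
    (by fun_prop)
  -- Telescoping: `γ` is changed first, then the `Z`-margin, then the `Y`-margin. In this order both
  -- margins are varied with `γ0` inside, the only copula root known to be a curve, and what is held
  -- fixed acts as an isometry.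
  have e : (fun s => joint μZ μY a b γ s - joint μZ μY a0 b0 γ0 s) = fun s =>
      (joint μZ μY a b (fun q => γ q - γ0 q) s +
      transport μY b (fun r => transport μZ a (fun q => γ0 q.swap) r.swap
        - transport μZ a0 (fun q => γ0 q.swap) r.swap) s.swap) +
      transport μZ a0 (fun r => transport μY b γ0 r.swap - transport μY b0 γ0 r.swap) s := by
    ext s
    simp only [joint, transport, Prod.swap]
    ring
  rw [e]
  set X := sqInt (unitVol.prod unitVol) fun q => γ q - γ0 q
  set Y := sqInt μY fun y => b y - b0 y
  set Z := sqInt μZ fun z => a z - a0 z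
  calc _ ≤ 2 * (2 * X + 2 * (lipConst K' * Z)) + 2 * (lipConst K * Y) := by
        refine (sqInt_add_le (by fun_prop)).trans ?_
        gcongr
        · refine (sqInt_add_le (by fun_prop)).trans ?_
          rw [hA, hB]
          gcongr
        · rw [hC, hC2]
          exact hC'
    _ = 4 * (1 * X + lipConst K' * Z) + 2 * (lipConst K * Y) := by ring
    _ ≤ 4 * ((1 + lipConst K + lipConst K') * X + (1 + lipConst K + lipConst K') * Z)
        + 4 * ((1 + lipConst K + lipConst K') * Y) := by
        gcongr
        · rw [add_assoc]; exact le_self_add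
        · exact le_add_self
        · norm_num
        · rw [add_comm 1, add_assoc]; exact le_self_add
    _ = _ := by ring

/-- The derivative of the joint density. -/
def jointDeriv (μZ μY : Measure ℝ) (a0 α b0 β : ℝ → ℝ) (γ0 γu γv κ : ℝ × ℝ → ℝ) (s : ℝ × ℝ) : ℝ :=
  joint μZ μY a0 b0 κ s +
  transport μY b0 (fun r => transportDeriv μZ a0 α (fun q => γ0 q.swap) (fun q => γv q.swap) r.swap)
    s.swap +
  transport μZ a0 (fun r => transportDeriv μY b0 β γ0 γu r.swap) s

theorem tendsto_joint_quotient [IsFiniteMeasureOnCompacts μZ]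
    {a b : ℕ → ℝ → ℝ} {γ : ℕ → ℝ × ℝ → ℝ} {a0 α b0 β : ℝ → ℝ} {γ0 γu γv κ : ℝ × ℝ → ℝ} {K K' : ℝ}
    {t : ℕ → ℝ} (hu : IsCurve unitVol γ0 γu K)
    (hv : IsCurve unitVol (fun q => γ0 q.swap) (fun q => γv q.swap) K')
    (ha : ∀ n, Measurable (a n)) (ha0 : Measurable a0) (hα : Measurable α)
    (ha1 : ∀ n, sqInt μZ (a n) = 1) (ha01 : sqInt μZ a0 = 1) (hα1 : sqInt μZ α ≠ ∞)
    (hane : ∀ n, ∀ᵐ s ∂μZ, a n s ≠ 0) (ha0ne : ∀ᵐ s ∂μZ, a0 s ≠ 0)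
    (hb : ∀ n, Measurable (b n)) (hb0 : Measurable b0) (hβ : Measurable β)
    (hb1 : ∀ n, sqInt μY (b n) = 1) (hb01 : sqInt μY b0 = 1) (hβ1 : sqInt μY β ≠ ∞)
    (hbne : ∀ n, ∀ᵐ s ∂μY, b n s ≠ 0) (hb0ne : ∀ᵐ s ∂μY, b0 s ≠ 0)
    (hγ : ∀ n, Measurable (γ n)) (hκ : Measurable κ) (hκ1 : sqInt (unitVol.prod unitVol) κ ≠ ∞)
    (ht0 : ∀ n, t n ≠ 0) (ht : Tendsto t atTop (𝓝 0))
    (hlima : Tendsto (fun n => sqInt μZ fun z => (a n z - a0 z) / t n - α z) atTop (𝓝 0))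
    (hlimb : Tendsto (fun n => sqInt μY fun z => (b n z - b0 z) / t n - β z) atTop (𝓝 0))
    (hlimγ : Tendsto (fun n => sqInt (unitVol.prod unitVol) fun q => (γ n q - γ0 q) / t n - κ q)
      atTop (𝓝 0)) :
    Tendsto (fun n => sqInt (μZ.prod μY) fun s =>
      (joint μZ μY (a n) (b n) (γ n) s - joint μZ μY a0 b0 γ0 s) / t n
        - jointDeriv μZ μY a0 α b0 β γ0 γu γv κ s) atTop (𝓝 0) := by
  have hγ0 := hu.meas
  have hγ0s := hv.meas
  have hγv' := hv.meas'
  have hda := tendsto_sqInt_of_tendsto_quotient ha ha0 hα1 ht0 ht hα hlima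
  have hdb := tendsto_sqInt_of_tendsto_quotient hb hb0 hβ1 ht0 ht hβ hlimb
  set Da := transportDeriv μZ a0 α (fun q => γ0 q.swap) (fun q => γv q.swap)
  set Db := transportDeriv μY b0 β γ0 γu
  have mDa : Measurable Da := measurable_transportDeriv ha0 hα ha01 hγ0s hγv'
  have mDb : Measurable Db := measurable_transportDeriv hb0 hβ hb01 hγ0 hu.meas'
  have m1 := fun n => measurable_transport (ha n) (ha1 n) hγ0s
  have m2 := measurable_transport ha0 ha01 hγ0s
  have m3 := fun n => measurable_transport (hb n) (hb1 n) hγ0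
  have m4 := measurable_transport hb0 hb01 hγ0
  have hQa := hv.tendsto_transport_quotient (μ := μZ) ha ha0 hα ha1 ha01 hα1 hane ha0ne ht0 ht hlima
  have hQb := hu.tendsto_transport_quotient (μ := μY) hb hb0 hβ hb1 hb01 hβ1 hbne hb0ne ht0 ht hlimb
  have hγ01 : sqInt (unitVol.prod unitVol) (fun q : ℝ × ℝ => γ0 q.swap) ≠ ∞ := by
    rw [sqInt_prod hγ0s]
    refine ne_top_of_le_ne_top (b := 1) (by simp) ?_
    calc _ ≤ ∫⁻ _, 1 ∂unitVol := lintegral_mono_ae (ae_unitVol_mem.mono fun v hv' => hv.norm v hv')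
      _ = 1 := by simp
  have hDa1 : sqInt (μZ.prod unitVol) Da ≠ ∞ := by
    refine sqInt_ne_top_of_tendsto (fun n => ?_) (fun n => ?_) hQa
    · have := m1 n; fun_prop
    · rw [sqInt_div_const]
      refine ENNReal.mul_ne_top ENNReal.ofReal_ne_top (ne_top_of_le_ne_top ?_
        (sqInt_sub_le (m1 n).aemeasurable))
      rw [sqInt_transport (ha n) (ha1 n) hγ0s, sqInt_transport ha0 ha01 hγ0s]
      simp only [ne_eq, ENNReal.add_eq_top, ENNReal.mul_eq_top, hγ01]
      simp
  -- the variation of `γ`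
  have hA : Tendsto (fun n => sqInt (μZ.prod μY)
      (joint μZ μY (a n) (b n) fun q => (γ n q - γ0 q) / t n - κ q)) atTop (𝓝 0) := by
    refine hlimγ.congr fun n => (sqInt_joint (ha n) (ha1 n) (hb n) (hb1 n) ?_).symm
    have := hγ n
    fun_prop
  -- the moving evaluation of `κ`
  have mκ := measurable_transport (μ := μZ) ha0 ha01 (f := fun q => κ q.swap) (by fun_prop)
  have mκn := fun n => measurable_transport (μ := μZ) (ha n) (ha1 n) (f := fun q => κ q.swap)
    (by fun_prop)
  have hκs : sqInt (unitVol.prod unitVol) (fun q : ℝ × ℝ => κ q.swap) ≠ ∞ := by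
    rwa [sqInt_swap hκ]
  have hB1 : Tendsto (fun n => sqInt (μZ.prod μY) fun s => transport μY (b n) (fun r =>
      transport μZ (a n) (fun q => κ q.swap) r.swap - transport μZ a0 (fun q => κ q.swap) r.swap)
      s.swap) atTop (𝓝 0) := by
    refine (tendsto_transport (μ := μZ) (ν := unitVol) ha ha0 ha1 ha01 hda (F := fun q => κ q.swap)
      (by fun_prop) hκs).congr fun n => (sqInt_transport_swap (hb n) (hb1 n) (f := fun r =>
      transport μZ (a n) (fun q => κ q.swap) r - transport μZ a0 (fun q => κ q.swap) r) ?_).symm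
    have := mκn n
    fun_prop
  -- For a fixed square integrable function at the moving `Y`-margin no rate is needed, and strong
  -- continuity suffices. It is applied to `κ` transported along `a0` and to the derivative `Da`.
  have hmove : ∀ {F : ℝ × ℝ → ℝ}, Measurable F → sqInt (μZ.prod unitVol) F ≠ ∞ →
      Tendsto (fun n => sqInt (μZ.prod μY) fun s => transport μY (b n) (fun r => F r.swap) s.swap -
      transport μY b0 (fun r => F r.swap) s.swap) atTop (𝓝 0) := by
    intro F hF hF1
    have hF1' : sqInt (unitVol.prod μZ) (fun r => F r.swap) ≠ ∞ := by rwa [sqInt_swap hF]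
    refine (tendsto_transport (μ := μY) (ν := μZ) hb hb0 hb1 hb01 hdb (F := fun r => F r.swap)
      (by fun_prop) hF1').congr fun n => ?_
    have h1 := measurable_transport (μ := μY) (hb n) (hb1 n) (f := fun r => F r.swap) (by fun_prop)
    have h2 := measurable_transport (μ := μY) hb0 hb01 (f := fun r => F r.swap) (by fun_prop)
    exact (sqInt_swap (μ := μY) (ν := μZ) (f := fun s => transport μY (b n) (fun r => F r.swap) s -
      transport μY b0 (fun r => F r.swap) s) (by fun_prop)).symm
  have hB2 := hmove mκ (by rwa [sqInt_transport ha0 ha01 (by fun_prop)])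
  have hC1 : Tendsto (fun n => sqInt (μZ.prod μY) fun s => transport μY (b n) (fun r =>
      (transport μZ (a n) (fun q => γ0 q.swap) r.swap - transport μZ a0 (fun q => γ0 q.swap) r.swap)
        / t n - Da r.swap) s.swap) atTop (𝓝 0) := by
    refine hQa.congr fun n => (sqInt_transport_swap (hb n) (hb1 n) (f := fun r =>
      (transport μZ (a n) (fun q => γ0 q.swap) r - transport μZ a0 (fun q => γ0 q.swap) r) / t n
      - Da r) ?_).symm
    have := m1 n
    fun_prop
  have hC2 := hmove mDa hDa1
  have hE : Tendsto (fun n => sqInt (μZ.prod μY) fun s => transport μZ a0 (fun r =>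
      (transport μY (b n) γ0 r.swap - transport μY b0 γ0 r.swap) / t n - Db r.swap) s)
      atTop (𝓝 0) := by
    refine hQb.congr fun n => ?_
    have := m3 n
    have h1 : Measurable fun r : ℝ × ℝ =>
      (transport μY (b n) γ0 r - transport μY b0 γ0 r) / t n - Db r := by fun_prop
    rw [sqInt_transport ha0 ha01 (f := fun r => (transport μY (b n) γ0 r.swap -
      transport μY b0 γ0 r.swap) / t n - Db r.swap) (by fun_prop)]
    exact (sqInt_swap (μ := μY) (ν := unitVol) h1).symm
  have k1 : ∀ n, Measurable (joint μZ μY (a n) (b n) fun q => (γ n q - γ0 q) / t n - κ q) :=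
    fun n => measurable_joint (ha n) (ha1 n) (hb n) (hb1 n) (by have := hγ n; fun_prop)
  have k2 : ∀ n, Measurable (transport μY (b n) (fun r : ℝ × ℝ =>
      transport μZ (a n) (fun q => κ q.swap) r.swap - transport μZ a0 (fun q => κ q.swap) r.swap)) :=
    fun n => measurable_transport (hb n) (hb1 n) (by have := mκn n; fun_prop)
  have k3 : ∀ n, Measurable (transport μY (b n) fun r : ℝ × ℝ =>
      transport μZ a0 (fun q => κ q.swap) r.swap) :=
    fun n => measurable_transport (hb n) (hb1 n) (by fun_prop)
  have k4 : Measurable (transport μY b0 fun r : ℝ × ℝ =>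
      transport μZ a0 (fun q => κ q.swap) r.swap) :=
    measurable_transport hb0 hb01 (by fun_prop)
  have k5 : ∀ n, Measurable (transport μY (b n) (fun r : ℝ × ℝ =>
      (transport μZ (a n) (fun q => γ0 q.swap) r.swap - transport μZ a0 (fun q => γ0 q.swap) r.swap)
        / t n - Da r.swap)) :=
    fun n => measurable_transport (hb n) (hb1 n) (by have := m1 n; fun_prop)
  have k6 : ∀ n, Measurable (transport μY (b n) fun r : ℝ × ℝ => Da r.swap) :=
    fun n => measurable_transport (hb n) (hb1 n) (by fun_prop)
  have k7 : Measurable (transport μY b0 fun r : ℝ × ℝ => Da r.swap) :=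
    measurable_transport hb0 hb01 (by fun_prop)
  have s1 := tendsto_sqInt_add k1 hA hB1
  have l1 := fun n => (k1 n).add ((k2 n).comp measurable_swap)
  have s2 := tendsto_sqInt_add l1 s1 hB2
  have l2 := fun n => (l1 n).add (((k3 n).comp measurable_swap).sub (k4.comp measurable_swap))
  have s3 := tendsto_sqInt_add l2 s2 hC1
  have l3 := fun n => (l2 n).add ((k5 n).comp measurable_swap)
  have s4 := tendsto_sqInt_add l3 s3 hC2
  have l4 := fun n => (l3 n).add (((k6 n).comp measurable_swap).sub (k7.comp measurable_swap))
  have hsum := tendsto_sqInt_add l4 s4 hE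
  refine hsum.congr fun n => ?_
  congr 1
  ext s
  have := ht0 n
  simp only [jointDeriv, joint, transport, Prod.swap, Db, Da, Pi.add_apply,
    Pi.sub_apply, Function.comp_apply]
  field_simp
  ring

end Joint

/-! ### Normalization in `L²` -/

section Normalize

variable {Ω : Type*} [MeasurableSpace Ω] {μ : Measure Ω}

/-- The `L²` norm of `a`. -/
def rootMass (μ : Measure Ω) (a : Ω → ℝ) : ℝ := √(∫ s, a s ^ 2 ∂μ)

/-- `a` divided by its `L²` norm. -/
def normalize (μ : Measure Ω) (a : Ω → ℝ) (z : Ω) : ℝ := a z / rootMass μ a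

variable {a a' : Ω → ℝ}

lemma rootMass_nonneg : 0 ≤ rootMass μ a := Real.sqrt_nonneg _

lemma rootMass_sq : rootMass μ a ^ 2 = ∫ s, a s ^ 2 ∂μ :=
  Real.sq_sqrt (integral_nonneg fun _ => sq_nonneg _)

lemma rootMass_eq (ha : Measurable a) : rootMass μ a = √(sqInt μ a).toReal := by
  rw [rootMass, integral_sq_eq_toReal ha.aestronglyMeasurable]

lemma ofReal_rootMass_sq (ha : Measurable a) (h1 : sqInt μ a ≠ ∞) :
    ENNReal.ofReal (rootMass μ a ^ 2) = sqInt μ a := by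
  rw [rootMass_sq, integral_sq_eq_toReal ha.aestronglyMeasurable, ENNReal.ofReal_toReal h1]

lemma rootMass_pos (ha : Measurable a) (h1 : sqInt μ a ≠ ∞) (h0 : sqInt μ a ≠ 0) :
    0 < rootMass μ a := by
  rw [rootMass_eq ha]
  exact Real.sqrt_pos.2 (ENNReal.toReal_pos h0 h1)

lemma measurable_normalize (ha : Measurable a) : Measurable (normalize μ a) := ha.div_const _

lemma rootMass_mul_normalize (ha : Measurable a) (h1 : sqInt μ a ≠ ∞) (h0 : sqInt μ a ≠ 0) (z : Ω) :
    rootMass μ a * normalize μ a z = a z :=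
  mul_div_cancel₀ _ (rootMass_pos ha h1 h0).ne'

lemma sqInt_normalize (ha : Measurable a) (h1 : sqInt μ a ≠ ∞) (h0 : sqInt μ a ≠ 0) :
    sqInt μ (normalize μ a) = 1 := by
  have hr := rootMass_pos ha h1 h0
  unfold normalize
  rw [sqInt_div_const, ← ofReal_rootMass_sq ha h1, ← ENNReal.ofReal_mul (by positivity),
    ← mul_pow, inv_mul_cancel₀ hr.ne']
  simp

lemma normalize_ne_zero (ha : Measurable a) (h1 : sqInt μ a ≠ ∞) (h0 : sqInt μ a ≠ 0)
    (hne : ∀ᵐ s ∂μ, a s ≠ 0) : ∀ᵐ s ∂μ, normalize μ a s ≠ 0 :=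
  hne.mono fun _ hs => div_ne_zero hs (rootMass_pos ha h1 h0).ne'

lemma ofReal_rootMass_sub_sq_le (ha : Measurable a) (ha' : Measurable a') (h1 : sqInt μ a ≠ ∞)
    (h1' : sqInt μ a' ≠ ∞) :
    ENNReal.ofReal ((rootMass μ a - rootMass μ a') ^ 2) ≤ sqInt μ fun z => a z - a' z := by
  rw [rootMass_eq ha, rootMass_eq ha']
  exact ofReal_sqrt_sub_sq_le ha.aestronglyMeasurable ha'.aestronglyMeasurable h1 h1'

variable {an : ℕ → Ω → ℝ} {a0 α : Ω → ℝ} {t : ℕ → ℝ}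

lemma tendsto_rootMass (ha : ∀ n, Measurable (an n)) (ha0 : Measurable a0)
    (ha1 : ∀ n, sqInt μ (an n) ≠ ∞) (ha01 : sqInt μ a0 ≠ ∞)
    (h : Tendsto (fun n => sqInt μ fun z => an n z - a0 z) atTop (𝓝 0)) :
    Tendsto (fun n => rootMass μ (an n)) atTop (𝓝 (rootMass μ a0)) := by
  have h2 : Tendsto (fun n => ENNReal.ofReal ((rootMass μ (an n) - rootMass μ a0) ^ 2)) atTop
      (𝓝 0) :=
    tendsto_of_tendsto_of_tendsto_of_le_of_le tendsto_const_nhds h (fun _ => zero_le)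
      fun n => ofReal_rootMass_sub_sq_le (ha n) ha0 (ha1 n) ha01
  have := tendsto_zero_of_ofReal_sq h2
  simpa using this.add_const (rootMass μ a0)

/-- The difference quotients of the `L²` norm. -/
lemma tendsto_rootMass_quotient (ha : ∀ n, Measurable (an n)) (ha0 : Measurable a0)
    (hα : Measurable α) (ha1 : ∀ n, sqInt μ (an n) ≠ ∞) (ha01 : sqInt μ a0 ≠ ∞)
    (h00 : sqInt μ a0 ≠ 0)
    (hα1 : sqInt μ α ≠ ∞) (ht0 : ∀ n, t n ≠ 0) (ht : Tendsto t atTop (𝓝 0))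
    (hlim : Tendsto (fun n => sqInt μ fun z => (an n z - a0 z) / t n - α z) atTop (𝓝 0)) :
    Tendsto (fun n => (rootMass μ (an n) - rootMass μ a0) / t n) atTop
      (𝓝 ((∫ s, a0 s * α s ∂μ) / rootMass μ a0)) := by
  have hr0 := rootMass_pos ha0 ha01 h00
  have h1 := tendsto_integral_sq_quotient ha ha0 hα ha1 ha01 hα1 ht0 ht hlim
  have h2 := (tendsto_rootMass ha ha0 ha1 ha01
    (tendsto_sqInt_of_tendsto_quotient ha ha0 hα1 ht0 ht hα hlim)).add_const (rootMass μ a0)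
  have h3 := h1.div h2 (by positivity)
  have e : 2 * (∫ s, a0 s * α s ∂μ) / (rootMass μ a0 + rootMass μ a0)
      = (∫ s, a0 s * α s ∂μ) / rootMass μ a0 := by
    field_simp; ring
  rw [e] at h3
  refine h3.congr fun n => ?_
  have hn : 0 ≤ rootMass μ (an n) := rootMass_nonneg
  have : rootMass μ (an n) + rootMass μ a0 ≠ 0 := by positivity
  have := ht0 n
  simp only [Pi.div_apply]
  rw [← rootMass_sq, ← rootMass_sq]
  field_simp
  ring

/-- Quotient rule for `a / ‖a‖`, with `⟨a0, α⟩ / ‖a0‖` the derivative of the norm. It is needed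
because slices of the density of `(Z, X)` at fixed `x` do not have mass one. -/
lemma tendsto_normalize_quotient (ha : ∀ n, Measurable (an n)) (ha0 : Measurable a0)
    (hα : Measurable α) (ha1 : ∀ n, sqInt μ (an n) ≠ ∞) (ha01 : sqInt μ a0 ≠ ∞)
    (h0 : ∀ n, sqInt μ (an n) ≠ 0) (h00 : sqInt μ a0 ≠ 0)
    (hα1 : sqInt μ α ≠ ∞) (ht0 : ∀ n, t n ≠ 0) (ht : Tendsto t atTop (𝓝 0))
    (hlim : Tendsto (fun n => sqInt μ fun z => (an n z - a0 z) / t n - α z) atTop (𝓝 0)) :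
    Tendsto (fun n => sqInt μ fun z => (normalize μ (an n) z - normalize μ a0 z) / t n
      - (α z - (∫ s, a0 s * α s ∂μ) / rootMass μ a0 * normalize μ a0 z) / rootMass μ a0)
      atTop (𝓝 0) := by
  have hr0 := rootMass_pos ha0 ha01 h00
  set r0 := rootMass μ a0 with hr0d
  set ρ := (∫ s, a0 s * α s ∂μ) / r0
  have hr := tendsto_rootMass ha ha0 ha1 ha01
    (tendsto_sqInt_of_tendsto_quotient ha ha0 hα1 ht0 ht hα hlim)
  have hq := tendsto_rootMass_quotient ha ha0 hα ha1 ha01 h00 hα1 ht0 ht hlim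
  have hri : Tendsto (fun n => (rootMass μ (an n))⁻¹) atTop (𝓝 r0⁻¹) := hr.inv₀ hr0.ne'
  have s1 := tendsto_sqInt_mul hri hlim
  have c2 : Tendsto (fun n => (rootMass μ (an n))⁻¹ - r0⁻¹) atTop (𝓝 0) := by
    simpa using hri.sub_const r0⁻¹
  have s2 := tendsto_sqInt_mul_const c2 hα1
  have c3 : Tendsto (fun n => r0⁻¹ * ρ - (rootMass μ (an n))⁻¹ *
      ((rootMass μ (an n) - rootMass μ a0) / t n)) atTop (𝓝 0) := by
    rw [← sub_self (r0⁻¹ * ρ)]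
    exact (hri.mul hq).const_sub (r0⁻¹ * ρ)
  have s3 := tendsto_sqInt_mul_const (μ := μ) (f := normalize μ a0) c3
    (by rw [sqInt_normalize ha0 ha01 h00]; simp)
  have m0 := measurable_normalize (μ := μ) ha0
  have l1 : ∀ n, Measurable fun z => (rootMass μ (an n))⁻¹ * ((an n z - a0 z) / t n - α z) :=
    fun n => by have := ha n; fun_prop
  have l2 : ∀ n, Measurable fun z => (rootMass μ (an n))⁻¹ * ((an n z - a0 z) / t n - α z)
      + ((rootMass μ (an n))⁻¹ - r0⁻¹) * α z := fun n => (l1 n).add (by fun_prop)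
  refine (tendsto_sqInt_add l2 (tendsto_sqInt_add l1 s1 s2) s3).congr fun n => ?_
  congr 1
  ext z
  have := ht0 n
  have := (rootMass_pos (ha n) (ha1 n) (h0 n)).ne'
  simp only [normalize, ← hr0d]
  field_simp
  ring

end Normalize

/-! ### Densities on the plane whose first margin has arbitrary mass -/

section ScaledJoint

variable {μZ μY : Measure ℝ}

/-- The square root of a density on the plane with margins `a ^ 2` (of arbitrary total mass) and
`b ^ 2` (of mass one), and copula density `γ ^ 2`. -/
def scaledJoint (μZ μY : Measure ℝ) (a b : ℝ → ℝ) (γ : ℝ × ℝ → ℝ) (s : ℝ × ℝ) : ℝ :=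
  a s.1 * b s.2 * γ (sqCdf μY b s.2, sqCdf μZ (normalize μZ a) s.1)

variable {a b : ℝ → ℝ} {γ : ℝ × ℝ → ℝ}

lemma scaledJoint_eq (ha : Measurable a) (h1 : sqInt μZ a ≠ ∞) (h0 : sqInt μZ a ≠ 0) (s : ℝ × ℝ) :
    scaledJoint μZ μY a b γ s = rootMass μZ a * joint μZ μY (normalize μZ a) b γ s := by
  rw [scaledJoint, joint, ← mul_assoc, ← mul_assoc, rootMass_mul_normalize ha h1 h0]

lemma measurable_scaledJoint (ha : Measurable a) (h1 : sqInt μZ a ≠ ∞) (h0 : sqInt μZ a ≠ 0)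
    (hb : Measurable b) (hb1 : sqInt μY b = 1) (hγ : Measurable γ) :
    Measurable (scaledJoint μZ μY a b γ) := by
  rw [show scaledJoint μZ μY a b γ = _ from funext (scaledJoint_eq ha h1 h0)]
  exact (measurable_joint (measurable_normalize ha) (sqInt_normalize ha h1 h0) hb hb1 hγ).const_mul _

/-- The derivative of the square root of a density on the plane, when the square roots of the
`Z`-margin, the `Y`-margin and the copula density vary in directions `α`, `β`, `κ`. -/
def scaledDeriv (μZ μY : Measure ℝ) (a0 α b0 β : ℝ → ℝ) (γ0 γu γv κ : ℝ × ℝ → ℝ) (s : ℝ × ℝ) : ℝ :=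
  let q : ℝ × ℝ := (sqCdf μY b0 s.2, sqCdf μZ (normalize μZ a0) s.1)
  b0 s.2 * γ0 q * α s.1 + a0 s.1 * γ0 q * β s.2 + a0 s.1 * b0 s.2 * κ q
    + a0 s.1 * b0 s.2 * γu q * (2 * ∫ r in Iic s.2, b0 r * β r ∂μY)
    + a0 s.1 * b0 s.2 * γv q * (2 / rootMass μZ a0 ^ 2 *
      ((∫ r in Iic s.1, a0 r * α r ∂μZ) - q.2 * ∫ r, a0 r * α r ∂μZ))

/-- Product rule for the mass times the joint root of the normalized margin: what normalization
removes from `α` along `a0` is restored by the derivative of the mass. Only the levels, which depend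
on the normalized margin, keep a correction. -/
lemma scaledDeriv_eq {a0 α b0 β : ℝ → ℝ} {γ0 γu γv κ : ℝ × ℝ → ℝ} (ha0 : Measurable a0)
    (h01 : sqInt μZ a0 ≠ ∞) (h00 : sqInt μZ a0 ≠ 0) (hα : Measurable α) (hα1 : sqInt μZ α ≠ ∞)
    (s : ℝ × ℝ) :
    scaledDeriv μZ μY a0 α b0 β γ0 γu γv κ s = rootMass μZ a0 * jointDeriv μZ μY (normalize μZ a0)
      (fun z => (α z - (∫ s, a0 s * α s ∂μZ) / rootMass μZ a0 * normalize μZ a0 z) / rootMass μZ a0)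
      b0 β γ0 γu γv κ s + (∫ s, a0 s * α s ∂μZ) / rootMass μZ a0 *
        joint μZ μY (normalize μZ a0) b0 γ0 s := by
  have hr := rootMass_pos ha0 h01 h00
  set r := rootMass μZ a0 with hrd
  have hm := measurable_normalize (μ := μZ) ha0
  have hN1 : sqInt μZ (normalize μZ a0) ≠ ∞ := by rw [sqInt_normalize ha0 h01 h00]; simp
  have hi : Integrable (fun z => a0 z * α z) μZ :=
    integrable_mul_of_sqInt ha0.aestronglyMeasurable hα.aestronglyMeasurable h01 hα1
  have hi2 : Integrable (fun z => normalize μZ a0 z ^ 2) μZ := by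
    simpa [sq] using integrable_mul_of_sqInt hm.aestronglyMeasurable hm.aestronglyMeasurable hN1 hN1
  have key : (∫ z in Iic s.1, normalize μZ a0 z *
      ((α z - (∫ s, a0 s * α s ∂μZ) / r * normalize μZ a0 z) / r) ∂μZ) =
      1 / r ^ 2 * ((∫ z in Iic s.1, a0 z * α z ∂μZ)
        - sqCdf μZ (normalize μZ a0) s.1 * ∫ s, a0 s * α s ∂μZ) := by
    have e : (fun z => normalize μZ a0 z *
      ((α z - (∫ s, a0 s * α s ∂μZ) / r * normalize μZ a0 z) / r)) = fun z =>
        1 / r ^ 2 * (a0 z * α z) - (∫ s, a0 s * α s ∂μZ) / r ^ 2 * normalize μZ a0 z ^ 2 := by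
      ext z
      simp only [normalize, ← hrd]
      field_simp
    rw [e, integral_sub (hi.integrableOn.const_mul _) (hi2.integrableOn.const_mul _),
      integral_const_mul, integral_const_mul, sqCdf]
    field_simp
  simp only [scaledDeriv, jointDeriv, joint, transport, transportDeriv, Prod.swap, key, ← hrd]
  have e2 : ∀ z, a0 z = r * normalize μZ a0 z := fun z =>
    (rootMass_mul_normalize ha0 h01 h00 z).symm
  rw [e2 s.1]
  field_simp
  ring

variable [SFinite μZ] [SFinite μY] [NullSingletonClass μZ] [NullSingletonClass μY]

lemma sqInt_scaledJoint (ha : Measurable a) (h1 : sqInt μZ a ≠ ∞) (h0 : sqInt μZ a ≠ 0)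
    (hb : Measurable b) (hb1 : sqInt μY b = 1) (hγ : Measurable γ) :
    sqInt (μZ.prod μY) (scaledJoint μZ μY a b γ) = sqInt μZ a * sqInt (unitVol.prod unitVol) γ := by
  rw [show scaledJoint μZ μY a b γ = _ from funext (scaledJoint_eq ha h1 h0), sqInt_const_mul,
    sqInt_joint (measurable_normalize ha) (sqInt_normalize ha h1 h0) hb hb1 hγ,
    ofReal_rootMass_sq ha h1]

/-- The Lipschitz estimate for densities on the plane. -/
theorem sqInt_scaledJoint_sub_le {a0 b0 : ℝ → ℝ} {γ0 γu γv : ℝ × ℝ → ℝ} {K K' : ℝ}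
    (hu : IsCurve unitVol γ0 γu K)
    (hv : IsCurve unitVol (fun q => γ0 q.swap) (fun q => γv q.swap) K')
    (ha : Measurable a) (ha0 : Measurable a0) (h1 : sqInt μZ a ≠ ∞) (h01 : sqInt μZ a0 ≠ ∞)
    (h0 : sqInt μZ a ≠ 0) (h00 : sqInt μZ a0 ≠ 0)
    (hane : ∀ᵐ s ∂μZ, a s ≠ 0) (ha0ne : ∀ᵐ s ∂μZ, a0 s ≠ 0)
    (hb : Measurable b) (hb0 : Measurable b0) (hb1 : sqInt μY b = 1) (hb01 : sqInt μY b0 = 1)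
    (hbne : ∀ᵐ s ∂μY, b s ≠ 0) (hb0ne : ∀ᵐ s ∂μY, b0 s ≠ 0) (hγ : Measurable γ)
    (hγ1 : sqInt (unitVol.prod unitVol) γ ≤ 1) (hγ01 : sqInt (unitVol.prod unitVol) γ0 ≤ 1) :
    sqInt (μZ.prod μY) (fun s => scaledJoint μZ μY a b γ s - scaledJoint μZ μY a0 b0 γ0 s)
      ≤ 200 * (1 + lipConst K + lipConst K') *
        (sqInt μZ a0 * (sqInt (unitVol.prod unitVol) fun q => γ q - γ0 q)
        + sqInt μZ a0 * (sqInt μY fun y => b y - b0 y) + sqInt μZ fun z => a z - a0 z) := by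
  have hγ0 := hu.meas
  set r := rootMass μZ a with hr
  set r0 := rootMass μZ a0 with hr0
  have mj := measurable_joint (μZ := μZ) (μY := μY) (measurable_normalize ha)
    (sqInt_normalize ha h1 h0) hb hb1 hγ
  have mj0 := measurable_joint (μZ := μZ) (μY := μY) (measurable_normalize ha0)
    (sqInt_normalize ha0 h01 h00) hb0 hb01 hγ0
  have hL := sqInt_joint_sub_le (μZ := μZ) (μY := μY) hu hv (measurable_normalize ha)
    (measurable_normalize ha0) (sqInt_normalize ha h1 h0) (sqInt_normalize ha0 h01 h00)
    (normalize_ne_zero ha h1 h0 hane) (normalize_ne_zero ha0 h01 h00 ha0ne) hb hb0 hb1 hb01 hbne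
    hb0ne hγ
  have hd := ofReal_rootMass_sub_sq_le ha ha0 h1 h01
  have hA0 := ofReal_rootMass_sq ha0 h01
  rw [← hr, ← hr0] at hd
  rw [← hr0] at hA0
  have hG : (sqInt (unitVol.prod unitVol) fun q => γ q - γ0 q) ≤ 4 := by
    refine (sqInt_sub_le hγ.aemeasurable).trans ?_
    calc _ ≤ (2 * 1 + 2 * 1 : ℝ≥0∞) := by gcongr
      _ = 4 := by norm_num
  have hB : (sqInt μY fun y => b y - b0 y) ≤ 4 := by
    refine (sqInt_sub_le hb.aemeasurable).trans ?_
    rw [hb1, hb01]; norm_num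
  -- With `N` for normalization, `r (N a - N a0) = (a - a0) + (r0 - r) N a0`, and `|r - r0|` is at
  -- most `‖a - a0‖`.
  have hN : ENNReal.ofReal (r ^ 2) * (sqInt μZ fun z => normalize μZ a z - normalize μZ a0 z)
      ≤ 4 * sqInt μZ fun z => a z - a0 z := by
    rw [← sqInt_const_mul]
    have e : (fun z => r * (normalize μZ a z - normalize μZ a0 z)) = fun z =>
        (a z - a0 z) + (r0 - r) * normalize μZ a0 z := by
      ext z
      rw [mul_sub, rootMass_mul_normalize ha h1 h0, sub_mul, rootMass_mul_normalize ha0 h01 h00]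
      ring
    rw [e]
    refine (sqInt_add_le (by fun_prop)).trans ?_
    rw [sqInt_const_mul, sqInt_normalize ha0 h01 h00, mul_one, show (r0 - r) ^ 2 = (r - r0) ^ 2 by ring]
    calc _ ≤ 2 * (sqInt μZ fun z => a z - a0 z) + 2 * (sqInt μZ fun z => a z - a0 z) := by gcongr
      _ = _ := by ring
  have hR : ENNReal.ofReal (r ^ 2) ≤ 2 * sqInt μZ a0 + 2 * sqInt μZ fun z => a z - a0 z := by
    calc ENNReal.ofReal (r ^ 2) = ENNReal.ofReal ((r0 + (r - r0)) ^ 2) := by ring_nf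
      _ ≤ 2 * ENNReal.ofReal (r0 ^ 2) + 2 * ENNReal.ofReal ((r - r0) ^ 2) := ofReal_add_sq_le _ _
      _ ≤ _ := by rw [hA0]; gcongr
  have e : (fun s => scaledJoint μZ μY a b γ s - scaledJoint μZ μY a0 b0 γ0 s) = fun s =>
      r * (joint μZ μY (normalize μZ a) b γ s - joint μZ μY (normalize μZ a0) b0 γ0 s)
      + (r - r0) * joint μZ μY (normalize μZ a0) b0 γ0 s := by
    ext s
    rw [scaledJoint_eq ha h1 h0, scaledJoint_eq ha0 h01 h00]
    ring
  rw [e]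
  set X := sqInt (unitVol.prod unitVol) fun q => γ q - γ0 q
  set Y := sqInt μY fun y => b y - b0 y
  set Z := sqInt μZ fun z => a z - a0 z
  set N := sqInt μZ fun z => normalize μZ a z - normalize μZ a0 z
  set L := 1 + lipConst K + lipConst K'
  -- The bound must involve the mass at the base point only, since that is the weight in the models
  -- for `Y` and for the copula. The excess of the new mass is absorbed because `X` and `Y` are at
  -- most `4`.
  have hXY : ENNReal.ofReal (r ^ 2) * (X + Y) ≤ 2 * sqInt μZ a0 * (X + Y) + 16 * Z := by
    calc _ ≤ (2 * sqInt μZ a0 + 2 * Z) * (X + Y) := by gcongr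
      _ = 2 * sqInt μZ a0 * (X + Y) + 2 * Z * (X + Y) := by ring
      _ ≤ 2 * sqInt μZ a0 * (X + Y) + 2 * Z * (4 + 4) := by gcongr
      _ = _ := by ring
  have h1L : 1 ≤ L := by
    simp only [L, add_assoc]
    exact le_self_add
  calc _ ≤ 2 * (ENNReal.ofReal (r ^ 2) * (4 * L * (X + Y + N))) + 2 * (Z * 1) := by
        refine (sqInt_add_le (by fun_prop)).trans ?_
        rw [sqInt_const_mul, sqInt_const_mul]
        gcongr
        rw [sqInt_joint (measurable_normalize ha0) (sqInt_normalize ha0 h01 h00) hb0 hb01 hγ0]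
        exact hγ01
    _ = 8 * L * (ENNReal.ofReal (r ^ 2) * (X + Y) + ENNReal.ofReal (r ^ 2) * N) + 2 * (1 * Z) := by
        ring
    _ ≤ 8 * L * ((2 * sqInt μZ a0 * (X + Y) + 16 * Z) + 4 * Z) + 2 * (L * Z) := by gcongr
    _ = 16 * L * (sqInt μZ a0 * X + sqInt μZ a0 * Y) + 162 * L * Z := by ring
    _ ≤ 200 * L * (sqInt μZ a0 * X + sqInt μZ a0 * Y) + 200 * L * Z := by
        gcongr <;> norm_num
    _ = _ := by ring

theorem tendsto_scaledJoint_quotient [IsFiniteMeasureOnCompacts μZ]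
    {a b : ℕ → ℝ → ℝ} {γ : ℕ → ℝ × ℝ → ℝ} {a0 α b0 β : ℝ → ℝ} {γ0 γu γv κ : ℝ × ℝ → ℝ} {K K' : ℝ}
    {t : ℕ → ℝ} (hu : IsCurve unitVol γ0 γu K)
    (hv : IsCurve unitVol (fun q => γ0 q.swap) (fun q => γv q.swap) K')
    (ha : ∀ n, Measurable (a n)) (ha0 : Measurable a0) (hα : Measurable α)
    (ha1 : ∀ n, sqInt μZ (a n) ≠ ∞) (ha01 : sqInt μZ a0 ≠ ∞)
    (h0 : ∀ n, sqInt μZ (a n) ≠ 0) (h00 : sqInt μZ a0 ≠ 0) (hα1 : sqInt μZ α ≠ ∞)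
    (hane : ∀ n, ∀ᵐ s ∂μZ, a n s ≠ 0) (ha0ne : ∀ᵐ s ∂μZ, a0 s ≠ 0)
    (hb : ∀ n, Measurable (b n)) (hb0 : Measurable b0) (hβ : Measurable β)
    (hb1 : ∀ n, sqInt μY (b n) = 1) (hb01 : sqInt μY b0 = 1) (hβ1 : sqInt μY β ≠ ∞)
    (hbne : ∀ n, ∀ᵐ s ∂μY, b n s ≠ 0) (hb0ne : ∀ᵐ s ∂μY, b0 s ≠ 0)
    (hγ : ∀ n, Measurable (γ n)) (hκ : Measurable κ) (hκ1 : sqInt (unitVol.prod unitVol) κ ≠ ∞)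
    (hγ01 : sqInt (unitVol.prod unitVol) γ0 ≤ 1)
    (ht0 : ∀ n, t n ≠ 0) (ht : Tendsto t atTop (𝓝 0))
    (hlima : Tendsto (fun n => sqInt μZ fun z => (a n z - a0 z) / t n - α z) atTop (𝓝 0))
    (hlimb : Tendsto (fun n => sqInt μY fun z => (b n z - b0 z) / t n - β z) atTop (𝓝 0))
    (hlimγ : Tendsto (fun n => sqInt (unitVol.prod unitVol) fun q => (γ n q - γ0 q) / t n - κ q)
      atTop (𝓝 0)) :
    Tendsto (fun n => sqInt (μZ.prod μY) fun s =>
      (scaledJoint μZ μY (a n) (b n) (γ n) s - scaledJoint μZ μY a0 b0 γ0 s) / t n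
        - scaledDeriv μZ μY a0 α b0 β γ0 γu γv κ s) atTop (𝓝 0) := by
  have hγ0 := hu.meas
  have hr0 := rootMass_pos ha0 ha01 h00
  set r0 := rootMass μZ a0 with hr0d
  set ρ := (∫ s, a0 s * α s ∂μZ) / r0 with hρ
  set α' : ℝ → ℝ := fun z => (α z - ρ * normalize μZ a0 z) / r0 with hα'
  have m0 := measurable_normalize (μ := μZ) ha0
  have mα' : Measurable α' := by fun_prop
  have hα'1 : sqInt μZ α' ≠ ∞ := by
    rw [hα', sqInt_div_const]
    refine ENNReal.mul_ne_top ENNReal.ofReal_ne_top (ne_top_of_le_ne_top ?_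
      (sqInt_sub_le hα.aemeasurable))
    rw [sqInt_const_mul, sqInt_normalize ha0 ha01 h00]
    simp [ENNReal.mul_eq_top, hα1]
  have hN := fun n => sqInt_normalize (ha n) (ha1 n) (h0 n)
  have hN0 := sqInt_normalize ha0 ha01 h00
  have hJ := tendsto_joint_quotient (μZ := μZ) (μY := μY) hu hv
    (fun n => measurable_normalize (ha n)) m0 mα' hN hN0 hα'1
    (fun n => normalize_ne_zero (ha n) (ha1 n) (h0 n) (hane n))
    (normalize_ne_zero ha0 ha01 h00 ha0ne) hb hb0 hβ hb1 hb01 hβ1 hbne hb0ne hγ hκ hκ1 ht0 ht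
    (tendsto_normalize_quotient ha ha0 hα ha1 ha01 h0 h00 hα1 ht0 ht hlima) hlimb hlimγ
  have hr := tendsto_rootMass ha ha0 ha1 ha01
    (tendsto_sqInt_of_tendsto_quotient ha ha0 hα1 ht0 ht hα hlima)
  have hq := tendsto_rootMass_quotient ha ha0 hα ha1 ha01 h00 hα1 ht0 ht hlima
  have mj := fun n => measurable_joint (μZ := μZ) (μY := μY) (measurable_normalize (ha n)) (hN n)
    (hb n) (hb1 n) (hγ n)
  have mj0 := measurable_joint (μZ := μZ) (μY := μY) m0 hN0 hb0 hb01 hγ0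
  set D := jointDeriv μZ μY (normalize μZ a0) α' b0 β γ0 γu γv κ with hD
  have mD : Measurable D := by
    have d1 := measurable_transportDeriv (μ := μZ) m0 mα' hN0 hv.meas hv.meas'
    have d2 := measurable_transportDeriv (μ := μY) hb0 hβ hb01 hu.meas hu.meas'
    exact ((measurable_joint m0 hN0 hb0 hb01 hκ).add
      ((measurable_transport hb0 hb01 (f := fun r => transportDeriv μZ (normalize μZ a0) α'
        (fun q => γ0 q.swap) (fun q => γv q.swap) r.swap) (by fun_prop)).comp measurable_swap)).add
      (measurable_transport m0 hN0 (f := fun r => transportDeriv μY b0 β γ0 γu r.swap) (by fun_prop))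
  have hJ01 : sqInt (μZ.prod μY) (joint μZ μY (normalize μZ a0) b0 γ0) ≠ ∞ := by
    rw [sqInt_joint m0 hN0 hb0 hb01 hγ0]
    exact (hγ01.trans_lt ENNReal.one_lt_top).ne
  have hγn : ∀ᶠ n in atTop, sqInt (unitVol.prod unitVol) (γ n) ≠ ∞ := by
    filter_upwards [(tendsto_sqInt_of_tendsto_quotient hγ hγ0 hκ1 ht0 ht hκ hlimγ).eventually
      (gt_mem_nhds one_pos)] with n hn
    have := sqInt_add_le (μ := unitVol.prod unitVol) (f := fun q => γ n q - γ0 q) (g := γ0)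
      (by have := hγ n; fun_prop)
    simp only [sub_add_cancel] at this
    refine ne_top_of_le_ne_top ?_ this
    simp [ENNReal.mul_eq_top, (hn.trans ENNReal.one_lt_top).ne, (hγ01.trans_lt ENNReal.one_lt_top).ne]
  have hD1 : sqInt (μZ.prod μY) D ≠ ∞ := by
    obtain ⟨n, hn, hn2⟩ := ((hJ.eventually (gt_mem_nhds one_pos)).and hγn).exists
    have hjn : sqInt (μZ.prod μY) (joint μZ μY (normalize μZ (a n)) (b n) (γ n)) ≠ ∞ := by
      rwa [sqInt_joint (measurable_normalize (ha n)) (hN n) (hb n) (hb1 n) (hγ n)]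
    have mn := mj n
    have h2 := sqInt_sub_le (μ := μZ.prod μY) (f := fun s =>
      (joint μZ μY (normalize μZ (a n)) (b n) (γ n) s - joint μZ μY (normalize μZ a0) b0 γ0 s) / t n)
      (g := fun s => (joint μZ μY (normalize μZ (a n)) (b n) (γ n) s
        - joint μZ μY (normalize μZ a0) b0 γ0 s) / t n - D s) (by fun_prop)
    simp only [sub_sub_cancel] at h2
    refine ne_top_of_le_ne_top ?_ h2
    rw [sqInt_div_const]
    refine ENNReal.add_ne_top.2 ⟨ENNReal.mul_ne_top (by simp) (ENNReal.mul_ne_top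
      ENNReal.ofReal_ne_top (ne_top_of_le_ne_top ?_ (sqInt_sub_le mn.aemeasurable))), ?_⟩
    · simp [ENNReal.mul_eq_top, hjn, hJ01]
    · exact ENNReal.mul_ne_top (by simp) (hn.trans ENNReal.one_lt_top).ne
  have s1 := tendsto_sqInt_mul hr hJ
  have c2 : Tendsto (fun n => rootMass μZ (a n) - r0) atTop (𝓝 0) := by
    rw [← sub_self r0]
    exact hr.sub_const r0
  have s2 := tendsto_sqInt_mul_const c2 hD1
  have c3 : Tendsto (fun n => (rootMass μZ (a n) - r0) / t n - ρ) atTop (𝓝 0) := by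
    rw [← sub_self ρ]
    exact hq.sub_const ρ
  have s3 := tendsto_sqInt_mul_const c3 hJ01
  have l1 : ∀ n, Measurable fun s => rootMass μZ (a n) *
      ((joint μZ μY (normalize μZ (a n)) (b n) (γ n) s - joint μZ μY (normalize μZ a0) b0 γ0 s)
        / t n - D s) := fun n => by have := mj n; fun_prop
  have l2 : ∀ n, Measurable fun s => rootMass μZ (a n) *
      ((joint μZ μY (normalize μZ (a n)) (b n) (γ n) s - joint μZ μY (normalize μZ a0) b0 γ0 s)
        / t n - D s) + (rootMass μZ (a n) - r0) * D s := fun n => (l1 n).add (by fun_prop)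
  refine (tendsto_sqInt_add l2 (tendsto_sqInt_add l1 s1 s2) s3).congr fun n => ?_
  congr 1
  ext s
  have := ht0 n
  rw [scaledJoint_eq (ha n) (ha1 n) (h0 n), scaledJoint_eq ha0 ha01 h00,
    scaledDeriv_eq ha0 ha01 h00 hα hα1]
  simp only [← hr0d, ← hρ, ← hα', ← hD]
  field_simp
  ring

end ScaledJoint

/-! ### The estimates on a single fibre -/

section Fibre

variable {μZ μY : Measure ℝ}

/-- `a`, `b`, `γ` are admissible square roots of a finite density, a probability density and a
copula density. -/
structure IsRootAt (μZ μY : Measure ℝ) (a b : ℝ → ℝ) (γ : ℝ × ℝ → ℝ) : Prop where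
  meas_a : Measurable a
  meas_b : Measurable b
  meas_γ : Measurable γ
  fin : sqInt μZ a ≠ ∞
  nz : sqInt μZ a ≠ 0
  ane : ∀ᵐ s ∂μZ, a s ≠ 0
  unit : sqInt μY b = 1
  bne : ∀ᵐ s ∂μY, b s ≠ 0
  a_nonneg : ∀ s, 0 ≤ a s
  b_nonneg : ∀ s, 0 ≤ b s
  marg_u : ∀ᵐ u ∂unitVol, sqInt unitVol (fun v => γ (u, v)) = 1
  marg_v : ∀ᵐ v ∂unitVol, sqInt unitVol (fun u => γ (u, v)) = 1

lemma IsRootAt.sqInt_eq_one {a b : ℝ → ℝ} {γ : ℝ × ℝ → ℝ} (h : IsRootAt μZ μY a b γ) :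
    sqInt (unitVol.prod unitVol) γ = 1 := by
  rw [sqInt_prod h.meas_γ, lintegral_congr_ae h.marg_u]
  simp

lemma IsRootAt.cop {a b : ℝ → ℝ} {γ : ℝ × ℝ → ℝ} (h : IsRootAt μZ μY a b γ) :
    sqInt (unitVol.prod unitVol) γ ≤ 1 := h.sqInt_eq_one.le

lemma sqInt_mul_sqInt {Ω : Type*} [MeasurableSpace Ω] {ν : Measure Ω} {a0 : ℝ → ℝ}
    (ha0 : Measurable a0) (h1 : sqInt μZ a0 ≠ ∞) (f : Ω → ℝ) :
    sqInt μZ a0 * sqInt ν f = sqInt ν fun ω => rootMass μZ a0 * f ω := by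
  rw [sqInt_const_mul, ofReal_rootMass_sq ha0 h1]

/-- Difference quotients in `L²` are bounded by their distance to a limit and the limit. -/
lemma sqInt_quotient_le {Ω : Type*} [MeasurableSpace Ω] {ν : Measure Ω} {f g d : Ω → ℝ}
    (hf : Measurable f) (hg : Measurable g) (hd : Measurable d) (t : ℝ) :
    ENNReal.ofReal (t⁻¹ ^ 2) * (sqInt ν fun ω => f ω - g ω)
      ≤ 2 * (sqInt ν fun ω => (f ω - g ω) / t - d ω) + 2 * sqInt ν d := by
  rw [← sqInt_div_const]
  have := sqInt_add_le (μ := ν) (f := fun ω => (f ω - g ω) / t - d ω) (g := d) (by fun_prop)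
  simpa using this

variable [SFinite μZ] [SFinite μY] [NullSingletonClass μZ] [NullSingletonClass μY]
  [IsFiniteMeasureOnCompacts μZ]

/-- The models for `Y` and for the copula are differentiable only after weighting with the root mass
of the fibre, so their directions are divided by it. Besides the limit there is a bound by fibre
errors and norms of directions, with constants that do not depend on the fibre; this is the
domination for the integral over `x`. -/
theorem tendsto_scaledJoint_weighted
    {a b : ℕ → ℝ → ℝ} {γ : ℕ → ℝ × ℝ → ℝ} {a0 α b0 β : ℝ → ℝ} {γ0 γu γv κ : ℝ × ℝ → ℝ} {K K' : ℝ}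
    {t : ℕ → ℝ} (hu : IsCurve unitVol γ0 γu K)
    (hv : IsCurve unitVol (fun q => γ0 q.swap) (fun q => γv q.swap) K')
    (hn : ∀ n, IsRootAt μZ μY (a n) (b n) (γ n)) (h0 : IsRootAt μZ μY a0 b0 γ0)
    (hα : Measurable α) (hβ : Measurable β) (hκ : Measurable κ)
    (hα1 : sqInt μZ α ≠ ∞) (hβ1 : sqInt μY β ≠ ∞) (hκ1 : sqInt (unitVol.prod unitVol) κ ≠ ∞)
    (ht0 : ∀ n, t n ≠ 0) (ht : Tendsto t atTop (𝓝 0))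
    {Ra Rb Rc : ℕ → ℝ≥0∞}
    (hRa : ∀ n, Ra n = sqInt μZ fun z => (a n z - a0 z) / t n - α z)
    (hRb : ∀ n, Rb n = sqInt μY fun z => (rootMass μZ a0 * b n z - rootMass μZ a0 * b0 z) / t n - β z)
    (hRc : ∀ n, Rc n = sqInt (unitVol.prod unitVol) fun q =>
      (rootMass μZ a0 * γ n q - rootMass μZ a0 * γ0 q) / t n - κ q)
    (hlima : Tendsto Ra atTop (𝓝 0)) (hlimb : Tendsto Rb atTop (𝓝 0))
    (hlimc : Tendsto Rc atTop (𝓝 0)) :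
    Tendsto (fun n => sqInt (μZ.prod μY) fun s =>
      (scaledJoint μZ μY (a n) (b n) (γ n) s - scaledJoint μZ μY a0 b0 γ0 s) / t n
        - scaledDeriv μZ μY a0 α b0 (fun y => β y / rootMass μZ a0) γ0 γu γv
          (fun q => κ q / rootMass μZ a0) s) atTop (𝓝 0) ∧
    ∀ n, (sqInt (μZ.prod μY) fun s =>
      (scaledJoint μZ μY (a n) (b n) (γ n) s - scaledJoint μZ μY a0 b0 γ0 s) / t n
        - scaledDeriv μZ μY a0 α b0 (fun y => β y / rootMass μZ a0) γ0 γu γv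
          (fun q => κ q / rootMass μZ a0) s)
      ≤ 4 * (200 * (1 + lipConst K + lipConst K')) * (Ra n + Rb n + Rc n)
        + 12 * (200 * (1 + lipConst K + lipConst K')) *
          (sqInt μZ α + sqInt μY β + sqInt (unitVol.prod unitVol) κ) := by
  have hr0 := rootMass_pos h0.meas_a h0.fin h0.nz
  have ma0 := h0.meas_a
  have mb0 := h0.meas_b
  have mγ0 := h0.meas_γ
  set r0 := rootMass μZ a0 with hr0d
  set D := scaledDeriv μZ μY a0 α b0 (fun y => β y / r0) γ0 γu γv (fun q => κ q / r0) with hD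
  have hinv : Tendsto (fun _ : ℕ => r0⁻¹) atTop (𝓝 r0⁻¹) := tendsto_const_nhds
  have hlimb' : Tendsto (fun n => sqInt μY fun z => (b n z - b0 z) / t n - β z / r0)
      atTop (𝓝 0) := by
    rw [funext hRb] at hlimb
    refine (tendsto_sqInt_mul hinv hlimb).congr fun n => ?_
    congr 1; ext z
    have := ht0 n
    field_simp
  have hlimc' : Tendsto (fun n => sqInt (unitVol.prod unitVol) fun z =>
      (γ n z - γ0 z) / t n - κ z / r0) atTop (𝓝 0) := by
    rw [funext hRc] at hlimc
    refine (tendsto_sqInt_mul hinv hlimc).congr fun n => ?_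
    congr 1; ext z
    have := ht0 n
    field_simp
  rw [funext hRa] at hlima
  have hN := tendsto_scaledJoint_quotient (μZ := μZ) (μY := μY) hu hv (fun n => (hn n).meas_a) ma0 hα
    (fun n => (hn n).fin) h0.fin (fun n => (hn n).nz) h0.nz hα1 (fun n => (hn n).ane) h0.ane
    (fun n => (hn n).meas_b) mb0 (hβ.div_const r0) (fun n => (hn n).unit) h0.unit
    (by rw [sqInt_div_const]; exact ENNReal.mul_ne_top ENNReal.ofReal_ne_top hβ1)
    (fun n => (hn n).bne) h0.bne (fun n => (hn n).meas_γ) (hκ.div_const r0)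
    (by rw [sqInt_div_const]; exact ENNReal.mul_ne_top ENNReal.ofReal_ne_top hκ1) h0.cop ht0 ht
    hlima hlimb' hlimc'
  refine ⟨hN, ?_⟩
  set C : ℝ≥0∞ := 200 * (1 + lipConst K + lipConst K') with hC
  have hC1 : C ≠ ∞ := by
    simp [C, ENNReal.mul_eq_top, lipConst_ne_top]
  set G := sqInt μZ α + sqInt μY β + sqInt (unitVol.prod unitVol) κ with hG
  have mS : ∀ n, Measurable (scaledJoint μZ μY (a n) (b n) (γ n)) := fun n =>
    measurable_scaledJoint (hn n).meas_a (hn n).fin (hn n).nz (hn n).meas_b (hn n).unit (hn n).meas_γ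
  have mS0 := measurable_scaledJoint (μZ := μZ) (μY := μY) ma0 h0.fin h0.nz mb0 h0.unit mγ0
  have hX : ∀ n, (sqInt (μZ.prod μY) fun s =>
      (scaledJoint μZ μY (a n) (b n) (γ n) s - scaledJoint μZ μY a0 b0 γ0 s) / t n)
      ≤ C * (2 * (Ra n + Rb n + Rc n) + 2 * G) := by
    intro n
    have ma := (hn n).meas_a
    have mb := (hn n).meas_b
    have mγ := (hn n).meas_γ
    rw [sqInt_div_const]
    have h := sqInt_scaledJoint_sub_le (μZ := μZ) (μY := μY) hu hv ma ma0 (hn n).fin h0.fin (hn n).nz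
      h0.nz (hn n).ane h0.ane mb mb0 (hn n).unit h0.unit (hn n).bne h0.bne mγ (hn n).cop h0.cop
    rw [sqInt_mul_sqInt ma0 h0.fin, sqInt_mul_sqInt ma0 h0.fin, ← hr0d] at h
    have q1 := sqInt_quotient_le (ν := μZ) ma ma0 hα (t n)
    have q2 := sqInt_quotient_le (ν := μY) (mb.const_mul r0) (mb0.const_mul r0) hβ (t n)
    have q3 := sqInt_quotient_le (ν := unitVol.prod unitVol) (mγ.const_mul r0) (mγ0.const_mul r0)
      hκ (t n)
    simp only [← mul_sub] at q2 q3
    simp only [mul_sub] at q2 q3 h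
    rw [← hRa] at q1
    rw [← hRb] at q2
    rw [← hRc] at q3
    calc _ ≤ _ := mul_le_mul' le_rfl h
      _ = C * (ENNReal.ofReal ((t n)⁻¹ ^ 2) * (sqInt (unitVol.prod unitVol) fun q =>
            r0 * γ n q - r0 * γ0 q)
          + ENNReal.ofReal ((t n)⁻¹ ^ 2) * (sqInt μY fun q => r0 * b n q - r0 * b0 q)
          + ENNReal.ofReal ((t n)⁻¹ ^ 2) * (sqInt μZ fun q => a n q - a0 q)) := by ring
      _ ≤ C * ((2 * Rc n + 2 * sqInt (unitVol.prod unitVol) κ) + (2 * Rb n + 2 * sqInt μY β)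
          + (2 * Ra n + 2 * sqInt μZ α)) := by gcongr
      _ = _ := by rw [hG]; ring
  -- The derivative inherits the Lipschitz bound as the limit of difference quotients.
  have hDle : sqInt (μZ.prod μY) D ≤ 4 * C * G := by
    have h1 : ∀ n, sqInt (μZ.prod μY) D ≤ 2 * (C * (2 * (Ra n + Rb n + Rc n) + 2 * G)) +
        2 * (sqInt (μZ.prod μY) fun s =>
      (scaledJoint μZ μY (a n) (b n) (γ n) s - scaledJoint μZ μY a0 b0 γ0 s) / t n - D s) := by
      intro n
      have := mS n
      have h2 := sqInt_sub_le (μ := μZ.prod μY) (f := fun s =>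
        (scaledJoint μZ μY (a n) (b n) (γ n) s - scaledJoint μZ μY a0 b0 γ0 s) / t n)
        (g := fun s => (scaledJoint μZ μY (a n) (b n) (γ n) s - scaledJoint μZ μY a0 b0 γ0 s) / t n
          - D s) (by fun_prop)
      simp only [sub_sub_cancel] at h2
      refine h2.trans ?_
      gcongr
      exact hX n
    have hlima2 : Tendsto Ra atTop (𝓝 0) := by rw [funext hRa]; exact hlima
    have hlim : Tendsto (fun n => 2 * (C * (2 * (Ra n + Rb n + Rc n) + 2 * G)) +
        2 * (sqInt (μZ.prod μY) fun s => (scaledJoint μZ μY (a n) (b n) (γ n) s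
          - scaledJoint μZ μY a0 b0 γ0 s) / t n - D s)) atTop
        (𝓝 (2 * (C * (2 * (0 + 0 + 0) + 2 * G)) + 2 * 0)) := by
      refine (ENNReal.Tendsto.const_mul (ENNReal.Tendsto.const_mul ((ENNReal.Tendsto.const_mul
        ((hlima2.add hlimb).add hlimc) (Or.inr (by simp))).add_const _) (Or.inr hC1))
        (Or.inr (by simp))).add (ENNReal.Tendsto.const_mul hN (Or.inr (by simp)))
    refine (ge_of_tendsto' hlim h1).trans (le_of_eq ?_)
    ring
  intro n
  have := mS n
  calc _ ≤ 2 * (C * (2 * (Ra n + Rb n + Rc n) + 2 * G)) + 2 * (4 * C * G) := by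
        refine (sqInt_sub_le (by fun_prop)).trans ?_
        gcongr
        exact hX n
    _ = _ := by ring

end Fibre

/-! ### Integration over the fibres -/

section Global

variable {𝒳 : Type*} [MeasurableSpace 𝒳] {μZ μY : Measure ℝ} {μX : Measure 𝒳}

lemma measurable_integral_Iic_param [SFinite μY] {f : 𝒳 × ℝ → ℝ} (hf : Measurable f) :
    Measurable fun s : 𝒳 × ℝ => ∫ r in Iic s.2, f (s.1, r) ∂μY := by
  have e : (fun s : 𝒳 × ℝ => ∫ r in Iic s.2, f (s.1, r) ∂μY)
      = fun s => ∫ r, {q : (𝒳 × ℝ) × ℝ | q.2 ≤ q.1.2}.indicator (fun q => f (q.1.1, q.2)) (s, r)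
        ∂μY := by
    ext s
    rw [← integral_indicator measurableSet_Iic]
    rfl
  rw [e]
  refine (StronglyMeasurable.integral_prod_right' (f := {q : (𝒳 × ℝ) × ℝ | q.2 ≤ q.1.2}.indicator
    (fun q => f (q.1.1, q.2))) ?_).measurable
  refine (Measurable.indicator (by fun_prop) ?_).stronglyMeasurable
  exact measurableSet_le (by fun_prop) (by fun_prop)

lemma measurable_rootMass [SFinite μZ] {a : ℝ × 𝒳 → ℝ} (ha : Measurable a) :
    Measurable fun x => rootMass μZ fun z => a (z, x) := by
  unfold rootMass
  refine Measurable.sqrt ?_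
  exact (StronglyMeasurable.integral_prod_right' (f := fun s : 𝒳 × ℝ => a (s.2, s.1) ^ 2)
    (by fun_prop)).measurable

lemma lintegral_triple [SFinite μZ] [SFinite μX] [SFinite μY] {F : ℝ × 𝒳 × ℝ → ℝ≥0∞}
    (hF : Measurable F) :
    ∫⁻ s, F s ∂(μZ.prod (μX.prod μY))
      = ∫⁻ x, ∫⁻ s, F (s.1, x, s.2) ∂(μZ.prod μY) ∂μX := by
  rw [lintegral_prod _ hF.aemeasurable]
  have h2 : ∀ z, ∫⁻ s, F (z, s) ∂(μX.prod μY) = ∫⁻ x, ∫⁻ y, F (z, x, y) ∂μY ∂μX := fun z =>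
    lintegral_prod _ (by fun_prop)
  simp only [h2]
  rw [lintegral_lintegral_swap]
  · refine lintegral_congr fun x => ?_
    rw [lintegral_prod _ (by fun_prop)]
  · refine Measurable.aemeasurable ?_
    exact Measurable.lintegral_prod_right' (f := fun s : (ℝ × 𝒳) × ℝ => F (s.1.1, s.1.2, s.2))
      (by fun_prop)

lemma sqInt_triple [SFinite μZ] [SFinite μX] [SFinite μY] {f : ℝ × 𝒳 × ℝ → ℝ} (hf : Measurable f) :
    sqInt (μZ.prod (μX.prod μY)) f
      = ∫⁻ x, sqInt (μZ.prod μY) (fun s => f (s.1, x, s.2)) ∂μX :=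
  lintegral_triple (F := fun s => ENNReal.ofReal (f s ^ 2)) (by fun_prop)

/-- The square root of the joint density of `(Z, X, Y)` built from the square roots of the density
of `(Z, X)`, the density of `Y` given `X` and the conditional copula density. -/
def rootDensity (μZ μY : Measure ℝ) (a : ℝ × 𝒳 → ℝ) (b : 𝒳 × ℝ → ℝ) (γ : 𝒳 × ℝ × ℝ → ℝ)
    (s : ℝ × 𝒳 × ℝ) : ℝ :=
  scaledJoint μZ μY (fun z => a (z, s.2.1)) (fun y => b (s.2.1, y)) (fun q => γ (s.2.1, q))
    (s.1, s.2.2)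

/-- The derivative of `rootDensity`, for directions weighted with the root of the density of
`X`. -/
def rootDeriv (μZ μY : Measure ℝ) (a0 α : ℝ × 𝒳 → ℝ) (b0 β : 𝒳 × ℝ → ℝ)
    (γ0 γu γv κ : 𝒳 × ℝ × ℝ → ℝ) (s : ℝ × 𝒳 × ℝ) : ℝ :=
  scaledDeriv μZ μY (fun z => a0 (z, s.2.1)) (fun z => α (z, s.2.1)) (fun y => b0 (s.2.1, y))
    (fun y => β (s.2.1, y) / rootMass μZ fun z => a0 (z, s.2.1)) (fun q => γ0 (s.2.1, q))
    (fun q => γu (s.2.1, q)) (fun q => γv (s.2.1, q))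
    (fun q => κ (s.2.1, q) / rootMass μZ fun z => a0 (z, s.2.1)) (s.1, s.2.2)

lemma measurable_sqCdf_param [SFinite μY] {b : 𝒳 × ℝ → ℝ} (hb : Measurable b) :
    Measurable fun s : 𝒳 × ℝ => sqCdf μY (fun y => b (s.1, y)) s.2 :=
  measurable_integral_Iic_param (f := fun s => b s ^ 2) (by fun_prop)

lemma measurable_sqCdf_normalize_param [SFinite μZ] {a : ℝ × 𝒳 → ℝ} (ha : Measurable a) :
    Measurable fun s : 𝒳 × ℝ => sqCdf μZ (normalize μZ fun z => a (z, s.1)) s.2 := by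
  have hr := (measurable_rootMass (μZ := μZ) ha).comp (measurable_fst : Measurable (@Prod.fst 𝒳 ℝ))
  simp only [Function.comp_def] at hr
  exact measurable_integral_Iic_param
    (f := fun s => (a (s.2, s.1) / rootMass μZ fun z => a (z, s.1)) ^ 2) (by fun_prop)

lemma measurable_rootDensity [SFinite μZ] [SFinite μY] {a : ℝ × 𝒳 → ℝ} {b : 𝒳 × ℝ → ℝ}
    {γ : 𝒳 × ℝ × ℝ → ℝ} (ha : Measurable a) (hb : Measurable b) (hγ : Measurable γ) :
    Measurable (rootDensity μZ μY a b γ) := by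
  have h1 : Measurable fun s : ℝ × 𝒳 × ℝ => sqCdf μY (fun y => b (s.2.1, y)) s.2.2 :=
    (measurable_sqCdf_param hb).comp measurable_snd
  have h2 : Measurable fun s : ℝ × 𝒳 × ℝ => sqCdf μZ (normalize μZ fun z => a (z, s.2.1)) s.1 :=
    (measurable_sqCdf_normalize_param ha).comp (g := fun s : 𝒳 × ℝ =>
      sqCdf μZ (normalize μZ fun z => a (z, s.1)) s.2) (f := fun s : ℝ × 𝒳 × ℝ => (s.2.1, s.1))
      (by fun_prop)
  unfold rootDensity scaledJoint
  fun_prop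

lemma measurable_rootDeriv [SFinite μZ] [SFinite μY] {a0 α : ℝ × 𝒳 → ℝ} {b0 β : 𝒳 × ℝ → ℝ}
    {γ0 γu γv κ : 𝒳 × ℝ × ℝ → ℝ} (ha : Measurable a0) (hα : Measurable α) (hb : Measurable b0)
    (hβ : Measurable β) (hγ : Measurable γ0) (hγu : Measurable γu) (hγv : Measurable γv)
    (hκ : Measurable κ) :
    Measurable (rootDeriv μZ μY a0 α b0 β γ0 γu γv κ) := by
  have h1 : Measurable fun s : ℝ × 𝒳 × ℝ => sqCdf μY (fun y => b0 (s.2.1, y)) s.2.2 :=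
    (measurable_sqCdf_param hb).comp measurable_snd
  have h2 : Measurable fun s : ℝ × 𝒳 × ℝ => sqCdf μZ (normalize μZ fun z => a0 (z, s.2.1)) s.1 :=
    (measurable_sqCdf_normalize_param ha).comp (g := fun s : 𝒳 × ℝ =>
      sqCdf μZ (normalize μZ fun z => a0 (z, s.1)) s.2) (f := fun s : ℝ × 𝒳 × ℝ => (s.2.1, s.1))
      (by fun_prop)
  have h3 : Measurable fun s : ℝ × 𝒳 × ℝ => rootMass μZ fun z => a0 (z, s.2.1) :=
    (measurable_rootMass ha).comp (by fun_prop : Measurable fun s : ℝ × 𝒳 × ℝ => s.2.1)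
  have h4 : Measurable fun s : ℝ × 𝒳 × ℝ => ∫ r in Iic s.2.2, b0 (s.2.1, r) *
      (β (s.2.1, r) / rootMass μZ fun z => a0 (z, s.2.1)) ∂μY := by
    have hr := (measurable_rootMass (μZ := μZ) ha).comp (measurable_fst : Measurable (@Prod.fst 𝒳 ℝ))
    simp only [Function.comp_def] at hr
    exact (measurable_integral_Iic_param (f := fun s => b0 s * (β s / rootMass μZ fun z => a0 (z, s.1)))
      (by fun_prop)).comp measurable_snd
  have h5 : Measurable fun s : ℝ × 𝒳 × ℝ => ∫ r in Iic s.1, a0 (r, s.2.1) * α (r, s.2.1) ∂μZ :=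
    (measurable_integral_Iic_param (μY := μZ) (f := fun s : 𝒳 × ℝ => a0 s.swap * α s.swap)
      (by fun_prop)).comp (f := fun s : ℝ × 𝒳 × ℝ => (s.2.1, s.1)) (by fun_prop)
  have h6 : Measurable fun s : ℝ × 𝒳 × ℝ => ∫ r, a0 (r, s.2.1) * α (r, s.2.1) ∂μZ := by
    have : Measurable fun x : 𝒳 => ∫ r, a0 (r, x) * α (r, x) ∂μZ :=
      (StronglyMeasurable.integral_prod_right' (f := fun s : 𝒳 × ℝ => a0 s.swap * α s.swap)
        (by fun_prop)).measurable
    exact this.comp (f := fun s : ℝ × 𝒳 × ℝ => s.2.1) (by fun_prop)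
  unfold rootDeriv scaledDeriv
  dsimp only
  fun_prop

/-- Admissible square roots of a density of `(Z, X)`, conditional densities of `Y` given `X`, and
conditional copula densities. -/
structure IsRoot (μZ : Measure ℝ) (μX : Measure 𝒳) (μY : Measure ℝ) (a : ℝ × 𝒳 → ℝ) (b : 𝒳 × ℝ → ℝ)
    (γ : 𝒳 × ℝ × ℝ → ℝ) : Prop where
  meas_a : Measurable a
  meas_b : Measurable b
  meas_γ : Measurable γ
  fibre : ∀ᵐ x ∂μX, IsRootAt μZ μY (fun z => a (z, x)) (fun y => b (x, y)) (fun q => γ (x, q))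

/-- `γ` is a family of copula roots with partial derivatives `γu`, `γv`. -/
structure IsCurveFamily (μX : Measure 𝒳) (γ γu γv : 𝒳 × ℝ × ℝ → ℝ) (K K' : ℝ) : Prop where
  meas_u : Measurable γu
  meas_v : Measurable γv
  curve_u : ∀ᵐ x ∂μX, IsCurve unitVol (fun q => γ (x, q)) (fun q => γu (x, q)) K
  curve_v : ∀ᵐ x ∂μX, IsCurve unitVol (fun q => γ (x, q.swap)) (fun q => γv (x, q.swap)) K'

variable [SFinite μZ] [SFinite μX] [SFinite μY] [NullSingletonClass μZ] [NullSingletonClass μY]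
  [IsFiniteMeasureOnCompacts μZ]

/-- The square error is the integral over `x` of the fibre errors. The hypotheses make the errors of
the pieces small only in the mean, so fibrewise convergence is available along subsequences. Every
subsequence has such a further one, which suffices, and `tendsto_scaledJoint_weighted` provides the
domination. -/
theorem tendsto_rootDensity_quotient
    {a : ℕ → ℝ × 𝒳 → ℝ} {b : ℕ → 𝒳 × ℝ → ℝ} {γ : ℕ → 𝒳 × ℝ × ℝ → ℝ}
    {a0 α : ℝ × 𝒳 → ℝ} {b0 β : 𝒳 × ℝ → ℝ} {γ0 γu γv κ : 𝒳 × ℝ × ℝ → ℝ} {K K' : ℝ} {t : ℕ → ℝ}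
    (hc : IsCurveFamily μX γ0 γu γv K K')
    (hn : ∀ n, IsRoot μZ μX μY (a n) (b n) (γ n)) (h0 : IsRoot μZ μX μY a0 b0 γ0)
    (hα : Measurable α) (hβ : Measurable β) (hκ : Measurable κ)
    (hα1 : sqInt (μZ.prod μX) α ≠ ∞) (hβ1 : sqInt (μX.prod μY) β ≠ ∞)
    (hκ1 : sqInt (μX.prod (unitVol.prod unitVol)) κ ≠ ∞)
    (ht0 : ∀ n, t n ≠ 0) (ht : Tendsto t atTop (𝓝 0))
    (hlima : Tendsto (fun n => sqInt (μZ.prod μX) fun s => (a n s - a0 s) / t n - α s) atTop (𝓝 0))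
    (hlimb : Tendsto (fun n => sqInt (μX.prod μY) fun s =>
      ((rootMass μZ fun z => a0 (z, s.1)) * b n s - (rootMass μZ fun z => a0 (z, s.1)) * b0 s) / t n
        - β s) atTop (𝓝 0))
    (hlimc : Tendsto (fun n => sqInt (μX.prod (unitVol.prod unitVol)) fun s =>
      ((rootMass μZ fun z => a0 (z, s.1)) * γ n s - (rootMass μZ fun z => a0 (z, s.1)) * γ0 s) / t n
        - κ s) atTop (𝓝 0)) :
    Tendsto (fun n => sqInt (μZ.prod (μX.prod μY)) fun s =>
      (rootDensity μZ μY (a n) (b n) (γ n) s - rootDensity μZ μY a0 b0 γ0 s) / t n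
        - rootDeriv μZ μY a0 α b0 β γ0 γu γv κ s) atTop (𝓝 0) := by
  have ma0 := h0.meas_a
  have mb0 := h0.meas_b
  have mγ0 := h0.meas_γ
  have hr := measurable_rootMass (μZ := μZ) ma0
  set Ra : ℕ → 𝒳 → ℝ≥0∞ := fun n x =>
    sqInt μZ fun z => (a n (z, x) - a0 (z, x)) / t n - α (z, x) with hRa
  set Rb : ℕ → 𝒳 → ℝ≥0∞ := fun n x => sqInt μY fun y =>
    ((rootMass μZ fun z => a0 (z, x)) * b n (x, y)
      - (rootMass μZ fun z => a0 (z, x)) * b0 (x, y)) / t n - β (x, y) with hRb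
  set Rc : ℕ → 𝒳 → ℝ≥0∞ := fun n x => sqInt (unitVol.prod unitVol) fun q =>
    ((rootMass μZ fun z => a0 (z, x)) * γ n (x, q)
      - (rootMass μZ fun z => a0 (z, x)) * γ0 (x, q)) / t n - κ (x, q) with hRc
  have mRa : ∀ n, Measurable (Ra n) := fun n => by
    have := (hn n).meas_a
    exact measurable_sqInt_right (f := fun s : 𝒳 × ℝ =>
      (a n s.swap - a0 s.swap) / t n - α s.swap) (by fun_prop)
  have mfb : ∀ n, Measurable fun s : 𝒳 × ℝ => ((rootMass μZ fun z => a0 (z, s.1)) * b n s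
      - (rootMass μZ fun z => a0 (z, s.1)) * b0 s) / t n - β s := fun n => by
    have := (hn n).meas_b
    have := hr.comp (measurable_fst : Measurable (@Prod.fst 𝒳 ℝ))
    simp only [Function.comp_def] at this
    fun_prop
  have mfc : ∀ n, Measurable fun s : 𝒳 × ℝ × ℝ => ((rootMass μZ fun z => a0 (z, s.1)) * γ n s
      - (rootMass μZ fun z => a0 (z, s.1)) * γ0 s) / t n - κ s := fun n => by
    have := (hn n).meas_γ
    have := hr.comp (measurable_fst : Measurable (@Prod.fst 𝒳 (ℝ × ℝ)))
    simp only [Function.comp_def] at this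
    fun_prop
  have mRb : ∀ n, Measurable (Rb n) := fun n => measurable_sqInt_right (mfb n)
  have mRc : ∀ n, Measurable (Rc n) := fun n => measurable_sqInt_right (mfc n)
  have hlimR : Tendsto (fun n => ∫⁻ x, (Ra n x + Rb n x + Rc n x) ∂μX) atTop (𝓝 0) := by
    have : ∀ n, ∫⁻ x, (Ra n x + Rb n x + Rc n x) ∂μX = _ := fun n => by
      rw [lintegral_add_left (by fun_prop), lintegral_add_left (by fun_prop),
        ← sqInt_prod_symm (f := fun s => (a n s - a0 s) / t n - α s)
          (by have := (hn n).meas_a; fun_prop),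
        ← sqInt_prod (mfb n), ← sqInt_prod (mfc n)]
    simp only [this]
    simpa using (hlima.add hlimb).add hlimc
  set G : 𝒳 → ℝ≥0∞ := fun x => (sqInt μZ fun z => α (z, x)) + (sqInt μY fun y => β (x, y))
    + sqInt (unitVol.prod unitVol) fun q => κ (x, q) with hG
  have mG1 : Measurable fun x => sqInt μZ fun z => α (z, x) :=
    measurable_sqInt_right (f := fun s : 𝒳 × ℝ => α s.swap) (by fun_prop)
  have mG2 : Measurable fun x => sqInt μY fun y => β (x, y) := measurable_sqInt_right hβ
  have mG3 : Measurable fun x => sqInt (unitVol.prod unitVol) fun q => κ (x, q) :=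
    measurable_sqInt_right hκ
  have mG : Measurable G := (mG1.add mG2).add mG3
  have hG1 : ∫⁻ x, G x ∂μX ≠ ∞ := by
    rw [hG, lintegral_add_left (by fun_prop), lintegral_add_left (by fun_prop), ← sqInt_prod_symm hα,
      ← sqInt_prod hβ, ← sqInt_prod hκ]
    simp [hα1, hβ1, hκ1]
  have mS : ∀ n, Measurable fun s : ℝ × 𝒳 × ℝ =>
      (rootDensity μZ μY (a n) (b n) (γ n) s - rootDensity μZ μY a0 b0 γ0 s) / t n
        - rootDeriv μZ μY a0 α b0 β γ0 γu γv κ s := fun n => by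
    have h1 := measurable_rootDensity (μZ := μZ) (μY := μY) (hn n).meas_a (hn n).meas_b (hn n).meas_γ
    have h2 := measurable_rootDensity (μZ := μZ) (μY := μY) ma0 mb0 mγ0
    have h3 := measurable_rootDeriv (μZ := μZ) (μY := μY) ma0 hα mb0 hβ mγ0 hc.meas_u hc.meas_v hκ
    fun_prop
  set N : ℕ → 𝒳 → ℝ≥0∞ := fun n x => sqInt (μZ.prod μY) fun s =>
    (rootDensity μZ μY (a n) (b n) (γ n) (s.1, x, s.2) - rootDensity μZ μY a0 b0 γ0 (s.1, x, s.2))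
      / t n - rootDeriv μZ μY a0 α b0 β γ0 γu γv κ (s.1, x, s.2) with hN
  have mN : ∀ n, Measurable (N n) := fun n =>
    measurable_sqInt_right (f := fun s : 𝒳 × ℝ × ℝ =>
      (rootDensity μZ μY (a n) (b n) (γ n) (s.2.1, s.1, s.2.2)
        - rootDensity μZ μY a0 b0 γ0 (s.2.1, s.1, s.2.2)) / t n
        - rootDeriv μZ μY a0 α b0 β γ0 γu γv κ (s.2.1, s.1, s.2.2))
      ((mS n).comp (f := fun s : 𝒳 × ℝ × ℝ => (s.2.1, s.1, s.2.2)) (by fun_prop))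
  simp only [fun n => sqInt_triple (μZ := μZ) (μX := μX) (μY := μY) (mS n)]
  refine tendsto_of_subseq_tendsto fun ns hns => ?_
  obtain ⟨φ, hφ, hφae⟩ := exists_subseq_tendsto_ae (R := fun n x => Ra (ns n) x + Rb (ns n) x
    + Rc (ns n) x) (fun n => ((mRa _).add (mRb _)).add (mRc _)) (hlimR.comp hns)
  refine ⟨φ, ?_⟩
  have hm : Tendsto (fun n => ns (φ n)) atTop atTop := hns.comp hφ.tendsto_atTop
  have hG2 := ae_lt_top mG hG1
  have key : ∀ᵐ x ∂μX, Tendsto (fun n => N (ns (φ n)) x) atTop (𝓝 0) ∧ ∀ n, N (ns (φ n)) x ≤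
      4 * (200 * (1 + lipConst K + lipConst K')) *
        (Ra (ns (φ n)) x + Rb (ns (φ n)) x + Rc (ns (φ n)) x)
      + 12 * (200 * (1 + lipConst K + lipConst K')) * G x := by
    filter_upwards [hφae, hG2, hc.curve_u, hc.curve_v, h0.fibre, ae_all_iff.2 fun n => (hn n).fibre]
      with x x1 x2 x3 x4 x5 x6
    have hle : ∀ {f : ℕ → ℝ≥0∞}, (∀ n, f n ≤ Ra (ns (φ n)) x + Rb (ns (φ n)) x + Rc (ns (φ n)) x) →
        Tendsto f atTop (𝓝 0) := fun h =>
      tendsto_of_tendsto_of_tendsto_of_le_of_le tendsto_const_nhds x1 (fun _ => zero_le) h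
    have fin := x2
    simp only [hG, ENNReal.add_lt_top] at fin
    have h := tendsto_scaledJoint_weighted (μZ := μZ) (μY := μY) (a := fun n z => a (ns (φ n)) (z, x))
      (b := fun n y => b (ns (φ n)) (x, y)) (γ := fun n q => γ (ns (φ n)) (x, q))
      (t := fun n => t (ns (φ n))) (α := fun z => α (z, x)) (β := fun y => β (x, y))
      (κ := fun q => κ (x, q)) (γv := fun q => γv (x, q)) x3 x4 (fun n => x6 (ns (φ n))) x5
      (by fun_prop) (by fun_prop) (by fun_prop) fin.1.1.ne fin.1.2.ne fin.2.ne
      (fun n => ht0 (ns (φ n))) (ht.comp hm) (Ra := fun n => Ra (ns (φ n)) x)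
      (Rb := fun n => Rb (ns (φ n)) x) (Rc := fun n => Rc (ns (φ n)) x)
      (fun n => rfl) (fun n => rfl) (fun n => rfl)
      (hle fun n => by rw [add_assoc]; exact le_self_add)
      (hle fun n => le_add_self.trans le_self_add) (hle fun n => le_add_self)
    exact h
  have hC : 200 * (1 + lipConst K + lipConst K') ≠ ∞ := by
    simp [ENNReal.mul_eq_top, lipConst_ne_top]
  refine AsympDominated.tendsto_zero (X := fun n => N (ns (φ n))) ?_ (fun n => (mN _).aemeasurable)
    (key.mono fun x hx => hx.1)
  refine ((asympDominated_of_tendsto (R := fun n x => Ra (ns (φ n)) x + Rb (ns (φ n)) x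
    + Rc (ns (φ n)) x) (fun n => ((mRa _).add (mRb _)).add (mRc _) |>.aemeasurable)
    (hlimR.comp hm)).const_mul (c := 4 * (200 * (1 + lipConst K + lipConst K')))
    (ENNReal.mul_ne_top (by simp) hC)).add ((asympDominated_const mG.aemeasurable hG1).const_mul
    (c := 12 * (200 * (1 + lipConst K + lipConst K'))) (ENNReal.mul_ne_top (by simp) hC))
    |>.mono (Eventually.of_forall fun n => key.mono fun x hx => hx.2 n)

end Global

lemma tendsto_zero_of_forall_ofReal {f : ℕ → ℝ≥0∞}
    (h : ∀ δ : ℝ, 0 < δ → ∀ᶠ n in atTop, f n ≤ ENNReal.ofReal δ) : Tendsto f atTop (𝓝 0) := by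
  rw [ENNReal.tendsto_nhds_zero]
  intro ε hε
  obtain ⟨δ, hδ, h1, h2⟩ := ENNReal.lt_iff_exists_real_btwn.1 hε
  filter_upwards [h δ (by simpa using h1)] with n hn using hn.trans h2.le

/-! ### Derivatives in `L²` and difference quotients along sequences -/

section RootDeriv

variable {Ω : Type*} [MeasurableSpace Ω] {μ : Measure Ω}
  {E : Type*} [NormedAddCommGroup E] [NormedSpace ℝ E]

/-- `D` is the derivative at `θ₀` of `S` as a map into `L²`. -/
structure IsRootDeriv (μ : Measure Ω) (Θ : Set E) (S : E → Ω → ℝ) (θ₀ : E) (D : Ω → E →L[ℝ] ℝ) :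
    Prop where
  meas : ∀ h, Measurable fun ω => D ω h
  fin : ∀ h, sqInt μ (fun ω => D ω h) ≠ ∞
  expansion : ∀ ε : ℝ, 0 < ε → ∀ᶠ θ in 𝓝[Θ] θ₀,
    sqInt μ (fun ω => S θ ω - S θ₀ ω - D ω (θ - θ₀)) ≤ ENNReal.ofReal (ε * ‖θ - θ₀‖ ^ 2)

variable [FiniteDimensional ℝ E] {Θ : Set E} {S : E → Ω → ℝ} {θ₀ : E} {D : Ω → E →L[ℝ] ℝ}

/-- In finite dimension the norms at a basis control those in all directions. -/
lemma tendsto_sqInt_apply (hm : ∀ h, Measurable fun ω => D ω h)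
    (hf : ∀ h, sqInt μ (fun ω => D ω h) ≠ ∞) {v : ℕ → E} (hv : Tendsto v atTop (𝓝 0)) :
    Tendsto (fun n => sqInt μ fun ω => D ω (v n)) atTop (𝓝 0) := by
  let B := Module.finBasis ℝ E
  have hle : ∀ w : E, (sqInt μ fun ω => D ω w) ≤
      ENNReal.ofReal (∑ i, B.repr w i ^ 2) * ∑ i, sqInt μ fun ω => D ω (B i) := by
    intro w
    unfold sqInt
    rw [← lintegral_finsetSum _ fun i _ => by have := hm (B i); fun_prop,
      ← lintegral_const_mul _ (Finset.measurable_sum _ fun i _ => by have := hm (B i); fun_prop)]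
    refine lintegral_mono fun ω => ?_
    rw [← ENNReal.ofReal_sum_of_nonneg fun _ _ => sq_nonneg _, ← ENNReal.ofReal_mul (by positivity)]
    refine ENNReal.ofReal_le_ofReal ?_
    dsimp only
    conv_lhs => rw [← B.sum_repr w, map_sum]
    simp only [map_smul, smul_eq_mul]
    exact Finset.sum_mul_sq_le_sq_mul_sq _ _ _
  have hc : Continuous fun w : E => ∑ i, B.repr w i ^ 2 := by
    refine continuous_finsetSum _ fun i _ => Continuous.pow ?_ 2
    exact (B.coord i).continuous_of_finiteDimensional
  have h0 : Tendsto (fun n => ENNReal.ofReal (∑ i, B.repr (v n) i ^ 2) *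
      ∑ i, sqInt μ fun ω => D ω (B i)) atTop (𝓝 0) := by
    have h1 : Tendsto (fun n => ENNReal.ofReal (∑ i, B.repr (v n) i ^ 2)) atTop (𝓝 0) := by
      simpa using ENNReal.tendsto_ofReal ((hc.tendsto 0).comp hv)
    simpa using ENNReal.Tendsto.mul_const h1
      (Or.inr (ENNReal.sum_ne_top.2 fun i _ => hf (B i)))
  exact tendsto_of_tendsto_of_tendsto_of_le_of_le tendsto_const_nhds h0 (fun _ => zero_le)
    fun n => hle (v n)

/-- A derivative in `L²` gives limits of difference quotients along sequences. -/
lemma IsRootDeriv.tendsto_quotient (h : IsRootDeriv μ Θ S θ₀ D) (hS : ∀ θ ∈ Θ, Measurable (S θ))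
    (hθ₀ : θ₀ ∈ Θ) {θ : ℕ → E} {t : ℕ → ℝ} {e : E} (hθ : ∀ n, θ n ∈ Θ) (ht0 : ∀ n, t n ≠ 0)
    (ht : Tendsto t atTop (𝓝 0)) (hlim : Tendsto (fun n => (t n)⁻¹ • (θ n - θ₀)) atTop (𝓝 e)) :
    Tendsto (fun n => sqInt μ fun ω => (S (θ n) ω - S θ₀ ω) / t n - D ω e) atTop (𝓝 0) := by
  have hθ2 : Tendsto θ atTop (𝓝[Θ] θ₀) := by
    refine tendsto_nhdsWithin_iff.2 ⟨?_, Eventually.of_forall hθ⟩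
    have : Tendsto (fun n => t n • (t n)⁻¹ • (θ n - θ₀) + θ₀) atTop (𝓝 ((0 : ℝ) • e + θ₀)) :=
      (ht.smul hlim).add_const _
    simpa [smul_smul, ht0] using this
  have h1 : Tendsto (fun n => sqInt μ fun ω =>
      (S (θ n) ω - S θ₀ ω - D ω (θ n - θ₀)) / t n) atTop (𝓝 0) := by
    refine tendsto_zero_of_forall_ofReal fun δ hδ => ?_
    have hb : ∀ᶠ n in atTop, ‖(t n)⁻¹ • (θ n - θ₀)‖ ^ 2 < ‖e‖ ^ 2 + 1 :=
      (hlim.norm.pow 2).eventually (gt_mem_nhds (by linarith))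
    filter_upwards [hb, hθ2.eventually (h.expansion (δ / (‖e‖ ^ 2 + 1)) (by positivity))]
      with n hn hn'
    rw [sqInt_div_const]
    calc _ ≤ ENNReal.ofReal ((t n)⁻¹ ^ 2) * ENNReal.ofReal (δ / (‖e‖ ^ 2 + 1) * ‖θ n - θ₀‖ ^ 2) := by
          gcongr
      _ = ENNReal.ofReal (δ / (‖e‖ ^ 2 + 1) * ‖(t n)⁻¹ • (θ n - θ₀)‖ ^ 2) := by
          rw [← ENNReal.ofReal_mul (by positivity), norm_smul, mul_pow, Real.norm_eq_abs, sq_abs]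
          ring_nf
      _ ≤ ENNReal.ofReal δ := by
          refine ENNReal.ofReal_le_ofReal ?_
          calc _ ≤ δ / (‖e‖ ^ 2 + 1) * (‖e‖ ^ 2 + 1) := by gcongr
            _ = δ := by field_simp
  have h2 := tendsto_sqInt_apply h.meas h.fin (v := fun n => (t n)⁻¹ • (θ n - θ₀) - e)
    (by simpa using hlim.sub_const e)
  refine (tendsto_sqInt_add (fun n => ?_) h1 h2).congr fun n => ?_
  · have a1 := hS _ (hθ n)
    have a2 := hS _ hθ₀
    have a3 := h.meas (θ n - θ₀)
    fun_prop
  · congr 1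
    ext ω
    have := ht0 n
    simp only [map_sub, map_smul, smul_eq_mul]
    field_simp
    ring

/-- Limits of difference quotients along sequences give a derivative in `L²`. -/
lemma isRootDeriv_of_tendsto_quotient (hS : ∀ θ ∈ Θ, Measurable (S θ)) (hθ₀ : θ₀ ∈ Θ)
    (hm : ∀ h, Measurable fun ω => D ω h) (hf : ∀ h, sqInt μ (fun ω => D ω h) ≠ ∞)
    (hlim : ∀ (θ : ℕ → E) (t : ℕ → ℝ) (e : E), (∀ n, θ n ∈ Θ) → (∀ n, t n ≠ 0) →
      Tendsto t atTop (𝓝 0) → Tendsto (fun n => (t n)⁻¹ • (θ n - θ₀)) atTop (𝓝 e) →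
      Tendsto (fun n => sqInt μ fun ω => (S (θ n) ω - S θ₀ ω) / t n - D ω e) atTop (𝓝 0)) :
    IsRootDeriv μ Θ S θ₀ D := by
  refine ⟨hm, hf, fun ε hε => ?_⟩
  by_contra hcon
  rw [not_eventually] at hcon
  -- A sequence violating the expansion has normalized increments on the compact unit sphere. Along
  -- a convergent subsequence, with `t n` the distance to `θ₀`, the hypothesis contradicts the
  -- violation.
  obtain ⟨θ, hθ, hP⟩ := exists_seq_forall_of_frequently (hcon.and_eventually self_mem_nhdsWithin)
  have hθ0 : Tendsto θ atTop (𝓝 θ₀) := hθ.mono_right nhdsWithin_le_nhds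
  have hne : ∀ n, θ n - θ₀ ≠ 0 := by
    intro n h0
    have h1 := (hP n).1
    rw [sub_eq_zero.1 h0] at h1
    simp [sqInt] at h1
  have hsph : ∀ n, ‖θ n - θ₀‖⁻¹ • (θ n - θ₀) ∈ Metric.sphere (0 : E) 1 := by
    intro n
    have := norm_ne_zero_iff.2 (hne n)
    simp [norm_smul, this]
  obtain ⟨e, -, φ, hφ, hφe⟩ := (isCompact_sphere (0 : E) 1).tendsto_subseq hsph
  have ht : Tendsto (fun n => ‖θ (φ n) - θ₀‖) atTop (𝓝 0) := by
    simpa using ((hθ0.comp hφ.tendsto_atTop).sub_const θ₀).norm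
  have ht0 : ∀ n, ‖θ (φ n) - θ₀‖ ≠ 0 := fun n => norm_ne_zero_iff.2 (hne _)
  have h1 := hlim (fun n => θ (φ n)) (fun n => ‖θ (φ n) - θ₀‖) e (fun n => (hP _).2) ht0 ht hφe
  have h2 := tendsto_sqInt_apply hm hf (v := fun n => e - ‖θ (φ n) - θ₀‖⁻¹ • (θ (φ n) - θ₀))
    (by simpa using hφe.const_sub e)
  have h3 := tendsto_sqInt_add (fun n => ?_) h1 h2
  · obtain ⟨n, hn⟩ := (h3.eventually (gt_mem_nhds (ENNReal.ofReal_pos.2 hε))).exists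
    refine (hP (φ n)).1 ?_
    have e1 : (fun ω => S (θ (φ n)) ω - S θ₀ ω - D ω (θ (φ n) - θ₀)) = fun ω =>
        ‖θ (φ n) - θ₀‖ * ((S (θ (φ n)) ω - S θ₀ ω) / ‖θ (φ n) - θ₀‖ - D ω e +
          D ω (e - ‖θ (φ n) - θ₀‖⁻¹ • (θ (φ n) - θ₀))) := by
      ext ω
      have := ht0 n
      rw [map_sub (D ω) e, map_smul, smul_eq_mul]
      field_simp
      ring
    rw [e1, sqInt_const_mul, mul_comm ε, ENNReal.ofReal_mul (by positivity)]
    gcongr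
  · have a1 := hS _ (hP (φ n)).2
    have a2 := hS _ hθ₀
    have a3 := hm e
    fun_prop

end RootDeriv

/-! ### Scores and derivatives of roots -/

section Score

variable {Ω : Type*} [MeasurableSpace Ω] {μ : Measure Ω}
  {E : Type*} [NormedAddCommGroup E] [NormedSpace ℝ E]
  {Θ : Set E} {p : E → Ω → ℝ} {θ₀ : E} {ℓ : Ω → E →L[ℝ] ℝ}

/-- Differentiability in quadratic mean is differentiability of the root of the density in `L²`. -/
lemma IsScoreAt.exists_isRootDeriv [FiniteDimensional ℝ E] (h : IsScoreAt μ Θ p θ₀ ℓ) (hp : ∀ θ ∈ Θ, Measurable (p θ))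
    (hfin : ∀ θ ∈ Θ, sqInt μ (fun ω => √(p θ ω)) ≠ ∞) (hθ₀ : θ₀ ∈ Θ) :
    ∃ D : Ω → E →L[ℝ] ℝ, IsRootDeriv μ Θ (fun θ ω => √(p θ ω)) θ₀ D ∧
      ∀ᵐ ω ∂μ, ∀ h, D ω h = 1 / 2 * ℓ ω h * √(p θ₀ ω) := by
  let B := Module.finBasis ℝ E
  have hB : ∀ i, AEStronglyMeasurable (fun ω => 1 / 2 * (ℓ ω (B i) * √(p θ₀ ω))) μ := fun i =>
    (h.memLp (B i)).aestronglyMeasurable.const_mul _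
  -- The score is measurable only up to null sets and after multiplication with the root. Measurable
  -- versions are chosen at basis vectors and extended linearly, which gives one null set for all
  -- directions.
  let f := fun i => (hB i).mk _
  have hf : ∀ i, Measurable (f i) := fun i => (hB i).stronglyMeasurable_mk.measurable
  let D : Ω → E →L[ℝ] ℝ := fun ω => ∑ i, f i ω • (B.coord i).toContinuousLinearMap
  have hD : ∀ ω h, D ω h = ∑ i, f i ω * B.repr h i := fun ω h => by simp [D]
  have hae : ∀ᵐ ω ∂μ, ∀ h, D ω h = 1 / 2 * ℓ ω h * √(p θ₀ ω) := by
    filter_upwards [ae_all_iff.2 fun i => (hB i).ae_eq_mk] with ω hω h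
    have e1 : ∀ i, f i ω = 1 / 2 * (ℓ ω (B i) * √(p θ₀ ω)) := fun i => (hω i).symm
    rw [hD]
    conv_rhs => rw [← B.sum_repr h, map_sum]
    simp only [e1, map_smul, smul_eq_mul, Finset.mul_sum, Finset.sum_mul]
    exact Finset.sum_congr rfl fun i _ => by ring
  have hDm : ∀ h, Measurable fun ω => D ω h := fun h => by
    simp only [hD]
    exact Finset.measurable_sum _ fun i _ => (hf i).mul_const _
  have hDL : ∀ k, MemLp (fun ω => D ω k) 2 μ := fun k =>
    ((h.memLp k).const_mul (1 / 2)).ae_eq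
      (hae.mono fun ω hω => by simp [hω k, mul_assoc])
  refine ⟨D, ⟨hDm, fun k => sqInt_ne_top_of_memLp (hDL k), fun ε hε => ?_⟩, hae⟩
  filter_upwards [h.expansion.def hε, self_mem_nhdsWithin] with θ hθ hθ'
  have hm : Measurable fun ω => √(p θ ω) - √(p θ₀ ω) - D ω (θ - θ₀) := by
    have := hp θ hθ'
    have := hp θ₀ hθ₀
    have := hDm (θ - θ₀)
    fun_prop
  have h2 : sqInt μ (fun ω => √(p θ ω) - √(p θ₀ ω) - D ω (θ - θ₀)) ≠ ∞ := by
    refine sqInt_ne_top_of_memLp (((memLp_of_sqInt ?_ (hfin θ hθ')).sub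
      (memLp_of_sqInt ?_ (hfin θ₀ hθ₀))).sub (hDL _))
    · exact (hp θ hθ').sqrt.aestronglyMeasurable
    · exact (hp θ₀ hθ₀).sqrt.aestronglyMeasurable
  rw [← ENNReal.ofReal_toReal h2, ← integral_sq_eq_toReal hm.aestronglyMeasurable]
  refine ENNReal.ofReal_le_ofReal ?_
  rw [Real.norm_of_nonneg (integral_nonneg fun _ => sq_nonneg _), norm_pow, norm_norm] at hθ
  refine le_trans (le_of_eq (integral_congr_ae ?_)) hθ
  filter_upwards [hae] with ω hω
  simp only [hω]

/-- Differentiability of the root of a positive density in `L²` is differentiability in quadratic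
mean. -/
lemma IsRootDeriv.isScoreAt {D : Ω → E →L[ℝ] ℝ}
    (h : IsRootDeriv μ Θ (fun θ ω => √(p θ ω)) θ₀ D) (hp : ∀ θ ∈ Θ, Measurable (p θ))
    (hθ₀ : θ₀ ∈ Θ) (hpos : ∀ᵐ ω ∂μ, 0 < p θ₀ ω) :
    IsScoreAt μ Θ p θ₀ fun ω => (2 / √(p θ₀ ω)) • D ω := by
  have e : ∀ᵐ ω ∂μ, √(p θ₀ ω) ≠ 0 := hpos.mono fun ω hω => (Real.sqrt_pos.2 hω).ne'
  constructor
  · intro k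
    refine ((memLp_of_sqInt (h.meas k).aestronglyMeasurable (h.fin k)).const_mul 2).ae_eq ?_
    filter_upwards [e] with ω hω
    simp only [smul_apply, smul_eq_mul]
    field_simp
  · refine IsLittleO.of_bound fun ε hε => ?_
    filter_upwards [h.expansion ε hε, self_mem_nhdsWithin] with θ hθ hθ'
    have hm : Measurable fun ω => √(p θ ω) - √(p θ₀ ω) - D ω (θ - θ₀) := by
      have := hp θ hθ'
      have := hp θ₀ hθ₀
      have := h.meas (θ - θ₀)
      fun_prop
    have e2 : ∫ ω, (√(p θ ω) - √(p θ₀ ω) - 1 / 2 * ((2 / √(p θ₀ ω)) • D ω) (θ - θ₀) * √(p θ₀ ω)) ^ 2 ∂μ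
        = ∫ ω, (√(p θ ω) - √(p θ₀ ω) - D ω (θ - θ₀)) ^ 2 ∂μ := by
      refine integral_congr_ae ?_
      filter_upwards [e] with ω hω
      simp only [smul_apply, smul_eq_mul]
      congr 2
      field_simp
    rw [e2, Real.norm_of_nonneg (integral_nonneg fun _ => sq_nonneg _), norm_pow, norm_norm,
      integral_sq_eq_toReal hm.aestronglyMeasurable]
    exact ENNReal.toReal_le_of_le_ofReal (by positivity) hθ

/-- The quadratic form of the information is `4 ‖D h‖²`. -/
lemma fisherInfo_self_eq_zero {D : Ω → E →L[ℝ] ℝ} (hD : ∀ h, Measurable fun ω => D ω h)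
    (hD1 : ∀ h, sqInt μ (fun ω => D ω h) ≠ ∞) (hpos : ∀ᵐ ω ∂μ, 0 < p θ₀ ω) {h : E}
    (hz : fisherInfo μ p θ₀ (fun ω => (2 / √(p θ₀ ω)) • D ω) h h = 0) :
    ∀ᵐ ω ∂μ, D ω h = 0 := by
  have e : fisherInfo μ p θ₀ (fun ω => (2 / √(p θ₀ ω)) • D ω) h h = 4 * ∫ ω, D ω h ^ 2 ∂μ := by
    rw [fisherInfo, ← integral_const_mul]
    refine integral_congr_ae ?_
    filter_upwards [hpos] with ω hω
    have h1 := (Real.sqrt_pos.2 hω).ne'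
    have h2 := Real.sq_sqrt hω.le
    simp only [smul_apply, smul_eq_mul]
    rw [← h2]
    simp only [Real.sqrt_sq (Real.sqrt_nonneg _)]
    field_simp
    ring
  rw [e, integral_sq_eq_toReal (hD h).aestronglyMeasurable] at hz
  have h3 : (sqInt μ fun ω => D ω h) = 0 := by
    rcases (ENNReal.toReal_eq_zero_iff _).1 (by linarith) with h | h'
    · exact h
    · exact absurd h' (hD1 h)
  exact (sqInt_eq_zero_iff (hD h).aemeasurable).1 h3

/-- If `D h` vanishes, so does `ℓ h √p`, which is a factor of the integrand of the information at
`(h, k)` for every `k`. -/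
lemma eq_zero_of_ae_eq_zero {D : Ω → E →L[ℝ] ℝ}
    (hD : ∀ᵐ ω ∂μ, ∀ h, D ω h = 1 / 2 * ℓ ω h * √(p θ₀ ω)) (hp : ∀ᵐ ω ∂μ, 0 ≤ p θ₀ ω)
    (hreg : ∀ h : E, (∀ k : E, fisherInfo μ p θ₀ ℓ h k = 0) → h = 0) {h : E}
    (hz : ∀ᵐ ω ∂μ, D ω h = 0) : h = 0 := by
  refine hreg h fun k => ?_
  rw [fisherInfo]
  refine integral_eq_zero_of_ae ?_
  filter_upwards [hD, hp, hz] with ω h1 h2 h3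
  rw [h1] at h3
  have h4 : ℓ ω h * √(p θ₀ ω) = 0 := by linarith
  rw [← Real.sq_sqrt h2]
  calc ℓ ω h * ℓ ω k * √(p θ₀ ω) ^ 2 = (ℓ ω h * √(p θ₀ ω)) * (ℓ ω k * √(p θ₀ ω)) := by ring
    _ = 0 := by rw [h4, zero_mul]

end Score

/-! ### Margins of a copula density -/

section CopulaDensity

lemma unitVol_restrict_Iic {u : ℝ} (h1 : u ≤ 1) :
    unitVol.restrict (Iic u) = volume.restrict (Ioc 0 u) := by
  rw [unitVol, Measure.restrict_restrict measurableSet_Iic]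
  rcases h1.lt_or_eq with h | rfl
  · congr 1
    ext s
    simp only [mem_inter_iff, mem_Iic, mem_Ioo, mem_Ioc]
    constructor
    · rintro ⟨a, b, c⟩; exact ⟨b, a⟩
    · rintro ⟨a, b⟩; exact ⟨b, a, by linarith⟩
  · have : Iic (1 : ℝ) ∩ Ioo 0 1 = Ioo 0 1 := inter_eq_right.2 fun s hs => hs.2.le
    rw [this]
    exact Measure.restrict_congr_set Ioo_ae_eq_Ioc

/-- A function is almost everywhere one on the unit interval if its integrals over initial
segments are those of one. -/
lemma ae_eq_one_of_setLIntegral_Iic {F : ℝ → ℝ≥0∞} (hF : Measurable F)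
    (h : ∀ u ∈ Icc (0 : ℝ) 1, ∫⁻ s in Iic u, F s ∂unitVol = ENNReal.ofReal u) :
    ∀ᵐ u ∂unitVol, F u = 1 := by
  have key : unitVol = unitVol.withDensity F := by
    refine Measure.ext_of_Iic _ _ fun a => ?_
    have hset : (Iic a : Set ℝ) =ᵐ[unitVol] Iic (max 0 (min a 1)) := by
      filter_upwards [ae_unitVol_mem] with u hu
      refine propext ?_
      change u ≤ a ↔ u ≤ max 0 (min a 1)
      simp only [le_max_iff, le_min_iff, hu.1.not_ge, hu.2.le, and_true, false_or]
    rw [withDensity_apply _ measurableSet_Iic, Measure.restrict_congr_set hset,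
      h _ ⟨le_max_left _ _, by simp⟩, unitVol_Iic]
    rcases le_total 0 (min a 1) with h | h
    · rw [max_eq_right h]
    · rw [max_eq_left h, ENNReal.ofReal_of_nonpos h, ENNReal.ofReal_zero]
  have h2 : unitVol.withDensity (1 : ℝ → ℝ≥0∞) = unitVol.withDensity F := by
    rw [withDensity_one]; exact key
  have := (withDensity_eq_iff_of_sigmaFinite (by fun_prop) hF.aemeasurable).1 h2
  filter_upwards [this] with u hu using hu.symm

variable {C c : ℝ → ℝ → ℝ}

/-- The integral form of a copula density on the unit square. -/
lemma HasCopulaDensity.setLIntegral (hC : IsCopula C) (hc : HasCopulaDensity C c)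
    (hpos : ∀ u ∈ Ioo (0 : ℝ) 1, ∀ v ∈ Ioo (0 : ℝ) 1, 0 < c u v)
    {u v : ℝ} (hu : u ∈ Icc (0 : ℝ) 1) (hv : v ∈ Icc (0 : ℝ) 1) :
    ∫⁻ s in Iic u ×ˢ Iic v, ENNReal.ofReal (c s.1 s.2) ∂(unitVol.prod unitVol)
      = ENNReal.ofReal (C u v) := by
  -- If the density were not integrable, its integral would be `0` by convention, contrary to `C 1 1
  -- = 1`.
  have hi : IntegrableOn (fun s : ℝ × ℝ => c s.1 s.2) (Ioc 0 1 ×ˢ Ioc 0 1) := by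
    by_contra hcon
    have h1 := hc 1 (by simp) 1 (by simp)
    rw [integral_undef hcon, hC.one_left 1 (by simp)] at h1
    exact one_ne_zero h1
  have e : (unitVol.prod unitVol).restrict (Iic u ×ˢ Iic v)
      = (volume : Measure (ℝ × ℝ)).restrict (Ioc 0 u ×ˢ Ioc 0 v) := by
    rw [← Measure.prod_restrict, unitVol_restrict_Iic hu.2, unitVol_restrict_Iic hv.2,
      Measure.prod_restrict, Measure.volume_eq_prod]
  have hae : ∀ᵐ s ∂(unitVol.prod unitVol), 0 ≤ c s.1 s.2 := by
    have : ∀ᵐ s ∂(unitVol.prod unitVol), s ∈ Ioo (0 : ℝ) 1 ×ˢ Ioo (0 : ℝ) 1 := by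
      unfold unitVol
      rw [Measure.prod_restrict]
      exact ae_restrict_mem (measurableSet_Ioo.prod measurableSet_Ioo)
    exact this.mono fun s hs => (hpos _ hs.1 _ hs.2).le
  rw [hc u hu v hv, e, ofReal_integral_eq_lintegral_ofReal]
  · exact hi.mono_set (prod_mono (Ioc_subset_Ioc_right hu.2) (Ioc_subset_Ioc_right hv.2))
  · rw [← e]
    exact ae_restrict_of_ae hae

/-- The margin and the constant `1` have the same integrals over initial segments, because `C u 1 =
u`. This identifies the margin only for almost every `u`. -/
lemma HasCopulaDensity.margin_left (hC : IsCopula C) (hc : HasCopulaDensity C c)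
    (hm : Measurable fun s : ℝ × ℝ => c s.1 s.2)
    (hpos : ∀ u ∈ Ioo (0 : ℝ) 1, ∀ v ∈ Ioo (0 : ℝ) 1, 0 < c u v) :
    ∀ᵐ u ∂unitVol, ∫⁻ v, ENNReal.ofReal (c u v) ∂unitVol = 1 := by
  have hm2 : Measurable fun u => ∫⁻ v, ENNReal.ofReal (c u v) ∂unitVol :=
    Measurable.lintegral_prod_right' (f := fun s : ℝ × ℝ => ENNReal.ofReal (c s.1 s.2))
      (by fun_prop)
  refine ae_eq_one_of_setLIntegral_Iic hm2 fun u hu => ?_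
  have h1 := hc.setLIntegral hC hpos hu (v := 1) (by simp)
  have e : unitVol.restrict (Iic 1) = unitVol := by
    rw [unitVol_restrict_Iic le_rfl, unitVol]
    exact (Measure.restrict_congr_set Ioo_ae_eq_Ioc).symm
  rw [← Measure.prod_restrict, e, lintegral_prod _ (by fun_prop), hC.one_right u hu] at h1
  exact h1

lemma HasCopulaDensity.swap (hC : IsCopula C) (hc : HasCopulaDensity C c) :
    IsCopula (fun u v => C v u) ∧ HasCopulaDensity (fun u v => C v u) fun u v => c v u := by
  refine ⟨⟨hC.zero_right, hC.zero_left, hC.one_right, hC.one_left, ?_⟩, ?_⟩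
  · intro u hu u' hu' v hv v' hv' h1 h2
    have := hC.two_increasing v hv v' hv' u hu u' hu' h2 h1
    linarith
  · intro u hu v hv
    dsimp only
    rw [hc v hv u hu, Measure.volume_eq_prod, ← Measure.prod_restrict, ← Measure.prod_restrict]
    exact (integral_prod_swap (fun s : ℝ × ℝ => c s.1 s.2)).symm

end CopulaDensity

/-! ### Roots of copula densities as curves -/

section RootPartial

/-- The partial derivative of `√c` in the first argument. -/
def rootPartial (c : ℝ → ℝ → ℝ) (u v : ℝ) : ℝ :=
  (Ioo (0 : ℝ) 1 ×ˢ Ioo (0 : ℝ) 1).indicator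
    (fun q : ℝ × ℝ => deriv (fun s => c s q.2) q.1 / (2 * √(c q.1 q.2))) (u, v)

variable {c : ℝ → ℝ → ℝ}

lemma rootPartial_eq {u v : ℝ} (hu : u ∈ Ioo (0 : ℝ) 1) (hv : v ∈ Ioo (0 : ℝ) 1) :
    rootPartial c u v = deriv (fun s => c s v) u / (2 * √(c u v)) :=
  indicator_of_mem (s := Ioo (0 : ℝ) 1 ×ˢ Ioo (0 : ℝ) 1) ⟨hu, hv⟩ _

lemma contDiffOn_slice (h : ContDiffOn ℝ 1 (fun s : ℝ × ℝ => c s.1 s.2) (Ioo 0 1 ×ˢ Ioo 0 1))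
    {v : ℝ} (hv : v ∈ Ioo (0 : ℝ) 1) : ContDiffOn ℝ 1 (fun s => c s v) (Ioo 0 1) :=
  h.comp (f := fun s : ℝ => (s, v)) (by fun_prop) fun s hs => ⟨hs, hv⟩

lemma hasDerivAt_slice (h : ContDiffOn ℝ 1 (fun s : ℝ × ℝ => c s.1 s.2) (Ioo 0 1 ×ˢ Ioo 0 1))
    {u v : ℝ} (hu : u ∈ Ioo (0 : ℝ) 1) (hv : v ∈ Ioo (0 : ℝ) 1) :
    HasDerivAt (fun s => c s v) (deriv (fun s => c s v) u) u :=
  (((contDiffOn_slice h hv).differentiableOn one_ne_zero).differentiableAt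
    (isOpen_Ioo.mem_nhds hu)).hasDerivAt

/-- On the open square the derivative is a limit of difference quotients with steps `1 / (n + 1)`,
which are jointly measurable. -/
lemma measurable_rootPartial {𝒳 : Type*} [MeasurableSpace 𝒳] {c : 𝒳 → ℝ → ℝ → ℝ}
    (hm : Measurable fun s : 𝒳 × ℝ × ℝ => c s.1 s.2.1 s.2.2)
    (h : ∀ x, ContDiffOn ℝ 1 (fun s : ℝ × ℝ => c x s.1 s.2) (Ioo 0 1 ×ˢ Ioo 0 1)) :
    Measurable fun s : 𝒳 × ℝ × ℝ => rootPartial (c s.1) s.2.1 s.2.2 := by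
  have hS : MeasurableSet {s : 𝒳 × ℝ × ℝ | s.2 ∈ Ioo (0 : ℝ) 1 ×ˢ Ioo (0 : ℝ) 1} :=
    (measurableSet_Ioo.prod measurableSet_Ioo).preimage measurable_snd
  refine measurable_of_tendsto_metrizable (f := fun (n : ℕ) (s : 𝒳 × ℝ × ℝ) =>
    {s : 𝒳 × ℝ × ℝ | s.2 ∈ Ioo (0 : ℝ) 1 ×ˢ Ioo (0 : ℝ) 1}.indicator (fun s =>
      ((1 / ((n : ℝ) + 1))⁻¹ * (c s.1 (s.2.1 + 1 / ((n : ℝ) + 1)) s.2.2 - c s.1 s.2.1 s.2.2))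
        / (2 * √(c s.1 s.2.1 s.2.2))) s) (fun n => ?_) (tendsto_pi_nhds.2 fun s => ?_)
  · have h1 : Measurable fun s : 𝒳 × ℝ × ℝ => c s.1 (s.2.1 + 1 / ((n : ℝ) + 1)) s.2.2 :=
      hm.comp (f := fun s : 𝒳 × ℝ × ℝ => (s.1, s.2.1 + 1 / ((n : ℝ) + 1), s.2.2)) (by fun_prop)
    exact Measurable.indicator (by fun_prop) hS
  · by_cases hs : s.2 ∈ Ioo (0 : ℝ) 1 ×ˢ Ioo (0 : ℝ) 1
    · rw [rootPartial_eq hs.1 hs.2]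
      have e : s ∈ {s : 𝒳 × ℝ × ℝ | s.2 ∈ Ioo (0 : ℝ) 1 ×ˢ Ioo (0 : ℝ) 1} := hs
      simp only [indicator_of_mem e]
      refine Tendsto.div_const ?_ _
      have hd := (hasDerivAt_slice (h s.1) hs.1 hs.2).tendsto_slope_zero
      have ht : Tendsto (fun n : ℕ => 1 / ((n : ℝ) + 1)) atTop (𝓝[≠] 0) :=
        tendsto_nhdsWithin_iff.2 ⟨tendsto_one_div_add_atTop_nhds_zero_nat,
          Eventually.of_forall fun n => by
            have : (0 : ℝ) < 1 / ((n : ℝ) + 1) := by positivity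
            exact this.ne'⟩
      exact hd.comp ht
    · have e : s ∉ {s : 𝒳 × ℝ × ℝ | s.2 ∈ Ioo (0 : ℝ) 1 ×ˢ Ioo (0 : ℝ) 1} := hs
      have e2 : rootPartial (c s.1) s.2.1 s.2.2 = 0 := indicator_of_notMem (a := (s.2.1, s.2.2)) hs _
      simp only [indicator_of_notMem e, e2]
      exact tendsto_const_nhds

/-- The root of a smooth copula density is a curve in `L²`. -/
lemma isCurve_sqrt {K : ℝ} (hm : Measurable fun s : ℝ × ℝ => c s.1 s.2)
    (hpos : ∀ u ∈ Ioo (0 : ℝ) 1, ∀ v ∈ Ioo (0 : ℝ) 1, 0 < c u v)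
    (h : ContDiffOn ℝ 1 (fun s : ℝ × ℝ => c s.1 s.2) (Ioo 0 1 ×ˢ Ioo 0 1))
    (hK : ∀ u ∈ Ioo (0 : ℝ) 1,
      ∫⁻ v, ENNReal.ofReal ((deriv (fun s => Real.log (c s v)) u) ^ 2 * c u v) ∂unitVol
        ≤ ENNReal.ofReal ((K / (u * (1 - u))) ^ 2))
    (hmarg : ∀ᵐ u ∂unitVol, ∫⁻ v, ENNReal.ofReal (c u v) ∂unitVol = 1) :
    IsCurve unitVol (fun q : ℝ × ℝ => √(c q.1 q.2)) (fun q => rootPartial c q.1 q.2) K where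
  meas := hm.sqrt
  meas' := (measurable_rootPartial (𝒳 := Unit) (c := fun _ => c)
    (hm.comp measurable_snd) fun _ => h).comp (measurable_prodMk_left (x := ()))
  hasDeriv := by
    filter_upwards [ae_unitVol_mem] with v hv u hu
    rw [rootPartial_eq hu hv]
    exact (hasDerivAt_slice h hu hv).sqrt (hpos u hu v hv).ne'
  cont := by
    filter_upwards [ae_unitVol_mem] with v hv
    have h1 := (contDiffOn_slice h hv).continuousOn_deriv_of_isOpen isOpen_Ioo le_rfl
    have h2 := (contDiffOn_slice h hv).continuousOn
    refine ContinuousOn.congr (f := fun u => deriv (fun s => c s v) u / (2 * √(c u v))) ?_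
      fun u hu => rootPartial_eq hu hv
    exact h1.div (by fun_prop) fun u hu =>
      mul_ne_zero two_ne_zero (Real.sqrt_pos.2 (hpos u hu v hv)).ne'
  -- The squared derivative of `√c` is a quarter of `(∂ log c)² c`; the quarter is given away.
  bound := by
    intro u hu
    refine le_trans (lintegral_mono_ae ?_) (hK u hu)
    filter_upwards [ae_unitVol_mem] with v hv
    refine ENNReal.ofReal_le_ofReal ?_
    have hp := hpos u hu v hv
    have hs := Real.sqrt_pos.2 hp
    rw [rootPartial_eq hu hv, ((hasDerivAt_slice h hu hv).log hp.ne').deriv, div_pow, div_pow,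
      mul_pow, Real.sq_sqrt hp.le, div_mul_eq_mul_div, div_le_div_iff₀ (by positivity) (by positivity)]
    nlinarith [mul_nonneg (sq_nonneg (deriv (fun s => c s v) u)) (sq_nonneg (c u v))]
  norm := by
    intro u hu
    -- Almost every level has margin one, and such levels are dense. Continuity of `c` and Fatou's
    -- lemma give at most one at all levels.
    have hden : ∃ᶠ w in 𝓝 u, w ∈ Ioo (0 : ℝ) 1 ∧ ∫⁻ v, ENNReal.ofReal (c w v) ∂unitVol = 1 := by
      have h1 : ∀ᵐ w, w ∈ Ioo (0 : ℝ) 1 → ∫⁻ v, ENNReal.ofReal (c w v) ∂unitVol = 1 :=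
        (ae_restrict_iff' measurableSet_Ioo).1 hmarg
      have h2 := (Measure.dense_of_ae h1) u
      exact ((mem_closure_iff_frequently.1 h2).and_eventually (isOpen_Ioo.mem_nhds hu)).mono
        fun w hw => ⟨hw.2, hw.1 hw.2⟩
    obtain ⟨w, hw, hP⟩ := exists_seq_forall_of_frequently hden
    calc sqInt unitVol (fun v => √(c u v))
        = ∫⁻ v, liminf (fun n => ENNReal.ofReal (c (w n) v)) atTop ∂unitVol := by
          refine lintegral_congr_ae ?_
          filter_upwards [ae_unitVol_mem] with v hv
          have h1 : ContinuousAt (fun s => c s v) u :=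
            (contDiffOn_slice h hv).continuousOn.continuousAt (isOpen_Ioo.mem_nhds hu)
          rw [Real.sq_sqrt (hpos u hu v hv).le]
          exact (ENNReal.tendsto_ofReal (h1.tendsto.comp hw)).liminf_eq.symm
      _ ≤ liminf (fun n => ∫⁻ v, ENNReal.ofReal (c (w n) v) ∂unitVol) atTop := by
          refine lintegral_liminf_le fun n => ?_
          have : Measurable fun v => c (w n) v := hm.comp measurable_prodMk_left
          fun_prop
      _ = 1 := by simp [(hP _).2]

end RootPartial

/-! ### Distances between roots of margins, on a fibre -/

section FibreContraction

variable {μZ μY : Measure ℝ} {a b a0 b0 : ℝ → ℝ} {γ γ0 : ℝ × ℝ → ℝ}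

lemma IsRootAt.measurable_scaledJoint (h : IsRootAt μZ μY a b γ) :
    Measurable (scaledJoint μZ μY a b γ) :=
  Frugal.measurable_scaledJoint h.meas_a h.fin h.nz h.meas_b h.unit h.meas_γ

/-- The change of variables in `y` turns the integral into the margin of the copula density at the
level of `z`, which is one for almost every `z`. -/
lemma IsRootAt.sqInt_scaledJoint_fst [NullSingletonClass μZ] [NullSingletonClass μY]
    (h : IsRootAt μZ μY a b γ) :
    ∀ᵐ z ∂μZ, sqInt μY (fun y => scaledJoint μZ μY a b γ (z, y)) = ENNReal.ofReal (a z ^ 2) := by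
  filter_upwards [ae_comp_sqCdf (measurable_normalize h.meas_a) (sqInt_normalize h.meas_a h.fin h.nz)
    (normalize_ne_zero h.meas_a h.fin h.nz h.ane) h.marg_v] with z hz
  have hγ := h.meas_γ
  simp only [scaledJoint, mul_assoc]
  rw [sqInt_const_mul]
  have := lintegral_comp_sqCdf h.meas_b h.unit
    (F := fun u => ENNReal.ofReal (γ (u, sqCdf μZ (normalize μZ a) z) ^ 2)) (by fun_prop)
  simp only [sqInt, mul_pow] at hz ⊢
  simp only [ENNReal.ofReal_mul (sq_nonneg _)]
  rw [this, hz, mul_one]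

lemma IsRootAt.sqInt_scaledJoint_snd [NullSingletonClass μZ] [NullSingletonClass μY]
    (h : IsRootAt μZ μY a b γ) :
    ∀ᵐ y ∂μY, sqInt μZ (fun z => scaledJoint μZ μY a b γ (z, y))
      = ENNReal.ofReal ((rootMass μZ a * b y) ^ 2) := by
  filter_upwards [ae_comp_sqCdf h.meas_b h.unit h.bne h.marg_u] with y hy
  have hγ := h.meas_γ
  have e : (fun z => scaledJoint μZ μY a b γ (z, y)) = fun z => rootMass μZ a * b y *
      (normalize μZ a z * γ (sqCdf μY b y, sqCdf μZ (normalize μZ a) z)) := by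
    ext z
    rw [scaledJoint_eq h.meas_a h.fin h.nz, joint]
    ring
  rw [e, sqInt_const_mul]
  have := lintegral_comp_sqCdf (measurable_normalize h.meas_a) (sqInt_normalize h.meas_a h.fin h.nz)
    (F := fun v => ENNReal.ofReal (γ (sqCdf μY b y, v) ^ 2)) (by fun_prop)
  simp only [sqInt, mul_pow] at hy ⊢
  simp only [ENNReal.ofReal_mul (sq_nonneg _)]
  rw [this, hy, mul_one]

variable [SFinite μZ] [SFinite μY] [NullSingletonClass μZ] [NullSingletonClass μY]

/-- Roots of `Z`-margins are no further apart than the roots of the joint densities. -/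
lemma IsRootAt.sqInt_sub_le_fst (h : IsRootAt μZ μY a b γ) (h0 : IsRootAt μZ μY a0 b0 γ0) :
    (sqInt μZ fun z => a z - a0 z) ≤ sqInt (μZ.prod μY) fun s =>
      scaledJoint μZ μY a b γ s - scaledJoint μZ μY a0 b0 γ0 s := by
  have m := h.measurable_scaledJoint
  have m0 := h0.measurable_scaledJoint
  rw [sqInt_prod (by fun_prop)]
  refine lintegral_mono_ae ?_
  filter_upwards [h.sqInt_scaledJoint_fst, h0.sqInt_scaledJoint_fst] with z hz hz0
  -- The root of the margin at `z` is the norm of the slice of the joint root, so the reverse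
  -- triangle inequality applies slice by slice.
  have := ofReal_sqrt_sub_sq_le (μ := μY) (f := fun y => scaledJoint μZ μY a b γ (z, y))
    (g := fun y => scaledJoint μZ μY a0 b0 γ0 (z, y))
    (m.comp measurable_prodMk_left).aestronglyMeasurable
    (m0.comp measurable_prodMk_left).aestronglyMeasurable (by rw [hz]; simp) (by rw [hz0]; simp)
  rwa [hz, hz0, ENNReal.toReal_ofReal (sq_nonneg _), ENNReal.toReal_ofReal (sq_nonneg _),
    Real.sqrt_sq (h.a_nonneg z), Real.sqrt_sq (h0.a_nonneg z)] at this

/-- Roots of `Y`-margins are no further apart than the roots of the joint densities. -/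
lemma IsRootAt.sqInt_sub_le_snd (h : IsRootAt μZ μY a b γ) (h0 : IsRootAt μZ μY a0 b0 γ0) :
    (sqInt μY fun y => rootMass μZ a * b y - rootMass μZ a0 * b0 y) ≤ sqInt (μZ.prod μY) fun s =>
      scaledJoint μZ μY a b γ s - scaledJoint μZ μY a0 b0 γ0 s := by
  have m := h.measurable_scaledJoint
  have m0 := h0.measurable_scaledJoint
  rw [sqInt_prod_symm (by fun_prop)]
  refine lintegral_mono_ae ?_
  filter_upwards [h.sqInt_scaledJoint_snd, h0.sqInt_scaledJoint_snd] with y hy hy0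
  have := ofReal_sqrt_sub_sq_le (μ := μZ) (f := fun z => scaledJoint μZ μY a b γ (z, y))
    (g := fun z => scaledJoint μZ μY a0 b0 γ0 (z, y))
    (m.comp measurable_prodMk_right).aestronglyMeasurable
    (m0.comp measurable_prodMk_right).aestronglyMeasurable (by rw [hy]; simp) (by rw [hy0]; simp)
  rwa [hy, hy0, ENNReal.toReal_ofReal (sq_nonneg _), ENNReal.toReal_ofReal (sq_nonneg _),
    Real.sqrt_sq (mul_nonneg rootMass_nonneg (h.b_nonneg y)),
    Real.sqrt_sq (mul_nonneg rootMass_nonneg (h0.b_nonneg y))] at this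

/-- With common margins, roots of copula densities are as far apart as roots of the joint
densities. -/
lemma IsRootAt.sqInt_sub_eq (h : IsRootAt μZ μY a b γ) (h0 : IsRootAt μZ μY a b γ0) :
    (sqInt (unitVol.prod unitVol) fun q => rootMass μZ a * γ q - rootMass μZ a * γ0 q)
      = sqInt (μZ.prod μY) fun s =>
      scaledJoint μZ μY a b γ s - scaledJoint μZ μY a b γ0 s := by
  have e : (fun s => scaledJoint μZ μY a b γ s - scaledJoint μZ μY a b γ0 s)
      = scaledJoint μZ μY a b fun q => γ q - γ0 q := by
    ext s; simp only [scaledJoint]; ring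
  rw [e, sqInt_scaledJoint h.meas_a h.fin h.nz h.meas_b h.unit (h.meas_γ.fun_sub h0.meas_γ),
    sqInt_mul_sqInt h.meas_a h.fin]
  simp only [mul_sub]

end FibreContraction

/-! ### The same comparisons for the joint density -/

section Contraction

variable {𝒳 : Type*} [MeasurableSpace 𝒳] {μZ μY : Measure ℝ} {μX : Measure 𝒳}
  {a a0 : ℝ × 𝒳 → ℝ} {b b0 : 𝒳 × ℝ → ℝ} {γ γ0 : 𝒳 × ℝ × ℝ → ℝ}

lemma measurable_rootMass_mul [SFinite μZ] {Ω : Type*} [MeasurableSpace Ω] (ha : Measurable a) {f : 𝒳 × Ω → ℝ}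
    (hf : Measurable f) : Measurable fun s : 𝒳 × Ω => (rootMass μZ fun z => a (z, s.1)) * f s := by
  have := (measurable_rootMass (μZ := μZ) ha).comp (measurable_fst : Measurable (@Prod.fst 𝒳 Ω))
  simp only [Function.comp_def] at this
  fun_prop

lemma IsRoot.measurable [SFinite μZ] [SFinite μY] (h : IsRoot μZ μX μY a b γ) : Measurable (rootDensity μZ μY a b γ) :=
  measurable_rootDensity h.meas_a h.meas_b h.meas_γ

variable [SFinite μZ] [SFinite μX] [SFinite μY] [NullSingletonClass μZ] [NullSingletonClass μY]

lemma IsRoot.sqInt_rootDensity (h : IsRoot μZ μX μY a b γ) :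
    sqInt (μZ.prod (μX.prod μY)) (rootDensity μZ μY a b γ) = sqInt (μZ.prod μX) a := by
  rw [sqInt_triple h.measurable, sqInt_prod_symm h.meas_a]
  refine lintegral_congr_ae ?_
  filter_upwards [h.fibre] with x hx
  have := sqInt_scaledJoint (μZ := μZ) (μY := μY) hx.meas_a hx.fin hx.nz hx.meas_b hx.unit hx.meas_γ
  rw [hx.sqInt_eq_one, mul_one] at this
  exact this

lemma IsRoot.sqInt_sub_le_fst (h : IsRoot μZ μX μY a b γ) (h0 : IsRoot μZ μX μY a0 b0 γ0) :
    (sqInt (μZ.prod μX) fun s => a s - a0 s) ≤ sqInt (μZ.prod (μX.prod μY)) fun s =>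
      rootDensity μZ μY a b γ s - rootDensity μZ μY a0 b0 γ0 s := by
  rw [sqInt_triple (h.measurable.fun_sub h0.measurable), sqInt_prod_symm (h.meas_a.fun_sub h0.meas_a)]
  refine lintegral_mono_ae ?_
  filter_upwards [h.fibre, h0.fibre] with x hx hx0 using hx.sqInt_sub_le_fst hx0

lemma IsRoot.sqInt_sub_le_snd (h : IsRoot μZ μX μY a b γ) (h0 : IsRoot μZ μX μY a0 b0 γ0) :
    (sqInt (μX.prod μY) fun s => (rootMass μZ fun z => a (z, s.1)) * b s
      - (rootMass μZ fun z => a0 (z, s.1)) * b0 s) ≤ sqInt (μZ.prod (μX.prod μY)) fun s =>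
      rootDensity μZ μY a b γ s - rootDensity μZ μY a0 b0 γ0 s := by
  rw [sqInt_triple (h.measurable.fun_sub h0.measurable), sqInt_prod
    ((measurable_rootMass_mul h.meas_a h.meas_b).fun_sub (measurable_rootMass_mul h0.meas_a h0.meas_b))]
  refine lintegral_mono_ae ?_
  filter_upwards [h.fibre, h0.fibre] with x hx hx0 using hx.sqInt_sub_le_snd hx0

lemma IsRoot.sqInt_sub_eq (h : IsRoot μZ μX μY a b γ) (h0 : IsRoot μZ μX μY a b γ0) :
    (sqInt (μX.prod (unitVol.prod unitVol)) fun s => (rootMass μZ fun z => a (z, s.1)) * γ s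
      - (rootMass μZ fun z => a (z, s.1)) * γ0 s) = sqInt (μZ.prod (μX.prod μY)) fun s =>
      rootDensity μZ μY a b γ s - rootDensity μZ μY a b γ0 s := by
  rw [sqInt_triple (h.measurable.fun_sub h0.measurable), sqInt_prod
    ((measurable_rootMass_mul h.meas_a h.meas_γ).fun_sub (measurable_rootMass_mul h0.meas_a h0.meas_γ))]
  refine lintegral_congr_ae ?_
  filter_upwards [h.fibre, h0.fibre] with x hx hx0 using hx.sqInt_sub_eq hx0

end Contraction

/-! ### Linear dependence on the direction -/

section Linear

variable {Ω 𝒳 : Type*} [MeasurableSpace Ω] [MeasurableSpace 𝒳]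
  {E : Type*} [NormedAddCommGroup E] [NormedSpace ℝ E] [FiniteDimensional ℝ E]

/-- A finite basis yields a single null set of fibres for all directions. -/
lemma ae_forall_sqInt_ne_top {μX : Measure 𝒳} {ν : Measure Ω} [SFinite μX] [SFinite ν]
    {D : 𝒳 × Ω → E →L[ℝ] ℝ} (hm : ∀ h, Measurable fun s => D s h)
    (hf : ∀ h, sqInt (μX.prod ν) (fun s => D s h) ≠ ∞) :
    ∀ᵐ x ∂μX, ∀ h, sqInt ν (fun ω => D (x, ω) h) ≠ ∞ := by
  let B := Module.finBasis ℝ E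
  have h1 : ∀ᵐ x ∂μX, ∀ i, sqInt ν (fun ω => D (x, ω) (B i)) < ∞ := by
    refine ae_all_iff.2 fun i => ae_lt_top (measurable_sqInt_right (hm (B i))) ?_
    rw [← sqInt_prod (hm (B i))]
    exact hf (B i)
  filter_upwards [h1] with x hx h
  have e : (fun ω => D (x, ω) h) = fun ω => ∑ i, B.repr h i * D (x, ω) (B i) := by
    ext ω
    conv_lhs => rw [← B.sum_repr h, map_sum]
    simp
  rw [e]
  refine sqInt_ne_top_of_memLp (memLp_finsetSum _ fun i _ => (memLp_of_sqInt ?_ (hx i).ne).const_mul _)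
  exact ((hm (B i)).comp measurable_prodMk_left).aestronglyMeasurable

/-- The continuous linear form with the given values, if these depend linearly on the argument. -/
def linearForm (f : E → ℝ) : E →L[ℝ] ℝ :=
  open Classical in if h : IsLinearMap ℝ f then (h.mk' f).toContinuousLinearMap else 0

lemma linearForm_apply {f : E → ℝ} (h : IsLinearMap ℝ f) (e : E) : linearForm f e = f e := by
  simp [linearForm, h]

end Linear

section Joint

variable {μZ μY : Measure ℝ}
  {E₁ E₂ E₃ : Type*} [NormedAddCommGroup E₁] [NormedSpace ℝ E₁]
  [NormedAddCommGroup E₂] [NormedSpace ℝ E₂]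
  [NormedAddCommGroup E₃] [NormedSpace ℝ E₃]

/-- The fibrewise derivative is linear in the direction. -/
lemma isLinearMap_scaledDeriv {a0 b0 : ℝ → ℝ} {γ0 γu γv : ℝ × ℝ → ℝ} {r : ℝ}
    {D₁ : ℝ → E₁ →L[ℝ] ℝ} {D₂ : ℝ → E₂ →L[ℝ] ℝ} {D₃ : ℝ × ℝ → E₃ →L[ℝ] ℝ}
    (h1 : ∀ h, Integrable (fun z => a0 z * D₁ z h) μZ)
    (h2 : ∀ h, Integrable (fun y => b0 y * D₂ y h) μY) (s : ℝ × ℝ) :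
    IsLinearMap ℝ fun h : E₁ × E₂ × E₃ => scaledDeriv μZ μY a0 (fun z => D₁ z h.1) b0
      (fun y => D₂ y h.2.1 / r) γ0 γu γv (fun q => D₃ q h.2.2 / r) s := by
  have e : ∀ h : E₂, ∫ y in Iic s.2, b0 y * (D₂ y h / r) ∂μY
      = (∫ y in Iic s.2, b0 y * D₂ y h ∂μY) / r := fun h => by
    rw [← integral_div]; simp only [mul_div_assoc]
  constructor
  · intro h k
    simp only [scaledDeriv, e]
    simp only [Prod.fst_add, Prod.snd_add, map_add, mul_add]
    rw [integral_add (h1 _).integrableOn (h1 _).integrableOn, integral_add (h1 _) (h1 _),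
      integral_add (h2 _).integrableOn (h2 _).integrableOn]
    ring
  · intro c h
    simp only [scaledDeriv, e]
    simp only [Prod.smul_fst, Prod.smul_snd, map_smul, smul_eq_mul,
      mul_left_comm _ c, integral_const_mul]
    ring

end Joint

lemma exists_seq_direction {E : Type*} [NormedAddCommGroup E] [NormedSpace ℝ E] {Θ : Set E}
    (hΘ : IsOpen Θ) {θ₀ : E} (hθ₀ : θ₀ ∈ Θ) (h : E) :
    ∃ t : ℕ → ℝ, (∀ n, t n ≠ 0) ∧ Tendsto t atTop (𝓝 0) ∧ ∀ n, θ₀ + t n • h ∈ Θ := by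
  have hc : ContinuousAt (fun r : ℝ => θ₀ + r • h) 0 := by fun_prop
  have h1 : ∀ᶠ r : ℝ in 𝓝 0, θ₀ + r • h ∈ Θ := hc.eventually (hΘ.mem_nhds (by simpa using hθ₀))
  have ht : Tendsto (fun n : ℕ => 1 / ((n : ℝ) + 1)) atTop (𝓝 0) :=
    tendsto_one_div_add_atTop_nhds_zero_nat
  obtain ⟨N, hN⟩ := eventually_atTop.1 (ht.eventually h1)
  refine ⟨fun n => 1 / (((n + N : ℕ) : ℝ) + 1), fun n => ?_, ?_, fun n => hN _ (by omega)⟩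
  · have : (0 : ℝ) < 1 / (((n + N : ℕ) : ℝ) + 1) := by positivity
    exact this.ne'
  · exact ht.comp (tendsto_add_atTop_nat N)

lemma sqInt_eq_zero_of_quotient {Ω : Type*} [MeasurableSpace Ω] {μ : Measure Ω}
    {f : ℕ → Ω → ℝ} {d : Ω → ℝ} (hf : ∀ n, Measurable (f n))
    (h1 : Tendsto (fun n => sqInt μ fun ω => f n ω - d ω) atTop (𝓝 0))
    (h2 : Tendsto (fun n => sqInt μ (f n)) atTop (𝓝 0)) : sqInt μ d = 0 := by
  have h3 : Tendsto (fun n => 2 * sqInt μ (f n) + 2 * sqInt μ fun ω => f n ω - d ω) atTop (𝓝 0) := by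
    simpa using (ENNReal.Tendsto.const_mul h2 (Or.inr (by simp : (2 : ℝ≥0∞) ≠ ∞))).add
      (ENNReal.Tendsto.const_mul h1 (Or.inr (by simp : (2 : ℝ≥0∞) ≠ ∞)))
  refine le_antisymm (ge_of_tendsto' h3 fun n => ?_) zero_le
  have := sqInt_sub_le (μ := μ) (f := f n) (g := fun ω => f n ω - d ω) (hf n).aemeasurable
  simpa using this

/-! ### The derivative of the joint root and its injectivity -/

section Joint

variable {𝒳 : Type*} [MeasurableSpace 𝒳] {μZ μY : Measure ℝ} {μX : Measure 𝒳}

lemma ae_triple [SFinite μZ] [SFinite μX] [SFinite μY] {P : 𝒳 → Prop} (h : ∀ᵐ x ∂μX, P x) :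
    ∀ᵐ s ∂(μZ.prod (μX.prod μY)), P s.2.1 :=
  ((Measure.quasiMeasurePreserving_fst (μ := μX) (ν := μY)).comp
    (Measure.quasiMeasurePreserving_snd (μ := μZ) (ν := μX.prod μY))).ae h

variable [SFinite μZ] [SFinite μX] [SFinite μY] [NullSingletonClass μZ] [NullSingletonClass μY]
  {E₁ E₂ E₃ : Type*} [NormedAddCommGroup E₁] [NormedSpace ℝ E₁]
  [NormedAddCommGroup E₂] [NormedSpace ℝ E₂]
  [NormedAddCommGroup E₃] [NormedSpace ℝ E₃]
  [FiniteDimensional ℝ E₁] [FiniteDimensional ℝ E₂] [FiniteDimensional ℝ E₃]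
  {Θ₁ : Set E₁} {Θ₂ : Set E₂} {Φ : Set E₃} {A : E₁ → ℝ × 𝒳 → ℝ} {B : E₂ → 𝒳 × ℝ → ℝ}
  {Γ : E₃ → 𝒳 × ℝ × ℝ → ℝ} {θ₀ : E₁ × E₂ × E₃}
  {D₁ : ℝ × 𝒳 → E₁ →L[ℝ] ℝ} {D₂ : 𝒳 × ℝ → E₂ →L[ℝ] ℝ} {D₃ : 𝒳 × ℝ × ℝ → E₃ →L[ℝ] ℝ}
  {γu γv : 𝒳 × ℝ × ℝ → ℝ} {K K' : ℝ}

/-- The root of the joint density is differentiable in `L²` if the roots of its pieces are. -/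
theorem exists_isRootDeriv_rootDensity [IsFiniteMeasureOnCompacts μZ]
    (hΘ₁ : IsOpen Θ₁) (hΘ₂ : IsOpen Θ₂) (hΦ : IsOpen Φ) (hθ₀ : θ₀ ∈ Θ₁ ×ˢ Θ₂ ×ˢ Φ)
    (hroot : ∀ θ ∈ Θ₁ ×ˢ Θ₂ ×ˢ Φ, IsRoot μZ μX μY (A θ.1) (B θ.2.1) (Γ θ.2.2))
    (hfin : ∀ θ ∈ Θ₁, sqInt (μZ.prod μX) (A θ) ≠ ∞)
    (h1 : IsRootDeriv (μZ.prod μX) Θ₁ A θ₀.1 D₁)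
    (h2 : IsRootDeriv (μX.prod μY) Θ₂
      (fun θ s => (rootMass μZ fun z => A θ₀.1 (z, s.1)) * B θ s) θ₀.2.1 D₂)
    (h3 : IsRootDeriv (μX.prod (unitVol.prod unitVol)) Φ
      (fun θ s => (rootMass μZ fun z => A θ₀.1 (z, s.1)) * Γ θ s) θ₀.2.2 D₃)
    (hc : IsCurveFamily μX (Γ θ₀.2.2) γu γv K K') :
    ∃ D, IsRootDeriv (μZ.prod (μX.prod μY)) (Θ₁ ×ˢ Θ₂ ×ˢ Φ)
      (fun θ => rootDensity μZ μY (A θ.1) (B θ.2.1) (Γ θ.2.2)) θ₀ D := by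
  have hr0 := hroot θ₀ hθ₀
  obtain ⟨k1, k2, k3⟩ : θ₀.1 ∈ Θ₁ ∧ θ₀.2.1 ∈ Θ₂ ∧ θ₀.2.2 ∈ Φ := id hθ₀
  set R : E₁ × E₂ × E₃ → ℝ × 𝒳 × ℝ → ℝ := fun h => rootDeriv μZ μY (A θ₀.1) (fun q => D₁ q h.1)
    (B θ₀.2.1) (fun q => D₂ q h.2.1) (Γ θ₀.2.2) γu γv (fun q => D₃ q h.2.2) with hR
  have mR : ∀ h, Measurable (R h) := fun h =>
    measurable_rootDeriv hr0.meas_a (h1.meas h.1) hr0.meas_b (h2.meas h.2.1) hr0.meas_γ hc.meas_u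
      hc.meas_v (h3.meas h.2.2)
  -- the directional derivatives are linear in the direction on almost every fibre
  have hlin : ∀ᵐ x ∂μX, ∀ z y : ℝ, IsLinearMap ℝ fun h => R h (z, x, y) := by
    filter_upwards [hr0.fibre, ae_forall_sqInt_ne_top (μX := μX) (ν := μY) h2.meas h2.fin,
      ae_forall_sqInt_ne_top (μX := μX) (ν := μZ) (D := fun s => D₁ s.swap)
      (fun h => (h1.meas h).comp measurable_swap) (fun h => by
        rw [sqInt_swap (μ := μZ) (ν := μX) (h1.meas h)]; exact h1.fin h)] with x x1 x2 x3 z y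
    refine isLinearMap_scaledDeriv (μZ := μZ) (μY := μY) (D₁ := fun z => D₁ (z, x))
      (D₂ := fun y => D₂ (x, y)) (D₃ := fun q => D₃ (x, q)) (fun h => ?_) (fun h => ?_) (z, y)
    · exact integrable_mul_of_sqInt x1.meas_a.aestronglyMeasurable
        ((h1.meas h).comp measurable_prodMk_right).aestronglyMeasurable x1.fin (x3 h)
    · exact integrable_mul_of_sqInt x1.meas_b.aestronglyMeasurable
        ((h2.meas h).comp measurable_prodMk_left).aestronglyMeasurable (by rw [x1.unit]; simp) (x2 h)
  -- The derivative has to be a linear form at every point. On a null set of fibres containing those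
  -- where linearity fails it is set to zero, and this set is taken measurable.
  obtain ⟨G, hG, hGm, hGl⟩ := hlin.exists_measurable_mem
  set G' : Set (ℝ × 𝒳 × ℝ) := {s | s.2.1 ∈ G} with hG'
  have hG'm : MeasurableSet G' := hGm.preimage (by fun_prop)
  have hG'ae : ∀ᵐ s ∂(μZ.prod (μX.prod μY)), s ∈ G' := ae_triple hG
  set D : ℝ × 𝒳 × ℝ → E₁ × E₂ × E₃ →L[ℝ] ℝ := G'.indicator fun s => linearForm fun h => R h s
    with hD
  have hDG : ∀ s ∈ G', ∀ h, D s h = R h s := fun s hs h => by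
    rw [hD, indicator_of_mem hs]
    exact linearForm_apply (hGl s.2.1 hs s.1 s.2.2) h
  have hDR : ∀ h, (fun s => D s h) = G'.indicator (R h) := fun h => by
    ext s
    by_cases hs : s ∈ G'
    · rw [indicator_of_mem hs, hDG s hs]
    · simp [hD, indicator_of_notMem hs]
  have hDae : ∀ h, (fun s => D s h) =ᵐ[μZ.prod (μX.prod μY)] R h := fun h =>
    hG'ae.mono fun s hs => hDG s hs h
  have hDm : ∀ h, Measurable fun s => D s h := fun h => by
    rw [hDR]; exact (mR h).indicator hG'm
  have key : ∀ (θ : ℕ → E₁ × E₂ × E₃) (t : ℕ → ℝ) (e : E₁ × E₂ × E₃), (∀ n, θ n ∈ Θ₁ ×ˢ Θ₂ ×ˢ Φ) →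
      (∀ n, t n ≠ 0) → Tendsto t atTop (𝓝 0) →
      Tendsto (fun n => (t n)⁻¹ • (θ n - θ₀)) atTop (𝓝 e) →
      Tendsto (fun n => sqInt (μZ.prod (μX.prod μY)) fun s =>
        (rootDensity μZ μY (A (θ n).1) (B (θ n).2.1) (Γ (θ n).2.2) s
          - rootDensity μZ μY (A θ₀.1) (B θ₀.2.1) (Γ θ₀.2.2) s) / t n - D s e) atTop (𝓝 0) := by
    intro θ t e hθ ht0 ht he
    have q1 := h1.tendsto_quotient (fun η hη => (hroot (η, θ₀.2) ⟨hη, k2, k3⟩).meas_a) k1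
      (θ := fun n => (θ n).1) (fun n => (hθ n).1) ht0 ht ((continuous_fst.tendsto e).comp he)
    have q2 := h2.tendsto_quotient (fun η hη => measurable_rootMass_mul hr0.meas_a
      (hroot (θ₀.1, η, θ₀.2.2) ⟨k1, hη, k3⟩).meas_b) k2
      (θ := fun n => (θ n).2.1) (fun n => (hθ n).2.1) ht0 ht
      ((continuous_snd.fst.tendsto e).comp he)
    have q3 := h3.tendsto_quotient (fun η hη => measurable_rootMass_mul hr0.meas_a
      (hroot (θ₀.1, θ₀.2.1, η) ⟨k1, k2, hη⟩).meas_γ) k3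
      (θ := fun n => (θ n).2.2) (fun n => (hθ n).2.2) ht0 ht
      ((continuous_snd.snd.tendsto e).comp he)
    refine (tendsto_rootDensity_quotient (μZ := μZ) (μX := μX) (μY := μY) hc
      (fun n => hroot (θ n) (hθ n)) hr0 (h1.meas e.1) (h2.meas e.2.1) (h3.meas e.2.2) (h1.fin e.1)
      (h2.fin e.2.1) (h3.fin e.2.2) ht0 ht q1 q2 q3).congr fun n => ?_
    refine sqInt_congr ?_
    filter_upwards [hDae e] with s hs
    rw [hs]
  refine ⟨D, isRootDeriv_of_tendsto_quotient (fun θ hθ => (hroot θ hθ).measurable) hθ₀ hDm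
    (fun h => ?_) key⟩
  -- Square integrability in the direction `h` is inherited from the difference quotients along the
  -- ray through `θ₀`.
  obtain ⟨t, ht0, ht, hmem⟩ := exists_seq_direction (hΘ₁.prod (hΘ₂.prod hΦ)) hθ₀ h
  have m0 := hr0.measurable (μZ := μZ) (μY := μY)
  refine sqInt_ne_top_of_tendsto (f := fun n s =>
    (rootDensity μZ μY (A (θ₀ + t n • h).1) (B (θ₀ + t n • h).2.1) (Γ (θ₀ + t n • h).2.2) s
      - rootDensity μZ μY (A θ₀.1) (B θ₀.2.1) (Γ θ₀.2.2) s) / t n) (fun n => ?_) (fun n => ?_)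
    (key (fun n => θ₀ + t n • h) t h hmem ht0 ht ?_)
  · have := (hroot _ (hmem n)).measurable (μZ := μZ) (μY := μY)
    fun_prop
  · have mn := (hroot _ (hmem n)).measurable (μZ := μZ) (μY := μY)
    rw [sqInt_div_const]
    refine ENNReal.mul_ne_top ENNReal.ofReal_ne_top (ne_top_of_le_ne_top ?_
      (sqInt_sub_le mn.aemeasurable))
    rw [(hroot _ (hmem n)).sqInt_rootDensity, hr0.sqInt_rootDensity]
    exact ENNReal.add_ne_top.2 ⟨ENNReal.mul_ne_top (by simp) (hfin _ (hmem n).1),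
      ENNReal.mul_ne_top (by simp) (hfin _ k1)⟩
  · simp [smul_smul, ht0]

/-- The derivative of the root of the joint density is injective if those of the roots of its
pieces are. -/
theorem IsRootDeriv.eq_zero_of_ae_eq_zero
    (hΘ₁ : IsOpen Θ₁) (hΘ₂ : IsOpen Θ₂) (hΦ : IsOpen Φ) (hθ₀ : θ₀ ∈ Θ₁ ×ˢ Θ₂ ×ˢ Φ)
    (hroot : ∀ θ ∈ Θ₁ ×ˢ Θ₂ ×ˢ Φ, IsRoot μZ μX μY (A θ.1) (B θ.2.1) (Γ θ.2.2))
    (h1 : IsRootDeriv (μZ.prod μX) Θ₁ A θ₀.1 D₁)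
    (h2 : IsRootDeriv (μX.prod μY) Θ₂
      (fun θ s => (rootMass μZ fun z => A θ₀.1 (z, s.1)) * B θ s) θ₀.2.1 D₂)
    (h3 : IsRootDeriv (μX.prod (unitVol.prod unitVol)) Φ
      (fun θ s => (rootMass μZ fun z => A θ₀.1 (z, s.1)) * Γ θ s) θ₀.2.2 D₃)
    (i1 : ∀ h, (∀ᵐ s ∂(μZ.prod μX), D₁ s h = 0) → h = 0)
    (i2 : ∀ h, (∀ᵐ s ∂(μX.prod μY), D₂ s h = 0) → h = 0)
    (i3 : ∀ h, (∀ᵐ s ∂(μX.prod (unitVol.prod unitVol)), D₃ s h = 0) → h = 0)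
    {D : ℝ × 𝒳 × ℝ → E₁ × E₂ × E₃ →L[ℝ] ℝ}
    (hD : IsRootDeriv (μZ.prod (μX.prod μY)) (Θ₁ ×ˢ Θ₂ ×ˢ Φ)
      (fun θ => rootDensity μZ μY (A θ.1) (B θ.2.1) (Γ θ.2.2)) θ₀ D)
    {h : E₁ × E₂ × E₃} (hz : ∀ᵐ s ∂(μZ.prod (μX.prod μY)), D s h = 0) : h = 0 := by
  have hr0 := hroot θ₀ hθ₀
  obtain ⟨k1, k2, k3⟩ : θ₀.1 ∈ Θ₁ ∧ θ₀.2.1 ∈ Θ₂ ∧ θ₀.2.2 ∈ Φ := id hθ₀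
  obtain ⟨t, ht0, ht, hmem⟩ := exists_seq_direction (hΘ₁.prod (hΘ₂.prod hΦ)) hθ₀ h
  set θ : ℕ → E₁ × E₂ × E₃ := fun n => θ₀ + t n • h with hθ
  have he : Tendsto (fun n => (t n)⁻¹ • (θ n - θ₀)) atTop (𝓝 h) := by simp [hθ, smul_smul, ht0]
  have hrn := fun n => hroot (θ n) (hmem n)
  have hS : Tendsto (fun n => ENNReal.ofReal ((t n)⁻¹ ^ 2) * sqInt (μZ.prod (μX.prod μY)) fun s =>
      rootDensity μZ μY (A (θ n).1) (B (θ n).2.1) (Γ (θ n).2.2) s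
        - rootDensity μZ μY (A θ₀.1) (B θ₀.2.1) (Γ θ₀.2.2) s) atTop (𝓝 0) := by
    refine (hD.tendsto_quotient (fun θ hθ => (hroot θ hθ).measurable) hθ₀ hmem ht0 ht he).congr
      fun n => ?_
    rw [← sqInt_div_const]
    refine sqInt_congr ?_
    filter_upwards [hz] with s hs
    rw [hs, sub_zero]
  -- A piece that moves no farther than the joint root along the ray has derivative zero when the
  -- joint root has.
  have zero_of_le : ∀ {Ω : Type _} [MeasurableSpace Ω] {μ : Measure Ω} {f : ℕ → Ω → ℝ} {f0 d : Ω → ℝ},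
      (∀ n, Measurable (f n)) → Measurable f0 → Measurable d →
      Tendsto (fun n => sqInt μ fun ω => (f n ω - f0 ω) / t n - d ω) atTop (𝓝 0) →
      (∀ n, (sqInt μ fun ω => f n ω - f0 ω) ≤ sqInt (μZ.prod (μX.prod μY)) fun s =>
        rootDensity μZ μY (A (θ n).1) (B (θ n).2.1) (Γ (θ n).2.2) s
        - rootDensity μZ μY (A θ₀.1) (B θ₀.2.1) (Γ θ₀.2.2) s) → ∀ᵐ ω ∂μ, d ω = 0 := by
    intro Ω _ μ f f0 d hf hf0 hd hl hle
    have h0 : Tendsto (fun n => sqInt μ fun ω => (f n ω - f0 ω) / t n) atTop (𝓝 0) := by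
      refine tendsto_of_tendsto_of_tendsto_of_le_of_le tendsto_const_nhds hS (fun _ => zero_le)
        fun n => ?_
      change (sqInt μ fun ω => (f n ω - f0 ω) / t n) ≤ _
      rw [sqInt_div_const]
      exact mul_le_mul' le_rfl (hle n)
    exact (sqInt_eq_zero_iff hd.aemeasurable).1 (sqInt_eq_zero_of_quotient
      (fun n => by have := hf n; fun_prop) hl h0)
  have z1 : h.1 = 0 := i1 _ (zero_of_le (fun n => (hrn n).meas_a) hr0.meas_a (h1.meas h.1)
    (h1.tendsto_quotient (fun η hη => (hroot (η, θ₀.2) ⟨hη, k2, k3⟩).meas_a) k1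
      (θ := fun n => (θ n).1) (fun n => (hmem n).1) ht0 ht ((continuous_fst.tendsto h).comp he))
    fun n => (hrn n).sqInt_sub_le_fst hr0)
  -- The order of elimination matters. Once `h.1 = 0`, the root mass is constant along the ray and
  -- the roots of the `Y`-margins carry equal weights. Once also `h.2.1 = 0`, both margins rest and
  -- the copula roots are exactly as far apart as the joint roots.
  have e1 : ∀ n, (θ n).1 = θ₀.1 := fun n => by simp [hθ, z1]
  have z2 : h.2.1 = 0 := by
    refine i2 _ (zero_of_le (fun n => measurable_rootMass_mul hr0.meas_a (hrn n).meas_b)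
      (measurable_rootMass_mul hr0.meas_a hr0.meas_b) (h2.meas h.2.1)
      (h2.tendsto_quotient (fun η hη => measurable_rootMass_mul hr0.meas_a
      (hroot (θ₀.1, η, θ₀.2.2) ⟨k1, hη, k3⟩).meas_b) k2
      (θ := fun n => (θ n).2.1) (fun n => (hmem n).2.1) ht0 ht
      ((continuous_snd.fst.tendsto h).comp he)) fun n => ?_)
    have := (hrn n).sqInt_sub_le_snd hr0
    rwa [e1] at this ⊢
  have e2 : ∀ n, (θ n).2.1 = θ₀.2.1 := fun n => by simp [hθ, z2]
  have z3 : h.2.2 = 0 := by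
    refine i3 _ (zero_of_le (fun n => measurable_rootMass_mul hr0.meas_a (hrn n).meas_γ)
      (measurable_rootMass_mul hr0.meas_a hr0.meas_γ) (h3.meas h.2.2)
      (h3.tendsto_quotient (fun η hη => measurable_rootMass_mul hr0.meas_a
      (hroot (θ₀.1, θ₀.2.1, η) ⟨k1, k2, hη⟩).meas_γ) k3
      (θ := fun n => (θ n).2.2) (fun n => (hmem n).2.2) ht0 ht
      ((continuous_snd.snd.tendsto h).comp he)) fun n => ?_)
    have h4 := hrn n
    rw [e1, e2] at h4 ⊢
    exact (h4.sqInt_sub_eq hr0).le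
  exact Prod.ext z1 (Prod.ext z2 z3)

end Joint

/-! ### Sklar's theorem on a fibre -/

section FibreCopula

variable {μZ μY : Measure ℝ} {a b : ℝ → ℝ} {γ : ℝ × ℝ → ℝ}

/-- A distribution function may have flat parts, but its level sets are null for the nowhere
vanishing density, so almost everywhere it reflects the order. -/
lemma ae_sqCdf_le_iff {μ : Measure ℝ} [NullSingletonClass μ] (ha : Measurable a)
    (h : sqInt μ a = 1) (hne : ∀ᵐ s ∂μ, a s ≠ 0) (z : ℝ) :
    ∀ᵐ s ∂μ, (sqCdf μ a s ≤ sqCdf μ a z ↔ s ≤ z) := by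
  have hno : ∀ᵐ u ∂unitVol, u ≠ sqCdf μ a z := by
    have : (volume : Measure ℝ) {sqCdf μ a z} = 0 := measure_singleton _
    exact ae_restrict_of_ae (measure_eq_zero_iff_ae_notMem.1 this)
  filter_upwards [ae_comp_sqCdf ha h hne hno] with s hs
  refine ⟨fun hle => ?_, fun hle => monotone_sqCdf ha h hle⟩
  by_contra hlt
  exact hs (le_antisymm hle (monotone_sqCdf ha h (not_le.1 hlt).le))

lemma sqCdf_le_ae_eq [NullSingletonClass μZ] [NullSingletonClass μY] (ha : Measurable a)
    (ha1 : sqInt μZ a = 1) (hane : ∀ᵐ s ∂μZ, a s ≠ 0) (hb : Measurable b) (hb1 : sqInt μY b = 1)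
    (hbne : ∀ᵐ s ∂μY, b s ≠ 0) (z y : ℝ) :
    ({s : ℝ × ℝ | sqCdf μY b s.2 ≤ sqCdf μY b y ∧ sqCdf μZ a s.1 ≤ sqCdf μZ a z} : Set (ℝ × ℝ))
      =ᵐ[μZ.prod μY] (Iic z ×ˢ Iic y : Set (ℝ × ℝ)) := by
  filter_upwards [Measure.quasiMeasurePreserving_fst.ae (ae_sqCdf_le_iff ha ha1 hane z),
    Measure.quasiMeasurePreserving_snd.ae (ae_sqCdf_le_iff hb hb1 hbne y)] with s h1 h2
  refine propext ?_
  change (sqCdf μY b s.2 ≤ sqCdf μY b y ∧ sqCdf μZ a s.1 ≤ sqCdf μZ a z) ↔ (s.1 ≤ z ∧ s.2 ≤ y)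
  rw [h1, h2, and_comm]

/-- Integrable densities on the plane with the same distribution function agree. -/
lemma ae_eq_of_setIntegral_Iic {f f' : ℝ × ℝ → ℝ} (hf : Integrable f (μZ.prod μY))
    (hf' : Integrable f' (μZ.prod μY)) (h0 : ∀ᵐ s ∂(μZ.prod μY), 0 ≤ f s)
    (h0' : ∀ᵐ s ∂(μZ.prod μY), 0 ≤ f' s)
    (h : ∀ z y, ∫ s in Iic z ×ˢ Iic y, f s ∂(μZ.prod μY) = ∫ s in Iic z ×ˢ Iic y, f' s ∂(μZ.prod μY)) :
    f =ᵐ[μZ.prod μY] f' := by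
  set μ := μZ.prod μY with hμ
  have hfin : ∀ {g : ℝ × ℝ → ℝ}, Integrable g μ →
      IsFiniteMeasure (μ.withDensity fun s => ENNReal.ofReal (g s)) := fun hg =>
    isFiniteMeasure_withDensity_ofReal hg.2
  have hap : ∀ {g : ℝ × ℝ → ℝ}, Integrable g μ → (∀ᵐ s ∂μ, 0 ≤ g s) → ∀ {S : Set (ℝ × ℝ)},
      MeasurableSet S → (μ.withDensity fun s => ENNReal.ofReal (g s)) S
        = ENNReal.ofReal (∫ s in S, g s ∂μ) := fun {g} hg hg0 {S} hS => by
    rw [withDensity_apply _ hS,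
      ofReal_integral_eq_lintegral_ofReal hg.integrableOn (ae_restrict_of_ae hg0)]
  have := hfin hf
  have := hfin hf'
  have e1 : ∀ z y, (μ.withDensity fun s => ENNReal.ofReal (f s)) (Iic z ×ˢ Iic y)
      = (μ.withDensity fun s => ENNReal.ofReal (f' s)) (Iic z ×ˢ Iic y) := fun z y => by
    rw [hap hf h0 (measurableSet_Iic.prod measurableSet_Iic),
      hap hf' h0' (measurableSet_Iic.prod measurableSet_Iic), h]
  have e2 : (μ.withDensity fun s => ENNReal.ofReal (f s))
      = μ.withDensity fun s => ENNReal.ofReal (f' s) := by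
    set P := μ.withDensity fun s => ENNReal.ofReal (f s)
    set Q := μ.withDensity fun s => ENNReal.ofReal (f' s)
    -- Half-lines determine a finite measure on the line; this is used in one coordinate at a time.
    have s1 : ∀ y : ℝ, ∀ {A : Set ℝ}, MeasurableSet A → P (A ×ˢ Iic y) = Q (A ×ˢ Iic y) := by
      intro y A hA
      have e : (P.restrict (univ ×ˢ Iic y)).map Prod.fst = (Q.restrict (univ ×ˢ Iic y)).map Prod.fst := by
        refine Measure.ext_of_Iic _ _ fun z => ?_
        rw [Measure.map_apply measurable_fst measurableSet_Iic,
          Measure.map_apply measurable_fst measurableSet_Iic,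
          Measure.restrict_apply (measurable_fst measurableSet_Iic),
          Measure.restrict_apply (measurable_fst measurableSet_Iic)]
        convert e1 z y using 2 <;> (ext s; simp [Prod.le_def])
      have e3 := congrArg (fun ν => ν A) e
      simp only [Measure.map_apply measurable_fst hA,
        Measure.restrict_apply (measurable_fst hA)] at e3
      convert e3 using 2 <;> (ext s; simp)
    refine Measure.ext_prod fun {A B} hA hB => ?_
    have e : (P.restrict (A ×ˢ univ)).map Prod.snd = (Q.restrict (A ×ˢ univ)).map Prod.snd := by
      refine Measure.ext_of_Iic _ _ fun y => ?_
      rw [Measure.map_apply measurable_snd measurableSet_Iic,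
        Measure.map_apply measurable_snd measurableSet_Iic,
        Measure.restrict_apply (measurable_snd measurableSet_Iic),
        Measure.restrict_apply (measurable_snd measurableSet_Iic)]
      convert s1 y hA using 2 <;> (ext s; simp [and_comm])
    have e3 := congrArg (fun ν => ν B) e
    simp only [Measure.map_apply measurable_snd hB,
      Measure.restrict_apply (measurable_snd hB)] at e3
    convert e3 using 2 <;> (ext s; simp [and_comm])
  have hfm : AEMeasurable f μ := hf.aemeasurable
  have hfm' : AEMeasurable f' μ := hf'.aemeasurable
  have hne : ∫⁻ s, ENNReal.ofReal (f s) ∂μ ≠ ∞ := by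
    rw [← ofReal_integral_eq_lintegral_ofReal hf h0]; simp
  have := (withDensity_eq_iff (by fun_prop) (by fun_prop) hne).1 e2
  filter_upwards [this, h0, h0'] with s e e0 e0'
  rwa [ENNReal.ofReal_eq_ofReal_iff e0 e0'] at e

variable [SFinite μZ] [SFinite μY]

/-- The distribution functions in `IsCopulaOf` are replaced by those of the known margins `a ^ 2`
and `b ^ 2`. -/
lemma isCopulaOf_iff {f : ℝ × ℝ → ℝ} {r C : ℝ → ℝ → ℝ} (hf : Integrable f (μZ.prod μY))
    (hr : ∀ᵐ s ∂(μZ.prod μY), r s.1 s.2 = f s) (hz : ∀ᵐ z ∂μZ, ∫ y, f (z, y) ∂μY = a z ^ 2)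
    (hy : ∀ᵐ y ∂μY, ∫ z, f (z, y) ∂μZ = b y ^ 2) :
    IsCopulaOf μZ μY r C ↔ ∀ u ∈ Icc (0 : ℝ) 1, ∀ v ∈ Icc (0 : ℝ) 1,
      ∫ s in {s : ℝ × ℝ | sqCdf μY b s.2 ≤ u ∧ sqCdf μZ a s.1 ≤ v}, f s ∂(μZ.prod μY) = C u v := by
  have hset : ∀ S : Set (ℝ × ℝ), ∫ s in S, r s.1 s.2 ∂(μZ.prod μY) = ∫ s in S, f s ∂(μZ.prod μY) :=
    fun S => integral_congr_ae (ae_restrict_of_ae hr)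
  have hFZ : ∀ z, ∫ s in Iic z ×ˢ univ, f s ∂(μZ.prod μY) = sqCdf μZ a z := fun z => by
    rw [setIntegral_prod _ hf.integrableOn, sqCdf]
    simp only [Measure.restrict_univ]
    exact integral_congr_ae (ae_restrict_of_ae hz)
  have hFY : ∀ y, ∫ s in univ ×ˢ Iic y, f s ∂(μZ.prod μY) = sqCdf μY b y := fun y => by
    have h1 : Integrable f (μZ.prod (μY.restrict (Iic y))) := by
      have := hf.integrableOn (s := univ ×ˢ Iic y)
      rwa [IntegrableOn, ← Measure.prod_restrict, Measure.restrict_univ] at this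
    rw [← Measure.prod_restrict, Measure.restrict_univ, integral_prod_symm _ h1, sqCdf]
    exact integral_congr_ae (ae_restrict_of_ae hy)
  simp only [IsCopulaOf, hset, hFZ, hFY]

variable [NullSingletonClass μZ] [NullSingletonClass μY]

/-- Cutting off at levels `u` and `v` amounts to cutting off the copula root to a rectangle, and the
norm of a joint root is known for any `γ`. -/
lemma IsRootAt.setIntegral_sq (h : IsRootAt μZ μY a b γ) (u v : ℝ) :
    ∫ s in {s : ℝ × ℝ | sqCdf μY b s.2 ≤ u ∧ sqCdf μZ (normalize μZ a) s.1 ≤ v},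
      scaledJoint μZ μY a b γ s ^ 2 ∂(μZ.prod μY) = rootMass μZ a ^ 2 *
        (∫⁻ q in Iic u ×ˢ Iic v, ENNReal.ofReal (γ q ^ 2) ∂(unitVol.prod unitVol)).toReal := by
  have m := h.measurable_scaledJoint
  have mV := measurable_sqCdf (measurable_normalize h.meas_a) (sqInt_normalize h.meas_a h.fin h.nz)
  have mU := measurable_sqCdf h.meas_b h.unit
  have hγ := h.meas_γ
  set S : Set (ℝ × ℝ) := {s | sqCdf μY b s.2 ≤ u ∧ sqCdf μZ (normalize μZ a) s.1 ≤ v} with hS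
  have hSm : MeasurableSet S :=
    (measurableSet_le (mU.comp measurable_snd) measurable_const).inter
      (measurableSet_le (mV.comp measurable_fst) measurable_const)
  have hTm : MeasurableSet (Iic u ×ˢ Iic v : Set (ℝ × ℝ)) := measurableSet_Iic.prod measurableSet_Iic
  have ind : ∀ {Ω : Type} [MeasurableSpace Ω] {μ : Measure Ω} {f : Ω → ℝ} {T : Set Ω},
      MeasurableSet T → ∫⁻ s in T, ENNReal.ofReal (f s ^ 2) ∂μ = sqInt μ (T.indicator f) := by
    intro Ω _ μ f T hT
    rw [← lintegral_indicator hT]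
    refine lintegral_congr fun s => ?_
    by_cases hs : s ∈ T <;> simp [hs]
  have e : S.indicator (scaledJoint μZ μY a b γ)
      = scaledJoint μZ μY a b ((Iic u ×ˢ Iic v : Set (ℝ × ℝ)).indicator γ) := by
    ext s
    by_cases hs : s ∈ S
    · have hs' : (sqCdf μY b s.2, sqCdf μZ (normalize μZ a) s.1) ∈ (Iic u ×ˢ Iic v : Set (ℝ × ℝ)) := hs
      simp only [scaledJoint, indicator_of_mem hs, indicator_of_mem hs']
    · have hs' : (sqCdf μY b s.2, sqCdf μZ (normalize μZ a) s.1) ∉ (Iic u ×ˢ Iic v : Set (ℝ × ℝ)) := hs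
      simp only [scaledJoint, indicator_of_notMem hs, indicator_of_notMem hs', mul_zero]
  rw [integral_eq_lintegral_of_nonneg_ae (ae_of_all _ fun _ => sq_nonneg _)
    (by fun_prop), ind hSm, ind hTm, e, sqInt_scaledJoint h.meas_a h.fin h.nz h.meas_b h.unit
    (hγ.indicator hTm), ENNReal.toReal_mul, rootMass_sq,
    integral_sq_eq_toReal h.meas_a.aestronglyMeasurable]

end FibreCopula

/-! ### Null sets, fibre by fibre -/

section AlmostEverywhere

variable {𝒳 : Type*} [MeasurableSpace 𝒳] {μZ μY : Measure ℝ} {μX : Measure 𝒳}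
  [SFinite μZ] [SFinite μX] [SFinite μY]

lemma ae_triple_iff {S : Set (ℝ × 𝒳 × ℝ)} (hS : MeasurableSet S) :
    (∀ᵐ s ∂(μZ.prod (μX.prod μY)), s ∈ S)
      ↔ ∀ᵐ x ∂μX, ∀ᵐ s ∂(μZ.prod μY), (s.1, x, s.2) ∈ S := by
  have h1 : (∀ᵐ s ∂(μZ.prod (μX.prod μY)), s ∈ S)
      ↔ ∫⁻ s, Sᶜ.indicator 1 s ∂(μZ.prod (μX.prod μY)) = 0 := by
    rw [lintegral_indicator_one hS.compl]; rfl
  have h2 : ∀ x, (∀ᵐ s ∂(μZ.prod μY), (s.1, x, s.2) ∈ S)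
      ↔ ∫⁻ s, Sᶜ.indicator (1 : ℝ × 𝒳 × ℝ → ℝ≥0∞) (s.1, x, s.2) ∂(μZ.prod μY) = 0 := fun x => by
    have hm : MeasurableSet {s : ℝ × ℝ | (s.1, x, s.2) ∈ Sᶜ} := hS.compl.preimage (by fun_prop)
    have : (fun s : ℝ × ℝ => Sᶜ.indicator (1 : ℝ × 𝒳 × ℝ → ℝ≥0∞) (s.1, x, s.2))
        = {s : ℝ × ℝ | (s.1, x, s.2) ∈ Sᶜ}.indicator 1 := rfl
    rw [this, lintegral_indicator_one hm]
    rfl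
  have hm : Measurable (Sᶜ.indicator (1 : ℝ × 𝒳 × ℝ → ℝ≥0∞)) := measurable_one.indicator hS.compl
  rw [h1, lintegral_triple hm, lintegral_eq_zero_iff]
  · exact ⟨fun h => h.mono fun x hx => (h2 x).2 hx, fun h => h.mono fun x hx => (h2 x).1 hx⟩
  · exact Measurable.lintegral_prod_right' (f := fun s : 𝒳 × ℝ × ℝ =>
      Sᶜ.indicator (1 : ℝ × 𝒳 × ℝ → ℝ≥0∞) (s.2.1, s.1, s.2.2))
      (hm.comp (f := fun s : 𝒳 × ℝ × ℝ => (s.2.1, s.1, s.2.2)) (by fun_prop))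

lemma ae_swap_iff {S : Set (ℝ × 𝒳)} (hS : MeasurableSet S) :
    (∀ᵐ s ∂(μZ.prod μX), s ∈ S) ↔ ∀ᵐ x ∂μX, ∀ᵐ z ∂μZ, (z, x) ∈ S := by
  refine Iff.trans ?_ (Measure.ae_prod_iff_ae_ae (μ := μX) (ν := μZ)
    (p := fun s : 𝒳 × ℝ => s.swap ∈ S) (hS.preimage measurable_swap))
  rw [← Measure.prod_swap]
  exact ae_map_iff (p := fun s => s ∈ S) measurable_swap.aemeasurable hS

end AlmostEverywhere

/-! ### Existence and uniqueness of the joint density -/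

section Model

variable {𝒳 : Type*} [MeasurableSpace 𝒳]

/-- A positive density of `(Z, X)`, positive conditional densities of `Y` given `X`, and conditional
copulas with positive densities. -/
structure IsModel (μZ : Measure ℝ) (μX : Measure 𝒳) (μY : Measure ℝ) (p : ℝ × 𝒳 → ℝ)
    (k : 𝒳 → ℝ → ℝ) (C c : 𝒳 → ℝ → ℝ → ℝ) : Prop where
  p_density : IsDensity (μZ.prod μX) p
  p_pos : ∀ x, ∀ᵐ z ∂μZ, 0 < p (z, x)
  k_meas : Measurable fun s : 𝒳 × ℝ => k s.1 s.2
  k_density : ∀ x, IsDensity μY (k x)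
  k_pos : ∀ x, ∀ᵐ y ∂μY, 0 < k x y
  copula : ∀ x, IsCopula (C x)
  c_meas : Measurable fun s : 𝒳 × ℝ × ℝ => c s.1 s.2.1 s.2.2
  c_density : ∀ x, HasCopulaDensity (C x) (c x)
  c_pos : ∀ x, ∀ u ∈ Ioo (0 : ℝ) 1, ∀ v ∈ Ioo (0 : ℝ) 1, 0 < c x u v

/-- The joint density of `(Z, X, Y)` with the given pieces. -/
def jointDensity (μZ μY : Measure ℝ) (p : ℝ × 𝒳 → ℝ) (k : 𝒳 → ℝ → ℝ) (c : 𝒳 → ℝ → ℝ → ℝ)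
    (s : ℝ × 𝒳 × ℝ) : ℝ :=
  rootDensity μZ μY (fun s => √(p s)) (fun s => √(k s.1 s.2)) (fun s => √(c s.1 s.2.1 s.2.2)) s ^ 2

variable {μZ μY : Measure ℝ} {μX : Measure 𝒳} {p : ℝ × 𝒳 → ℝ} {k : 𝒳 → ℝ → ℝ}
  {C c : 𝒳 → ℝ → ℝ → ℝ}

lemma sqrt_jointDensity {𝒳 : Type*} {p : ℝ × 𝒳 → ℝ} {k : 𝒳 → ℝ → ℝ} {c : 𝒳 → ℝ → ℝ → ℝ}
    (s : ℝ × 𝒳 × ℝ) : √(jointDensity μZ μY p k c s) = rootDensity μZ μY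
    (fun s => √(p s)) (fun s => √(k s.1 s.2)) (fun s => √(c s.1 s.2.1 s.2.2)) s := by
  refine Real.sqrt_sq ?_
  unfold rootDensity scaledJoint
  positivity

lemma sqInt_sqrt {Ω : Type*} [MeasurableSpace Ω] {μ : Measure Ω} {f : Ω → ℝ}
    (h : ∀ᵐ ω ∂μ, 0 ≤ f ω) : sqInt μ (fun ω => √(f ω)) = ∫⁻ ω, ENNReal.ofReal (f ω) ∂μ := by
  refine lintegral_congr_ae ?_
  filter_upwards [h] with ω hω
  rw [Real.sq_sqrt hω]

lemma IsModel.rootMass_sq (h : IsModel μZ μX μY p k C c) (x : 𝒳) :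
    (rootMass μZ fun z => √(p (z, x))) ^ 2 = margX μZ p x := by
  rw [Frugal.rootMass_sq, margX]
  refine integral_congr_ae ?_
  filter_upwards [h.p_pos x] with z hz using Real.sq_sqrt hz.le

lemma IsModel.isRoot [SFinite μZ] [SFinite μX] (h : IsModel μZ μX μY p k C c) :
    IsRoot μZ μX μY (fun s => √(p s)) (fun s => √(k s.1 s.2))
      (fun s => √(c s.1 s.2.1 s.2.2)) where
  meas_a := h.p_density.measurable.sqrt
  meas_b := h.k_meas.sqrt
  meas_γ := h.c_meas.sqrt
  fibre := by
    have hp := h.p_density.measurable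
    have h1 : ∫⁻ x, ∫⁻ z, ENNReal.ofReal (p (z, x)) ∂μZ ∂μX ≠ ∞ := by
      rw [← lintegral_prod_symm (fun s => ENNReal.ofReal (p s)) (by fun_prop), h.p_density.total]
      simp
    have h2 : Measurable fun x => ∫⁻ z, ENNReal.ofReal (p (z, x)) ∂μZ :=
      Measurable.lintegral_prod_right' (f := fun s : 𝒳 × ℝ => ENNReal.ofReal (p s.swap))
        (by fun_prop)
    -- Slices are positive, so they can have norm zero only if `μZ` vanishes, which the total mass
    -- one excludes.
    have hμ : μZ ≠ 0 := by
      rintro rfl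
      have := h.p_density.total
      simp at this
    filter_upwards [ae_lt_top h2 h1] with x hx
    have hc := h.c_meas.comp (measurable_prodMk_left (x := x))
    have hc2 : Measurable fun s : ℝ × ℝ => c x s.1 s.2 := hc
    refine ⟨(hp.comp measurable_prodMk_right).sqrt, (h.k_density x).measurable.sqrt, hc.sqrt, ?_, ?_,
      ?_, ?_, ?_, fun _ => Real.sqrt_nonneg _, fun _ => Real.sqrt_nonneg _, ?_, ?_⟩
    · rw [sqInt_sqrt ((h.p_pos x).mono fun z hz => hz.le)]
      exact hx.ne
    · have mpx : Measurable fun z => √(p (z, x)) := by fun_prop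
      rw [Ne, sqInt_eq_zero_iff mpx.aemeasurable]
      intro h0
      have : ∀ᵐ z ∂μZ, False := by
        filter_upwards [h0, h.p_pos x] with z h1 h2
        exact (Real.sqrt_pos.2 h2).ne' h1
      exact hμ (by simpa using this)
    · exact (h.p_pos x).mono fun z hz => (Real.sqrt_pos.2 hz).ne'
    · rw [sqInt_sqrt (h.k_density x).nonneg, (h.k_density x).total]
    · exact (h.k_pos x).mono fun z hz => (Real.sqrt_pos.2 hz).ne'
    · filter_upwards [(h.c_density x).margin_left (h.copula x) hc2 (h.c_pos x), ae_unitVol_mem]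
        with u hu hu'
      rw [← hu]
      exact sqInt_sqrt (ae_unitVol_mem.mono fun v hv => (h.c_pos x u hu' v hv).le)
    · obtain ⟨s1, s2⟩ := (h.c_density x).swap (h.copula x)
      filter_upwards [s2.margin_left s1 (hc2.comp measurable_swap)
        fun u hu v hv => h.c_pos x v hv u hu, ae_unitVol_mem] with v hv hv'
      rw [← hv]
      exact sqInt_sqrt (ae_unitVol_mem.mono fun u hu => (h.c_pos x u hu v hv').le)

/-- The conditional density of `Z` given `X` is a density. -/
lemma IsModel.isDensity_condZ [SFinite μZ] [SFinite μX] (h : IsModel μZ μX μY p k C c) :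
    ∀ᵐ x ∂μX, IsDensity μZ fun z => condZ μZ p z x := by
  filter_upwards [h.isRoot.fibre] with x hx
  have mp := h.p_density.measurable
  have hm : 0 < margX μZ p x := by
    rw [← h.rootMass_sq]
    have := rootMass_pos hx.meas_a hx.fin hx.nz
    positivity
  refine ⟨?_, ?_, ?_⟩
  · unfold condZ
    fun_prop
  · filter_upwards [h.p_pos x] with z hz using div_nonneg hz.le hm.le
  · rw [← sqInt_normalize hx.meas_a hx.fin hx.nz]
    refine lintegral_congr_ae ?_
    filter_upwards [h.p_pos x] with z hz
    rw [normalize, div_pow, h.rootMass_sq, Real.sq_sqrt hz.le, condZ]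

variable [SFinite μZ] [SFinite μX] [SFinite μY]

lemma measurable_margZX {q : ℝ × 𝒳 × ℝ → ℝ} (hq : Measurable q) : Measurable (margZX μY q) :=
  (StronglyMeasurable.integral_prod_right' (f := fun s : (ℝ × 𝒳) × ℝ => q (s.1.1, s.1.2, s.2))
    (by fun_prop)).measurable

/-- The fibres of a density with the `(Z, X)`-margin of the model. -/
lemma IsModel.ae_fibre (h : IsModel μZ μX μY p k C c) {q : ℝ × 𝒳 × ℝ → ℝ}
    (hq : IsDensity (μZ.prod (μX.prod μY)) q) (hpast : margZX μY q =ᵐ[μZ.prod μX] p) :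
    ∀ᵐ x ∂μX, 0 < margX μZ p x ∧
      Integrable (fun s : ℝ × ℝ => q (s.1, x, s.2) / margX μZ p x) (μZ.prod μY) ∧
      (∀ᵐ s ∂(μZ.prod μY), 0 ≤ q (s.1, x, s.2) / margX μZ p x) ∧
      (∀ᵐ z ∂μZ, ∀ y, causal μY q (condZ μZ p) x z y = q (z, x, y) / margX μZ p x) ∧
      ∀ᵐ z ∂μZ, ∫ y, q (z, x, y) / margX μZ p x ∂μY
        = (normalize μZ fun z => √(p (z, x))) z ^ 2 := by
  have mq := hq.measurable
  have mp := h.p_density.measurable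
  have a1 := (ae_triple_iff (measurableSet_le measurable_const mq)).1 hq.nonneg
  have a2 := (ae_swap_iff (measurableSet_eq_fun (measurable_margZX (μY := μY) mq) mp)).1 hpast
  have h1 : ∫⁻ x, ∫⁻ s, ENNReal.ofReal (q (s.1, x, s.2)) ∂(μZ.prod μY) ∂μX ≠ ∞ := by
    rw [← lintegral_triple (F := fun s => ENNReal.ofReal (q s)) (by fun_prop), hq.total]
    simp
  have h2 : Measurable fun x => ∫⁻ s, ENNReal.ofReal (q (s.1, x, s.2)) ∂(μZ.prod μY) :=
    Measurable.lintegral_prod_right' (f := fun s : 𝒳 × ℝ × ℝ =>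
      ENNReal.ofReal (q (s.2.1, s.1, s.2.2))) (by fun_prop)
  filter_upwards [a1, a2, ae_lt_top h2 h1, h.isRoot.fibre] with x x1 x2 x3 x4
  have hm : 0 < margX μZ p x := by
    rw [← h.rootMass_sq]
    have := rootMass_pos x4.meas_a x4.fin x4.nz
    positivity
  have mf : Measurable fun s : ℝ × ℝ => q (s.1, x, s.2) := by fun_prop
  refine ⟨hm, ?_, ?_, ?_, ?_⟩
  · refine Integrable.div_const ⟨mf.aestronglyMeasurable, ?_⟩ _
    rw [hasFiniteIntegral_iff_ofReal x1]
    exact x3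
  · filter_upwards [x1] with s hs using div_nonneg hs hm.le
  -- With the model's own conditional density as weight the reweighting cancels: `q / p * (p / p_X)
  -- = q / p_X`.
  · filter_upwards [x2, h.p_pos x] with z hz hz' y
    rw [causal, condY, condZ, show margZX μY q (z, x) = p (z, x) from hz]
    field_simp
  · filter_upwards [x2, h.p_pos x] with z hz hz'
    rw [integral_div, normalize, div_pow, h.rootMass_sq, Real.sq_sqrt hz'.le, ← hz]
    rfl

variable [NullSingletonClass μZ] [NullSingletonClass μY]

/-- The pieces determine the joint density. -/
theorem IsModel.ae_eq (h : IsModel μZ μX μY p k C c) {q q' : ℝ × 𝒳 × ℝ → ℝ}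
    (hq : HasPieces μZ μX μY q (condZ μZ p) p k C)
    (hq' : HasPieces μZ μX μY q' (condZ μZ p) p k C) :
    q' =ᵐ[μZ.prod (μX.prod μY)] q := by
  refine (ae_triple_iff (S := {s | q' s = q s})
    (measurableSet_eq_fun hq'.density.measurable hq.density.measurable)).2 ?_
  -- On a fibre the distribution function is the copula at the distribution functions of the
  -- margins, hence the same for all densities with the given pieces.
  have key : ∀ {q : ℝ × 𝒳 × ℝ → ℝ}, HasPieces μZ μX μY q (condZ μZ p) p k C → ∀ᵐ x ∂μX,
      ∀ z y, ∫ s in Iic z ×ˢ Iic y, q (s.1, x, s.2) / margX μZ p x ∂(μZ.prod μY)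
        = C x (sqCdf μY (fun y => √(k x y)) y) (sqCdf μZ (normalize μZ fun z => √(p (z, x))) z) := by
    intro q hq
    filter_upwards [h.ae_fibre hq.density hq.past, hq.association,
      Measure.ae_ae_of_ae_prod hq.kernel, h.isRoot.fibre] with x ⟨x1, x2, x3, x4, x5⟩ x6 x7 x8 z y
    have hN := sqInt_normalize x8.meas_a x8.fin x8.nz
    have hm := measurable_normalize (μ := μZ) x8.meas_a
    have hr : ∀ᵐ s ∂(μZ.prod μY), causal μY q (condZ μZ p) x s.1 s.2
        = q (s.1, x, s.2) / margX μZ p x :=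
      Measure.quasiMeasurePreserving_fst.ae (x4.mono fun z hz => hz) |>.mono fun s hs => hs s.2
    have hy : ∀ᵐ y ∂μY, ∫ z, q (z, x, y) / margX μZ p x ∂μZ = √(k x y) ^ 2 := by
      filter_upwards [x7, h.k_pos x] with y hy hy'
      rw [Real.sq_sqrt hy'.le, ← hy, cognate]
      refine integral_congr_ae ?_
      filter_upwards [x4] with z hz using (hz y).symm
    have hC := (isCopulaOf_iff x2 hr x5 hy).1 x6 _
      ⟨sqCdf_nonneg _, sqCdf_le_one x8.meas_b x8.unit y⟩ _ ⟨sqCdf_nonneg _, sqCdf_le_one hm hN z⟩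
    rwa [setIntegral_congr_set (sqCdf_le_ae_eq hm hN (normalize_ne_zero x8.meas_a x8.fin x8.nz x8.ane)
      x8.meas_b x8.unit x8.bne z y)] at hC
  filter_upwards [h.ae_fibre hq.density hq.past, h.ae_fibre hq'.density hq'.past, key hq, key hq']
    with x ⟨x1, x2, x3, _, _⟩ ⟨_, x2', x3', _, _⟩ k1 k2
  filter_upwards [ae_eq_of_setIntegral_Iic x2 x2' x3 x3' fun z y => (k1 z y).trans (k2 z y).symm]
    with s hs
  have := congrArg (· * margX μZ p x) hs
  simp only [div_mul_cancel₀ _ x1.ne'] at this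
  exact this.symm

/-- The joint density has the prescribed pieces. -/
theorem IsModel.hasPieces (h : IsModel μZ μX μY p k C c) :
    HasPieces μZ μX μY (jointDensity μZ μY p k c) (condZ μZ p) p k C := by
  have hr := h.isRoot
  have mq : Measurable (jointDensity μZ μY p k c) := hr.measurable.pow_const 2
  have mp := h.p_density.measurable
  have hdens : IsDensity (μZ.prod (μX.prod μY)) (jointDensity μZ μY p k c) := by
    refine ⟨mq, ae_of_all _ fun _ => sq_nonneg _, ?_⟩
    have := hr.sqInt_rootDensity
    rw [sqInt_sqrt h.p_density.nonneg, h.p_density.total] at this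
    exact this
  have hpast : margZX μY (jointDensity μZ μY p k c) =ᵐ[μZ.prod μX] p := by
    refine (ae_swap_iff (S := {s | margZX μY (jointDensity μZ μY p k c) s = p s})
      (measurableSet_eq_fun (measurable_margZX mq) mp)).2 ?_
    filter_upwards [hr.fibre] with x hx
    filter_upwards [hx.sqInt_scaledJoint_fst, h.p_pos x] with z hz hz'
    have m := hx.measurable_scaledJoint.comp (measurable_prodMk_left (x := z))
    have e : margZX μY (jointDensity μZ μY p k c) (z, x) = _ :=
      (integral_sq_eq_toReal (μ := μY) m.aestronglyMeasurable).trans (congrArg ENNReal.toReal hz)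
    change margZX μY (jointDensity μZ μY p k c) (z, x) = p (z, x)
    rw [e, ENNReal.toReal_ofReal (sq_nonneg _), Real.sq_sqrt hz'.le]
  have hfib := h.ae_fibre hdens hpast
  have hker : ∀ᵐ x ∂μX, ∀ᵐ y ∂μY,
      ∫ z, jointDensity μZ μY p k c (z, x, y) / margX μZ p x ∂μZ = k x y := by
    filter_upwards [hr.fibre, hfib] with x hx ⟨hm, _⟩
    filter_upwards [hx.sqInt_scaledJoint_snd, h.k_pos x] with y hy hy'
    have m := hx.measurable_scaledJoint.comp (measurable_prodMk_right (y := y))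
    have e : ∫ z, jointDensity μZ μY p k c (z, x, y) ∂μZ = _ :=
      (integral_sq_eq_toReal (μ := μZ) m.aestronglyMeasurable).trans (congrArg ENNReal.toReal hy)
    rw [integral_div, e, ENNReal.toReal_ofReal (sq_nonneg _), mul_pow, h.rootMass_sq, Real.sq_sqrt hy'.le]
    field_simp
  refine ⟨hdens, hpast, ?_, ?_⟩
  · have mX : Measurable (margX μZ p) :=
      (StronglyMeasurable.integral_prod_right' (f := fun s : 𝒳 × ℝ => p s.swap)
        (by fun_prop)).measurable
    have mc : Measurable fun s : 𝒳 × ℝ =>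
        cognate μZ μY (jointDensity μZ μY p k c) (condZ μZ p) s.1 s.2 := by
      have m1 : Measurable fun s : (𝒳 × ℝ) × ℝ => margZX μY (jointDensity μZ μY p k c) (s.2, s.1.1) :=
        (measurable_margZX mq).comp (by fun_prop)
      have m2 : Measurable fun s : (𝒳 × ℝ) × ℝ => margX μZ p s.1.1 := mX.comp (by fun_prop)
      refine (StronglyMeasurable.integral_prod_right' (f := fun s : (𝒳 × ℝ) × ℝ =>
        causal μY (jointDensity μZ μY p k c) (condZ μZ p) s.1.1 s.2 s.1.2) ?_).measurable
      unfold causal condY condZ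
      fun_prop
    refine (Measure.ae_prod_iff_ae_ae (measurableSet_eq_fun mc h.k_meas)).2 ?_
    filter_upwards [hker, hfib] with x hx ⟨_, _, _, x4, _⟩
    filter_upwards [hx] with y hy
    rw [← hy, cognate]
    refine integral_congr_ae ?_
    filter_upwards [x4] with z hz using hz y
  · filter_upwards [hr.fibre, hfib, hker] with x hx ⟨x1, x2, x3, x4, x5⟩ x6
    have hs : ∀ᵐ s ∂(μZ.prod μY), causal μY (jointDensity μZ μY p k c) (condZ μZ p) x s.1 s.2
        = jointDensity μZ μY p k c (s.1, x, s.2) / margX μZ p x :=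
      Measure.quasiMeasurePreserving_fst.ae (x4.mono fun z hz => hz) |>.mono fun s hs => hs s.2
    refine (isCopulaOf_iff (b := fun y => √(k x y)) x2 hs x5 ?_).2 fun u hu v hv => ?_
    · filter_upwards [x6, h.k_pos x] with y hy hy'
      rw [Real.sq_sqrt hy'.le, hy]
    · have h1 := hx.setIntegral_sq u v
      have h2 := (h.c_density x).setLIntegral (h.copula x) (h.c_pos x) hu hv
      have h3 : ∫⁻ q in Iic u ×ˢ Iic v, ENNReal.ofReal (√(c x q.1 q.2) ^ 2) ∂(unitVol.prod unitVol)
          = ENNReal.ofReal (C x u v) := by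
        rw [← h2]
        refine lintegral_congr_ae (ae_restrict_of_ae ?_)
        filter_upwards [Measure.quasiMeasurePreserving_fst.ae ae_unitVol_mem,
          Measure.quasiMeasurePreserving_snd.ae ae_unitVol_mem] with q hq1 hq2
        rw [Real.sq_sqrt (h.c_pos x _ hq1 _ hq2).le]
      -- The rectangle inequality with lower corner `(0, 0)`.
      have hC0 : 0 ≤ C x u v := by
        have := (h.copula x).two_increasing 0 (by simp) u hu 0 (by simp) v hv hu.1 hv.1
        rw [(h.copula x).zero_right u hu, (h.copula x).zero_left v hv,
          (h.copula x).zero_left 0 (by simp)] at this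
        linarith
      rw [h3, ENNReal.toReal_ofReal hC0, h.rootMass_sq] at h1
      rw [integral_div]
      refine (div_eq_iff x1.ne').2 ?_
      rw [mul_comm, ← h1]
      rfl

end Model

/-! ### Curves, weights and positivity in a model -/

section Model

variable {𝒳 : Type*} [MeasurableSpace 𝒳] {μZ μY : Measure ℝ} {μX : Measure 𝒳} {p : ℝ × 𝒳 → ℝ}
  {k : 𝒳 → ℝ → ℝ} {C c : 𝒳 → ℝ → ℝ → ℝ}

/-- Smooth positive conditional copula densities have roots that are curves in `L²`. -/
lemma SmoothInArguments.exists_isCurveFamily (hs : SmoothInArguments c)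
    (hC : ∀ x, IsCopula (C x)) (hm : Measurable fun s : 𝒳 × ℝ × ℝ => c s.1 s.2.1 s.2.2)
    (hc : ∀ x, HasCopulaDensity (C x) (c x))
    (hpos : ∀ x, ∀ u ∈ Ioo (0 : ℝ) 1, ∀ v ∈ Ioo (0 : ℝ) 1, 0 < c x u v) :
    ∃ γu γv K K', IsCurveFamily μX (fun s : 𝒳 × ℝ × ℝ => √(c s.1 s.2.1 s.2.2)) γu γv K K' := by
  obtain ⟨K, hK⟩ := hs.score_left
  obtain ⟨K', hK'⟩ := hs.score_right
  have hsw : ∀ x, ContDiffOn ℝ 1 (fun s : ℝ × ℝ => c x s.2 s.1) (Ioo 0 1 ×ˢ Ioo 0 1) := fun x =>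
    (hs.contDiffOn x).comp (f := fun s : ℝ × ℝ => (s.2, s.1)) (by fun_prop) fun s h => ⟨h.2, h.1⟩
  have hmx : ∀ x, Measurable fun s : ℝ × ℝ => c x s.1 s.2 := fun x =>
    hm.comp (measurable_prodMk_left (x := x))
  refine ⟨fun s => rootPartial (c s.1) s.2.1 s.2.2,
    fun s => rootPartial (fun v u => c s.1 u v) s.2.2 s.2.1, K, K',
    measurable_rootPartial hm hs.contDiffOn, ?_, ae_of_all _ fun x => ?_, ae_of_all _ fun x => ?_⟩
  · exact (measurable_rootPartial (c := fun x v u => c x u v)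
      (hm.comp (f := fun s : 𝒳 × ℝ × ℝ => (s.1, s.2.2, s.2.1)) (by fun_prop)) hsw).comp
      (f := fun s : 𝒳 × ℝ × ℝ => (s.1, s.2.2, s.2.1)) (by fun_prop)
  · exact isCurve_sqrt (hmx x) (hpos x) (hs.contDiffOn x) (hK x)
      ((hc x).margin_left (hC x) (hmx x) (hpos x))
  · obtain ⟨s1, s2⟩ := (hc x).swap (hC x)
    have hmx' : Measurable fun s : ℝ × ℝ => c x s.2 s.1 := (hmx x).comp measurable_swap
    have hpos' : ∀ u ∈ Ioo (0 : ℝ) 1, ∀ v ∈ Ioo (0 : ℝ) 1, 0 < c x v u := fun u hu v hv =>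
      hpos x v hv u hu
    exact isCurve_sqrt (c := fun v u => c x u v) hmx' hpos' (hsw x) (hK' x)
      (s2.margin_left s1 hmx' hpos')

/-- The conditional models are smooth when weighted with the density of `X`; its root is the root
mass of the fibre. -/
lemma IsModel.sqrt_margX_mul (h : IsModel μZ μX μY p k C c) (x : 𝒳) (r : ℝ) :
    √(margX μZ p x * r) = (rootMass μZ fun z => √(p (z, x))) * √r := by
  rw [← h.rootMass_sq, Real.sqrt_mul (sq_nonneg _), Real.sqrt_sq rootMass_nonneg]

lemma IsModel.measurable_margX_mul [SFinite μZ] (h : IsModel μZ μX μY p k C c) {Ω : Type*} [MeasurableSpace Ω]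
    {f : 𝒳 × Ω → ℝ} (hf : Measurable f) : Measurable fun s => margX μZ p s.1 * f s := by
  have hp := h.p_density.measurable
  have mX : Measurable (margX μZ p) :=
    (StronglyMeasurable.integral_prod_right' (f := fun s : 𝒳 × ℝ => p s.swap)
      (by fun_prop)).measurable
  have := mX.comp (measurable_fst : Measurable (@Prod.fst 𝒳 Ω))
  simp only [Function.comp_def] at this
  fun_prop

lemma IsModel.ae_margX_mul_nonneg [SFinite μZ] (h : IsModel μZ μX μY p k C c) {Ω : Type*} [MeasurableSpace Ω]
    {ν : Measure Ω} [SFinite ν] {f : 𝒳 × Ω → ℝ} (hf : Measurable f)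
    (hf0 : ∀ x, ∀ᵐ ω ∂ν, 0 ≤ f (x, ω)) : ∀ᵐ s ∂(μX.prod ν), 0 ≤ margX μZ p s.1 * f s := by
  refine (Measure.ae_prod_iff_ae_ae (measurableSet_le measurable_const
    (h.measurable_margX_mul hf))).2 (ae_of_all _ fun x => ?_)
  filter_upwards [hf0 x] with ω hω
  rw [← h.rootMass_sq]
  positivity

variable [SFinite μZ] [SFinite μX]

/-- A conditional model weighted with the margin of `X` has total mass one. -/
lemma IsModel.sqInt_rootMass_mul (h : IsModel μZ μX μY p k C c) {Ω : Type*} [MeasurableSpace Ω]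
    {ν : Measure Ω} [SFinite ν] {f : 𝒳 × Ω → ℝ} (hf : Measurable f)
    (hf1 : ∀ᵐ x ∂μX, sqInt ν (fun ω => f (x, ω)) = 1) :
    sqInt (μX.prod ν) (fun s => (rootMass μZ fun z => √(p (z, s.1))) * f s) = 1 := by
  have ha : Measurable fun s => √(p s) := h.p_density.measurable.sqrt
  rw [sqInt_prod (measurable_rootMass_mul (μZ := μZ) (a := fun s => √(p s)) ha hf),
    ← h.p_density.total, ← sqInt_sqrt h.p_density.nonneg, sqInt_prod_symm ha]
  refine lintegral_congr_ae ?_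
  filter_upwards [h.isRoot.fibre, hf1] with x hx hx1
  rw [sqInt_const_mul, hx1, mul_one, ofReal_rootMass_sq hx.meas_a hx.fin]

variable [SFinite μY] [NullSingletonClass μZ] [NullSingletonClass μY]

/-- Almost everywhere the levels lie in the open unit square, where the copula density is positive.
Positivity permits dividing by the root to recover a score. -/
lemma IsModel.ae_jointDensity_pos (h : IsModel μZ μX μY p k C c) :
    ∀ᵐ s ∂(μZ.prod (μX.prod μY)), 0 < jointDensity μZ μY p k c s := by
  refine (ae_triple_iff (S := {s | 0 < jointDensity μZ μY p k c s})
    (measurableSet_lt measurable_const (h.isRoot.measurable.pow_const 2))).2 ?_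
  filter_upwards [h.isRoot.fibre] with x hx
  filter_upwards [Measure.quasiMeasurePreserving_fst.ae hx.ane,
    Measure.quasiMeasurePreserving_snd.ae hx.bne,
    Measure.quasiMeasurePreserving_fst.ae (ae_sqCdf_mem (measurable_normalize hx.meas_a)
      (sqInt_normalize hx.meas_a hx.fin hx.nz) (normalize_ne_zero hx.meas_a hx.fin hx.nz hx.ane)),
    Measure.quasiMeasurePreserving_snd.ae (ae_sqCdf_mem hx.meas_b hx.unit hx.bne)] with s h1 h2 h3 h4
  refine sq_pos_of_ne_zero (mul_ne_zero (mul_ne_zero h1 h2) ?_)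
  exact (Real.sqrt_pos.2 (h.c_pos x _ h4 _ h3)).ne'

end Model

/-! ### Smoothness and regularity of the joint model -/

section Main

variable {𝒳 : Type*} [MeasurableSpace 𝒳] {μZ μY : Measure ℝ} {μX : Measure 𝒳}
  [SFinite μZ] [SFinite μX] [SFinite μY] [NullSingletonClass μZ] [NullSingletonClass μY]
  [IsFiniteMeasureOnCompacts μZ]
  {E₁ E₂ E₃ : Type*} [NormedAddCommGroup E₁] [NormedSpace ℝ E₁] [FiniteDimensional ℝ E₁]
  [NormedAddCommGroup E₂] [NormedSpace ℝ E₂] [FiniteDimensional ℝ E₂]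
  [NormedAddCommGroup E₃] [NormedSpace ℝ E₃] [FiniteDimensional ℝ E₃]
  {Θ₁ : Set E₁} {Θ₂ : Set E₂} {Φ : Set E₃} {pZX : E₁ → ℝ × 𝒳 → ℝ} {pYX : E₂ → 𝒳 → ℝ → ℝ}
  {C c : E₃ → 𝒳 → ℝ → ℝ → ℝ}

/-- The joint model is smooth and regular if its pieces are. -/
theorem isSmoothRegular_jointDensity (hΘ₁ : IsOpen Θ₁) (hΘ₂ : IsOpen Θ₂) (hΦ : IsOpen Φ)
    (hM : ∀ θ ∈ Θ₁ ×ˢ Θ₂ ×ˢ Φ, IsModel μZ μX μY (pZX θ.1) (pYX θ.2.1) (C θ.2.2) (c θ.2.2))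
    (hs : ∀ φ ∈ Φ, SmoothInArguments (c φ))
    (r1 : IsSmoothRegular (μZ.prod μX) Θ₁ pZX)
    (r2 : ∀ θ₁ ∈ Θ₁, IsSmoothRegular (μX.prod μY) Θ₂
      fun θ₂ s => margX μZ (pZX θ₁) s.1 * pYX θ₂ s.1 s.2)
    (r3 : ∀ θ₁ ∈ Θ₁, IsSmoothRegular (μX.prod (unitVol.prod unitVol)) Φ
      fun φ s => margX μZ (pZX θ₁) s.1 * c φ s.1 s.2.1 s.2.2) :
    IsSmoothRegular (μZ.prod (μX.prod μY)) (Θ₁ ×ˢ Θ₂ ×ˢ Φ)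
      fun θ => jointDensity μZ μY (pZX θ.1) (pYX θ.2.1) (c θ.2.2) := by
  intro θ₀ hθ₀
  obtain ⟨k1, k2, k3⟩ : θ₀.1 ∈ Θ₁ ∧ θ₀.2.1 ∈ Θ₂ ∧ θ₀.2.2 ∈ Φ := id hθ₀
  have M0 := hM θ₀ hθ₀
  -- Each piece is varied with the others frozen at `θ₀`.
  have M1 : ∀ η ∈ Θ₁, IsModel μZ μX μY (pZX η) (pYX θ₀.2.1) (C θ₀.2.2) (c θ₀.2.2) := fun η hη =>
    hM (η, θ₀.2) ⟨hη, k2, k3⟩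
  have M2 : ∀ η ∈ Θ₂, IsModel μZ μX μY (pZX θ₀.1) (pYX η) (C θ₀.2.2) (c θ₀.2.2) := fun η hη =>
    hM (θ₀.1, η, θ₀.2.2) ⟨k1, hη, k3⟩
  have M3 : ∀ η ∈ Φ, IsModel μZ μX μY (pZX θ₀.1) (pYX θ₀.2.1) (C η) (c η) := fun η hη =>
    hM (θ₀.1, θ₀.2.1, η) ⟨k1, k2, hη⟩
  have fin1 : ∀ η ∈ Θ₁, sqInt (μZ.prod μX) (fun s => √(pZX η s)) ≠ ∞ := fun η hη => by
    rw [sqInt_sqrt (M1 η hη).p_density.nonneg, (M1 η hη).p_density.total]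
    simp
  obtain ⟨ℓ₁, s1, f1⟩ := r1 θ₀.1 k1
  obtain ⟨ℓ₂, s2, f2⟩ := r2 θ₀.1 k1 θ₀.2.1 k2
  obtain ⟨ℓ₃, s3, f3⟩ := r3 θ₀.1 k1 θ₀.2.2 k3
  obtain ⟨D₁, d1, e1⟩ := s1.exists_isRootDeriv (fun η hη => (M1 η hη).p_density.measurable) fin1 k1
  obtain ⟨D₂, d2, e2⟩ := s2.exists_isRootDeriv
    (fun η hη => M0.measurable_margX_mul (M2 η hη).k_meas) (fun η hη => by
      simp only [M0.sqrt_margX_mul]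
      rw [M0.sqInt_rootMass_mul (f := fun s : 𝒳 × ℝ => √(pYX η s.1 s.2)) (M2 η hη).k_meas.sqrt
        ((M2 η hη).isRoot.fibre.mono fun x hx => hx.unit)]
      simp) k2
  obtain ⟨D₃, d3, e3⟩ := s3.exists_isRootDeriv
    (fun η hη => M0.measurable_margX_mul (M3 η hη).c_meas) (fun η hη => by
      simp only [M0.sqrt_margX_mul]
      rw [M0.sqInt_rootMass_mul (f := fun s : 𝒳 × ℝ × ℝ => √(c η s.1 s.2.1 s.2.2)) (M3 η hη).c_meas.sqrt
        ((M3 η hη).isRoot.fibre.mono fun x hx => hx.sqInt_eq_one)]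
      simp) k3
  simp only [M0.sqrt_margX_mul] at d2 d3
  obtain ⟨γu, γv, K, K', hc⟩ := (hs _ k3).exists_isCurveFamily (μX := μX) M0.copula M0.c_meas
    M0.c_density M0.c_pos
  have hroot := fun θ hθ => (hM θ hθ).isRoot
  obtain ⟨D, hD⟩ := exists_isRootDeriv_rootDensity (μZ := μZ) (μX := μX) (μY := μY)
    (A := fun η s => √(pZX η s)) (B := fun η s => √(pYX η s.1 s.2))
    (Γ := fun η s => √(c η s.1 s.2.1 s.2.2)) hΘ₁ hΘ₂ hΦ hθ₀ hroot fin1 d1 d2 d3 hc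
  have hinj := fun h => IsRootDeriv.eq_zero_of_ae_eq_zero (μZ := μZ) (μX := μX) (μY := μY)
    (A := fun η s => √(pZX η s)) (B := fun η s => √(pYX η s.1 s.2))
    (Γ := fun η s => √(c η s.1 s.2.1 s.2.2)) hΘ₁ hΘ₂ hΦ hθ₀ hroot d1 d2 d3
    (fun h => eq_zero_of_ae_eq_zero e1 M0.p_density.nonneg f1)
    (fun h => eq_zero_of_ae_eq_zero e2 (M0.ae_margX_mul_nonneg M0.k_meas fun x =>
      (M0.k_density x).nonneg) f2)
    (fun h => eq_zero_of_ae_eq_zero e3 (M0.ae_margX_mul_nonneg M0.c_meas fun x => by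
      filter_upwards [Measure.quasiMeasurePreserving_fst.ae ae_unitVol_mem,
        Measure.quasiMeasurePreserving_snd.ae ae_unitVol_mem] with q hq1 hq2
      exact (M0.c_pos x _ hq1 _ hq2).le) f3) hD (h := h)
  have hD' : IsRootDeriv (μZ.prod (μX.prod μY)) (Θ₁ ×ˢ Θ₂ ×ˢ Φ)
      (fun θ s => √(jointDensity μZ μY (pZX θ.1) (pYX θ.2.1) (c θ.2.2) s)) θ₀ D := by
    simpa only [sqrt_jointDensity] using hD
  have hpos := M0.ae_jointDensity_pos
  -- The score is `2 D / √p`. If the information annihilates `h`, its value at `(h, h)` already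
  -- forces `D h = 0`.
  exact ⟨_, hD'.isScoreAt (p := fun θ => jointDensity μZ μY (pZX θ.1) (pYX θ.2.1) (c θ.2.2))
    (fun θ hθ => (hroot θ hθ).measurable.pow_const 2) hθ₀ hpos, fun h hh =>
    hinj h (fisherInfo_self_eq_zero hD.meas hD.fin hpos (hh h))⟩

end Main

end Frugal

end

theorem proposition2
    {E₁ E₂ E₃ : Type*}
    [NormedAddCommGroup E₁] [NormedSpace ℝ E₁] [FiniteDimensional ℝ E₁]
    [NormedAddCommGroup E₂] [NormedSpace ℝ E₂] [FiniteDimensional ℝ E₂]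
    [NormedAddCommGroup E₃] [NormedSpace ℝ E₃] [FiniteDimensional ℝ E₃]
    {𝒳 : Type*} [MeasurableSpace 𝒳] (μX : Measure 𝒳) [SigmaFinite μX]
    -- the state spaces of `Z` and `Y`, with Lebesgue measure
    (𝒵 𝒴 : Set ℝ) (h𝒵 : MeasurableSet 𝒵) (h𝒴 : MeasurableSet 𝒴)
    (μZ μY : Measure ℝ) (hμZ : μZ = volume.restrict 𝒵) (hμY : μY = volume.restrict 𝒴)
    (Θ₁ : Set E₁) (Θ₂ : Set E₂) (Φ : Set E₃)
    (hΘ₁ : IsOpen Θ₁) (hΘ₂ : IsOpen Θ₂) (hΦ : IsOpen Φ)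
    -- a smooth and regular model for `(Z, X)`, with positive densities
    (pZX : E₁ → ℝ × 𝒳 → ℝ)
    (hZX : ∀ θ₁ ∈ Θ₁, Frugal.IsDensity (μZ.prod μX) (pZX θ₁))
    (hZX_pos : ∀ θ₁ ∈ Θ₁, ∀ z ∈ 𝒵, ∀ x, 0 < pZX θ₁ (z, x))
    (hZX_reg : Frugal.IsSmoothRegular (μZ.prod μX) Θ₁ pZX)
    -- a smooth and regular model for `Y` given `X`, with positive densities
    (pYX : E₂ → 𝒳 → ℝ → ℝ)
    (hYX_meas : ∀ θ₂ ∈ Θ₂, Measurable fun s : 𝒳 × ℝ => pYX θ₂ s.1 s.2)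
    (hYX : ∀ θ₂ ∈ Θ₂, ∀ x, Frugal.IsDensity μY (pYX θ₂ x))
    (hYX_pos : ∀ θ₂ ∈ Θ₂, ∀ x, ∀ y ∈ 𝒴, 0 < pYX θ₂ x y)
    (hYX_reg : ∀ θ₁ ∈ Θ₁, Frugal.IsSmoothRegular (μX.prod μY) Θ₂
      (fun θ₂ s => Frugal.margX μZ (pZX θ₁) s.1 * pYX θ₂ s.1 s.2))
    -- a smooth and regular model for the conditional copula of `Y, Z` given `X`, with positive
    -- densities
    (C c : E₃ → 𝒳 → ℝ → ℝ → ℝ)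
    (hC : ∀ φ ∈ Φ, ∀ x, Frugal.IsCopula (C φ x))
    (hc_meas : ∀ φ ∈ Φ, Measurable fun s : 𝒳 × ℝ × ℝ => c φ s.1 s.2.1 s.2.2)
    (hc : ∀ φ ∈ Φ, ∀ x, Frugal.HasCopulaDensity (C φ x) (c φ x))
    (hc_pos : ∀ φ ∈ Φ, ∀ x, ∀ u ∈ Ioo (0 : ℝ) 1, ∀ v ∈ Ioo (0 : ℝ) 1, 0 < c φ x u v)
    (hc_smooth : ∀ φ ∈ Φ, Frugal.SmoothInArguments (c φ))
    (hc_reg : ∀ θ₁ ∈ Θ₁,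
      Frugal.IsSmoothRegular (μX.prod (Frugal.unitVol.prod Frugal.unitVol)) Φ
        (fun φ s => Frugal.margX μZ (pZX θ₁) s.1 * c φ s.1 s.2.1 s.2.2)) :
    let w : E₁ × E₂ × E₃ → ℝ → 𝒳 → ℝ := fun θ => Frugal.condZ μZ (pZX θ.1)
    let Θ : Set (E₁ × E₂ × E₃) := Frugal.jointParams μZ μX μY Θ₁ Θ₂ Φ w pZX pYX C
    -- every combination of parameter values arises from a joint distribution,
    Θ = Θ₁ ×ˢ Θ₂ ×ˢ Φ ∧
    -- the three pieces form a frugal parameterization of the joint distribution,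
    (∃ q : E₁ × E₂ × E₃ → ℝ × 𝒳 × ℝ → ℝ, Frugal.IsFrugal μZ μX μY Θ q w pZX pYX C) ∧
    -- and `φ` is variation independent of `(θ_ZX, θ_Y|X)`
    Frugal.VariationIndependent Θ (fun θ => θ.2.2) (fun θ => (θ.1, θ.2.1)) := by
  intro w Θ
  subst hμZ hμY
  have hZpos : ∀ θ₁ ∈ Θ₁, ∀ x, ∀ᵐ z ∂(volume.restrict 𝒵), 0 < pZX θ₁ (z, x) := fun θ₁ h1 x =>
    (ae_restrict_mem h𝒵).mono fun z hz => hZX_pos θ₁ h1 z hz x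
  have hYpos : ∀ θ₂ ∈ Θ₂, ∀ x, ∀ᵐ y ∂(volume.restrict 𝒴), 0 < pYX θ₂ x y := fun θ₂ h2 x =>
    (ae_restrict_mem h𝒴).mono fun y hy => hYX_pos θ₂ h2 x y hy
  have hM : ∀ θ ∈ Θ₁ ×ˢ Θ₂ ×ˢ Φ, Frugal.IsModel (volume.restrict 𝒵) μX (volume.restrict 𝒴)
      (pZX θ.1) (pYX θ.2.1) (C θ.2.2) (c θ.2.2) := by
    rintro θ ⟨h1, h2, h3⟩
    exact ⟨hZX _ h1, hZpos _ h1, hYX_meas _ h2, hYX _ h2, hYpos _ h2, hC _ h3, hc_meas _ h3,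
      hc _ h3, hc_pos _ h3⟩
  -- Sklar's construction realizes every combination of parameters.
  have hΘ : Θ = Θ₁ ×ˢ Θ₂ ×ˢ Φ :=
    Subset.antisymm (fun θ hθ => hθ.1) fun θ hθ => ⟨hθ, _, (hM θ hθ).hasPieces⟩
  rw [hΘ]
  refine ⟨rfl, ⟨fun θ => Frugal.jointDensity (volume.restrict 𝒵) (volume.restrict 𝒴) (pZX θ.1)
    (pYX θ.2.1) (c θ.2.2), ⟨fun θ hθ => (hM θ hθ).isDensity_condZ, fun θ hθ => (hM θ hθ).hasPieces,
    fun θ hθ q' hq' => (hM θ hθ).ae_eq (hM θ hθ).hasPieces hq',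
    Frugal.isSmoothRegular_jointDensity hΘ₁ hΘ₂ hΦ hM hc_smooth hZX_reg hYX_reg hc_reg⟩⟩, ?_⟩
  ext ⟨φ, η⟩
  constructor
  · rintro ⟨θ, hθ, h⟩
    exact ⟨⟨θ, hθ, congrArg Prod.fst h⟩, ⟨θ, hθ, congrArg Prod.snd h⟩⟩
  · rintro ⟨⟨θ, hθ, h⟩, ⟨θ', hθ', h'⟩⟩
    -- A product set contains the point mixed from `φ` of one element and the other coordinates of
    -- another.
    exact ⟨(θ'.1, θ'.2.1, θ.2.2), ⟨hθ'.1, hθ'.2.1, hθ.2.2⟩, Prod.ext h h'⟩
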